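/- \textbf{Setting and conventions.} Let $\Gamma(t)=(t,t^2,t^3)$, and let $\mathbf t(c),\mathbf n(c),\mathbf b(c)$ be its Frenet frame (unit tangent, normal, binormal) at $\Gamma(c)$. For $R\ge 2$, partition $[0,1]$ into intervals $I$ of length $R^{-1/3}$ with left endpoints $c_I=kR^{-1/3}$, $k=0,1,\dots$, $c_I<1$ (the last interval is cut off at $1$ if $R^{1/3}\notin\mathbb N$). Fix an implicit constant $K\ge 1$. For nonnegative quantities, $X\sim Y$ means $K^{-1}Y\le X\le KY$. A $(d_1,d_2,d_3)$-box with axes $e_1,e_2,e_3$ is a convex set $B$ with $K^{-1}B_0\subset B\subset KB_0$ (dilations about the centre of $B_0$), where $B_0$ is a rectangular box with side lengths $d_1,d_2,d_3$ in the orthonormal directions $e_1,e_2,e_3$. All boxes associated with $I$ have axes $\mathbf t(c_I),\mathbf n(c_I),\mathbf b(c_I)$. An $s$-cube is an $(s,s,s)$-box with arbitrary orthonormal axes. A family of sets tiles $A$ if its members have pairwise disjoint interiors and cover $A$. For each $I$, let $[-R,R]^3$ be tiled with $(R^{1/2},R^{5/6},R)$-boxes $\Sigma_I$ (which may stick out),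 let each $\Sigma_I$ be tiled with $(R^{1/2},R^{2/3},R)$-boxes $\tau_I\subset\Sigma_I$, and let each $\tau_I$ be tiled with $(R^{1/3},R^{2/3},R)$-boxes $P_I\subset\tau_I$, called Vinogradov planks. All boxes $\tau_I$ and all planks $P_I$ arise in this way. \textbf{Proposition.} Let $\mathbb P$ be a finite collection of Vinogradov planks $P_I$ from these tilings, for various $I$, all contained in $[-R,R]^3$, and let $N,Z_1>0$. Call $\tau_I$ heavy if it contains $\sim N$ planks $P_I\in\mathbb P$ associated with the same $I$, and call $\Sigma_I$ heavy if it contains $\sim Z_1$ heavy boxes $\tau_I$. Assume: (Sp1) for each $I$, each $\tau_I$ is either heavy or contains no plank $P_I\in\mathbb P$; (Sp2) for each $I$, each $\Sigma_I$ is either heavy or contains no heavy $\tau_I$. Let $1\le r\le R^{1/3}$, and let $\mathcal Q_r(\mathbb P)$ be any family of $R^{1/3}$-cubes with pairwise disjoint interiors, each of which is $r$-rich, that is, intersects at least $r$ planks of $\mathbb P$. Then $\mathcal Q_r(\mathbb P)$ is finite and $$|\mathcal Q_r(\mathbb P)|\le A\,(\log R)^{D}\,\frac{|\mathbb P|\,N^5Z_1R^2}{r^7},$$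 where $D\in\mathbb N$ is an absolute constant and $A>0$ depends only on the implicit constant $K$. -/

import Mathlib

open Real

/-- Euclidean three-space. -/
abbrev E3 : Type := EuclideanSpace ℝ (Fin 3)

/-- The Frenet frame (tangent, normal, binormal) of the twisted cubic `Γ(t) = (t, t², t³)` at
`Γ(c)`: the unit vectors in the directions `Γ'(c) = (1, 2c, 3c²)`,
`b × t ∥ (-2c - 9c³, 1 - 9c⁴, 3c + 6c³)` and `Γ'(c) × Γ''(c) ∥ (3c², -3c, 1)`. -/
noncomputable def frenet (c : ℝ) : Fin 3 → E3 :=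
  let t : E3 := !₂[1, 2 * c, 3 * c ^ 2]
  let n : E3 := !₂[-2 * c - 9 * c ^ 3, 1 - 9 * c ^ 4, 3 * c + 6 * c ^ 3]
  let b : E3 := !₂[3 * c ^ 2, -3 * c, 1]
  ![‖t‖⁻¹ • t, ‖n‖⁻¹ • n, ‖b‖⁻¹ • b]

/-- The closed rectangular box with centre `z` and side lengths `d 0, d 1, d 2` in the directions
`e 0, e 1, e 2`. -/
def rectBox (e : Fin 3 → E3) (d : Fin 3 → ℝ) (z : E3) : Set E3 :=
  {x | ∀ i, |inner ℝ (e i) (x - z)| ≤ d i / 2}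

/-- `B` is an (almost rectangular) `d`-box with axes `e`, with implicit constant `K`: a convex set
with `K⁻¹ • B₀ ⊆ B ⊆ K • B₀` (dilations about the centre) for a rectangular box `B₀` with side
lengths `d` in the directions `e`. -/
def IsBox (K : ℝ) (e : Fin 3 → E3) (d : Fin 3 → ℝ) (B : Set E3) : Prop :=
  Convex ℝ B ∧ ∃ z : E3,
    rectBox e (fun i => K⁻¹ * d i) z ⊆ B ∧ B ⊆ rectBox e (fun i => K * d i) z

/-- An `s`-cube, with implicit constant `K`, in any orientation. -/
def IsCube (K s : ℝ) (q : Set E3) : Prop :=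
  ∃ e : Fin 3 → E3, Orthonormal ℝ e ∧ IsBox K e (fun _ => s) q

/-- The members of the family have pairwise disjoint interiors. -/
def NonOverlapping (F : Set (Set E3)) : Prop :=
  F.Pairwise fun B B' => Disjoint (interior B) (interior B')

/-- The family tiles `A` (members may stick out of `A`). -/
def Tiles (F : Set (Set E3)) (A : Set E3) : Prop :=
  A ⊆ ⋃₀ F ∧ NonOverlapping F

/-- The cube `[-R, R]³`. -/
def bigCube (R : ℝ) : Set E3 := {x | ∀ i, |x i| ≤ R}

/-- The number of intervals in the partition of `[0,1]` into intervals of length `R^{-1/3}`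
(the last one being cut off at `1` if `R^{1/3}` is not an integer). -/
noncomputable def numIntervals (R : ℝ) : ℕ := ⌈R ^ (1 / 3 : ℝ)⌉₊

/-- The left endpoint of the `k`-th interval of this partition. -/
noncomputable def leftEndpoint (R : ℝ) (k : Fin (numIntervals R)) : ℝ :=
  (k : ℝ) * R ^ (-(1 / 3) : ℝ)

/-- The nested tilings attached to the interval with left endpoint `c`, with implicit constant `K`:
`[-R,R]³` is tiled by `(R^{1/2}, R^{5/6}, R)`-boxes `Σ` (the family `𝒮`), each `Σ` is tiled by
`(R^{1/2}, R^{2/3}, R)`-boxes `τ` (the family `𝒯`), and each `τ` is tiled by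
`(R^{1/3}, R^{2/3}, R)`-boxes, the spatial Vinogradov planks (the family `𝒱`). All boxes have the
tangent, normal and binormal at `Γ(c)` as their axes. -/
structure IsVinogradovTiling (K R c : ℝ) (𝒮 𝒯 𝒱 : Set (Set E3)) : Prop where
  box_sigma : ∀ S ∈ 𝒮,
    IsBox K (frenet c) ![R ^ (1 / 2 : ℝ), R ^ (5 / 6 : ℝ), R] S
  box_tau : ∀ T ∈ 𝒯,
    IsBox K (frenet c) ![R ^ (1 / 2 : ℝ), R ^ (2 / 3 : ℝ), R] T
  box_plank : ∀ P ∈ 𝒱,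
    IsBox K (frenet c) ![R ^ (1 / 3 : ℝ), R ^ (2 / 3 : ℝ), R] P
  tiles_cube : Tiles 𝒮 (bigCube R)
  tiles_sigma : ∀ S ∈ 𝒮, Tiles {T | T ∈ 𝒯 ∧ T ⊆ S} S
  tau_subset : ∀ T ∈ 𝒯, ∃ S ∈ 𝒮, T ⊆ S
  tiles_tau : ∀ T ∈ 𝒯, Tiles {P | P ∈ 𝒱 ∧ P ⊆ T} T
  plank_subset : ∀ P ∈ 𝒱, ∃ T ∈ 𝒯, P ⊆ T

/-- `x ∼ y` with implicit constant `K`. -/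
def Sim (K x y : ℝ) : Prop := x ≤ K * y ∧ y ≤ K * x

/-- `τ` is heavy with respect to the family `Pl` of planks parallel to it: it contains `∼ N` of
them. -/
def HeavyTau (K N : ℝ) (Pl : Finset (Set E3)) (T : Set E3) : Prop :=
  Sim K ({P | P ∈ Pl ∧ P ⊆ T}.ncard : ℝ) N

/-- `Σ` is heavy: it contains `∼ Z` heavy boxes `τ`. -/
def HeavySigma (K N Z : ℝ) (Pl : Finset (Set E3)) (𝒯 : Set (Set E3)) (S : Set E3) : Prop :=
  Sim K ({T | T ∈ 𝒯 ∧ T ⊆ S ∧ HeavyTau K N Pl T}.ncard : ℝ) Z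

/-- The number of planks of the collection (counted over all intervals) that meet `q`. -/
noncomputable def richness {n : ℕ} (Pl : Fin n → Finset (Set E3)) (q : Set E3) : ℕ :=
  ∑ k, {P | P ∈ Pl k ∧ (P ∩ q).Nonempty}.ncard

/-! Put R = m⁶ and attach to a point z the quadratic polynomial v(x) = z·Γ'(x)/m². Up to constants,
R^{1/3}-cubes become unit cubes, directions become the numbers j/m² with j ≤ m², and a plank, a box
τ, a box Σ of direction x become the sets of polynomials for which (v(x), v'(x), leading
coefficient) lies in a box of dimensions (1, m², m⁴), (m, m², m⁴), (m, m³, m⁴). The counting is done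
for the abstract `PlankConfig`; the target is P N⁵ Z m¹² / r⁷ up to logarithms. Two estimates carry
it.

Small scale. `card_near_le_boxBound` bounds the number nU of rich points in a box of dimensions 1,
m, m². Three transversal constraints pin a quadratic polynomial down, so a shorter box holds few
points lying on planks in two further directions (`transversal_count`, two factors N). For the full
box, the planks with directions in a block of angular length 1/m are merged into unit strips, and
double counting bounds the rich strips (one more factor N, `card_heavy_strips_le`). Two points share
strips over few blocks unless their leading coefficients are close (`card_common_strips_le`), and
Cauchy–Schwarz then gives `pair_energy`.

Large scale. Points with many directions in a window of about 2^l consecutive directions are grouped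
into cells of dimensions 4m, m², m⁴/2^(l+2). Points of a cell lying in the same three planks fit
into few boxes 1, m, m², so counting triples of directions bounds the points of the cell by N³ nU
times the number of directions with a box τ through the cell (`card_cell_le`). After rescaling, the
cells are unit cubes and the boxes τ are unit tubes of length about 2^l pointing along a conical
curve, about Z of them in a slab. Their incidences are bounded by `exists_tube_incidence`, a
high-low argument: a Gaussian tube kernel is cut dyadically in frequency, and the overlap of the
pieces over all directions is controlled by the total variation of the arctangent of a quadratic
sequence. The boxes τ number about P/N in total, whence N^(3+3-1) = N⁵.

Selection. For each point, the block of directions maximising |X ∩ block|⁴/length is chosen. This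
prevents concentration on shorter blocks, and it keeps enough directions for the block length to
drop out of the final bound. All other parameters (arc size, window scale, distances of blocks) are
pigeonholed dyadically, at the cost of logarithms. -/

noncomputable section
namespace Vinogradov

/-! ### Gaussians, characters and quadratic forms of kernels. -/

section Fourier
open MeasureTheory

/-- Coordinate triples; also used for quadratic polynomials via their coefficients. -/
abbrev V3 : Type := ℝ × ℝ × ℝ

/-- The Gaussian `exp (-π (p x)²)`. -/
def gauss (p x : ℝ) : ℝ := Real.exp (-π * (p * x) ^ 2)

lemma gauss_pos (p x : ℝ) : 0 < gauss p x := Real.exp_pos _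

lemma gauss_neg (p x : ℝ) : gauss p (-x) = gauss p x := by simp [gauss]

lemma gauss_le_one (p x : ℝ) : gauss p x ≤ 1 := by
  unfold gauss
  rw [Real.exp_le_one_iff]
  have := Real.pi_pos
  have := mul_nonneg this.le (sq_nonneg (p * x))
  linarith

lemma integrable_gauss {p : ℝ} (hp : 0 < p) : Integrable (gauss p) := by
  have := integrable_exp_neg_mul_sq (b := π * p ^ 2) (by positivity)
  refine this.congr (Filter.Eventually.of_forall fun x => ?_)
  simp only [gauss]
  congr 1
  ring

lemma fourier_gauss {p : ℝ} (hp : 0 < p) (x : ℝ) :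
    ∫ η : ℝ, (gauss p η : ℂ) * Complex.exp (2 * π * Complex.I * (η * x : ℝ))
      = ((gauss p⁻¹ x / p : ℝ) : ℂ) := by
  have hp' : (p : ℂ) ≠ 0 := by exact_mod_cast hp.ne'
  have hpi : (π : ℂ) ≠ 0 := by exact_mod_cast Real.pi_ne_zero
  have h := fourierIntegral_gaussian (b := (π * p ^ 2 : ℝ))
    (by rw [Complex.ofReal_re]; positivity) (2 * π * x)
  have e1 : (π : ℂ) / ((π * p ^ 2 : ℝ) : ℂ) = ((p⁻¹ ^ 2 : ℝ) : ℂ) := by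
    push_cast
    field_simp
  have e2 : ((p⁻¹ ^ 2 : ℝ) : ℂ) ^ (1 / 2 : ℂ) = ((p⁻¹ : ℝ) : ℂ) := by
    rw [show (1 / 2 : ℂ) = ((1 / 2 : ℝ) : ℂ) by push_cast; rfl,
      ← Complex.ofReal_cpow (by positivity), ← Real.sqrt_eq_rpow,
      Real.sqrt_sq (by positivity)]
  rw [e1, e2] at h
  have e3 : ∀ η : ℝ, (gauss p η : ℂ) * Complex.exp (2 * π * Complex.I * (η * x : ℝ)) =
      Complex.exp (Complex.I * (2 * π * x) * η) * Complex.exp (-((π * p ^ 2 : ℝ) : ℂ) * η ^ 2) := by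
    intro η
    simp only [gauss]
    rw [Complex.ofReal_exp, ← Complex.exp_add, ← Complex.exp_add]
    congr 1
    push_cast
    ring
  simp_rw [e3]
  rw [h]
  simp only [gauss]
  push_cast
  rw [div_eq_mul_inv, mul_comm]
  congr 1
  congr 1
  field_simp
  ring

/-- The bilinear pairing on triples. -/
def dot (η v : V3) : ℝ := η.1 * v.1 + (η.2.1 * v.2.1 + η.2.2 * v.2.2)

lemma continuous_dot_left (v : V3) : Continuous fun η => dot η v := by
  unfold dot; fun_prop

lemma dot_sub (η v w : V3) : dot η (v - w) = dot η v - dot η w := by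
  simp [dot]; ring

/-- The character with frequency `v`. -/
def chi (v η : V3) : ℂ := Complex.exp (2 * π * Complex.I * (dot η v : ℝ))

lemma continuous_chi (v : V3) : Continuous (chi v) := by
  unfold chi
  have := continuous_dot_left v
  fun_prop

lemma norm_chi (v η : V3) : ‖chi v η‖ = 1 := by
  unfold chi
  rw [show (2 * π * Complex.I * (dot η v : ℝ) : ℂ) = ((2 * π * dot η v : ℝ) : ℂ) * Complex.I by
    push_cast; ring]
  exact Complex.norm_exp_ofReal_mul_I _

lemma chi_sub (v w η : V3) : chi (v - w) η = chi v η * (starRingEnd ℂ) (chi w η) := by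
  unfold chi
  rw [← Complex.exp_conj, ← Complex.exp_add, dot_sub]
  congr 1
  simp only [map_mul, map_ofNat, Complex.conj_ofReal, Complex.conj_I, Complex.ofReal_sub]
  ring

/-- `G` is the inverse Fourier transform of the integrable function `H`. -/
def IsFT (H G : V3 → ℝ) : Prop :=
  Integrable H ∧ ∀ v, (G v : ℂ) = ∫ η, (H η : ℂ) * chi v η

lemma IsFT.integrable_mul_chi {H G : V3 → ℝ} (h : IsFT H G) (v : V3) :
    Integrable fun η => (H η : ℂ) * chi v η := by
  refine h.1.ofReal.mul_bdd (c := 1) (continuous_chi v).aestronglyMeasurable ?_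
  exact Filter.Eventually.of_forall fun η => (norm_chi v η).le

/-- Expanding the square modulus of the exponential sum under the integral gives the double sum.
Kernels can thus be compared through their transforms, where positivity and domination are visible.
-/
lemma IsFT.quadForm {ι : Type*} {H G : V3 → ℝ} (h : IsFT H G) (S : Finset ι) (c : ι → ℝ)
    (v : ι → V3) :
    ∑ i ∈ S, ∑ j ∈ S, c i * c j * G (v i - v j)
      = ∫ η, H η * Complex.normSq (∑ i ∈ S, (c i : ℂ) * chi (v i) η) := by
  have key : (((∑ i ∈ S, ∑ j ∈ S, c i * c j * G (v i - v j) : ℝ)) : ℂ)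
      = ((∫ η, H η * Complex.normSq (∑ i ∈ S, (c i : ℂ) * chi (v i) η) : ℝ) : ℂ) := by
    rw [← integral_complex_ofReal]
    have e : ∀ η, ((H η * Complex.normSq (∑ i ∈ S, (c i : ℂ) * chi (v i) η) : ℝ) : ℂ)
        = ∑ i ∈ S, ∑ j ∈ S, (c i * c j : ℂ) * ((H η : ℂ) * chi (v i - v j) η) := by
      intro η
      rw [Complex.ofReal_mul, Complex.normSq_eq_conj_mul_self, map_sum, Finset.sum_mul_sum,
        Finset.mul_sum, Finset.sum_comm]
      simp_rw [Finset.mul_sum]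
      rw [Finset.sum_comm]
      rw [Finset.sum_comm]
      refine Finset.sum_congr rfl fun i _ => Finset.sum_congr rfl fun j _ => ?_
      rw [chi_sub]
      simp
      ring
    simp_rw [e]
    rw [integral_finsetSum]
    · push_cast
      refine Finset.sum_congr rfl fun i _ => ?_
      rw [integral_finsetSum]
      · refine Finset.sum_congr rfl fun j _ => ?_
        rw [integral_const_mul, h.2]
      · intro j _
        exact (h.integrable_mul_chi _).const_mul _
    · intro i _
      refine integrable_finsetSum _ fun j _ => ?_
      exact (h.integrable_mul_chi _).const_mul _
  exact_mod_cast key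

lemma IsFT.integrable_quad {ι : Type*} {H G : V3 → ℝ} (h : IsFT H G) (S : Finset ι) (c : ι → ℝ)
    (v : ι → V3) :
    Integrable fun η => H η * Complex.normSq (∑ i ∈ S, (c i : ℂ) * chi (v i) η) := by
  refine h.1.mul_bdd (c := (∑ i ∈ S, |c i|) ^ 2) ?_ ?_
  · refine Continuous.aestronglyMeasurable ?_
    refine Complex.continuous_normSq.comp ?_
    exact continuous_finsetSum _ fun i _ => continuous_const.mul (continuous_chi _)
  · refine Filter.Eventually.of_forall fun η => ?_
    rw [Real.norm_of_nonneg (Complex.normSq_nonneg _), Complex.normSq_eq_norm_sq]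
    refine pow_le_pow_left₀ (norm_nonneg _) ?_ 2
    refine (norm_sum_le _ _).trans (Finset.sum_le_sum fun i _ => ?_)
    rw [norm_mul, norm_chi, mul_one, Complex.norm_real, Real.norm_eq_abs]

lemma IsFT.quadForm_nonneg {ι : Type*} {H G : V3 → ℝ} (h : IsFT H G) (hH : ∀ η, 0 ≤ H η)
    (S : Finset ι) (c : ι → ℝ) (v : ι → V3) :
    0 ≤ ∑ i ∈ S, ∑ j ∈ S, c i * c j * G (v i - v j) := by
  rw [h.quadForm]
  exact integral_nonneg fun η => mul_nonneg (hH η) (Complex.normSq_nonneg _)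

/-- Only the transforms need to be ordered; the kernels `G`, `G'` themselves need not be. -/
lemma IsFT.quadForm_mono {ι : Type*} {H G H' G' : V3 → ℝ} (h : IsFT H G) (h' : IsFT H' G')
    (hH : ∀ η, H η ≤ H' η) (S : Finset ι) (c : ι → ℝ) (v : ι → V3) :
    ∑ i ∈ S, ∑ j ∈ S, c i * c j * G (v i - v j) ≤
      ∑ i ∈ S, ∑ j ∈ S, c i * c j * G' (v i - v j) := by
  rw [h.quadForm, h'.quadForm]
  exact integral_mono (h.integrable_quad _ _ _) (h'.integrable_quad _ _ _)
    fun η => mul_le_mul_of_nonneg_right (hH η) (Complex.normSq_nonneg _)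

lemma IsFT.sum {κ : Type*} {H G : κ → V3 → ℝ} (s : Finset κ) (h : ∀ i ∈ s, IsFT (H i) (G i)) :
    IsFT (fun η => ∑ i ∈ s, H i η) (fun v => ∑ i ∈ s, G i v) := by
  refine ⟨integrable_finsetSum _ fun i hi => (h i hi).1, fun v => ?_⟩
  push_cast
  simp_rw [Finset.sum_mul]
  rw [integral_finsetSum]
  · exact Finset.sum_congr rfl fun i hi => (h i hi).2 v
  · exact fun i hi => (h i hi).integrable_mul_chi v

lemma IsFT.const_mul {H G : V3 → ℝ} (c : ℝ) (h : IsFT H G) :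
    IsFT (fun η => c * H η) (fun v => c * G v) := by
  refine ⟨h.1.const_mul c, fun v => ?_⟩
  push_cast
  rw [h.2 v, ← integral_const_mul]
  simp_rw [mul_assoc]

lemma IsFT.sub {H G H' G' : V3 → ℝ} (h : IsFT H G) (h' : IsFT H' G') :
    IsFT (fun η => H η - H' η) (fun v => G v - G' v) := by
  refine ⟨h.1.sub h'.1, fun v => ?_⟩
  push_cast
  simp_rw [sub_mul]
  rw [integral_sub (h.integrable_mul_chi v) (h'.integrable_mul_chi v), h.2, h'.2]

/-- Transform of a product Gaussian. -/
lemma isFT_gauss {p q r : ℝ} (hp : 0 < p) (hq : 0 < q) (hr : 0 < r) :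
    IsFT (fun η => gauss p η.1 * (gauss q η.2.1 * gauss r η.2.2))
      (fun v => gauss p⁻¹ v.1 / p * (gauss q⁻¹ v.2.1 / q * (gauss r⁻¹ v.2.2 / r))) := by
  constructor
  · exact (integrable_gauss hp).mul_prod ((integrable_gauss hq).mul_prod (integrable_gauss hr))
  · intro v
    let F : ℝ → ℝ → ℝ → ℂ := fun p w x =>
      (gauss p x : ℂ) * Complex.exp (2 * π * Complex.I * (x * w : ℝ))
    have e : ∀ η : V3, ((gauss p η.1 * (gauss q η.2.1 * gauss r η.2.2) : ℝ) : ℂ) * chi v η =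
        F p v.1 η.1 * (fun y : ℝ × ℝ => F q v.2.1 y.1 * F r v.2.2 y.2) η.2 := by
      intro η
      simp only [chi, dot, F]
      push_cast
      rw [mul_add, mul_add, Complex.exp_add, Complex.exp_add]
      ring
    have e1 := integral_prod_mul (μ := (volume : Measure ℝ)) (ν := (volume : Measure (ℝ × ℝ)))
      (F p v.1) (fun y : ℝ × ℝ => F q v.2.1 y.1 * F r v.2.2 y.2)
    have e2 := integral_prod_mul (μ := (volume : Measure ℝ)) (ν := (volume : Measure ℝ))
      (F q v.2.1) (F r v.2.2)
    rw [integral_congr_ae (Filter.Eventually.of_forall e)]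
    refine Eq.trans ?_ e1.symm
    refine Eq.trans ?_ (congrArg (fun z => (∫ x, F p v.1 x) * z) e2.symm)
    simp only [F, fourier_gauss hp, fourier_gauss hq, fourier_gauss hr]
    push_cast
    ring

/-- Precomposition with a measure preserving map which is adjoint to `A`. -/
lemma IsFT.comp {H G : V3 → ℝ} (h : IsFT H G) {φ : V3 → V3} {A : V3 → V3}
    (hφ : MeasurePreserving φ) (hA : ∀ ξ v, dot (φ ξ) (A v) = dot ξ v) :
    IsFT (fun ξ => H (φ ξ)) (fun v => G (A v)) := by
  refine ⟨hφ.integrable_comp_of_integrable h.1, fun v => ?_⟩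
  have e : ∀ ξ, (H (φ ξ) : ℂ) * chi v ξ = (fun η => (H η : ℂ) * chi (A v) η) (φ ξ) := by
    intro ξ
    simp only [chi, hA]
  simp_rw [e]
  rw [h.2, ← hφ.map_eq, integral_map hφ.measurable.aemeasurable]
  · simp [hφ.map_eq]
  · rw [hφ.map_eq]; exact (h.integrable_mul_chi _).aestronglyMeasurable

/-! ### Shears, and the overlap of frequency pieces along a conical curve. -/

/-- Frequency variables adapted to the direction `t`. -/
def shear (κ t : ℝ) (ξ : V3) : V3 :=
  (ξ.1, ξ.2.1 - κ * t * ξ.1, ξ.2.2 - 2 * t * ξ.2.1 + κ * t ^ 2 * ξ.1)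

/-- Space variables adapted to the direction `t`. -/
def tilt (κ t : ℝ) (v : V3) : V3 :=
  (v.1 + κ * (v.2.1 * t + v.2.2 * t ^ 2), v.2.1 + 2 * v.2.2 * t, v.2.2)

/-- `shear` is the inverse transpose of `tilt`, so tilting a kernel in space shears its transform.
-/
lemma dot_shear_tilt (κ t : ℝ) (ξ v : V3) : dot (shear κ t ξ) (tilt κ t v) = dot ξ v := by
  simp [dot, shear, tilt]; ring

lemma tilt_sub (κ t : ℝ) (v w : V3) : tilt κ t (v - w) = tilt κ t v - tilt κ t w := by
  simp only [tilt, Prod.fst_sub, Prod.snd_sub, Prod.mk_sub_mk, Prod.mk.injEq, and_true]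
  constructor <;> ring

lemma measurePreserving_shear (κ t : ℝ) : MeasurePreserving (shear κ t) := by
  have h2 : ∀ x : ℝ, MeasurePreserving
      (fun y : ℝ × ℝ => (y.1 - κ * t * x, y.2 - 2 * t * y.1 + κ * t ^ 2 * x)) := by
    intro x
    refine MeasurePreserving.skew_product (μa := volume) (μb := volume) (μc := volume)
      (μd := volume) (f := fun a : ℝ => a - κ * t * x)
      (g := fun (a b : ℝ) => b - 2 * t * a + κ * t ^ 2 * x) ?_ ?_ ?_
    · exact measurePreserving_sub_right volume _
    · fun_prop
    · refine Filter.Eventually.of_forall fun a => ?_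
      have := (measurePreserving_add_right (volume : Measure ℝ) (-(2 * t * a) + κ * t ^ 2 * x)).map_eq
      convert this using 2
      ext b; ring
  refine MeasurePreserving.skew_product (μa := volume) (μb := volume) (μc := volume)
      (μd := volume) (f := fun a : ℝ => a)
      (g := fun (x : ℝ) (y : ℝ × ℝ) =>
        (y.1 - κ * t * x, y.2 - 2 * t * y.1 + κ * t ^ 2 * x)) ?_ ?_ ?_
  · exact MeasurePreserving.id _
  · fun_prop
  · exact Filter.Eventually.of_forall fun a => (h2 a).map_eq

/-- A convex sequence first decreases and then increases, and `arctan` varies by at most π on each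
stretch. -/
lemma variation_arctan_of_monotone (y : ℕ → ℝ) (hy : Monotone fun i => y (i + 1) - y i) (n : ℕ) :
    ∑ i ∈ Finset.range n, |arctan (y (i + 1)) - arctan (y i)| ≤ 2 * π := by
  have b1 := fun x => (arctan_lt_pi_div_two x).le
  have b2 := fun x => (neg_pi_div_two_lt_arctan x).le
  -- Adding `arctan (y n)` makes the bound inductive: an increasing step raises both sides equally,
  -- and by convexity a decreasing step is preceded only by decreasing ones, so that the sum
  -- telescopes.
  have key : ∑ i ∈ Finset.range n, |arctan (y (i + 1)) - arctan (y i)|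
      ≤ 3 * π / 2 + arctan (y n) := by
    induction n with
    | zero => simp; linarith [b2 (y 0), Real.pi_pos]
    | succ n ih =>
      rw [Finset.sum_range_succ]
      rcases le_total (y n) (y (n + 1)) with h | h
      · rw [abs_of_nonneg (sub_nonneg.2 (arctan_strictMono.monotone h))]
        linarith
      · have e : ∀ i ∈ Finset.range (n + 1), |arctan (y (i + 1)) - arctan (y i)|
            = arctan (y i) - arctan (y (i + 1)) := by
          intro i hi
          have h1 : y (i + 1) - y i ≤ y (n + 1) - y n :=
            hy (Nat.lt_succ_iff.1 (Finset.mem_range.1 hi))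
          rw [abs_of_nonpos (sub_nonpos.2 (arctan_strictMono.monotone (by linarith)))]
          ring
        rw [← Finset.sum_range_succ, Finset.sum_congr rfl e, Finset.sum_range_sub']
        linarith [b1 (y 0), b2 (y (n + 1))]
  linarith [b1 (y n)]

lemma variation_arctan_quadratic (a b c : ℝ) (n : ℕ) :
    ∑ i ∈ Finset.range n, |arctan (a + b * ((i + 1 : ℕ) : ℝ) + c * ((i + 1 : ℕ) : ℝ) ^ 2)
      - arctan (a + b * i + c * (i : ℝ) ^ 2)| ≤ 2 * π := by
  rcases le_total 0 c with h | h
  · refine variation_arctan_of_monotone (fun i => a + b * (i : ℝ) + c * (i : ℝ) ^ 2) ?_ n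
    refine monotone_nat_of_le_succ fun i => ?_
    push_cast
    nlinarith
  · have := variation_arctan_of_monotone (fun i => -(a + b * (i : ℝ) + c * (i : ℝ) ^ 2)) ?_ n
    · refine le_trans (le_of_eq ?_) this
      refine Finset.sum_congr rfl fun i _ => ?_
      rw [arctan_neg, arctan_neg, ← abs_neg]
      congr 1
      ring
    · refine monotone_nat_of_le_succ fun i => ?_
      push_cast
      nlinarith

/-- By the mean value theorem the difference quotient of `arctan` is 1/(1+z²) with z within M of x,
and this is comparable to 1/(1+x²) up to 2(1+M²). -/
lemma abs_div_le_arctan_sub {x y M : ℝ} (hM : |y - x| ≤ M) :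
    |y - x| / (1 + x ^ 2) ≤ 2 * (1 + M ^ 2) * |arctan y - arctan x| := by
  have main : ∀ u v : ℝ, u < v → v - u ≤ M → (x = u ∨ x = v) →
      (v - u) / (1 + x ^ 2) ≤ 2 * (1 + M ^ 2) * (arctan v - arctan u) := by
    intro u v huv hM hx
    obtain ⟨z, ⟨hz1, hz2⟩, hz⟩ := exists_deriv_eq_slope arctan huv
      Real.continuous_arctan.continuousOn Real.differentiable_arctan.differentiableOn
    rw [Real.deriv_arctan] at hz
    have hz' : 1 / (1 + z ^ 2) = (arctan v - arctan u) / (v - u) := hz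
    have e : arctan v - arctan u = (v - u) * (1 / (1 + z ^ 2)) := by
      rw [hz', mul_div_cancel₀ _ (sub_ne_zero.2 huv.ne')]
    rw [e]
    have hz3 : 1 + z ^ 2 ≤ 2 * (1 + M ^ 2) * (1 + x ^ 2) := by
      have : |z - x| ≤ M := by
        rw [abs_le]; rcases hx with rfl | rfl <;> constructor <;> linarith
      have h2 : (z - x) ^ 2 ≤ M ^ 2 := sq_le_sq' (by linarith [abs_le.1 this]) (abs_le.1 this).2
      nlinarith [sq_nonneg (z - 2 * x), mul_nonneg (sq_nonneg M) (sq_nonneg x)]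
    rw [div_le_iff₀ (by positivity)]
    have : (v - u) * 1 ≤ (v - u) * ((1 / (1 + z ^ 2)) * (2 * (1 + M ^ 2) * (1 + x ^ 2))) := by
      refine mul_le_mul_of_nonneg_left ?_ (by linarith)
      rw [one_div, inv_mul_eq_div, le_div_iff₀ (by positivity)]
      linarith
    linarith
  rcases lt_trichotomy x y with h | h | h
  · rw [abs_of_pos (sub_pos.2 h)] at hM ⊢
    rw [abs_of_pos (sub_pos.2 (arctan_strictMono h))]
    exact main x y h hM (Or.inl rfl)
  · subst h; simp
  · rw [abs_of_neg (sub_neg.2 h)] at hM ⊢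
    rw [abs_of_neg (sub_neg.2 (arctan_strictMono h))]
    have := main y x h (by linarith) (Or.inr rfl)
    simpa using this

/-- The frequency side of the piece of the tube kernel at scale `B`. -/
def pieceHat (L B : ℝ) (η : V3) : ℝ :=
  gauss 1 η.1 * ((gauss B η.2.1 - gauss (2 * B) η.2.1) * (L * gauss L η.2.2))

/-- The piece of the tube kernel at scale `B`. -/
def piece (L B : ℝ) (v : V3) : ℝ :=
  gauss 1 v.1 * ((gauss B⁻¹ v.2.1 / B - gauss (2 * B)⁻¹ v.2.1 / (2 * B)) * gauss L⁻¹ v.2.2)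

lemma isFT_piece {L B : ℝ} (hL : 0 < L) (hB : 0 < B) : IsFT (pieceHat L B) (piece L B) := by
  have h := ((isFT_gauss one_pos hB hL).sub
    (isFT_gauss one_pos (by positivity : 0 < 2 * B) hL)).const_mul L
  convert h using 1
  · ext η; simp only [pieceHat]; ring
  · ext v; simp only [piece]; field_simp

lemma gauss_anti {p q : ℝ} (hp : 0 ≤ p) (h : p ≤ q) (x : ℝ) : gauss q x ≤ gauss p x := by
  unfold gauss
  rw [Real.exp_le_exp]
  have : (p * x) ^ 2 ≤ (q * x) ^ 2 := by
    rw [mul_pow, mul_pow]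
    exact mul_le_mul_of_nonneg_right (pow_le_pow_left₀ hp h 2) (sq_nonneg x)
  nlinarith [Real.pi_pos]

lemma pieceHat_nonneg {L B : ℝ} (hL : 0 ≤ L) (hB : 0 ≤ B) (η : V3) : 0 ≤ pieceHat L B η := by
  refine mul_nonneg (gauss_pos _ _).le (mul_nonneg ?_ (mul_nonneg hL (gauss_pos _ _).le))
  exact sub_nonneg.2 (gauss_anti hB (by linarith) _)

/-- The difference of two Gaussians vanishes at the origin. The resulting factor |u| compensates for
the many directions in which a frequency with small second coordinate is seen. -/
lemma gauss_sub_le {B : ℝ} (hB : 1 ≤ B) (u : ℝ) :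
    gauss B u - gauss (2 * B) u ≤ 4 * B * |u| * gauss 1 u := by
  have hB0 : 0 < B := by linarith
  set z := B * |u| with hz
  have hz0 : 0 ≤ z := by positivity
  have hzz : z ^ 2 = (B * u) ^ 2 := by rw [hz, mul_pow, mul_pow, sq_abs]
  have e : gauss (2 * B) u = gauss B u * Real.exp (-(3 * π * z ^ 2)) := by
    unfold gauss
    rw [← Real.exp_add, hzz]
    congr 1; ring
  have h1 : gauss B u - gauss (2 * B) u ≤ gauss B u * (4 * z) := by
    rw [e, ← mul_one_sub]
    refine mul_le_mul_of_nonneg_left ?_ (gauss_pos _ _).le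
    have h2 := Real.add_one_le_exp (-(3 * π * z ^ 2))
    have h3 := Real.exp_pos (-(3 * π * z ^ 2))
    rcases le_total 1 (4 * z) with h | h
    · linarith
    · have : 3 * π * z ^ 2 ≤ 12 * z ^ 2 := by nlinarith [Real.pi_lt_four, sq_nonneg z]
      nlinarith
  have h2 : gauss B u ≤ gauss 1 u := gauss_anti (by norm_num) hB u
  calc _ ≤ gauss B u * (4 * z) := h1
    _ ≤ gauss 1 u * (4 * z) := by gcongr
    _ = _ := by rw [hz]; ring

/-- Half of the Gaussian is traded for the rational decay that `abs_div_le_arctan_sub` can sum; the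
other half keeps decay at unit scale. -/
lemma gauss_le_div {L : ℝ} (hL : 1 ≤ L) (w : ℝ) :
    gauss L w ≤ Real.exp (-(π / 2) * w ^ 2) / (1 + (L * w) ^ 2) := by
  have hpi := Real.pi_gt_three
  rw [le_div_iff₀ (by positivity)]
  have e : gauss L w = Real.exp (-(π / 2) * (L * w) ^ 2) * Real.exp (-(π / 2 * (L * w) ^ 2)) := by
    unfold gauss
    rw [← Real.exp_add]; congr 1; ring
  have h1 : 1 + (L * w) ^ 2 ≤ Real.exp (π / 2 * (L * w) ^ 2) := by
    have := Real.add_one_le_exp (π / 2 * (L * w) ^ 2)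
    nlinarith [sq_nonneg (L * w)]
  have h2 : Real.exp (-(π / 2) * (L * w) ^ 2) ≤ Real.exp (-(π / 2) * w ^ 2) := by
    rw [Real.exp_le_exp, mul_pow]
    nlinarith [mul_nonneg (sq_nonneg w) (by nlinarith : (0:ℝ) ≤ L ^ 2 - 1)]
  rw [e, mul_assoc]
  calc _ ≤ Real.exp (-(π / 2) * w ^ 2) *
        (Real.exp (-(π / 2 * (L * w) ^ 2)) * Real.exp (π / 2 * (L * w) ^ 2)) := by gcongr
    _ = _ := by rw [← Real.exp_add]; simp

/-- L times the third sheared coordinate is a quadratic sequence y in i, with increments -2 times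
the second sheared coordinate up to O(|ξ.1|/L). Hence the sum is essentially a Riemann sum of
|y'|/(1+y²), that is, the variation of arctan y, and it does not grow with L. -/
lemma sum_slope_le (L : ℕ) (hL : 1 ≤ L) {κ : ℝ} (hκ0 : 0 ≤ κ) (hκ1 : κ ≤ 1) (ξ : V3) :
    ∑ i ∈ Finset.range L, |(shear κ (i / L) ξ).2.1| / (1 + (L * (shear κ (i / L) ξ).2.2) ^ 2)
      ≤ 8 * (1 + 18 * (ξ.1 ^ 2 + ξ.2.1 ^ 2 + ξ.2.2 ^ 2)) := by
  obtain ⟨ξ0, ξ1, ξ2⟩ := ξ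
  simp only [shear]
  have hL0 : (0 : ℝ) < L := by exact_mod_cast hL
  have hL1 : (1 : ℝ) ≤ L := by exact_mod_cast hL
  set y : ℕ → ℝ := fun i => L * ξ2 + (-2 * ξ1) * (i : ℝ) + (κ * ξ0 / L) * (i : ℝ) ^ 2 with hy
  have ey : ∀ i : ℕ, (L : ℝ) * (ξ2 - 2 * (i / L) * ξ1 + κ * (i / L) ^ 2 * ξ0) = y i := by
    intro i; simp only [hy]; field_simp; ring
  set M := 2 * |ξ1| + 3 * |ξ0| with hM
  have hκξ : |κ * ξ0| ≤ |ξ0| := by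
    rw [abs_mul, abs_of_nonneg hκ0]; nlinarith [abs_nonneg ξ0]
  have hd : ∀ i : ℕ, y (i + 1) - y i = -2 * (ξ1 - κ * (i / L) * ξ0) + κ * ξ0 / L := by
    intro i; simp only [hy]; push_cast; field_simp; ring
  have hq : |κ * ξ0 / L| ≤ |ξ0| / L := by
    rw [abs_div, abs_of_pos hL0]; gcongr
  have hq' : |ξ0| / L ≤ |ξ0| := div_le_self (abs_nonneg _) hL1
  have hΔ : ∀ i ∈ Finset.range L, |y (i + 1) - y i| ≤ M := by
    intro i hi
    rw [hd]
    have hi' : (i : ℝ) / L ≤ 1 := by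
      rw [div_le_one hL0]; exact_mod_cast (Finset.mem_range.1 hi).le
    have hi0 : (0 : ℝ) ≤ i / L := by positivity
    have h1 : |κ * (i / L) * ξ0| ≤ |ξ0| := by
      rw [mul_right_comm, abs_mul, abs_of_nonneg hi0]
      nlinarith [abs_nonneg (κ * ξ0)]
    have h1' := abs_le.1 h1
    have h2' := abs_le.1 (hq.trans hq')
    rw [abs_le]
    have := neg_abs_le ξ1
    have := le_abs_self ξ1
    constructor <;> linarith
  have hterm : ∀ i ∈ Finset.range L,
      |ξ1 - κ * (i / L) * ξ0| / (1 + (L * (ξ2 - 2 * (i / L) * ξ1 + κ * (i / L) ^ 2 * ξ0)) ^ 2)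
      ≤ (1 + M ^ 2) * |arctan (y (i + 1)) - arctan (y i)| + |ξ0| / L := by
    intro i hi
    rw [ey]
    have h1 := abs_div_le_arctan_sub (hΔ i hi)
    have h2 : |ξ1 - κ * (i / L) * ξ0| ≤ |y (i + 1) - y i| / 2 + |ξ0| / L := by
      have h2' := abs_le.1 hq
      have := hd i
      have e : ξ1 - κ * (i / L) * ξ0 = (-(y (i + 1) - y i) + κ * ξ0 / L) / 2 := by linarith
      rw [e, abs_le]
      have := neg_abs_le (y (i + 1) - y i)
      have := le_abs_self (y (i + 1) - y i)
      constructor <;> linarith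
    have hpos : (0 : ℝ) < 1 + y i ^ 2 := by positivity
    have h3 : |ξ0| / L / (1 + y i ^ 2) ≤ |ξ0| / L :=
      div_le_self (by positivity) (by nlinarith [sq_nonneg (y i)])
    calc _ ≤ (|y (i + 1) - y i| / 2 + |ξ0| / L) / (1 + y i ^ 2) := by gcongr
      _ = (|y (i + 1) - y i| / (1 + y i ^ 2)) / 2 + |ξ0| / L / (1 + y i ^ 2) := by ring
      _ ≤ _ := by linarith
  refine (Finset.sum_le_sum hterm).trans ?_
  rw [Finset.sum_add_distrib, ← Finset.mul_sum, Finset.sum_const, Finset.card_range, nsmul_eq_mul,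
    mul_div_cancel₀ _ hL0.ne']
  have hv := variation_arctan_quadratic (L * ξ2) (-2 * ξ1) (κ * ξ0 / L) L
  have hv' : ∑ i ∈ Finset.range L, |arctan (y (i + 1)) - arctan (y i)| ≤ 7 := by
    refine le_trans hv ?_
    linarith [Real.pi_lt_d2]
  have hM2 : M ^ 2 ≤ 18 * (ξ0 ^ 2 + ξ1 ^ 2) := by
    rw [hM, ← sq_abs ξ0, ← sq_abs ξ1]
    nlinarith [sq_nonneg (|ξ1| - |ξ0|), sq_nonneg |ξ1|]
  have h0 : |ξ0| ≤ 1 + ξ0 ^ 2 := by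
    rw [← sq_abs ξ0]; nlinarith [sq_nonneg (|ξ0| - 1), sq_nonneg (|ξ0|)]
  have : (1 + M ^ 2) * ∑ i ∈ Finset.range L, |arctan (y (i + 1)) - arctan (y i)|
      ≤ (1 + M ^ 2) * 7 := by gcongr
  nlinarith [sq_nonneg ξ1, sq_nonneg ξ2, sq_nonneg ξ0]

/-- `gauss_sub_le` and `gauss_le_div` produce the summand of `sum_slope_le`, so summing over L
directions costs nothing beyond the bound B L for a single piece. The leftover Gaussians of the
sheared frequency are dominated by one Gaussian of ξ, since the shears distort |ξ|² by at most 16.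
-/
lemma sum_pieceHat_le (L : ℕ) (hL : 1 ≤ L) {κ B : ℝ} (hκ0 : 0 ≤ κ) (hκ1 : κ ≤ 1) (hB : 1 ≤ B)
    (ξ : V3) :
    ∑ i ∈ Finset.range L, pieceHat L B (shear κ (i / L) ξ)
      ≤ (12800 * B * L) * (gauss 8⁻¹ ξ.1 * (gauss 8⁻¹ ξ.2.1 * gauss 8⁻¹ ξ.2.2)) := by
  have hL1 : (1 : ℝ) ≤ L := by exact_mod_cast hL
  have hL0 : (0 : ℝ) < L := by linarith
  set X := ξ.1 ^ 2 + ξ.2.1 ^ 2 + ξ.2.2 ^ 2 with hX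
  have hX0 : 0 ≤ X := by positivity
  have hpi := Real.pi_gt_three
  have hterm : ∀ i ∈ Finset.range L, pieceHat L B (shear κ (i / L) ξ) ≤
      (4 * B * L * Real.exp (-(π / 32) * X)) *
      (|(shear κ (i / L) ξ).2.1| / (1 + (L * (shear κ (i / L) ξ).2.2) ^ 2)) := by
    intro i hi
    have ht1 : (i : ℝ) / L ≤ 1 := by
      rw [div_le_one hL0]; exact_mod_cast (Finset.mem_range.1 hi).le
    have ht0 : (0 : ℝ) ≤ i / L := by positivity
    set t : ℝ := i / L
    set η := shear κ t ξ with hη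
    have e0 : ξ.1 = η.1 := rfl
    have e1 : ξ.2.1 = η.2.1 + κ * t * η.1 := by simp [hη, shear]
    have e2 : ξ.2.2 = η.2.2 + 2 * t * η.2.1 + κ * t ^ 2 * η.1 := by
      simp only [hη, shear]; ring
    have hX' : X ≤ 16 * (η.1 ^ 2 + η.2.1 ^ 2 + η.2.2 ^ 2) := by
      have a1 : (κ * t) ^ 2 ≤ 1 := by
        have : κ * t ≤ 1 := mul_le_one₀ hκ1 ht0 ht1
        exact pow_le_one₀ (by positivity) this
      have a2 : (κ * t ^ 2) ^ 2 ≤ 1 := by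
        have : κ * t ^ 2 ≤ 1 := mul_le_one₀ hκ1 (by positivity) (pow_le_one₀ ht0 ht1)
        exact pow_le_one₀ (by positivity) this
      have a3 : t ^ 2 ≤ 1 := pow_le_one₀ ht0 ht1
      have b1 : ξ.2.1 ^ 2 ≤ 2 * η.2.1 ^ 2 + 2 * η.1 ^ 2 := by
        rw [e1]
        nlinarith [sq_nonneg (η.2.1 - κ * t * η.1), mul_le_mul_of_nonneg_right a1 (sq_nonneg η.1)]
      have b2 : ξ.2.2 ^ 2 ≤ 3 * (η.2.2 ^ 2 + 4 * η.2.1 ^ 2 + η.1 ^ 2) := by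
        have : ξ.2.2 ^ 2 ≤ 3 * (η.2.2 ^ 2 + (2 * t * η.2.1) ^ 2 + (κ * t ^ 2 * η.1) ^ 2) := by
          rw [e2]
          nlinarith [sq_nonneg (η.2.2 - 2 * t * η.2.1), sq_nonneg (η.2.2 - κ * t ^ 2 * η.1),
            sq_nonneg (2 * t * η.2.1 - κ * t ^ 2 * η.1)]
        nlinarith [mul_le_mul_of_nonneg_right a2 (sq_nonneg η.1),
          mul_le_mul_of_nonneg_right a3 (sq_nonneg η.2.1)]
      rw [hX, e0] at *
      nlinarith [sq_nonneg η.1, sq_nonneg η.2.1, sq_nonneg η.2.2]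
    have hexp : gauss 1 η.1 * gauss 1 η.2.1 * Real.exp (-(π / 2) * η.2.2 ^ 2)
        ≤ Real.exp (-(π / 32) * X) := by
      unfold gauss
      rw [← Real.exp_add, ← Real.exp_add, Real.exp_le_exp]
      nlinarith [sq_nonneg η.1, sq_nonneg η.2.1, mul_le_mul_of_nonneg_left hX' Real.pi_pos.le]
    calc pieceHat L B η
        ≤ gauss 1 η.1 * ((4 * B * |η.2.1| * gauss 1 η.2.1) *
            (L * (Real.exp (-(π / 2) * η.2.2 ^ 2) / (1 + (L * η.2.2) ^ 2)))) := by
          refine mul_le_mul_of_nonneg_left ?_ (gauss_pos _ _).le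
          refine mul_le_mul (gauss_sub_le hB _) ?_ (mul_nonneg hL0.le (gauss_pos _ _).le) ?_
          · exact mul_le_mul_of_nonneg_left (gauss_le_div hL1 _) hL0.le
          · have := gauss_pos 1 η.2.1
            positivity
      _ = (4 * B * L * (gauss 1 η.1 * gauss 1 η.2.1 * Real.exp (-(π / 2) * η.2.2 ^ 2))) *
          (|η.2.1| / (1 + (L * η.2.2) ^ 2)) := by ring
      _ ≤ _ := by gcongr
  refine (Finset.sum_le_sum hterm).trans ?_
  rw [← Finset.mul_sum]
  have h1 := sum_slope_le L hL hκ0 hκ1 ξ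
  have e : gauss 8⁻¹ ξ.1 * (gauss 8⁻¹ ξ.2.1 * gauss 8⁻¹ ξ.2.2) = Real.exp (-(π / 64) * X) := by
    unfold gauss
    rw [← Real.exp_add, ← Real.exp_add]; congr 1; rw [hX]; ring
  rw [e]
  have h2 : Real.exp (-(π / 32) * X) = Real.exp (-(π / 64) * X) * Real.exp (-(π / 64 * X)) := by
    rw [← Real.exp_add]; congr 1; ring
  -- Half of the remaining Gaussian decay absorbs the quadratic growth in `sum_slope_le`.
  have h3 : 8 * (1 + 18 * X) * Real.exp (-(π / 64 * X)) ≤ 3200 := by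
    have := Real.add_one_le_exp (π / 64 * X)
    have h4 : 8 * (1 + 18 * X) ≤ 3200 * Real.exp (π / 64 * X) := by nlinarith
    calc _ ≤ 3200 * Real.exp (π / 64 * X) * Real.exp (-(π / 64 * X)) := by gcongr
      _ = 3200 := by rw [mul_assoc, ← Real.exp_add]; simp
  rw [h2]
  have hE := Real.exp_pos (-(π / 64) * X)
  calc _ ≤ 4 * B * L * (Real.exp (-(π / 64) * X) * Real.exp (-(π / 64 * X))) *
        (8 * (1 + 18 * X)) := by
        refine mul_le_mul_of_nonneg_left h1 ?_
        have := Real.exp_pos (-(π / 64 * X))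
        positivity
    _ = 4 * B * L * Real.exp (-(π / 64) * X) * (8 * (1 + 18 * X) * Real.exp (-(π / 64 * X))) := by
        ring
    _ ≤ 4 * B * L * Real.exp (-(π / 64) * X) * 3200 := by
        refine mul_le_mul_of_nonneg_left h3 (by positivity)
    _ = _ := by ring

/-! ### Counting through windows, and Gaussian sums over sparse points. -/

open scoped Classical

/-- Counting in a window of radius `A` through windows of radius `w`. -/
lemma card_le_of_windows {ι : Type*} (S : Finset ι) (x : ι → ℝ) {c A w M : ℝ} (hw : 0 < w)
    (hA : 0 ≤ A) (hM : ∀ y, ((S.filter fun s => |x s - y| ≤ w).card : ℝ) ≤ M)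
    (hS : ∀ s ∈ S, |x s - c| ≤ A) : (S.card : ℝ) ≤ (2 * A / w + 1) * M := by
  have hM0 : 0 ≤ M := (Nat.cast_nonneg _).trans (hM 0)
  set f : ι → ℕ := fun s => ⌊(x s - c + A) / w⌋₊ with hf
  have hmaps : Set.MapsTo f S (Finset.range (⌊2 * A / w⌋₊ + 1)) := by
    intro s hs
    rw [Finset.mem_coe, Finset.mem_range, Nat.lt_succ_iff]
    refine Nat.floor_le_floor ?_
    have := abs_le.1 (hS s hs)
    gcongr
    linarith
  rw [Finset.card_eq_sum_card_fiberwise hmaps]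
  push_cast
  have hfib : ∀ n ∈ Finset.range (⌊2 * A / w⌋₊ + 1),
      (((S.filter fun s => f s = n).card : ℕ) : ℝ) ≤ M := by
    intro n _
    refine le_trans ?_ (hM (c - A + n * w))
    refine Nat.cast_le.2 (Finset.card_le_card fun s hs => ?_)
    rw [Finset.mem_filter] at hs ⊢
    refine ⟨hs.1, ?_⟩
    have h1 := abs_le.1 (hS s hs.1)
    have h0 : 0 ≤ (x s - c + A) / w := div_nonneg (by linarith) hw.le
    have h2 := Nat.floor_le h0
    have h3 := Nat.lt_floor_add_one ((x s - c + A) / w)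
    have h4 : ((⌊(x s - c + A) / w⌋₊ : ℕ) : ℝ) = n := by exact_mod_cast hs.2
    rw [h4] at h2 h3
    rw [le_div_iff₀ hw] at h2
    rw [div_lt_iff₀ hw] at h3
    rw [abs_le]; constructor <;> nlinarith
  refine (Finset.sum_le_sum hfib).trans ?_
  rw [Finset.sum_const, Finset.card_range, nsmul_eq_mul]
  push_cast
  have := Nat.floor_le (show 0 ≤ 2 * A / w by positivity)
  gcongr

lemma summable_one_div_one_add_int_sq : Summable fun n : ℤ => 1 / (1 + (n : ℝ) ^ 2) := by
  have h := (Real.summable_one_div_int_pow (p := 2)).2 one_lt_two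
  have h2 : Summable fun n : ℤ => if n = 0 then (1 : ℝ) else 0 :=
    summable_of_ne_finset_zero (s := {0}) (by intro b hb; simpa using hb)
  refine Summable.of_nonneg_of_le (fun n => by positivity) (fun n => ?_) (h.add h2)
  by_cases hn : n = 0
  · simp [hn]
  · simp only [hn, if_false, add_zero]
    have : (0 : ℝ) < (n : ℝ) ^ 2 := by positivity
    exact one_div_le_one_div_of_le this (by linarith)

/-- Sorted by the integer part n of c - x, the points fall into unit windows on which the Gaussian
is O(1/(1+n²)). The weights g allow the bound to be iterated one coordinate at a time. -/
lemma exists_gauss_sum_le {p : ℝ} (hp : 0 < p) : ∃ W : ℝ, 0 < W ∧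
    ∀ {ι : Type} (S : Finset ι) (x g : ι → ℝ) (M c : ℝ), (∀ s ∈ S, 0 ≤ g s) →
      (∀ y, ∑ s ∈ S.filter (fun s => |x s - y| ≤ 1), g s ≤ M) →
      ∑ s ∈ S, gauss p (c - x s) * g s ≤ W * M := by
  set V : ℝ := ∑' n : ℤ, 1 / (1 + (n : ℝ) ^ 2) with hV
  have hV0 : 0 ≤ V := tsum_nonneg fun n => by positivity
  set D : ℝ := 3 + 1 / p ^ 2 with hD
  have hD0 : 0 < D := by positivity
  refine ⟨D * (V + 1), by positivity, ?_⟩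
  intro ι S x g M c hg hM
  have hM0 : 0 ≤ M := (Finset.sum_nonneg fun s hs => hg s (Finset.mem_filter.1 hs).1).trans (hM 0)
  set f : ι → ℤ := fun s => ⌊c - x s⌋ with hf
  rw [← Finset.sum_fiberwise_of_maps_to (t := S.image f) (g := f)
    (fun s hs => Finset.mem_image_of_mem _ hs)]
  have hfib : ∀ n ∈ S.image f, ∑ s ∈ S with f s = n, gauss p (c - x s) * g s
      ≤ D * M * (1 / (1 + (n : ℝ) ^ 2)) := by
    intro n _
    have h1 : ∀ s ∈ S.filter (fun s => f s = n), gauss p (c - x s) * g s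
        ≤ (D * (1 / (1 + (n : ℝ) ^ 2))) * g s := by
      intro s hs
      rw [Finset.mem_filter] at hs
      refine mul_le_mul_of_nonneg_right ?_ (hg s hs.1)
      set z := c - x s
      have hz1 : (n : ℝ) ≤ z := by rw [← hs.2]; exact Int.floor_le _
      have hz2 : z < n + 1 := by rw [← hs.2]; exact Int.lt_floor_add_one _
      have hn : 1 + (n : ℝ) ^ 2 ≤ 3 + 2 * z ^ 2 := by
        nlinarith [sq_nonneg ((n : ℝ) - 2 * z), sq_nonneg ((n : ℝ) - z)]
      have hG : gauss p z * (1 + π * (p * z) ^ 2) ≤ 1 := by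
        have h3 := Real.add_one_le_exp (π * (p * z) ^ 2)
        have h4 : gauss p z * Real.exp (π * (p * z) ^ 2) = 1 := by
          unfold gauss; rw [← Real.exp_add]; simp
        rw [← h4]
        exact mul_le_mul_of_nonneg_left (by linarith) (gauss_pos _ _).le
      have hDz : 3 + 2 * z ^ 2 ≤ D * (1 + π * (p * z) ^ 2) := by
        have e : D * (1 + π * (p * z) ^ 2) =
            3 + 1 / p ^ 2 + 3 * π * (p * z) ^ 2 + π * z ^ 2 := by
          rw [hD]; field_simp; ring
        rw [e]
        have : 0 < 1 / p ^ 2 := by positivity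
        nlinarith [Real.pi_gt_three, sq_nonneg z, mul_nonneg Real.pi_pos.le (sq_nonneg (p * z))]
      rw [mul_one_div, le_div_iff₀ (by positivity)]
      calc gauss p z * (1 + (n : ℝ) ^ 2) ≤ gauss p z * (D * (1 + π * (p * z) ^ 2)) :=
            mul_le_mul_of_nonneg_left (hn.trans hDz) (gauss_pos _ _).le
        _ = D * (gauss p z * (1 + π * (p * z) ^ 2)) := by ring
        _ ≤ D * 1 := by gcongr
        _ = D := mul_one D
    refine (Finset.sum_le_sum h1).trans ?_
    rw [← Finset.mul_sum]
    have h2 : ∑ s ∈ S with f s = n, g s ≤ M := by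
      refine le_trans ?_ (hM (c - n))
      refine Finset.sum_le_sum_of_subset_of_nonneg ?_ ?_
      · intro s hs
        rw [Finset.mem_filter] at hs ⊢
        refine ⟨hs.1, ?_⟩
        have hz1 : (n : ℝ) ≤ c - x s := by rw [← hs.2]; exact Int.floor_le _
        have hz2 : c - x s < n + 1 := by rw [← hs.2]; exact Int.lt_floor_add_one _
        rw [abs_le]; constructor <;> linarith
      · intro s hs _
        exact hg s (Finset.mem_filter.1 hs).1
    calc _ ≤ D * (1 / (1 + (n : ℝ) ^ 2)) * M := by gcongr
      _ = _ := by ring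
  refine (Finset.sum_le_sum hfib).trans ?_
  rw [← Finset.mul_sum]
  have := summable_one_div_one_add_int_sq.sum_le_tsum (S.image f) (fun n _ => by positivity)
  calc _ ≤ D * M * V := by gcongr
    _ ≤ D * M * (V + 1) := by gcongr; linarith
    _ = _ := by ring

lemma exists_gauss_sum2_le {p : ℝ} (hp : 0 < p) : ∃ W : ℝ, 0 < W ∧
    ∀ {ι : Type} (S : Finset ι) (x y : ι → ℝ) (M a b : ℝ),
      (∀ a b, ((S.filter fun s => |x s - a| ≤ 1 ∧ |y s - b| ≤ 1).card : ℝ) ≤ M) →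
      ∑ s ∈ S, gauss p (a - x s) * gauss p (b - y s) ≤ W * M := by
  obtain ⟨W, hW, h⟩ := exists_gauss_sum_le hp
  refine ⟨W * W, by positivity, ?_⟩
  intro ι S x y M a b hM
  rw [mul_assoc]
  refine h S x _ _ a (fun s _ => (gauss_pos _ _).le) fun a' => ?_
  have := h (S.filter fun s => |x s - a'| ≤ 1) y (fun _ => 1) M b (fun _ _ => zero_le_one)
    fun b' => ?_
  · simpa using this
  · rw [Finset.filter_filter, Finset.sum_const, nsmul_eq_mul, mul_one]
    exact hM a' b'

lemma exists_gauss_sum3_le {p : ℝ} (hp : 0 < p) : ∃ W : ℝ, 0 < W ∧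
    ∀ {ι : Type} (S : Finset ι) (v : ι → V3) (M : ℝ) (u : V3),
      (∀ u : V3, ((S.filter fun s => |(v s).1 - u.1| ≤ 1 ∧ |(v s).2.1 - u.2.1| ≤ 1 ∧
        |(v s).2.2 - u.2.2| ≤ 1).card : ℝ) ≤ M) →
      ∑ s ∈ S, gauss p (u.1 - (v s).1) *
        (gauss p (u.2.1 - (v s).2.1) * gauss p (u.2.2 - (v s).2.2)) ≤ W * M := by
  obtain ⟨W, hW, h⟩ := exists_gauss_sum_le hp
  obtain ⟨W', hW', h'⟩ := exists_gauss_sum2_le hp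
  refine ⟨W * W', by positivity, ?_⟩
  intro ι S v M u hM
  rw [mul_assoc]
  refine h S (fun s => (v s).1) _ _ u.1
    (fun s _ => mul_nonneg (gauss_pos _ _).le (gauss_pos _ _).le) fun a' => ?_
  refine h' _ (fun s => (v s).2.1) (fun s => (v s).2.2) M _ _ fun b' c' => ?_
  rw [Finset.filter_filter]
  exact hM (a', b', c')

/-! ### Incidences of points and tubes. -/

/-- The quadratic form with weights √l on S and -1/√l on T is nonnegative because the transform is.
-/
lemma IsFT.cross_le {ι θ : Type*} {H G : V3 → ℝ} (h : IsFT H G) (hH : ∀ η, 0 ≤ H η)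
    (hG : ∀ v, G (-v) = G v) (S : Finset ι) (T : Finset θ) (v : ι → V3) (w : θ → V3) {l : ℝ}
    (hl : 0 < l) :
    2 * ∑ s ∈ S, ∑ t ∈ T, G (v s - w t) ≤
      l * (∑ s ∈ S, ∑ s' ∈ S, G (v s - v s')) + l⁻¹ * ∑ t ∈ T, ∑ t' ∈ T, G (w t - w t') := by
  have key := h.quadForm_nonneg hH (S.disjSum T) (Sum.elim (fun _ => √l) (fun _ => -(√l)⁻¹))
    (Sum.elim v w)
  have hs : 0 < √l := Real.sqrt_pos.2 hl
  have e1 : √l * √l = l := Real.mul_self_sqrt hl.le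
  have e2 : √l * (√l)⁻¹ = 1 := mul_inv_cancel₀ hs.ne'
  have e3 : (√l)⁻¹ * (√l)⁻¹ = l⁻¹ := by rw [← mul_inv, e1]
  have e4 : ∑ t ∈ T, ∑ s ∈ S, G (w t - v s) = ∑ s ∈ S, ∑ t ∈ T, G (v s - w t) := by
    rw [Finset.sum_comm]
    refine Finset.sum_congr rfl fun s _ => Finset.sum_congr rfl fun t _ => ?_
    rw [← hG, neg_sub]
  simp only [Finset.sum_disjSum, Sum.elim_inl, Sum.elim_inr, mul_neg, neg_mul, e1, e2, e3,
    mul_comm (√l)⁻¹ √l, one_mul, Finset.sum_add_distrib, Finset.sum_neg_distrib, e4,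
    ← Finset.mul_sum] at key
  linarith

lemma piece_neg (L B : ℝ) (v : V3) : piece L B (-v) = piece L B v := by
  simp [piece, gauss_neg]

lemma gauss_inv_mul {L : ℝ} (x : ℝ) : gauss L⁻¹ x = gauss 1 (x / L) := by
  unfold gauss; congr 2; ring

lemma gauss_inv_mono {B L : ℝ} (hB : 0 < B) (hBL : B ≤ L) (x : ℝ) :
    gauss B⁻¹ x ≤ gauss L⁻¹ x :=
  gauss_anti (inv_nonneg.2 (hB.le.trans hBL)) (inv_anti₀ hB hBL) x

/-- The gain 1/B for parallel tubes balances the factor B lost in `sum_pieceHat_le`. -/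
lemma piece_le {L B : ℝ} (hB : 0 < B) (hBL : B ≤ L) (v : V3) :
    piece L B v ≤ B⁻¹ * (gauss 1 v.1 * gauss 1 (v.2.1 / L)) := by
  have h1 : gauss B⁻¹ v.2.1 / B - gauss (2 * B)⁻¹ v.2.1 / (2 * B) ≤ gauss 1 (v.2.1 / L) / B := by
    have h2 : 0 ≤ gauss (2 * B)⁻¹ v.2.1 / (2 * B) :=
      div_nonneg (gauss_pos _ _).le (by positivity)
    have h3 : gauss B⁻¹ v.2.1 / B ≤ gauss 1 (v.2.1 / L) / B := by
      rw [← gauss_inv_mul]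
      exact div_le_div_of_nonneg_right (gauss_inv_mono hB hBL _) hB.le
    linarith
  have h4 : 0 ≤ gauss 1 (v.2.1 / L) / B := div_nonneg (gauss_pos _ _).le hB.le
  unfold piece
  calc _ ≤ gauss 1 v.1 * (gauss 1 (v.2.1 / L) / B * 1) := by
        refine mul_le_mul_of_nonneg_left ?_ (gauss_pos _ _).le
        refine (mul_le_mul_of_nonneg_right h1 (gauss_pos _ _).le).trans ?_
        exact mul_le_mul_of_nonneg_left (gauss_le_one _ _) h4
    _ = _ := by ring

/-- The tube kernel is a sum of pieces plus a spread out remainder. -/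
lemma kernel_eq (k : ℕ) (v : V3) :
    gauss 1 v.1 * (gauss 1 v.2.1 * gauss ((2 : ℝ) ^ k)⁻¹ v.2.2) =
      (∑ n ∈ Finset.range k, piece (2 ^ k) (2 ^ n) v) +
        gauss 1 v.1 * (gauss ((2 : ℝ) ^ k)⁻¹ v.2.1 / 2 ^ k * gauss ((2 : ℝ) ^ k)⁻¹ v.2.2) := by
  have e : ∀ n ∈ Finset.range k, piece (2 ^ k) (2 ^ n) v = (gauss 1 v.1 *
      gauss ((2 : ℝ) ^ k)⁻¹ v.2.2) * (gauss ((2 : ℝ) ^ n)⁻¹ v.2.1 / 2 ^ n -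
        gauss ((2 : ℝ) ^ (n + 1))⁻¹ v.2.1 / 2 ^ (n + 1)) := by
    intro n _
    unfold piece
    rw [pow_succ' (2 : ℝ) n]; ring
  rw [Finset.sum_congr rfl e, ← Finset.mul_sum,
    Finset.sum_range_sub' (fun n => gauss ((2 : ℝ) ^ n)⁻¹ v.2.1 / 2 ^ n)]
  simp
  ring

/-- `IsFT.cross_le` is applied in each direction with weight μ/B. The form of the points, summed
over directions, is O(B L M |S|) by `sum_pieceHat_le` and the sparsity of the points; the form of
parallel tubes is O(Z |T i|/B). The scale B cancels, so every dyadic scale obeys the same bound. -/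
lemma exists_piece_incidence_le : ∃ C : ℝ, 0 < C ∧
    ∀ {ι θ : Type} (L : ℕ) (B κ μ M Z : ℝ) (S : Finset ι) (pos : ι → V3) (T : ℕ → Finset θ)
      (tb : θ → V3), 1 ≤ L → 1 ≤ B → B ≤ L → 0 ≤ κ → κ ≤ 1 → 0 < μ →
      (∀ u : V3, ((S.filter fun s => |(pos s).1 - u.1| ≤ 1 ∧ |(pos s).2.1 - u.2.1| ≤ 1 ∧
        |(pos s).2.2 - u.2.2| ≤ 1).card : ℝ) ≤ M) →
      (∀ i a b, (((T i).filter fun t => |(tb t).1 - a| ≤ 1 ∧ |(tb t).2.1 - b| ≤ L).card : ℝ) ≤ Z) →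
      ∑ i ∈ Finset.range L, ∑ s ∈ S, ∑ t ∈ T i, piece L B (tilt κ (i / L) (pos s) - tb t) ≤
        C * (μ * L * M * S.card + μ⁻¹ * Z * ∑ i ∈ Finset.range L, ((T i).card : ℝ)) := by
  obtain ⟨W3, hW3, h3⟩ := exists_gauss_sum3_le (p := 8) (by norm_num)
  obtain ⟨W2, hW2, h2⟩ := exists_gauss_sum2_le (p := 1) (by norm_num)
  refine ⟨12800 * 512 * W3 + W2, by positivity, ?_⟩
  intro ι θ L B κ μ M Z S pos T tb hL hB hBL hκ0 hκ1 hμ hS hT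
  have hL0 : (0 : ℝ) < L := by exact_mod_cast hL
  have hB0 : 0 < B := by linarith
  have hM0 : 0 ≤ M := (Nat.cast_nonneg _).trans (hS 0)
  have hZ0 : 0 ≤ Z := (Nat.cast_nonneg _).trans (hT 0 0 0)
  have hft := isFT_piece hL0 hB0
  have hcross : ∀ i ∈ Finset.range L,
      2 * ∑ s ∈ S, ∑ t ∈ T i, piece L B (tilt κ (i / L) (pos s) - tb t) ≤
      (μ / B) * (∑ s ∈ S, ∑ s' ∈ S, piece L B (tilt κ (i / L) (pos s - pos s'))) +
        μ⁻¹ * (W2 * Z) * (T i).card := by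
    intro i _
    have h := hft.cross_le (pieceHat_nonneg hL0.le hB0.le) (piece_neg _ _) S (T i)
      (fun s => tilt κ (i / L) (pos s)) tb (l := μ / B) (by positivity)
    simp_rw [tilt_sub]
    refine h.trans (add_le_add_right ?_ _)
    have h4 : ∀ t ∈ T i, ∑ t' ∈ T i, piece L B (tb t - tb t') ≤ B⁻¹ * (W2 * Z) := by
      intro t _
      refine (Finset.sum_le_sum fun t' _ => piece_le hB0 hBL _).trans ?_
      rw [← Finset.mul_sum]
      refine mul_le_mul_of_nonneg_left ?_ (by positivity)
      have h5 := h2 (T i) (fun t => (tb t).1) (fun t => (tb t).2.1 / L) Z (tb t).1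
        ((tb t).2.1 / L) ?_
      · simpa [sub_div] using h5
      · intro a b
        refine le_trans ?_ (hT i a (b * L))
        refine Nat.cast_le.2 (Finset.card_le_card fun t' ht' => ?_)
        rw [Finset.mem_filter] at ht' ⊢
        refine ⟨ht'.1, ht'.2.1, ?_⟩
        have e : (tb t').2.1 - b * L = ((tb t').2.1 / L - b) * L := by field_simp
        rw [e, abs_mul, abs_of_pos hL0]
        nlinarith [ht'.2.2]
    have h5 := Finset.sum_le_sum h4
    rw [Finset.sum_const, nsmul_eq_mul] at h5
    calc (μ / B)⁻¹ * ∑ t ∈ T i, ∑ t' ∈ T i, piece L B (tb t - tb t')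
        ≤ (μ / B)⁻¹ * ((T i).card * (B⁻¹ * (W2 * Z))) := by gcongr
      _ = _ := by field_simp
  have hsum := Finset.sum_le_sum hcross
  rw [← Finset.mul_sum, Finset.sum_add_distrib, ← Finset.mul_sum, ← Finset.mul_sum] at hsum
  have hSS : ∑ i ∈ Finset.range L, ∑ s ∈ S, ∑ s' ∈ S, piece L B (tilt κ (i / L) (pos s - pos s'))
      ≤ 12800 * B * L * 512 * (W3 * M) * S.card := by
    have f1 := IsFT.sum (Finset.range L) fun i _ =>
      hft.comp (measurePreserving_shear κ (i / L)) (dot_shear_tilt κ (i / L))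
    -- The transform of each factor `gauss 8⁻¹` is 8 times `gauss 8`, whence 512 = 8³.
    have f2 := (isFT_gauss (p := 8⁻¹) (q := 8⁻¹) (r := 8⁻¹) (by norm_num) (by norm_num)
      (by norm_num)).const_mul (12800 * B * L)
    have h := f1.quadForm_mono f2 (fun ξ => sum_pieceHat_le L hL hκ0 hκ1 hB ξ) S (fun _ => 1) pos
    simp only [one_mul, inv_inv] at h
    have e : ∑ i ∈ Finset.range L, ∑ s ∈ S, ∑ s' ∈ S, piece L B (tilt κ (i / L) (pos s - pos s'))
        = ∑ s ∈ S, ∑ s' ∈ S, ∑ i ∈ Finset.range L, piece L B (tilt κ (i / L) (pos s - pos s')) := by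
      rw [Finset.sum_comm]
      exact Finset.sum_congr rfl fun s _ => Finset.sum_comm
    rw [e]
    refine h.trans ?_
    have h6 : ∀ s ∈ S, ∑ s' ∈ S, 12800 * B * L * (gauss 8 (pos s - pos s').1 / 8⁻¹ *
        (gauss 8 (pos s - pos s').2.1 / 8⁻¹ * (gauss 8 (pos s - pos s').2.2 / 8⁻¹)))
        ≤ 12800 * B * L * 512 * (W3 * M) := by
      intro s _
      have h7 := h3 S pos M (pos s) hS
      calc _ = 12800 * B * L * 512 * ∑ s' ∈ S, gauss 8 ((pos s).1 - (pos s').1) *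
            (gauss 8 ((pos s).2.1 - (pos s').2.1) * gauss 8 ((pos s).2.2 - (pos s').2.2)) := by
            rw [Finset.mul_sum]
            refine Finset.sum_congr rfl fun s' _ => ?_
            simp only [Prod.fst_sub, Prod.snd_sub]
            ring
        _ ≤ _ := by gcongr
    have h8 := Finset.sum_le_sum h6
    rw [Finset.sum_const, nsmul_eq_mul] at h8
    linarith
  have h9 : μ / B * ∑ i ∈ Finset.range L, ∑ s ∈ S, ∑ s' ∈ S,
      piece L B (tilt κ (i / L) (pos s - pos s')) ≤ 12800 * 512 * W3 * (μ * L * M * S.card) := by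
    calc _ ≤ μ / B * (12800 * B * L * 512 * (W3 * M) * S.card) := by gcongr
      _ = _ := by field_simp
  set V := ∑ i ∈ Finset.range L, ((T i).card : ℝ)
  have hVT : 0 ≤ V := Finset.sum_nonneg fun _ _ => Nat.cast_nonneg _
  have p1 : 0 ≤ μ * L * M * S.card := by positivity
  have p2 : 0 ≤ μ⁻¹ * Z * V := by positivity
  have p3 : μ⁻¹ * (W2 * Z) * V = W2 * (μ⁻¹ * Z * V) := by ring
  nlinarith [mul_nonneg hW2.le p1, mul_nonneg hW3.le p2, mul_nonneg hW2.le p2,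
    mul_nonneg hW3.le p1]

/-- The number of directions `i < L` in which the point `v` is near a tube. -/
def tubeHits {θ : Type} (L : ℕ) (κ C₀ : ℝ) (T : ℕ → Finset θ) (tb : θ → V3) (v : V3) : ℕ :=
  ((Finset.range L).filter fun i => ∃ t ∈ T i, |(tilt κ (i / L) v - tb t).1| ≤ C₀ ∧
    |(tilt κ (i / L) v - tb t).2.1| ≤ C₀).card

/-- By `kernel_eq` there are k pieces, each bounded by `exists_piece_incidence_le`. The remainder
has height 2^(-k), hence contributes O(2^(-k) Z) per point and direction, and O(Z) per point in
total. -/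
lemma exists_tube_kernel_le : ∃ C : ℝ, 0 < C ∧
    ∀ {ι θ : Type} (k : ℕ) (κ μ M Z : ℝ) (S : Finset ι) (pos : ι → V3) (T : ℕ → Finset θ)
      (tb : θ → V3), 0 ≤ κ → κ ≤ 1 → 0 < μ →
      (∀ u : V3, ((S.filter fun s => |(pos s).1 - u.1| ≤ 1 ∧ |(pos s).2.1 - u.2.1| ≤ 1 ∧
        |(pos s).2.2 - u.2.2| ≤ 1).card : ℝ) ≤ M) →
      (∀ i a b, (((T i).filter fun t => |(tb t).1 - a| ≤ 1 ∧ |(tb t).2.1 - b| ≤ 2 ^ k).card : ℝ)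
        ≤ Z) →
      ∑ i ∈ Finset.range (2 ^ k), ∑ s ∈ S, ∑ t ∈ T i,
        (fun v : V3 => gauss 1 v.1 * (gauss 1 v.2.1 * gauss ((2 : ℝ) ^ k)⁻¹ v.2.2))
          (tilt κ (i / (2 : ℝ) ^ k) (pos s) - tb t) ≤
        C * (Z * S.card + k * (μ * 2 ^ k * M * S.card +
          μ⁻¹ * Z * ∑ i ∈ Finset.range (2 ^ k), ((T i).card : ℝ))) := by
  obtain ⟨C, hC, h⟩ := exists_piece_incidence_le
  obtain ⟨W2, hW2, h2⟩ := exists_gauss_sum2_le (p := 1) (by norm_num)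
  refine ⟨C + W2, by positivity, ?_⟩
  intro ι θ k κ μ M Z S pos T tb hκ0 hκ1 hμ hS hT
  have hL0 : (0 : ℝ) < 2 ^ k := by positivity
  have hM0 : 0 ≤ M := (Nat.cast_nonneg _).trans (hS 0)
  have hZ0 : 0 ≤ Z := (Nat.cast_nonneg _).trans (hT 0 0 0)
  simp only [kernel_eq]
  simp_rw [Finset.sum_add_distrib]
  have e1 : ∑ i ∈ Finset.range (2 ^ k), ∑ s ∈ S, ∑ t ∈ T i, ∑ n ∈ Finset.range k,
      piece (2 ^ k) (2 ^ n) (tilt κ (i / (2 : ℝ) ^ k) (pos s) - tb t) =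
      ∑ n ∈ Finset.range k, ∑ i ∈ Finset.range (2 ^ k), ∑ s ∈ S, ∑ t ∈ T i,
      piece (2 ^ k) (2 ^ n) (tilt κ (i / (2 : ℝ) ^ k) (pos s) - tb t) := by
    rw [Finset.sum_comm (s := Finset.range k)]
    refine Finset.sum_congr rfl fun i _ => ?_
    rw [Finset.sum_comm (s := Finset.range k)]
    refine Finset.sum_congr rfl fun s _ => ?_
    rw [Finset.sum_comm (s := Finset.range k)]
  set V := ∑ i ∈ Finset.range (2 ^ k), ((T i).card : ℝ) with hV
  have hV0 : 0 ≤ V := Finset.sum_nonneg fun _ _ => Nat.cast_nonneg _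
  have h1 : ∑ n ∈ Finset.range k, ∑ i ∈ Finset.range (2 ^ k), ∑ s ∈ S, ∑ t ∈ T i,
      piece (2 ^ k) (2 ^ n) (tilt κ (i / (2 : ℝ) ^ k) (pos s) - tb t) ≤
      k * (C * (μ * 2 ^ k * M * S.card + μ⁻¹ * Z * V)) := by
    have : ∀ n ∈ Finset.range k, ∑ i ∈ Finset.range (2 ^ k), ∑ s ∈ S, ∑ t ∈ T i,
      piece (2 ^ k) (2 ^ n) (tilt κ (i / (2 : ℝ) ^ k) (pos s) - tb t) ≤
      C * (μ * 2 ^ k * M * S.card + μ⁻¹ * Z * V) := by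
      intro n hn
      have := h (2 ^ k) (2 ^ n) κ μ M Z S pos T tb Nat.one_le_two_pow
        (one_le_pow₀ one_le_two) (by
          push_cast
          exact pow_le_pow_right₀ one_le_two (Finset.mem_range.1 hn).le) hκ0 hκ1 hμ hS
        (by push_cast; exact hT)
      push_cast at this
      exact this
    refine (Finset.sum_le_sum this).trans ?_
    rw [Finset.sum_const, Finset.card_range, nsmul_eq_mul]
  have h3 : ∑ i ∈ Finset.range (2 ^ k), ∑ s ∈ S, ∑ t ∈ T i,
      (gauss 1 (tilt κ (i / (2 : ℝ) ^ k) (pos s) - tb t).1 *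
        (gauss ((2 : ℝ) ^ k)⁻¹ (tilt κ (i / (2 : ℝ) ^ k) (pos s) - tb t).2.1 / 2 ^ k *
          gauss ((2 : ℝ) ^ k)⁻¹ (tilt κ (i / (2 : ℝ) ^ k) (pos s) - tb t).2.2))
      ≤ W2 * Z * S.card := by
    have h4 : ∀ i ∈ Finset.range (2 ^ k), ∀ s ∈ S, ∑ t ∈ T i,
      (gauss 1 (tilt κ (i / (2 : ℝ) ^ k) (pos s) - tb t).1 *
        (gauss ((2 : ℝ) ^ k)⁻¹ (tilt κ (i / (2 : ℝ) ^ k) (pos s) - tb t).2.1 / 2 ^ k *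
          gauss ((2 : ℝ) ^ k)⁻¹ (tilt κ (i / (2 : ℝ) ^ k) (pos s) - tb t).2.2))
        ≤ (2 ^ k)⁻¹ * (W2 * Z) := by
      intro i _ s _
      set u := tilt κ (i / (2 : ℝ) ^ k) (pos s)
      have h5 := h2 (T i) (fun t => (tb t).1) (fun t => (tb t).2.1 / 2 ^ k) Z u.1
        (u.2.1 / 2 ^ k) ?_
      · refine le_trans ?_ (mul_le_mul_of_nonneg_left h5 (by positivity))
        rw [Finset.mul_sum]
        refine Finset.sum_le_sum fun t _ => ?_
        rw [gauss_inv_mul (u - tb t).2.1, ← sub_div]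
        have g1 := gauss_le_one ((2 : ℝ) ^ k)⁻¹ (u - tb t).2.2
        have g2 := (gauss_pos ((2 : ℝ) ^ k)⁻¹ (u - tb t).2.2).le
        have g3 := (gauss_pos 1 (u - tb t).1).le
        have g4 := (gauss_pos 1 ((u - tb t).2.1 / 2 ^ k)).le
        calc _ ≤ gauss 1 (u - tb t).1 * (gauss 1 ((u - tb t).2.1 / 2 ^ k) / 2 ^ k * 1) := by
              gcongr
          _ = _ := by simp only [Prod.fst_sub, Prod.snd_sub]; ring
      · intro a b
        refine le_trans ?_ (hT i a (b * 2 ^ k))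
        refine Nat.cast_le.2 (Finset.card_le_card fun t' ht' => ?_)
        rw [Finset.mem_filter] at ht' ⊢
        refine ⟨ht'.1, ht'.2.1, ?_⟩
        have e : (tb t').2.1 - b * 2 ^ k = ((tb t').2.1 / 2 ^ k - b) * 2 ^ k := by
          rw [sub_mul, div_mul_cancel₀ _ hL0.ne']
        rw [e, abs_mul, abs_of_pos hL0]
        nlinarith [ht'.2.2]
    refine (Finset.sum_le_sum fun i hi => Finset.sum_le_sum (h4 i hi)).trans ?_
    simp only [Finset.sum_const, Finset.card_range, nsmul_eq_mul]
    push_cast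
    apply le_of_eq
    have e : (2 : ℝ) ^ k * (2 ^ k)⁻¹ = 1 := mul_inv_cancel₀ hL0.ne'
    calc _ = ((2 : ℝ) ^ k * (2 ^ k)⁻¹) * (W2 * Z * S.card) := by ring
      _ = _ := by rw [e, one_mul]
  rw [e1]
  clear_value V
  clear hT hS h2 h hV e1
  have p1 : 0 ≤ (k : ℝ) * (μ * 2 ^ k * M * S.card + μ⁻¹ * Z * V) := by positivity
  have p2 : 0 ≤ Z * (S.card : ℝ) := by positivity
  nlinarith [mul_nonneg hC.le p2, mul_nonneg hW2.le p1]

/-- A tube of unit width and length about L is swept by windows in the third, second and first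
coordinate in turn; fixing one coordinate confines the next to a bounded interval. This is the
trivial bound for tubes that are too crowded for the Fourier argument. -/
lemma card_near_tube_le {ι : Type} (S : Finset ι) (pos : ι → V3) {C₀ κ t M L a b : ℝ}
    (hC₀ : 0 ≤ C₀) (hL : 1 ≤ L) (hκ0 : 0 ≤ κ) (hκ1 : κ ≤ 1) (ht0 : 0 ≤ t) (ht1 : t ≤ 1)
    (hM : ∀ u : V3, ((S.filter fun s => |(pos s).1 - u.1| ≤ 1 ∧ |(pos s).2.1 - u.2.1| ≤ 1 ∧
        |(pos s).2.2 - u.2.2| ≤ 1).card : ℝ) ≤ M)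
    (hS : ∀ s ∈ S, |(pos s).2.2| ≤ C₀ * L) :
    ((S.filter fun s => |(tilt κ t (pos s)).1 - a| ≤ C₀ ∧ |(tilt κ t (pos s)).2.1 - b| ≤ C₀).card
      : ℝ) ≤ (2 * C₀ + 5) ^ 3 * (L * M) := by
  have hM0 : 0 ≤ M := (Nat.cast_nonneg _).trans (hM 0)
  have h1 := card_le_of_windows (S.filter fun s => |(tilt κ t (pos s)).1 - a| ≤ C₀ ∧
    |(tilt κ t (pos s)).2.1 - b| ≤ C₀) (fun s => (pos s).2.2) (c := 0) (A := C₀ * L) (w := 1)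
    (M := (2 * C₀ + 5) ^ 2 * M) one_pos (by positivity) ?_ ?_
  · refine h1.trans ?_
    have : 2 * (C₀ * L) / 1 + 1 ≤ (2 * C₀ + 5) * L := by nlinarith
    calc _ ≤ ((2 * C₀ + 5) * L) * ((2 * C₀ + 5) ^ 2 * M) := by gcongr
      _ = _ := by ring
  · intro g
    have h2 := card_le_of_windows (((S.filter fun s => |(tilt κ t (pos s)).1 - a| ≤ C₀ ∧
      |(tilt κ t (pos s)).2.1 - b| ≤ C₀)).filter fun s => |(pos s).2.2 - g| ≤ 1)
      (fun s => (pos s).2.1) (c := b - 2 * g * t) (A := C₀ + 2) (w := 1)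
      (M := (2 * C₀ + 5) * M) one_pos (by positivity) ?_ ?_
    · refine h2.trans (le_of_eq ?_); ring
    · intro b'
      have h3 := card_le_of_windows ((((S.filter fun s => |(tilt κ t (pos s)).1 - a| ≤ C₀ ∧
        |(tilt κ t (pos s)).2.1 - b| ≤ C₀)).filter fun s => |(pos s).2.2 - g| ≤ 1).filter
        fun s => |(pos s).2.1 - b'| ≤ 1)
        (fun s => (pos s).1) (c := a - κ * (b' * t + g * t ^ 2)) (A := C₀ + 2) (w := 1)
        (M := M) one_pos (by positivity) ?_ ?_
      · refine h3.trans (le_of_eq ?_); ring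
      · intro a'
        refine le_trans ?_ (hM (a', b', g))
        refine Nat.cast_le.2 (Finset.card_le_card fun s hs => ?_)
        simp only [Finset.mem_filter] at hs ⊢
        exact ⟨hs.1.1.1.1, hs.2, hs.1.2, hs.1.1.2⟩
      · intro s hs
        simp only [Finset.mem_filter] at hs
        obtain ⟨⟨⟨_, h4, _⟩, h5⟩, h6⟩ := hs
        simp only [tilt] at h4
        have e : (pos s).1 - (a - κ * (b' * t + g * t ^ 2)) =
            ((pos s).1 + κ * ((pos s).2.1 * t + (pos s).2.2 * t ^ 2) - a)
            - κ * t * ((pos s).2.1 - b') - κ * t ^ 2 * ((pos s).2.2 - g) := by ring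
        have k1 : 0 ≤ κ * t := by positivity
        have k2 : κ * t ≤ 1 := mul_le_one₀ hκ1 ht0 ht1
        have k3 : 0 ≤ κ * t ^ 2 := by positivity
        have k4 : κ * t ^ 2 ≤ 1 := mul_le_one₀ hκ1 (by positivity) (pow_le_one₀ ht0 ht1)
        have q1 : |κ * t * ((pos s).2.1 - b')| ≤ 1 := by
          rw [abs_mul, abs_of_nonneg k1]; exact mul_le_one₀ k2 (abs_nonneg _) h6
        have q2 : |κ * t ^ 2 * ((pos s).2.2 - g)| ≤ 1 := by
          rw [abs_mul, abs_of_nonneg k3]; exact mul_le_one₀ k4 (abs_nonneg _) h5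
        rw [e]
        rw [abs_le] at *
        constructor <;> linarith
    · intro s hs
      simp only [Finset.mem_filter] at hs
      obtain ⟨⟨_, _, h4⟩, h5⟩ := hs
      simp only [tilt] at h4
      have e : (pos s).2.1 - (b - 2 * g * t) = ((pos s).2.1 + 2 * (pos s).2.2 * t - b)
          - 2 * (t * ((pos s).2.2 - g)) := by ring
      have q1 : |t * ((pos s).2.2 - g)| ≤ 1 := by
        rw [abs_mul, abs_of_nonneg ht0]; exact mul_le_one₀ ht1 (abs_nonneg _) h5
      rw [e]
      rw [abs_le] at *
      constructor <;> linarith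
  · intro s hs
    rw [sub_zero]
    exact hS s (Finset.mem_filter.1 hs).1

lemma sum_tubeHits_le {ι θ : Type} (k : ℕ) {κ C₀ : ℝ} (S : Finset ι) (pos : ι → V3)
    (T : ℕ → Finset θ) (tb : θ → V3) (F : ℕ → ι → θ → ℝ) (hF0 : ∀ i s t, 0 ≤ F i s t)
    (hF : ∀ i ∈ Finset.range (2 ^ k), ∀ s ∈ S, ∀ t ∈ T i,
        |(tilt κ (i / (2 : ℝ) ^ k) (pos s) - tb t).1| ≤ C₀ →
        |(tilt κ (i / (2 : ℝ) ^ k) (pos s) - tb t).2.1| ≤ C₀ → 1 ≤ F i s t) :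
    ∑ s ∈ S, (tubeHits (2 ^ k) κ C₀ T tb (pos s) : ℝ) ≤
      ∑ i ∈ Finset.range (2 ^ k), ∑ s ∈ S, ∑ t ∈ T i, F i s t := by
  have hcast : ∀ i : ℕ, (i : ℝ) / ((2 ^ k : ℕ) : ℝ) = i / (2 : ℝ) ^ k := by intro i; push_cast; rfl
  rw [Finset.sum_comm]
  refine Finset.sum_le_sum fun s hs => ?_
  unfold tubeHits
  simp only [hcast]
  rw [Finset.card_filter]
  push_cast
  refine Finset.sum_le_sum fun i hi => ?_
  split_ifs with hex
  · obtain ⟨t, ht, h1, h2⟩ := hex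
    exact (hF i hi s hs t ht h1 h2).trans
      (Finset.single_le_sum (f := fun t => F i s t) (fun t _ => hF0 i s t) ht)
  · exact Finset.sum_nonneg fun t _ => hF0 i s t

/-- With this μ the term in μ is at most t₀ n/4 ≤ H/4, and `hcase` gives the same for the term Z n.
Both are absorbed into H, leaving the term in μ⁻¹. -/
lemma optimize_scale {H E C₀ C g k L n V Z t₀ μ : ℝ} (hg : 0 < g) (hC : 0 < C) (hC₀ : 1 ≤ C₀)
    (hE : E = C * C₀ / g ^ 3) (hk : 0 ≤ k) (hL : 0 < L) (hn : 0 ≤ n) (hV : 0 ≤ V) (hZ : 0 ≤ Z)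
    (ht₀ : 0 < t₀) (hμ : μ = t₀ / (4 * E * (k + 1) * L)) (hcase : 4 * E * Z ≤ t₀)
    (hHS : t₀ * n ≤ H)
    (h3 : H ≤ C * (Z * n + k * (μ * L * C₀ * n + μ⁻¹ * Z * V)) / g ^ 3) :
    H ≤ 8 * E ^ 2 * ((k + 1) ^ 2 * (Z * (L / t₀) * V)) := by
  have hE0 : 0 < E := by rw [hE]; positivity
  have hk1 : 0 < k + 1 := by linarith
  have hμ0 : 0 < μ := by rw [hμ]; positivity
  have h4 : (C * (Z * n + k * (μ * L * C₀ * n + μ⁻¹ * Z * V))) / g ^ 3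
      ≤ E * (Z * n) + E * ((k + 1) * (μ * L) * n) + E * ((k + 1) * (μ⁻¹ * Z * V)) := by
    have p1 : 0 ≤ Z * n := by positivity
    have p2 : 0 ≤ μ * L * n := by positivity
    have p3 : 0 ≤ μ⁻¹ * Z * V := by positivity
    have hc : 0 ≤ C₀ - 1 := by linarith
    have : Z * n + k * (μ * L * C₀ * n + μ⁻¹ * Z * V) ≤
        C₀ * (Z * n + (k + 1) * (μ * L) * n + (k + 1) * (μ⁻¹ * Z * V)) := by
      linarith [mul_nonneg hc p1, mul_nonneg hk p3, mul_nonneg hc (mul_nonneg hk p3),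
        mul_nonneg hc p3, mul_nonneg (by linarith : 0 ≤ C₀) p2]
    rw [hE]
    calc _ ≤ (C * (C₀ * (Z * n + (k + 1) * (μ * L) * n +
          (k + 1) * (μ⁻¹ * Z * V)))) / g ^ 3 := by gcongr
      _ = _ := by ring
  have h5 : E * ((k + 1) * (μ * L) * n) = t₀ * n / 4 := by
    rw [hμ]; field_simp
  have h6 : E * ((k + 1) * (μ⁻¹ * Z * V)) = 4 * E ^ 2 * ((k + 1) ^ 2 * (Z * (L / t₀) * V)) := by
    rw [hμ]; field_simp
  have h7 : E * (Z * n) ≤ t₀ * n / 4 := by nlinarith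
  linarith

/-- Incidences of points and tubes with directions along a conical curve. -/
theorem exists_tube_incidence (C₀ : ℝ) (hC₀ : 1 ≤ C₀) : ∃ C : ℝ, 0 < C ∧
    ∀ {ι θ : Type} (k : ℕ) (κ Z t₀ : ℝ) (S : Finset ι) (pos : ι → V3) (T : ℕ → Finset θ)
      (tb : θ → V3), 0 ≤ κ → κ ≤ 1 → 0 < t₀ →
      (∀ u : V3, ((S.filter fun s => |(pos s).1 - u.1| ≤ 1 ∧ |(pos s).2.1 - u.2.1| ≤ 1 ∧
        |(pos s).2.2 - u.2.2| ≤ 1).card : ℝ) ≤ C₀) →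
      (∀ s ∈ S, |(pos s).2.2| ≤ C₀ * 2 ^ k) → (∀ i, ∀ t ∈ T i, (tb t).2.2 = 0) →
      (∀ i a b, (((T i).filter fun t => |(tb t).1 - a| ≤ 1 ∧ |(tb t).2.1 - b| ≤ 2 ^ k).card : ℝ)
        ≤ Z) →
      (∀ s ∈ S, t₀ ≤ tubeHits (2 ^ k) κ C₀ T tb (pos s)) →
      ∑ s ∈ S, (tubeHits (2 ^ k) κ C₀ T tb (pos s) : ℝ) ≤
        C * (k + 1) ^ 2 * (Z * (2 ^ k / t₀) * ∑ i ∈ Finset.range (2 ^ k), ((T i).card : ℝ)) := by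
  obtain ⟨C, hC, hker⟩ := exists_tube_kernel_le
  set g := gauss 1 C₀ with hg
  have hg0 : 0 < g := gauss_pos _ _
  set E := C * C₀ / g ^ 3 with hE
  have hE0 : 0 < E := by positivity
  refine ⟨8 * E ^ 2 * C₀ + 4 * E * ((2 * C₀ + 5) ^ 3 * C₀) + 8 * E ^ 2, by positivity, ?_⟩
  intro ι θ k κ Z t₀ S pos T tb hκ0 hκ1 ht₀ hS hγ htb hT hhit
  have hZ0 : 0 ≤ Z := (Nat.cast_nonneg _).trans (hT 0 0 0)
  have hL0 : (0 : ℝ) < 2 ^ k := by positivity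
  have hL1 : (1 : ℝ) ≤ 2 ^ k := one_le_pow₀ one_le_two
  set V := ∑ i ∈ Finset.range (2 ^ k), ((T i).card : ℝ) with hV
  have hV0 : 0 ≤ V := Finset.sum_nonneg fun _ _ => Nat.cast_nonneg _
  have hk1 : (1 : ℝ) ≤ (k + 1) ^ 2 := one_le_pow₀ (by linarith [(Nat.cast_nonneg k : (0:ℝ) ≤ k)])
  set H := ∑ s ∈ S, (tubeHits (2 ^ k) κ C₀ T tb (pos s) : ℝ) with hH
  have hHS : t₀ * S.card ≤ H := by
    have := Finset.sum_le_sum hhit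
    rw [Finset.sum_const, nsmul_eq_mul] at this
    linarith
  clear_value V H E g
  -- If t₀ dominates Z, the low-frequency term is absorbed. Otherwise Z/t₀ is bounded below and the
  -- trivial count of points in each tube suffices.
  rcases le_total (4 * E * Z) t₀ with hcase | hcase
  · set μ := t₀ / (4 * E * (k + 1) * 2 ^ k) with hμ
    have hμ0 : 0 < μ := by positivity
    have h1 := hker k κ μ C₀ Z S pos T tb hκ0 hκ1 hμ0 hS hT
    -- The tube kernel is at least g³ at every incidence, so dividing by g³ yields a majorant of the
    -- incidence indicator.
    have h2 := sum_tubeHits_le (κ := κ) (C₀ := C₀) k S pos T tb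
      (fun i s t => (fun v : V3 => gauss 1 v.1 * (gauss 1 v.2.1 *
      gauss ((2 : ℝ) ^ k)⁻¹ v.2.2)) (tilt κ (i / (2 : ℝ) ^ k) (pos s) - tb t) / g ^ 3)
      (fun i s t => div_nonneg (mul_nonneg (gauss_pos _ _).le
        (mul_nonneg (gauss_pos _ _).le (gauss_pos _ _).le)) (by positivity)) ?_
    · have h3 : H ≤ (C * (Z * S.card + k * (μ * 2 ^ k * C₀ * S.card + μ⁻¹ * Z * V))) / g ^ 3 := by
        rw [hH]
        refine h2.trans ?_
        rw [← hV] at h1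
        simp only [← Finset.sum_div]
        exact div_le_div_of_nonneg_right h1 (by positivity)
      have h4 := optimize_scale hg0 hC hC₀ hE (Nat.cast_nonneg k) hL0 (Nat.cast_nonneg S.card) hV0
        hZ0 ht₀ hμ hcase hHS h3
      clear h3 h2 h1 hker hT hS hhit hγ
      have p5 : 0 ≤ (8 * E ^ 2 * C₀ + 4 * E * ((2 * C₀ + 5) ^ 3 * C₀)) *
        ((k + 1 : ℝ) ^ 2 * (Z * (2 ^ k / t₀) * V)) := by positivity
      linarith
    · intro i hi s hs t ht h8 h9
      have hmono : ∀ {x y : ℝ}, |x| ≤ y → gauss 1 y ≤ gauss 1 x := by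
        intro x y hxy
        unfold gauss
        rw [Real.exp_le_exp]
        have := sq_le_sq' (by linarith [abs_le.1 hxy, abs_nonneg x]) (abs_le.1 hxy).2
        nlinarith [Real.pi_pos]
      rw [le_div_iff₀ (by positivity), one_mul]
      have h10 : g ≤ gauss ((2 : ℝ) ^ k)⁻¹ (tilt κ (i / (2 : ℝ) ^ k) (pos s) - tb t).2.2 := by
        rw [gauss_inv_mul, hg]
        refine hmono ?_
        rw [abs_div, abs_of_pos hL0, div_le_iff₀ hL0, Prod.snd_sub, Prod.snd_sub, htb i t ht,
          sub_zero]
        exact hγ s hs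
      calc g ^ 3 = g * (g * g) := by ring
        _ ≤ _ := by
          have a1 := hmono h8
          have a2 := hmono h9
          rw [← hg] at a1 a2
          have a3 := (gauss_pos 1 (tilt κ (i / (2 : ℝ) ^ k) (pos s) - tb t).1).le
          have a4 := (gauss_pos 1 (tilt κ (i / (2 : ℝ) ^ k) (pos s) - tb t).2.1).le
          dsimp only
          gcongr
  · have h2 := sum_tubeHits_le (κ := κ) (C₀ := C₀) k S pos T tb
      (fun i s t => if |(tilt κ (i / (2 : ℝ) ^ k) (pos s) - tb t).1| ≤ C₀ ∧
        |(tilt κ (i / (2 : ℝ) ^ k) (pos s) - tb t).2.1| ≤ C₀ then 1 else 0)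
      (fun i s t => by split_ifs <;> norm_num)
      (fun i _ s _ t _ a b => by simp only [a, b, and_self, if_true]; norm_num)
    have h3 : H ≤ (2 * C₀ + 5) ^ 3 * (2 ^ k * C₀) * V := by
      rw [hH]
      refine h2.trans ?_
      rw [hV, Finset.mul_sum]
      refine Finset.sum_le_sum fun i hi => ?_
      rw [Finset.sum_comm]
      have : ∀ t ∈ T i, ∑ s ∈ S, (if |(tilt κ (i / (2 : ℝ) ^ k) (pos s) - tb t).1| ≤ C₀ ∧
        |(tilt κ (i / (2 : ℝ) ^ k) (pos s) - tb t).2.1| ≤ C₀ then (1 : ℝ) else 0)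
          ≤ (2 * C₀ + 5) ^ 3 * (2 ^ k * C₀) := by
        intro t _
        rw [← Finset.sum_filter, Finset.sum_const, nsmul_eq_mul, mul_one]
        refine card_near_tube_le S pos (by linarith) hL1 hκ0 hκ1 (by positivity) ?_ hS hγ
        rw [div_le_one hL0]
        exact_mod_cast (Finset.mem_range.1 hi).le
      refine (Finset.sum_le_sum this).trans ?_
      rw [Finset.sum_const, nsmul_eq_mul]
      linarith
    have h4 : 1 ≤ 4 * E * Z / t₀ := by rwa [le_div_iff₀ ht₀, one_mul]
    have p5 : 0 ≤ (8 * E ^ 2 * C₀ + 8 * E ^ 2) * ((k + 1 : ℝ) ^ 2 * (Z * (2 ^ k / t₀) * V)) := by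
      positivity
    have h5 : (2 * C₀ + 5) ^ 3 * (2 ^ k * C₀) * V ≤
        (2 * C₀ + 5) ^ 3 * (2 ^ k * C₀) * V * (4 * E * Z / t₀) :=
      le_mul_of_one_le_right (by positivity) h4
    have h6 : (2 * C₀ + 5) ^ 3 * (2 ^ k * C₀) * V * (4 * E * Z / t₀) ≤
        (k + 1 : ℝ) ^ 2 * ((2 * C₀ + 5) ^ 3 * (2 ^ k * C₀) * V * (4 * E * Z / t₀)) :=
      le_mul_of_one_le_left (by positivity) hk1
    calc H ≤ (k + 1 : ℝ) ^ 2 * ((2 * C₀ + 5) ^ 3 * (2 ^ k * C₀) * V * (4 * E * Z / t₀)) := by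
          linarith
      _ = 4 * E * ((2 * C₀ + 5) ^ 3 * C₀) * ((k + 1 : ℝ) ^ 2 * (Z * (2 ^ k / t₀) * V)) := by ring
      _ ≤ _ := by linarith

end Fourier

/-! ### Quadratic polynomials and abstract plank configurations. -/

open scoped Classical

/-- The value at `x` of the quadratic polynomial with coefficients `v`. -/
def ev (v : V3) (x : ℝ) : ℝ := v.1 + v.2.1 * x + v.2.2 * x ^ 2

/-- The derivative at `x` of the quadratic polynomial with coefficients `v`. -/
def de (v : V3) (x : ℝ) : ℝ := v.2.1 + 2 * v.2.2 * x

/-- The leading coefficient of the quadratic polynomial with coefficients `v`. -/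
def co (v : V3) : ℝ := v.2.2

lemma ev_sub (v w : V3) (x : ℝ) : ev (v - w) x = ev v x - ev w x := by simp [ev]; ring

lemma de_sub (v w : V3) (x : ℝ) : de (v - w) x = de v x - de w x := by simp [de]; ring

lemma co_sub (v w : V3) : co (v - w) = co v - co w := by simp [co]

lemma ev_taylor (v : V3) (x y : ℝ) :
    ev v y = ev v x + de v x * (y - x) + co v * (y - x) ^ 2 := by simp [ev, de, co]; ring

lemma de_taylor (v : V3) (x y : ℝ) : de v y = de v x + 2 * co v * (y - x) := by
  simp [de, co]; ring

lemma abs_ev_le {v : V3} {x y a b c d : ℝ} (ha : |ev v x| ≤ a) (hb : |de v x| ≤ b)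
    (hc : |co v| ≤ c) (hd : |y - x| ≤ d) : |ev v y| ≤ a + b * d + c * d ^ 2 := by
  rw [ev_taylor v x y]
  refine (abs_add_le _ _).trans (add_le_add ((abs_add_le _ _).trans (add_le_add ha ?_)) ?_)
  · rw [abs_mul]
    exact mul_le_mul hb hd (abs_nonneg _) ((abs_nonneg _).trans hb)
  · rw [abs_mul, abs_pow]
    exact mul_le_mul hc (pow_le_pow_left₀ (abs_nonneg _) hd 2) (by positivity)
      ((abs_nonneg _).trans hc)

lemma abs_de_le {v : V3} {x y b c d : ℝ} (hb : |de v x| ≤ b)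
    (hc : |co v| ≤ c) (hd : |y - x| ≤ d) : |de v y| ≤ b + 2 * c * d := by
  rw [de_taylor v x y]
  refine (abs_add_le _ _).trans (add_le_add hb ?_)
  rw [abs_mul, abs_mul, abs_two]
  have : 0 ≤ c := (abs_nonneg _).trans hc
  gcongr

/-- Three values of a quadratic polynomial control its coefficients. -/
lemma abs_coeff_le_of_three {v : V3} {x y z a d : ℝ} (hd : 0 < d) (hx : |ev v x| ≤ a)
    (hy : |ev v y| ≤ a) (hz : |ev v z| ≤ a) (hxy : d ≤ |y - x|) (hxz : d ≤ |z - x|)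
    (hyz : d ≤ |y - z|) : |co v| ≤ 4 * a / d ^ 2 ∧ |de v x| ≤ 2 * a / d + 4 * a / d ^ 2 * |y - x| := by
  have ha : 0 ≤ a := (abs_nonneg _).trans hx
  have slope : ∀ w, d ≤ |w - x| → |ev v w| ≤ a → |de v x + co v * (w - x)| ≤ 2 * a / d := by
    intro w hw hw'
    have e : (de v x + co v * (w - x)) * (w - x) = ev v w - ev v x := by
      rw [ev_taylor v x w]; ring
    have h1 : |de v x + co v * (w - x)| * |w - x| ≤ 2 * a := by
      rw [← abs_mul, e]
      exact (abs_sub _ _).trans (by linarith)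
    rw [le_div_iff₀ hd]
    refine le_trans ?_ h1
    exact mul_le_mul_of_nonneg_left hw (abs_nonneg _)
  have h1 := slope y hxy hy
  have h2 := slope z hxz hz
  have hco : |co v| ≤ 4 * a / d ^ 2 := by
    have e : co v * (y - z) = (de v x + co v * (y - x)) - (de v x + co v * (z - x)) := by ring
    have h3 : |co v| * |y - z| ≤ 4 * a / d := by
      rw [← abs_mul, e]
      refine (abs_sub _ _).trans ?_
      have : 4 * a / d = 2 * a / d + 2 * a / d := by ring
      linarith
    rw [le_div_iff₀ (by positivity)]
    rw [le_div_iff₀ hd] at h3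
    calc |co v| * d ^ 2 = |co v| * d * d := by ring
      _ ≤ |co v| * |y - z| * d := by gcongr
      _ ≤ _ := h3
  refine ⟨hco, ?_⟩
  have e : de v x = (de v x + co v * (y - x)) - co v * (y - x) := by ring
  rw [e]
  refine (abs_sub _ _).trans (add_le_add h1 ?_)
  rw [abs_mul]
  gcongr

lemma card_le_mul_of_fibers {α β : Type*} [DecidableEq β] (S : Finset α) (F : α → β)
    {A B : ℝ} (hB : 0 ≤ B)
    (hA : ((S.image F).card : ℝ) ≤ A)
    (hfib : ∀ a ∈ S, ((S.filter fun x => F x = F a).card : ℝ) ≤ B) : (S.card : ℝ) ≤ A * B := by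
  rw [Finset.card_eq_sum_card_image F S]
  push_cast
  have : ∀ b ∈ S.image F, ((S.filter fun x => F x = b).card : ℝ) ≤ B := by
    intro b hb
    obtain ⟨a, ha, rfl⟩ := Finset.mem_image.1 hb
    exact hfib a ha
  refine (Finset.sum_le_sum this).trans ?_
  rw [Finset.sum_const, nsmul_eq_mul]
  gcongr

/-- If every element of `S` is related to at least `κ` elements of `T`, each of which is related to
at most `B` elements of `S`, then `κ |S| ≤ |T| B`. -/
lemma mul_card_le_of_double_count {α β : Type*} (S : Finset α) (T : Finset β) (r : α → β → Prop)
    [∀ a, DecidablePred (r a)] [∀ b, DecidablePred fun a => r a b] {κ B : ℝ}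
    (h1 : ∀ a ∈ S, κ ≤ ((T.filter fun b => r a b).card : ℝ))
    (h2 : ∀ b ∈ T, ((S.filter fun a => r a b).card : ℝ) ≤ B) :
    κ * S.card ≤ T.card * B := by
  have h3 := @Finset.sum_card_bipartiteAbove_eq_sum_card_bipartiteBelow _ _ r S T
    (fun a b => ‹∀ a, DecidablePred (r a)› a b)
  have h4 := Finset.sum_le_sum h1
  have h5 := Finset.sum_le_sum h2
  rw [Finset.sum_const, nsmul_eq_mul] at h4 h5
  have h6 : (∑ a ∈ S, ((T.filter fun b => r a b).card : ℝ)) =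
      ∑ b ∈ T, ((S.filter fun a => r a b).card : ℝ) := by
    have h7 : ∑ a ∈ S, (T.filter fun b => r a b).card = ∑ b ∈ T, (S.filter fun a => r a b).card := by
      convert h3 using 3 <;> (ext; simp [Finset.bipartiteAbove, Finset.bipartiteBelow])
    exact_mod_cast h7
  linarith

/-- Points, described by quadratic polynomials, and families of planks through them in the
directions `j / m²`, organised in coarser boxes `tau`. -/
structure PlankConfig (ι ϖ θ : Type) where
  C : ℝ
  m : ℝ
  N : ℝ
  Z : ℝ
  P : ℝ
  pts : Finset ι
  pos : ι → V3
  X : ι → Finset ℕ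
  pl : ι → ℕ → ϖ
  tau : ℕ → Finset θ
  ta : θ → ℝ
  tb : θ → ℝ
  one_le_C : 1 ≤ C
  one_le_m : 1 ≤ m
  dir_le : ∀ q ∈ pts, ∀ j ∈ X q, (j : ℝ) ≤ m ^ 2
  sep : ∀ x : ℝ, 0 ≤ x → x ≤ 1 → ∀ a b c : ℝ, 1 ≤ a → 1 ≤ b → 1 ≤ c → ∀ v : V3,
    ((pts.filter fun q => |ev (pos q - v) x| ≤ a ∧ |de (pos q - v) x| ≤ b ∧
      |co (pos q - v)| ≤ c).card : ℝ) ≤ C * (a * b * c)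
  co_le : ∀ q ∈ pts, |co (pos q)| ≤ C * m ^ 4
  thin : ∀ q ∈ pts, ∀ q' ∈ pts, ∀ j ∈ X q, j ∈ X q' → pl q j = pl q' j →
    |ev (pos q - pos q') (j / m ^ 2)| ≤ C
  -- Such a window is about A B cross-sections of boxes τ, each carrying about N planks.
  plank_count : ∀ (j : ℕ) (v : V3) (A B : ℝ), 1 ≤ A → 1 ≤ B →
    (((pts.filter fun q => j ∈ X q ∧ |ev (pos q - v) (j / m ^ 2)| ≤ A * m ∧
      |de (pos q - v) (j / m ^ 2)| ≤ B * m ^ 2).image fun q => pl q j).card : ℝ) ≤ C * (A * B * N)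
  tau_mem : ∀ q ∈ pts, ∀ j ∈ X q, ∃ t ∈ tau j, |ev (pos q) (j / m ^ 2) - ta t| ≤ C * m ∧
    |de (pos q) (j / m ^ 2) - tb t| ≤ C * m ^ 2
  -- An m × m³ window is the cross-section of a box Σ.
  tau_count : ∀ (j : ℕ) (a b : ℝ),
    (((tau j).filter fun t => |ta t - a| ≤ m ∧ |tb t - b| ≤ m ^ 3).card : ℝ) ≤ C * Z
  -- P stands for the total number of planks, about N for each box τ.
  tau_total : ∀ n : ℕ, N * ∑ j ∈ Finset.range n, ((tau j).card : ℝ) ≤ C * P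
  one_le_N : 1 ≤ C * N
  one_le_Z : 1 ≤ C * Z

namespace PlankConfig
variable {ι ϖ θ : Type} (G : PlankConfig ι ϖ θ)

/-- The members of `S` in the box of dimensions `a, b, c` at `v`, in the coordinates adapted to
`x`. -/
def near (S : Finset ι) (v : V3) (x a b c : ℝ) : Finset ι :=
  S.filter fun q => |ev (G.pos q - v) x| ≤ a ∧ |de (G.pos q - v) x| ≤ b ∧ |co (G.pos q - v)| ≤ c

lemma mem_near {S : Finset ι} {v : V3} {x a b c : ℝ} {q : ι} : q ∈ G.near S v x a b c ↔
    q ∈ S ∧ |ev (G.pos q - v) x| ≤ a ∧ |de (G.pos q - v) x| ≤ b ∧ |co (G.pos q - v)| ≤ c := by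
  simp [near]

lemma near_pair {S : Finset ι} {v : V3} {x a b c : ℝ} {q q' : ι} (hq : q ∈ G.near S v x a b c)
    (hq' : q' ∈ G.near S v x a b c) : |ev (G.pos q - G.pos q') x| ≤ 2 * a ∧
      |de (G.pos q - G.pos q') x| ≤ 2 * b ∧ |co (G.pos q - G.pos q')| ≤ 2 * c := by
  rw [mem_near] at hq hq'
  obtain ⟨_, h1, h2, h3⟩ := hq
  obtain ⟨_, k1, k2, k3⟩ := hq'
  have e : G.pos q - G.pos q' = (G.pos q - v) - (G.pos q' - v) := by abel
  rw [e, ev_sub, de_sub, co_sub]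
  refine ⟨(abs_sub _ _).trans ?_, (abs_sub _ _).trans ?_, (abs_sub _ _).trans ?_⟩ <;> linarith

lemma m_pos : 0 < G.m := by linarith [G.one_le_m]

lemma C_pos : 0 < G.C := by linarith [G.one_le_C]

lemma N_pos : 0 < G.N := by
  have h1 := G.one_le_N
  by_contra h
  nlinarith [G.C_pos]

lemma Z_pos : 0 < G.Z := by
  have h1 := G.one_le_Z
  by_contra h
  nlinarith [G.C_pos]

set_option maxHeartbeats 1000000 in
/-- Counting the points of a narrow box which lie on planks in three transversal directions. -/
lemma transversal_count {S : Finset ι} (hS : S ⊆ G.pts) {v : V3} {x σ ε κ : ℝ}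
    (hx0 : 0 ≤ x) (hx1 : x ≤ 1) (hσ2 : σ ≤ 2) (hσm : 1 ≤ 2 * G.m * σ) (hε : 0 < ε) (hε1 : ε ≤ 1)
    (T : Finset (ℕ × ℕ))
    (hT : ∀ p ∈ T, |(p.1 : ℝ) / G.m ^ 2 - x| ≤ σ ∧ |(p.2 : ℝ) / G.m ^ 2 - x| ≤ σ ∧
      ε * σ ≤ |(p.1 : ℝ) / G.m ^ 2 - x| ∧ ε * σ ≤ |(p.2 : ℝ) / G.m ^ 2 - x| ∧
      ε * σ ≤ |(p.1 : ℝ) / G.m ^ 2 - (p.2 : ℝ) / G.m ^ 2|)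
    (hκ : ∀ q ∈ S, κ ≤ ((T.filter fun p => p.1 ∈ G.X q ∧ p.2 ∈ G.X q).card : ℝ)) :
    κ * (G.near S v x 2 (2 * G.m) (G.m / σ ^ 2)).card ≤
      T.card * (2 * 10 ^ 6 * G.C ^ 3 * (G.C + 4) ^ 2 / ε ^ 4 * (G.N ^ 2 / σ ^ 3)) := by
  have hm := G.one_le_m
  have hm0 := G.m_pos
  have hC := G.one_le_C
  have hC0 := G.C_pos
  have hN0 := G.N_pos
  have hσ0 : 0 < σ := by
    by_contra h
    nlinarith
  refine mul_card_le_of_double_count _ T (fun q p => p.1 ∈ G.X q ∧ p.2 ∈ G.X q)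
    (fun q hq => hκ q (G.mem_near.1 hq).1) fun p hp => ?_
  obtain ⟨t1, t2, t3, t4, t5⟩ := hT p hp
  set U := (G.near S v x 2 (2 * G.m) (G.m / σ ^ 2)).filter
    fun q => p.1 ∈ G.X q ∧ p.2 ∈ G.X q with hU
  -- Over a distance σ ≥ 1/(2m) the box of dimensions 2, 2m, m/σ² keeps values O(m) and slopes
  -- O(m²), so it meets O(N) planks of each of the two directions.
  have himg : ∀ j : ℕ, (∀ q ∈ U, j ∈ G.X q) → |(j : ℝ) / G.m ^ 2 - x| ≤ σ →
      ((U.image fun q => G.pl q j).card : ℝ) ≤ 70 * G.C * G.N := by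
    intro j hj hjσ
    have h1 := G.plank_count j v 7 10 (by norm_num) (by norm_num)
    refine le_trans (Nat.cast_le.2 (Finset.card_le_card (Finset.image_subset_image ?_)))
      (h1.trans (le_of_eq (by ring)))
    intro q hq
    rw [Finset.mem_filter]
    have hq' := (Finset.mem_filter.1 hq).1
    rw [mem_near] at hq'
    obtain ⟨q0, q1, q2, q3⟩ := hq'
    refine ⟨hS q0, hj q hq, (abs_ev_le q1 q2 q3 hjσ).trans ?_, (abs_de_le q2 q3 hjσ).trans ?_⟩
    · have : G.m / σ ^ 2 * σ ^ 2 = G.m := by field_simp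
      rw [this]; nlinarith
    · have : 2 * (G.m / σ ^ 2) * σ = 2 * G.m / σ := by field_simp
      rw [this]
      have : 2 * G.m / σ ≤ 4 * G.m ^ 2 := by
        rw [div_le_iff₀ hσ0]; nlinarith
      nlinarith
  -- Two points of the box in the same two planks differ by O(1) at x and at both directions. These
  -- are εσ-separated, so the difference lies in a box of dimensions about 1, 1/σ, 1/σ².
  have hfib : ∀ a ∈ U, ((U.filter fun q => (G.pl q p.1, G.pl q p.2) = (G.pl a p.1, G.pl a p.2)).card
      : ℝ) ≤ G.C * (4 * (20 * (G.C + 4) / (ε ^ 2 * σ)) * (4 * (G.C + 4) / (ε * σ) ^ 2)) := by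
    intro a ha
    have haU := Finset.mem_filter.1 ha
    have ha0 := hS (G.mem_near.1 haU.1).1
    have b1 : 1 ≤ 20 * (G.C + 4) / (ε ^ 2 * σ) := by
      rw [le_div_iff₀ (by positivity)]
      have : ε ^ 2 ≤ 1 := pow_le_one₀ hε.le hε1
      nlinarith
    have b2 : 1 ≤ 4 * (G.C + 4) / (ε * σ) ^ 2 := by
      rw [le_div_iff₀ (by positivity)]
      have h2 : ε * σ ≤ 2 := by nlinarith
      have h3 : 0 < ε * σ := by positivity
      nlinarith
    refine le_trans (Nat.cast_le.2 (Finset.card_le_card ?_))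
      (G.sep x hx0 hx1 4 _ _ (by norm_num) b1 b2 (G.pos a))
    intro q hq
    obtain ⟨hqU, hpl⟩ := Finset.mem_filter.1 hq
    have hqU' := Finset.mem_filter.1 hqU
    have hq0 := hS (G.mem_near.1 hqU'.1).1
    rw [Prod.mk.injEq] at hpl
    have h1 := G.thin q hq0 a ha0 p.1 hqU'.2.1 haU.2.1 hpl.1
    have h2 := G.thin q hq0 a ha0 p.2 hqU'.2.2 haU.2.2 hpl.2
    obtain ⟨h3, h4, h5⟩ := G.near_pair hqU'.1 haU.1
    obtain ⟨c1, c2⟩ := abs_coeff_le_of_three (a := G.C + 4) (d := ε * σ) (by positivity)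
      (h3.trans (by linarith)) (h1.trans (by linarith)) (h2.trans (by linarith)) t3 t4 t5
    rw [Finset.mem_filter]
    refine ⟨hq0, h3.trans (by norm_num), c2.trans ?_, c1⟩
    have e1 : 2 * (G.C + 4) / (ε * σ) ≤ 2 * (G.C + 4) / (ε ^ 2 * σ) := by
      gcongr
      nlinarith
    have e2 : 4 * (G.C + 4) / (ε * σ) ^ 2 * |(p.1 : ℝ) / G.m ^ 2 - x| ≤
        4 * (G.C + 4) / (ε * σ) ^ 2 * σ := by gcongr
    have e3 : 4 * (G.C + 4) / (ε * σ) ^ 2 * σ = 4 * (G.C + 4) / (ε ^ 2 * σ) := by field_simp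
    have e4 : 20 * (G.C + 4) / (ε ^ 2 * σ) = 2 * (G.C + 4) / (ε ^ 2 * σ) +
      4 * (G.C + 4) / (ε ^ 2 * σ) + 14 * (G.C + 4) / (ε ^ 2 * σ) := by ring
    have e5 : 0 ≤ 14 * (G.C + 4) / (ε ^ 2 * σ) := by positivity
    linarith
  have hprod : ((U.image fun q => (G.pl q p.1, G.pl q p.2)).card : ℝ) ≤ (70 * G.C * G.N) ^ 2 := by
    have hsub : (U.image fun q => (G.pl q p.1, G.pl q p.2)) ⊆
        (U.image fun q => G.pl q p.1) ×ˢ (U.image fun q => G.pl q p.2) := by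
      intro z hz
      obtain ⟨q, hq, rfl⟩ := Finset.mem_image.1 hz
      exact Finset.mk_mem_product (Finset.mem_image_of_mem _ hq) (Finset.mem_image_of_mem _ hq)
    have h1 := Finset.card_le_card hsub
    rw [Finset.card_product] at h1
    refine (Nat.cast_le.2 h1).trans ?_
    push_cast
    rw [sq]
    refine mul_le_mul (himg p.1 (fun q hq => (Finset.mem_filter.1 hq).2.1) t1)
      (himg p.2 (fun q hq => (Finset.mem_filter.1 hq).2.2) t2) (Nat.cast_nonneg _) (by positivity)
  refine (card_le_mul_of_fibers U _ (by positivity) hprod hfib).trans ?_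
  have e : (70 * G.C * G.N) ^ 2 *
      (G.C * (4 * (20 * (G.C + 4) / (ε ^ 2 * σ)) * (4 * (G.C + 4) / (ε * σ) ^ 2))) =
      1568000 * G.C ^ 3 * (G.C + 4) ^ 2 / ε ^ 4 * (G.N ^ 2 / σ ^ 3) := by
    field_simp; ring
  rw [e]
  gcongr
  norm_num

end PlankConfig

/-! ### Strips over blocks of directions, and the energy of shared strips. -/

/-- The part of `X` in the `i`-th dyadic block of length `2 ^ a`. -/
def arc (X : Finset ℕ) (a i : ℕ) : Finset ℕ := X.filter fun j => j / 2 ^ a = i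

lemma mem_arc {X : Finset ℕ} {a i j : ℕ} : j ∈ arc X a i ↔ j ∈ X ∧ j / 2 ^ a = i := by
  simp [arc]

lemma div_two_pow_eq_iff {a i j : ℕ} : j / 2 ^ a = i ↔ i * 2 ^ a ≤ j ∧ j < (i + 1) * 2 ^ a := by
  have h : 0 < 2 ^ a := by positivity
  rw [Nat.div_eq_iff h]
  constructor
  · rintro ⟨h1, h2⟩
    refine ⟨h1, ?_⟩
    have : (i + 1) * 2 ^ a = i * 2 ^ a + 2 ^ a := by ring
    omega
  · rintro ⟨h1, h2⟩
    have : (i + 1) * 2 ^ a = i * 2 ^ a + 2 ^ a := by ring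
    omega

/-- The number of collisions of a map controls the size of its domain. -/
lemma card_sq_le_image_mul_collisions {α β : Type*} [DecidableEq β] (I : Finset α) (F : α → β) :
    (I.card : ℝ) ^ 2 ≤ (I.image F).card * (((I ×ˢ I).filter fun p => F p.1 = F p.2).card : ℝ) := by
  have h1 : (I.card : ℝ) = ∑ b ∈ I.image F, ((I.filter fun x => F x = b).card : ℝ) := by
    exact_mod_cast Finset.card_eq_sum_card_image F I
  have h2 : (((I ×ˢ I).filter fun p => F p.1 = F p.2).card : ℝ) =
      ∑ b ∈ I.image F, ((I.filter fun x => F x = b).card : ℝ) ^ 2 := by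
    have h3 := Finset.card_eq_sum_card_fiberwise (s := (I ×ˢ I).filter fun p => F p.1 = F p.2)
      (t := I.image F) (f := fun p => F p.1) (by
        intro p hp
        simp only [Finset.coe_filter, Finset.mem_product, Set.mem_ofPred_eq] at hp
        exact Finset.mem_coe.2 (Finset.mem_image_of_mem _ hp.1.1))
    rw [h3]
    push_cast
    refine Finset.sum_congr rfl fun b _ => ?_
    rw [sq, ← Nat.cast_mul, ← Finset.card_product]
    congr 2
    ext p
    simp only [Finset.mem_filter, Finset.mem_product]
    constructor
    · rintro ⟨⟨⟨h1, h2⟩, h3⟩, h4⟩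
      exact ⟨⟨h1, h4⟩, h2, h3 ▸ h4⟩
    · rintro ⟨⟨h1, h2⟩, h3, h4⟩
      exact ⟨⟨⟨h1, h3⟩, h2.trans h4.symm⟩, h2⟩
  rw [h1, h2]
  exact sq_sum_le_card_mul_sum_sq

/-- Integers in an interval. -/
lemma card_le_of_int_window {ι : Type*} (S : Finset ι) (n : ι → ℤ) (hn : Set.InjOn n S) {c A : ℝ}
    (hA : 0 ≤ A) (hS : ∀ s ∈ S, |(n s : ℝ) - c| ≤ A) : (S.card : ℝ) ≤ 6 * A + 1 := by
  have h := card_le_of_windows S (fun s => (n s : ℝ)) (c := c) (A := A) (w := 1 / 3) (M := 1)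
    (by norm_num) hA ?_ hS
  · refine h.trans (le_of_eq ?_); ring
  · intro y
    have : (S.filter fun s => |(n s : ℝ) - y| ≤ 1 / 3).card ≤ 1 := by
      rw [Finset.card_le_one]
      intro s hs t ht
      rw [Finset.mem_filter] at hs ht
      refine hn hs.1 ht.1 ?_
      have h1 := abs_le.1 hs.2
      have h2 := abs_le.1 ht.2
      have h3 : (n s : ℝ) < n t + 1 := by linarith
      have h4 : (n t : ℝ) < n s + 1 := by linarith
      have h5 : n s < n t + 1 := by exact_mod_cast h3
      have h6 : n t < n s + 1 := by exact_mod_cast h4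
      omega
    exact_mod_cast this

namespace PlankConfig
variable {ι ϖ θ : Type} (G : PlankConfig ι ϖ θ)

/-- The direction at the left end of the `i`-th block of length `2 ^ a`. -/
def start (a i : ℕ) : ℝ := (i : ℝ) * 2 ^ a / G.m ^ 2

lemma near_subset (S : Finset ι) (v : V3) (x a b c : ℝ) : G.near S v x a b c ⊆ S :=
  Finset.filter_subset _ _

/-- The number of unit strips over a block of directions which are rich in planks. -/
lemma card_heavy_strips_le {S : Finset ι} {v : V3} {x η : ℝ} {a i f : ℕ}
    (hS : S ⊆ G.near G.pts v x 1 G.m (G.m ^ 2)) (ha : (2 : ℝ) ^ a ≤ G.m)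
    (hη : ∀ j : ℕ, j / 2 ^ a = i → |(j : ℝ) / G.m ^ 2 - x| ≤ η) (hη1 : η ^ 2 * G.m ≤ 1)
    (hf : ∀ q ∈ S, 2 ^ f ≤ (arc (G.X q) a i).card) :
    (2 : ℝ) ^ f * (S.image fun q => ⌊ev (G.pos q) (G.start a i)⌋).card ≤
      2 ^ a * (1000 * G.C ^ 2 * G.N) := by
  have hm := G.one_le_m
  have hm0 := G.m_pos
  have hC := G.one_le_C
  have hN0 := G.N_pos
  set F : ι → ℤ := fun q => ⌊ev (G.pos q) (G.start a i)⌋ with hF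
  -- One representative is kept per strip, so that strips can be counted through points.
  obtain ⟨S', hS', hSi, hSinj⟩ : ∃ S' ⊆ S, S'.image F = S.image F ∧ Set.InjOn F S' := by
    obtain ⟨u, h1, h2, h3⟩ := Finset.exists_subset_injOn_image_eq_of_surjOn (f := F) (S : Set ι)
      (S.image F) (by rw [Finset.coe_image]; exact Set.surjOn_image _ _)
    exact ⟨u, by exact_mod_cast h1, h3, h2⟩
  have hη0 : 0 ≤ η := by
    refine (abs_nonneg _).trans (hη (i * 2 ^ a) ?_)
    exact Nat.mul_div_cancel _ (by positivity)
  have hηm : η * G.m ≤ G.m := by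
    have : η ^ 2 ≤ 1 := by nlinarith [sq_nonneg η]
    have : η ≤ 1 := by nlinarith
    nlinarith
  rw [← hSi, Finset.card_image_of_injOn hSinj]
  have h := mul_card_le_of_double_count S' (Finset.Ico (i * 2 ^ a) ((i + 1) * 2 ^ a))
    (fun q j => j ∈ G.X q) (κ := 2 ^ f) (B := 1000 * G.C ^ 2 * G.N) ?_ ?_
  · refine h.trans (le_of_eq ?_)
    rw [Nat.card_Ico]
    congr 1
    have : (i + 1) * 2 ^ a - i * 2 ^ a = 2 ^ a := by
      rw [add_mul, one_mul, Nat.add_sub_cancel_left]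
    rw [this]; push_cast; rfl
  · intro q hq
    have h1 := hf q (hS' hq)
    refine le_trans (by exact_mod_cast h1) (Nat.cast_le.2 (Finset.card_le_card ?_))
    intro j hj
    rw [mem_arc, div_two_pow_eq_iff] at hj
    simp only [Finset.mem_filter, Finset.mem_Ico]
    exact ⟨hj.2, hj.1⟩
  · intro j hj
    rw [Finset.mem_Ico, ← div_two_pow_eq_iff] at hj
    have hjη := hη j hj
    set U := S'.filter fun q => j ∈ G.X q with hU
    have hmem : ∀ q ∈ U, q ∈ G.near G.pts v x 1 G.m (G.m ^ 2) ∧ j ∈ G.X q := fun q hq =>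
      ⟨hS (hS' (Finset.mem_filter.1 hq).1), (Finset.mem_filter.1 hq).2⟩
    have hA : ((U.image fun q => G.pl q j).card : ℝ) ≤ 9 * G.C * G.N := by
      have h1 := G.plank_count j v 3 3 (by norm_num) (by norm_num)
      refine le_trans (Nat.cast_le.2 (Finset.card_le_card (Finset.image_subset_image ?_)))
        (h1.trans (le_of_eq (by ring)))
      intro q hq
      obtain ⟨h2, h3⟩ := hmem q hq
      rw [mem_near] at h2
      obtain ⟨q0, q1, q2, q3⟩ := h2
      rw [Finset.mem_filter]
      refine ⟨q0, h3, (abs_ev_le q1 q2 q3 hjη).trans ?_, (abs_de_le q2 q3 hjη).trans ?_⟩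
      · nlinarith
      · nlinarith
    -- The points of one plank lie in boundedly many strips, because differences have slope O(m) at
    -- j and the block has angular length at most 1/m.
    have hfib : ∀ b ∈ U, ((U.filter fun q => G.pl q j = G.pl b j).card : ℝ) ≤
        6 * (2 * G.C + 13) + 1 := by
      intro b hb
      refine card_le_of_int_window _ F ?_ (c := F b) (by linarith) ?_
      · refine hSinj.mono ?_
        intro q hq
        exact (Finset.mem_filter.1 (Finset.mem_filter.1 hq).1).1
      · intro q hq
        obtain ⟨hq1, hq2⟩ := Finset.mem_filter.1 hq
        obtain ⟨a1, a2⟩ := hmem q hq1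
        obtain ⟨b1, b2⟩ := hmem b hb
        have hthin := G.thin q (G.near_subset _ _ _ _ _ _ a1) b (G.near_subset _ _ _ _ _ _ b1) j a2
          b2 hq2
        obtain ⟨d1, d2, d3⟩ := G.near_pair a1 b1
        set δ := G.pos q - G.pos b with hδ
        set u := (j : ℝ) / G.m ^ 2 - x with hu
        -- Near x the slope bound propagates by Taylor expansion. Far from x, two bounded values
        -- force a mean slope O(m), and the slope at j is twice the mean slope minus the slope at x.
        have hde : |de δ (j / G.m ^ 2)| ≤ (G.C + 10) * G.m := by
          rcases le_total |u| (2 / G.m) with h | h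
          · refine (abs_de_le d2 d3 h).trans ?_
            have : 2 * (2 * G.m ^ 2) * (2 / G.m) = 8 * G.m := by field_simp; ring
            rw [this]; nlinarith
          · have hu0 : 0 < |u| := lt_of_lt_of_le (by positivity) h
            have e1 : (de δ x + co δ * u) * u = ev δ (j / G.m ^ 2) - ev δ x := by
              rw [ev_taylor δ x (j / G.m ^ 2)]; ring
            have e2 : |de δ x + co δ * u| * |u| ≤ G.C + 2 := by
              rw [← abs_mul, e1]
              exact (abs_sub _ _).trans (by linarith)
            have e3 : |de δ x + co δ * u| ≤ (G.C + 2) * G.m / 2 := by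
              have e4 : |de δ x + co δ * u| * (2 / G.m) ≤ G.C + 2 :=
                (mul_le_mul_of_nonneg_left h (abs_nonneg _)).trans e2
              rw [mul_div_assoc', div_le_iff₀ hm0] at e4
              linarith
            have e5 : de δ (j / G.m ^ 2) = 2 * (de δ x + co δ * u) - de δ x := by
              rw [de_taylor δ x (j / G.m ^ 2)]; ring
            rw [e5]
            refine (abs_sub _ _).trans ?_
            rw [abs_mul, abs_two]
            nlinarith
        have hd : |G.start a i - j / G.m ^ 2| ≤ 1 / G.m := by
          obtain ⟨k1, k2⟩ := div_two_pow_eq_iff.1 hj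
          have k1' : (i : ℝ) * 2 ^ a ≤ j := by exact_mod_cast k1
          have k2' : (j : ℝ) < ((i : ℝ) + 1) * 2 ^ a := by exact_mod_cast k2
          unfold start
          rw [← sub_div, abs_div, abs_of_pos (by positivity : 0 < G.m ^ 2), div_le_div_iff₀
            (by positivity) hm0]
          have : |(i : ℝ) * 2 ^ a - j| ≤ G.m := by rw [abs_le]; constructor <;> nlinarith
          nlinarith
        have hev := abs_ev_le hthin hde d3 hd
        have hev' : |ev δ (G.start a i)| ≤ 2 * G.C + 12 := by
          refine hev.trans (le_of_eq ?_)
          field_simp; ring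
        rw [hδ, ev_sub] at hev'
        have f1 := Int.floor_le (ev (G.pos q) (G.start a i))
        have f2 := Int.lt_floor_add_one (ev (G.pos q) (G.start a i))
        have f3 := Int.floor_le (ev (G.pos b) (G.start a i))
        have f4 := Int.lt_floor_add_one (ev (G.pos b) (G.start a i))
        have f5 := abs_le.1 hev'
        rw [abs_le]
        simp only [hF]
        constructor <;> linarith
    refine (card_le_mul_of_fibers U _ (by linarith) hA hfib).trans ?_
    have : 9 * G.C * G.N * (6 * (2 * G.C + 13) + 1) ≤ 9 * G.C * G.N * (100 * G.C) := by
      gcongr; linarith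
    nlinarith [mul_pos (pow_pos G.C_pos 2) hN0]

/-- Blocks at distance about `2 ^ v` over which a quadratic polynomial is small. -/
lemma card_common_strips_le {δ : V3} {a i v : ℕ} (R : Finset ℕ) (ha : (2 : ℝ) ^ a ≤ G.m)
    (h0 : |ev δ (G.start a i)| ≤ 2) (h1 : |de δ (G.start a i)| ≤ 2 * G.m)
    (h2 : |co δ| ≤ 2 * G.m ^ 2)
    (hR : ∀ i' ∈ R, Nat.log 2 ((i' : ℤ) - i).natAbs = v ∧ |ev δ (G.start a i')| ≤ 1) :
    (R.card : ℝ) ≤ 40 * 2 ^ v / max 1 (|co δ| * (2 ^ v * 2 ^ a / G.m ^ 2) ^ 2) := by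
  have hm := G.one_le_m
  have hm0 := G.m_pos
  set y : ℝ := 2 ^ v * 2 ^ a / G.m ^ 2 with hy
  have hy0 : 0 < y := by positivity
  have hv1 : (1 : ℝ) ≤ 2 ^ v := one_le_pow₀ one_le_two
  have hmy : G.m * y ≤ 2 ^ v := by
    rw [hy, mul_div_assoc', div_le_iff₀ (by positivity)]
    nlinarith [mul_le_mul_of_nonneg_left ha (by positivity : 0 ≤ G.m * 2 ^ v)]
  set g := |co δ| * y ^ 2 with hg
  have hcastinj : Set.InjOn (fun n : ℕ => (n : ℤ)) R := Nat.cast_injective.injOn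
  have htriv : (R.card : ℝ) ≤ 13 * 2 ^ v := by
    have := card_le_of_int_window R (fun n => (n : ℤ)) hcastinj (c := i) (A := 2 * 2 ^ v)
      (by positivity) ?_
    · linarith
    · intro i' hi'
      have h3 := Nat.lt_pow_succ_log_self (b := 2) one_lt_two ((i' : ℤ) - i).natAbs
      rw [(hR i' hi').1] at h3
      have h4 : ((((i' : ℤ) - i).natAbs : ℕ) : ℝ) < 2 * 2 ^ v := by
        have : (((((i' : ℤ) - i).natAbs : ℕ)) : ℝ) < ((2 ^ (v + 1) : ℕ) : ℝ) := by exact_mod_cast h3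
        push_cast at this
        rw [pow_succ] at this
        linarith
      rw [Nat.cast_natAbs] at h4
      push_cast at h4
      push_cast
      exact h4.le
  -- For g ≤ 2 the divisor is bounded and counting integers at distance less than 2·2^v is enough.
  rcases le_or_gt g 2 with hg2 | hg2
  · rw [le_div_iff₀ (by positivity)]
    have : max 1 g ≤ 2 := max_le (by norm_num) hg2
    nlinarith
  -- As `Nat.log 2 0 = 0`, the class v = 0 contains i' = i, for which the distance has no lower
  -- bound. There y ≤ 1/m and |co δ| ≤ 2m² force g ≤ 2.
  · have hv : v ≠ 0 := by
      rintro rfl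
      have : y ≤ 1 / G.m := by
        rw [hy, pow_zero, one_mul, div_le_div_iff₀ (by positivity) hm0]; nlinarith
      have : y ^ 2 ≤ (1 / G.m) ^ 2 := pow_le_pow_left₀ hy0.le this 2
      have : g ≤ 2 * G.m ^ 2 * (1 / G.m) ^ 2 := by rw [hg]; gcongr
      have e : 2 * G.m ^ 2 * (1 / G.m) ^ 2 = 2 := by field_simp
      linarith
    have hco : 0 < |co δ| := by
      by_contra h
      have : |co δ| = 0 := le_antisymm (not_lt.1 h) (abs_nonneg _)
      rw [hg, this, zero_mul] at hg2
      linarith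
    rw [max_eq_right (by linarith)]
    -- The polynomial is O(1) at both ends of a segment of length at least y, so its mean slope is
    -- at most 3/y.
    have hstep : ∀ i' ∈ R, y ≤ |G.start a i' - G.start a i| ∧
        |de δ (G.start a i) + co δ * (G.start a i' - G.start a i)| ≤ 3 / y := by
      intro i' hi'
      obtain ⟨h3, h4⟩ := hR i' hi'
      have h5 : y ≤ |G.start a i' - G.start a i| := by
        have h6 : ((i' : ℤ) - i).natAbs ≠ 0 := by
          intro h; rw [h] at h3; exact hv (by simpa using h3.symm)
        have h7 := Nat.pow_log_le_self 2 h6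
        rw [h3] at h7
        have h8 : (2 : ℝ) ^ v ≤ |(i' : ℝ) - i| := by
          have : (((2 ^ v : ℕ)) : ℝ) ≤ ((((i' : ℤ) - i).natAbs : ℕ) : ℝ) := by exact_mod_cast h7
          rw [Nat.cast_natAbs] at this
          push_cast at this
          exact this
        have e : G.start a i' - G.start a i = ((i' : ℝ) - i) * (2 ^ a / G.m ^ 2) := by
          unfold start; ring
        rw [e, abs_mul, abs_of_pos (by positivity : (0:ℝ) < 2 ^ a / G.m ^ 2), hy, mul_div_assoc]
        gcongr
      refine ⟨h5, ?_⟩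
      set u := G.start a i' - G.start a i
      have e1 : (de δ (G.start a i) + co δ * u) * u = ev δ (G.start a i') - ev δ (G.start a i) := by
        rw [ev_taylor δ (G.start a i) (G.start a i')]; ring
      have e2 : |de δ (G.start a i) + co δ * u| * |u| ≤ 3 := by
        rw [← abs_mul, e1]
        exact (abs_sub _ _).trans (by linarith)
      rw [le_div_iff₀ hy0]
      exact (mul_le_mul_of_nonneg_left h5 (abs_nonneg _)).trans e2
    rcases R.eq_empty_or_nonempty with rfl | ⟨i₁, hi₁⟩
    · simp; positivity
    -- A single common strip already bounds g by 5·2^v, which makes the +1 of the integer count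
    -- below harmless.
    have hg5 : g ≤ 5 * 2 ^ v := by
      obtain ⟨h3, h4⟩ := hstep i₁ hi₁
      set u := G.start a i₁ - G.start a i
      have h5 : |co δ| * |u| ≤ 2 * G.m + 3 / y := by
        rw [← abs_mul, show co δ * u = (de δ (G.start a i) + co δ * u) - de δ (G.start a i) by ring]
        exact (abs_sub _ _).trans (by linarith)
      calc g = |co δ| * y * y := by rw [hg]; ring
        _ ≤ |co δ| * |u| * y := by gcongr
        _ ≤ (2 * G.m + 3 / y) * y := by gcongr
        _ = 2 * (G.m * y) + 3 := by field_simp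
        _ ≤ _ := by linarith
    -- The mean slope is affine in i', and its smallness confines i' to an interval of radius
    -- 3·2^v/g.
    have hcount := card_le_of_int_window R (fun n => (n : ℤ)) hcastinj
      (c := i - de δ (G.start a i) / co δ * (G.m ^ 2 / 2 ^ a)) (A := 3 * 2 ^ v / g)
      (by positivity) ?_
    · refine hcount.trans ?_
      rw [le_div_iff₀ (by linarith)]
      have : (6 * (3 * 2 ^ v / g) + 1) * g = 18 * 2 ^ v + g := by
        have : g ≠ 0 := by linarith
        field_simp; ring
      rw [this]; linarith
    · intro i' hi'
      obtain ⟨h3, h4⟩ := hstep i' hi'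
      have hne : co δ ≠ 0 := abs_pos.1 hco
      have e : ((i' : ℤ) : ℝ) - (i - de δ (G.start a i) / co δ * (G.m ^ 2 / 2 ^ a)) =
          (de δ (G.start a i) + co δ * (G.start a i' - G.start a i)) *
            (G.m ^ 2 / 2 ^ a / co δ) := by
        unfold start; push_cast; field_simp; ring
      rw [e, abs_mul, abs_div, abs_of_pos (by positivity : (0:ℝ) < G.m ^ 2 / 2 ^ a)]
      have e2 : 3 * 2 ^ v / g = 3 / y * (G.m ^ 2 / 2 ^ a / |co δ|) := by
        rw [hg, hy]; field_simp
      rw [e2]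
      gcongr

/-- Splitting the leading coefficient into short intervals. -/
lemma card_le_of_split (S₀ S : Finset ι) {v : V3} {x a b c c' w g n₀ : ℝ} (hw : 0 < w)
    (hc : 0 ≤ c) (hS : S ⊆ G.near S₀ v x a b c') (hg : ∀ q ∈ S, |co (G.pos q) - g| ≤ c)
    (hn : ∀ u : V3, ((G.near S₀ u x (2 * a) (2 * b) w).card : ℝ) ≤ n₀) :
    (S.card : ℝ) ≤ (2 * c / w + 1) * n₀ := by
  have hn0 : 0 ≤ n₀ := (Nat.cast_nonneg _).trans (hn 0)
  refine card_le_of_windows S (fun q => co (G.pos q)) (c := g) hw hc (fun y => ?_) hg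
  rcases (S.filter fun q => |co (G.pos q) - y| ≤ w).eq_empty_or_nonempty with h | ⟨p, hp⟩
  · rw [h]; simpa using hn0
  -- The centre takes its value and slope at x from a member p of the window, which doubles the
  -- first two dimensions, and its leading coefficient from the window itself.
  · set u : V3 := (ev (G.pos p) x - ((de (G.pos p) x - 2 * y * x) * x + y * x ^ 2),
      de (G.pos p) x - 2 * y * x, y) with hu
    refine le_trans (Nat.cast_le.2 (Finset.card_le_card ?_)) (hn u)
    intro q hq
    obtain ⟨hq1, hq2⟩ := Finset.mem_filter.1 hq
    have hp1 := (Finset.mem_filter.1 hp).1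
    have hqS := (G.mem_near.1 (hS hq1)).1
    obtain ⟨d1, d2, d3⟩ := G.near_pair (hS hq1) (hS hp1)
    have e1 : ev u x = ev (G.pos p) x := by simp only [hu, ev]; ring
    have e2 : de u x = de (G.pos p) x := by simp only [hu, de]; ring
    have e3 : co u = y := by simp only [hu, co]
    rw [ev_sub] at d1
    rw [de_sub] at d2
    rw [mem_near, ev_sub, de_sub, co_sub, e1, e2, e3]
    exact ⟨hqS, d1, d2, hq2⟩

/-- The energy estimate for points with many common strips, at a fixed distance of blocks. -/
lemma pair_energy_at_scale {S₀ : Finset ι} (hS₀ : S₀ ⊆ G.pts) {v : V3} {a b i f k : ℕ} {σ μ n₀ η : ℝ}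
    (ha : (2 : ℝ) ^ a ≤ G.m) (ha' : G.m < 2 * 2 ^ a) (hσ : 0 < σ) (hμ : 0 < μ) (hkb : k ≤ b)
    (hη : ∀ j : ℕ, j / 2 ^ (a + b) = i / 2 ^ b → |(j : ℝ) / G.m ^ 2 - G.start a i| ≤ η)
    (hη1 : η ^ 2 * G.m ≤ 1)
    (hn : ∀ u : V3, ((G.near S₀ u (G.start a i) 2 (2 * G.m) (G.m / σ ^ 2)).card : ℝ) ≤ n₀)
    (S : Finset ι) (hS : S ⊆ G.near S₀ v (G.start a i) 1 G.m (G.m ^ 2))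
    (R : Finset ℕ)
    (hR : ∀ i' ∈ R, i' / 2 ^ b = i / 2 ^ b ∧ Nat.log 2 ((i' : ℤ) - i).natAbs = k)
    (hky : (2 : ℝ) ^ k * 2 ^ a / G.m ^ 2 ≤ η)
    (hM : ∀ q ∈ S, μ ≤ ((R.filter fun i' => 2 ^ f ≤ (arc (G.X q) a i').card).card : ℝ)) :
    (S.card : ℝ) ≤ 10 ^ 8 * G.C ^ 2 * (a + 2) * G.N * (2 ^ a / 2 ^ f) / μ ^ 2 *
      (G.m * σ ^ 2 + 4 ^ b) * n₀ := by
  have hm := G.one_le_m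
  have hm0 := G.m_pos
  have hC := G.one_le_C
  have hC0 := G.C_pos
  have hN0 := G.N_pos
  have hn0 : 0 ≤ n₀ := (Nat.cast_nonneg _).trans (hn 0)
  set x := G.start a i with hx
  set y : ℝ := 2 ^ k * 2 ^ a / G.m ^ 2 with hy
  have hy0 : 0 < y := by positivity
  have hSpts : S ⊆ G.near G.pts v x 1 G.m (G.m ^ 2) := by
    intro q hq
    have := hS hq
    rw [mem_near] at this ⊢
    exact ⟨hS₀ this.1, this.2⟩
  set n : ι → ℕ → ℤ := fun q i' => ⌊ev (G.pos q) (G.start a i')⌋ with hndef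
  set I := (S ×ˢ R).filter fun p => 2 ^ f ≤ (arc (G.X p.1) a p.2).card with hI
  -- An incidence of a point and a rich block is sent to the strip through the point over that
  -- block. Collisions are pairs of points sharing a strip.
  set F : ι × ℕ → ℕ × ℤ := fun p => (p.2, n p.1 p.2) with hF
  have hIcard : μ * S.card ≤ I.card := by
    have h1 := Finset.card_eq_sum_card_fiberwise (s := I) (t := S) (f := Prod.fst) (by
      intro p hp
      have := (Finset.mem_filter.1 (Finset.mem_coe.1 hp)).1
      exact (Finset.mem_product.1 this).1)
    rw [h1]
    push_cast
    have h2 := Finset.sum_le_sum hM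
    rw [Finset.sum_const, nsmul_eq_mul, mul_comm] at h2
    refine h2.trans (Finset.sum_le_sum fun q hq => ?_)
    refine Nat.cast_le.2 (Finset.card_le_card_of_injOn (fun i' => (q, i')) ?_ ?_)
    · intro i' hi'
      have := Finset.mem_filter.1 (Finset.mem_coe.1 hi')
      simp only [hI, Finset.coe_filter, Set.mem_ofPred_eq, Finset.mem_filter, Finset.mem_product]
      exact ⟨⟨⟨hq, this.1⟩, this.2⟩, trivial⟩
    · intro s _ t _ h
      exact (Prod.mk.inj h).2
  have hRcard : (R.card : ℝ) ≤ 13 * 2 ^ k := by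
    have := card_le_of_int_window R (fun n => (n : ℤ)) Nat.cast_injective.injOn (c := i)
      (A := 2 * 2 ^ k) (by positivity) ?_
    · have : (1 : ℝ) ≤ 2 ^ k := one_le_pow₀ one_le_two
      linarith
    · intro i' hi'
      have h3 := Nat.lt_pow_succ_log_self (b := 2) one_lt_two ((i' : ℤ) - i).natAbs
      rw [(hR i' hi').2] at h3
      have h4 : ((((i' : ℤ) - i).natAbs : ℕ) : ℝ) < 2 * 2 ^ k := by
        have : (((((i' : ℤ) - i).natAbs : ℕ)) : ℝ) < ((2 ^ (k + 1) : ℕ) : ℝ) := by exact_mod_cast h3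
        push_cast at this
        rw [pow_succ] at this
        linarith
      rw [Nat.cast_natAbs] at h4
      push_cast at h4
      push_cast
      exact h4.le
  have hblock : ∀ i' ∈ R, ∀ j : ℕ, j / 2 ^ a = i' → |(j : ℝ) / G.m ^ 2 - x| ≤ η := by
    intro i' hi' j hj
    refine hη j ?_
    rw [pow_add, ← Nat.div_div_eq_div_mul, hj]
    exact (hR i' hi').1
  -- the number of strips
  set V : ℝ := 2 ^ a / 2 ^ f * (1000 * G.C ^ 2 * G.N) with hV
  have hV0 : 0 ≤ V := by positivity
  have himg : ((I.image F).card : ℝ) ≤ 13 * 2 ^ k * V := by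
    have h1 := Finset.card_eq_sum_card_fiberwise (s := I.image F) (t := R) (f := Prod.fst) (by
      intro p hp
      obtain ⟨z, hz, rfl⟩ := Finset.mem_image.1 (Finset.mem_coe.1 hp)
      exact (Finset.mem_product.1 (Finset.mem_filter.1 hz).1).2)
    rw [h1]
    push_cast
    have h2 : ∀ i' ∈ R, ((((I.image F).filter fun z => z.1 = i').card : ℕ) : ℝ) ≤ V := by
      intro i' hi'
      set S' := S.filter fun q => 2 ^ f ≤ (arc (G.X q) a i').card with hS'
      have h3 := G.card_heavy_strips_le (S := S') (i := i') (f := f) (v := v) (x := x) (η := η)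
        ((Finset.filter_subset _ _).trans hSpts) ha (hblock i' hi') hη1
        (fun q hq => (Finset.mem_filter.1 hq).2)
      have h4 : ((I.image F).filter fun z => z.1 = i').card ≤
          (S'.image fun q => ⌊ev (G.pos q) (G.start a i')⌋).card := by
        refine Finset.card_le_card_of_injOn Prod.snd ?_ ?_
        · intro z hz
          obtain ⟨hz1, hz2⟩ := Finset.mem_filter.1 (Finset.mem_coe.1 hz)
          obtain ⟨p, hp, rfl⟩ := Finset.mem_image.1 hz1
          obtain ⟨hp1, hp2⟩ := Finset.mem_filter.1 hp
          simp only [hF] at hz2 ⊢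
          subst hz2
          exact Finset.mem_coe.2 (Finset.mem_image.2 ⟨p.1, Finset.mem_filter.2
            ⟨(Finset.mem_product.1 hp1).1, hp2⟩, rfl⟩)
        · intro z hz w hw hzw
          have hz2 := (Finset.mem_filter.1 (Finset.mem_coe.1 hz)).2
          have hw2 := (Finset.mem_filter.1 (Finset.mem_coe.1 hw)).2
          exact Prod.ext (hz2.trans hw2.symm) hzw
      have h5 : (2 : ℝ) ^ f * ((((I.image F).filter fun z => z.1 = i').card : ℕ) : ℝ) ≤
          2 ^ a * (1000 * G.C ^ 2 * G.N) :=
        (mul_le_mul_of_nonneg_left (Nat.cast_le.2 h4) (by positivity)).trans h3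
      rw [hV, div_mul_eq_mul_div, le_div_iff₀ (by positivity)]
      linarith
    refine (Finset.sum_le_sum h2).trans ?_
    rw [Finset.sum_const, nsmul_eq_mul]
    gcongr
  -- collisions
  set E : ℝ := (a + 2) * (40 * 2 ^ k * ((4 * σ ^ 2 / (y ^ 2 * G.m) + 1) * n₀)) with hE
  have hE0 : 0 ≤ E := by positivity
  have hq : ∀ q ∈ S, ∑ q' ∈ S, ((R.filter fun i' => n q i' = n q' i').card : ℝ) ≤ E := by
    intro q hqS
    set gap : ι → ℝ := fun q' => max 1 (|co (G.pos q' - G.pos q)| * y ^ 2) with hgap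
    have h1 : ∀ q' ∈ S, ((R.filter fun i' => n q i' = n q' i').card : ℝ) ≤ 40 * 2 ^ k / gap q' := by
      intro q' hq'
      obtain ⟨d1, d2, d3⟩ := G.near_pair (hSpts hq') (hSpts hqS)
      refine G.card_common_strips_le (a := a) (i := i) _ ha (by linarith) d2 d3 ?_
      intro i' hi'
      obtain ⟨hi1, hi2⟩ := Finset.mem_filter.1 hi'
      refine ⟨(hR i' hi1).2, ?_⟩
      have f1 := Int.floor_le (ev (G.pos q) (G.start a i'))
      have f2 := Int.lt_floor_add_one (ev (G.pos q) (G.start a i'))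
      have f3 := Int.floor_le (ev (G.pos q') (G.start a i'))
      have f4 := Int.lt_floor_add_one (ev (G.pos q') (G.start a i'))
      have f5 : (⌊ev (G.pos q) (G.start a i')⌋ : ℝ) = ⌊ev (G.pos q') (G.start a i')⌋ := by
        exact_mod_cast hi2
      rw [ev_sub, abs_le]
      constructor <;> linarith
    refine (Finset.sum_le_sum h1).trans ?_
    -- For gap about 2^w there are O(2^w) times more candidate points than for gap 1, but each
    -- shares 2^w times fewer strips, so every dyadic class contributes equally.
    set u : ι → ℕ := fun q' => Nat.log 2 ⌊gap q'⌋₊ with hu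
    have hgap1 : ∀ q', 1 ≤ gap q' := fun q' => le_max_left _ _
    have hlow : ∀ q', (2 : ℝ) ^ u q' ≤ gap q' := by
      intro q'
      have h2 : ⌊gap q'⌋₊ ≠ 0 := (Nat.floor_pos.2 (hgap1 q')).ne'
      have h3 := Nat.pow_log_le_self 2 h2
      have h4 : ((2 ^ u q' : ℕ) : ℝ) ≤ ⌊gap q'⌋₊ := by exact_mod_cast h3
      push_cast at h4
      exact h4.trans (Nat.floor_le (by linarith [hgap1 q']))
    have hhigh : ∀ q', gap q' < 2 * 2 ^ u q' := by
      intro q'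
      have h3 := Nat.lt_pow_succ_log_self (b := 2) one_lt_two ⌊gap q'⌋₊
      have h4 : ((⌊gap q'⌋₊ + 1 : ℕ) : ℝ) ≤ ((2 ^ (u q' + 1) : ℕ) : ℝ) := by exact_mod_cast h3
      push_cast at h4
      rw [pow_succ] at h4
      linarith [Nat.lt_floor_add_one (gap q')]
    -- Since |co| ≤ 2m² and y² m ≤ 1, the gap is at most 2m, which leaves a + 2 dyadic classes.
    have hmaps : ∀ q' ∈ S, u q' ∈ Finset.range (a + 2) := by
      intro q' hq'
      obtain ⟨d1, d2, d3⟩ := G.near_pair (hSpts hq') (hSpts hqS)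
      rw [Finset.mem_range]
      by_contra hcon
      have h2 : (2 : ℝ) ^ (a + 2) ≤ 2 ^ u q' := pow_le_pow_right₀ one_le_two (not_lt.1 hcon)
      have h3 : gap q' ≤ 2 * G.m := by
        refine max_le (by linarith) ?_
        have h4 : y ^ 2 * G.m ≤ 1 := by
          have : y ^ 2 ≤ η ^ 2 := pow_le_pow_left₀ hy0.le hky 2
          nlinarith
        calc _ ≤ 2 * G.m ^ 2 * y ^ 2 := by gcongr
          _ = 2 * G.m * (y ^ 2 * G.m) := by ring
          _ ≤ 2 * G.m * 1 := by gcongr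
          _ = _ := mul_one _
      have h5 := hlow q'
      rw [pow_add] at h2
      linarith
    rw [← Finset.sum_fiberwise_of_maps_to (t := Finset.range (a + 2)) (g := u) hmaps]
    have h2 : ∀ w ∈ Finset.range (a + 2), ∑ q' ∈ S with u q' = w, 40 * 2 ^ k / gap q' ≤
        40 * 2 ^ k * ((4 * σ ^ 2 / (y ^ 2 * G.m) + 1) * n₀) := by
      intro w _
      have h3 : ∀ q' ∈ S.filter (fun q' => u q' = w), 40 * 2 ^ k / gap q' ≤
          40 * 2 ^ k / (2 : ℝ) ^ w := by
        intro q' hq'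
        have := hlow q'
        rw [(Finset.mem_filter.1 hq').2] at this
        gcongr
      refine (Finset.sum_le_sum h3).trans ?_
      rw [Finset.sum_const, nsmul_eq_mul]
      have h4 : ((S.filter fun q' => u q' = w).card : ℝ) ≤
          (2 * (2 * 2 ^ w / y ^ 2) / (G.m / σ ^ 2) + 1) * n₀ := by
        refine G.card_le_of_split S₀ _ (v := v) (x := x) (a := 1) (b := G.m) (c' := G.m ^ 2)
          (g := co (G.pos q)) (by positivity) (by positivity)
          ((Finset.filter_subset _ _).trans hS) ?_ (by simpa using hn)
        intro q' hq'
        have h6 := (le_max_right _ _).trans (hhigh q').le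
        rw [(Finset.mem_filter.1 hq').2] at h6
        rw [le_div_iff₀ (by positivity), ← co_sub]
        exact h6
      have h5 : (2 * (2 * 2 ^ w / y ^ 2) / (G.m / σ ^ 2) + 1) ≤
          2 ^ w * (4 * σ ^ 2 / (y ^ 2 * G.m) + 1) := by
        have : 2 * (2 * 2 ^ w / y ^ 2) / (G.m / σ ^ 2) = 2 ^ w * (4 * σ ^ 2 / (y ^ 2 * G.m)) := by
          field_simp; ring
        rw [this, mul_add, mul_one]
        gcongr
        exact one_le_pow₀ one_le_two
      calc ((S.filter fun q' => u q' = w).card : ℝ) * (40 * 2 ^ k / 2 ^ w)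
          ≤ (2 ^ w * (4 * σ ^ 2 / (y ^ 2 * G.m) + 1) * n₀) * (40 * 2 ^ k / 2 ^ w) := by
            gcongr
            exact h4.trans (mul_le_mul_of_nonneg_right h5 hn0)
        _ = _ := by field_simp
    refine (Finset.sum_le_sum h2).trans ?_
    rw [Finset.sum_const, Finset.card_range, nsmul_eq_mul]
    push_cast
    exact le_rfl
  have hcoll : (((I ×ˢ I).filter fun p => F p.1 = F p.2).card : ℝ) ≤ S.card * E := by
    have h1 : ((I ×ˢ I).filter fun p => F p.1 = F p.2).card ≤
        ((S ×ˢ S).sigma fun z => R.filter fun i' => n z.1 i' = n z.2 i').card := by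
      refine Finset.card_le_card_of_injOn (fun p => ⟨(p.1.1, p.2.1), p.1.2⟩) ?_ ?_
      · intro p hp
        obtain ⟨hp1, hp2⟩ := Finset.mem_filter.1 (Finset.mem_coe.1 hp)
        obtain ⟨hp3, hp4⟩ := Finset.mem_product.1 hp1
        have hp5 := Finset.mem_product.1 (Finset.mem_filter.1 hp3).1
        have hp6 := Finset.mem_product.1 (Finset.mem_filter.1 hp4).1
        simp only [hF, Prod.mk.injEq] at hp2
        simp only [Finset.coe_sigma, Set.mem_sigma_iff, Finset.mem_coe, Finset.mem_product,
          Finset.mem_filter]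
        refine ⟨⟨hp5.1, hp6.1⟩, hp5.2, ?_⟩
        rw [hp2.2, hp2.1]
      · rintro ⟨⟨p1, p2⟩, ⟨p3, p4⟩⟩ hp ⟨⟨q1, q2⟩, ⟨q3, q4⟩⟩ hq h
        have hp2 := (Finset.mem_filter.1 (Finset.mem_coe.1 hp)).2
        have hq2 := (Finset.mem_filter.1 (Finset.mem_coe.1 hq)).2
        simp only [hF, Prod.mk.injEq] at hp2 hq2
        simp only [Sigma.mk.injEq, Prod.mk.injEq, heq_eq_eq] at h
        obtain ⟨⟨h1, h2⟩, h3⟩ := h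
        simp only [Prod.mk.injEq]
        exact ⟨⟨h1, h3⟩, h2, by rw [← hp2.1, ← hq2.1, h3]⟩
    refine (Nat.cast_le.2 h1).trans ?_
    rw [Finset.card_sigma, Finset.sum_product]
    push_cast
    refine (Finset.sum_le_sum hq).trans ?_
    rw [Finset.sum_const, nsmul_eq_mul]
  have hCS := card_sq_le_image_mul_collisions I F
  have hfinal : (μ * S.card) ^ 2 ≤ (13 * 2 ^ k * V) * (S.card * E) := by
    calc (μ * S.card) ^ 2 ≤ (I.card : ℝ) ^ 2 := by gcongr
      _ ≤ _ := hCS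
      _ ≤ _ := by gcongr
  have hcancel : μ ^ 2 * S.card ≤ 13 * 2 ^ k * V * E := by
    rcases (Nat.cast_nonneg S.card : (0 : ℝ) ≤ S.card).eq_or_lt with h | h
    · rw [← h, mul_zero]; positivity
    · refine le_of_mul_le_mul_right ?_ h
      linarith
  -- The length y is proportional to 2^k, so k drops out of the first term, and the bound is uniform
  -- over k ≤ b.
  have hgeom : (2 : ℝ) ^ k * 2 ^ k * (4 * σ ^ 2 / (y ^ 2 * G.m) + 1) ≤
      16 * (G.m * σ ^ 2 + 4 ^ b) := by
    have e1 : (2 : ℝ) ^ k * 2 ^ k * (4 * σ ^ 2 / (y ^ 2 * G.m)) =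
        4 * σ ^ 2 * G.m ^ 3 / (2 ^ a) ^ 2 := by
      rw [hy]; field_simp
    have e2 : 4 * σ ^ 2 * G.m ^ 3 / (2 ^ a) ^ 2 ≤ 16 * (G.m * σ ^ 2) := by
      rw [div_le_iff₀ (by positivity)]
      have : G.m ^ 2 ≤ (2 * 2 ^ a) ^ 2 := pow_le_pow_left₀ hm0.le ha'.le 2
      calc 4 * σ ^ 2 * G.m ^ 3 = 4 * σ ^ 2 * G.m * G.m ^ 2 := by ring
        _ ≤ 4 * σ ^ 2 * G.m * (2 * 2 ^ a) ^ 2 := by gcongr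
        _ = _ := by ring
    have e3 : (2 : ℝ) ^ k * 2 ^ k ≤ 4 ^ b := by
      rw [← mul_pow]
      norm_num
      exact pow_le_pow_right₀ (by norm_num) hkb
    have e4 : (0 : ℝ) ≤ 4 ^ b := by positivity
    rw [mul_add, e1, mul_one]
    linarith
  rw [show 10 ^ 8 * G.C ^ 2 * (a + 2) * G.N * (2 ^ a / 2 ^ f) / μ ^ 2 *
      (G.m * σ ^ 2 + 4 ^ b) * n₀ = (10 ^ 8 * G.C ^ 2 * (a + 2) * G.N * (2 ^ a / 2 ^ f) *
      (G.m * σ ^ 2 + 4 ^ b) * n₀) / μ ^ 2 by ring, le_div_iff₀ (by positivity)]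
  calc (S.card : ℝ) * μ ^ 2 ≤ 13 * 2 ^ k * V * E := by linarith
    _ = (13 * 1000 * 40 * G.C ^ 2 * (a + 2) * G.N * (2 ^ a / 2 ^ f) * n₀) *
        (2 ^ k * 2 ^ k * (4 * σ ^ 2 / (y ^ 2 * G.m) + 1)) := by rw [hV, hE]; ring
    _ ≤ (13 * 1000 * 40 * G.C ^ 2 * (a + 2) * G.N * (2 ^ a / 2 ^ f) * n₀) *
        (16 * (G.m * σ ^ 2 + 4 ^ b)) := by gcongr
    _ = (13 * 1000 * 40 * 16) * (G.C ^ 2 * (a + 2) * G.N * (2 ^ a / 2 ^ f) * n₀ *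
        (G.m * σ ^ 2 + 4 ^ b)) := by ring
    _ ≤ 10 ^ 8 * (G.C ^ 2 * (a + 2) * G.N * (2 ^ a / 2 ^ f) * n₀ *
        (G.m * σ ^ 2 + 4 ^ b)) := by
        refine mul_le_mul_of_nonneg_right (by norm_num) (by positivity)
    _ = _ := by ring

end PlankConfig

/-! ### Dyadic blocks, transversal pairs and the count in a box 1, m, m². -/

/-- The `i`-th dyadic block of length `2 ^ a`. -/
def block (a i : ℕ) : Finset ℕ := Finset.Ico (i * 2 ^ a) ((i + 1) * 2 ^ a)

lemma mem_block {a i j : ℕ} : j ∈ block a i ↔ j / 2 ^ a = i := by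
  rw [block, Finset.mem_Ico, div_two_pow_eq_iff]

lemma card_block (a i : ℕ) : (block a i).card = 2 ^ a := by
  rw [block, Nat.card_Ico, add_mul, one_mul, Nat.add_sub_cancel_left]

/-- Two indices are not adjacent. -/
def Apart (i j : ℕ) : Prop := i + 2 ≤ j ∨ j + 2 ≤ i

/-- Pairs in the block of length `2 ^ s` around the `i`-th block of length `2 ^ a`, separated from
each other and from that block. -/
def transversalPairs (a s i : ℕ) : Finset (ℕ × ℕ) :=
  (block s (i / 2 ^ (s - a)) ×ˢ block s (i / 2 ^ (s - a))).filter fun p =>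
    Apart (p.1 / 2 ^ (s - 20)) (i * 2 ^ a / 2 ^ (s - 20)) ∧
    Apart (p.2 / 2 ^ (s - 20)) (i * 2 ^ a / 2 ^ (s - 20)) ∧
    Apart (p.1 / 2 ^ (s - 20)) (p.2 / 2 ^ (s - 20))

lemma card_transversalPairs_le (a s i : ℕ) : ((transversalPairs a s i).card : ℝ) ≤ 4 ^ s := by
  have h : (transversalPairs a s i).card ≤ 2 ^ s * 2 ^ s := by
    refine (Finset.card_le_card (Finset.filter_subset _ _)).trans ?_
    rw [Finset.card_product, card_block]
  have h2 : ((transversalPairs a s i).card : ℝ) ≤ 2 ^ s * 2 ^ s := by exact_mod_cast h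
  refine h2.trans (le_of_eq ?_)
  rw [← mul_pow]; norm_num

lemma Apart.le_abs_sub {c i j : ℕ} (h : Apart (i / 2 ^ c) (j / 2 ^ c)) :
    (2 : ℝ) ^ c ≤ |(i : ℝ) - j| := by
  have key : ∀ i j : ℕ, i / 2 ^ c + 2 ≤ j / 2 ^ c → i + 2 ^ c ≤ j := by
    intro i j h
    obtain ⟨_, h2⟩ := div_two_pow_eq_iff.1 (rfl : i / 2 ^ c = i / 2 ^ c)
    obtain ⟨h3, _⟩ := div_two_pow_eq_iff.1 (rfl : j / 2 ^ c = j / 2 ^ c)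
    have h4 : (i / 2 ^ c + 2) * 2 ^ c ≤ j / 2 ^ c * 2 ^ c := Nat.mul_le_mul_right _ h
    have h5 : (i / 2 ^ c + 2) * 2 ^ c = (i / 2 ^ c + 1) * 2 ^ c + 2 ^ c := by ring
    omega
  rcases h with h | h
  · have := key i j h
    have h2 : (i : ℝ) + 2 ^ c ≤ j := by exact_mod_cast this
    rw [abs_sub_comm]
    exact le_trans (by linarith) (le_abs_self _)
  · have := key j i h
    have h2 : (j : ℝ) + 2 ^ c ≤ i := by exact_mod_cast this
    exact le_trans (by linarith) (le_abs_self _)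

lemma abs_sub_lt_of_mem_block {s D i j : ℕ} (hi : i / 2 ^ s = D) (hj : j / 2 ^ s = D) :
    |(i : ℝ) - j| ≤ 2 ^ s := by
  obtain ⟨h1, h2⟩ := div_two_pow_eq_iff.1 hi
  obtain ⟨h3, h4⟩ := div_two_pow_eq_iff.1 hj
  have e : (D + 1) * 2 ^ s = D * 2 ^ s + 2 ^ s := by ring
  have h5 : i ≤ j + 2 ^ s := by omega
  have h6 : j ≤ i + 2 ^ s := by omega
  have h5' : (i : ℝ) ≤ j + 2 ^ s := by exact_mod_cast h5
  have h6' : (j : ℝ) ≤ i + 2 ^ s := by exact_mod_cast h6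
  rw [abs_le]; constructor <;> linarith

lemma mul_two_pow_div {a s i : ℕ} (h : a ≤ s) : i * 2 ^ a / 2 ^ s = i / 2 ^ (s - a) := by
  have : 2 ^ s = 2 ^ a * 2 ^ (s - a) := by rw [← pow_add]; congr 1; omega
  rw [this, ← Nat.div_div_eq_div_mul, Nat.mul_div_cancel _ (by positivity)]

namespace PlankConfig
variable {ι ϖ θ : Type} (G : PlankConfig ι ϖ θ)

/-- The energy estimate for points with many common strips. -/
lemma pair_energy {S₀ : Finset ι} (hS₀ : S₀ ⊆ G.pts) (v : V3) {a b i f : ℕ} {σ μ n₀ : ℝ}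
    (ha : (2 : ℝ) ^ a ≤ G.m) (ha' : G.m < 2 * 2 ^ a) (hσ : 0 < σ) (hμ : 0 < μ)
    (hb : (4 : ℝ) ^ (a + b) ≤ G.m ^ 3)
    (hn : ∀ u : V3, ((G.near S₀ u (G.start a i) 2 (2 * G.m) (G.m / σ ^ 2)).card : ℝ) ≤ n₀)
    (hM : ∀ q ∈ S₀, μ ≤ (((block b (i / 2 ^ b)).filter
      fun i' => 2 ^ f ≤ (arc (G.X q) a i').card).card : ℝ)) :
    ((G.near S₀ v (G.start a i) 1 G.m (G.m ^ 2)).card : ℝ) ≤ (b + 1) ^ 3 *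
      (10 ^ 8 * G.C ^ 2 * (a + 2) * G.N * (2 ^ a / 2 ^ f) / μ ^ 2 *
        (G.m * σ ^ 2 + 4 ^ b) * n₀) := by
  have hm0 := G.m_pos
  set S := G.near S₀ v (G.start a i) 1 G.m (G.m ^ 2) with hS
  set R : ℕ → Finset ℕ := fun k => (block b (i / 2 ^ b)).filter
    fun i' => Nat.log 2 ((i' : ℤ) - i).natAbs = k with hR
  set M : ι → Finset ℕ := fun q => (block b (i / 2 ^ b)).filter
    fun i' => 2 ^ f ≤ (arc (G.X q) a i').card with hMdef
  set S' : ℕ → Finset ι := fun k => S.filter fun q =>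
    μ / (b + 1) ≤ (((R k).filter fun i' => 2 ^ f ≤ (arc (G.X q) a i').card).card : ℝ) with hS'
  set η : ℝ := 2 ^ (a + b) / G.m ^ 2 with hη
  -- The 2^(a+b) directions span an angle of at most m^(-1/2), over which a box of dimensions 1, m,
  -- m² keeps values O(m).
  have hη1 : η ^ 2 * G.m ≤ 1 := by
    have e : η ^ 2 * G.m = 4 ^ (a + b) / G.m ^ 3 := by
      rw [hη, div_pow, ← pow_mul, mul_comm (a + b) 2, pow_mul]
      norm_num
      field_simp
    rw [e, div_le_one (by positivity)]
    exact hb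
  have hcover : S ⊆ (Finset.range (b + 1)).biUnion S' := by
    intro q hq
    have hqS₀ := G.near_subset _ _ _ _ _ _ hq
    have hmaps : ∀ i' ∈ M q, Nat.log 2 ((i' : ℤ) - i).natAbs ∈ Finset.range (b + 1) := by
      intro i' hi'
      rw [Finset.mem_range, Nat.lt_succ_iff]
      have h1 := abs_sub_lt_of_mem_block (mem_block.1 (Finset.mem_filter.1 hi').1)
        (rfl : i / 2 ^ b = i / 2 ^ b)
      have h2 : ((((i' : ℤ) - i).natAbs : ℕ) : ℝ) ≤ 2 ^ b := by
        rw [Nat.cast_natAbs]; push_cast; exact h1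
      have h3 : ((i' : ℤ) - i).natAbs ≤ 2 ^ b := by exact_mod_cast h2
      calc _ ≤ Nat.log 2 (2 ^ b) := Nat.log_mono_right h3
        _ = b := Nat.log_pow one_lt_two b
    have h1 := Finset.card_eq_sum_card_fiberwise (s := M q) (t := Finset.range (b + 1))
      (f := fun i' : ℕ => Nat.log 2 ((i' : ℤ) - i).natAbs) (fun i' hi' => hmaps i' hi')
    have h2 := hM q hqS₀
    by_contra hcon
    have h3 : ∀ k ∈ Finset.range (b + 1),
        ((((M q).filter fun i' : ℕ => Nat.log 2 ((i' : ℤ) - i).natAbs = k).card : ℕ) : ℝ)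
          < μ / (b + 1) := by
      intro k hk
      by_contra hlt
      refine hcon (Finset.mem_biUnion.2 ⟨k, hk, Finset.mem_filter.2 ⟨hq, ?_⟩⟩)
      refine (not_lt.1 hlt).trans (le_of_eq ?_)
      congr 2
      ext i'
      simp only [hMdef, hR, Finset.mem_filter]
      tauto
    have h4 := Finset.sum_lt_sum_of_nonempty (by simp) h3
    rw [Finset.sum_const, Finset.card_range, nsmul_eq_mul] at h4
    have h5 : ((M q).card : ℝ) < μ := by
      rw [h1]
      push_cast at h4 ⊢
      refine h4.trans_le (le_of_eq ?_)
      field_simp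
    linarith
  have hk : ∀ k ∈ Finset.range (b + 1), ((S' k).card : ℝ) ≤
      10 ^ 8 * G.C ^ 2 * (a + 2) * G.N * (2 ^ a / 2 ^ f) / (μ / (b + 1)) ^ 2 *
        (G.m * σ ^ 2 + 4 ^ b) * n₀ := by
    intro k hk
    have hkb : k ≤ b := Nat.lt_succ_iff.1 (Finset.mem_range.1 hk)
    refine G.pair_energy_at_scale hS₀ (v := v) (η := η) (i := i) ha ha' hσ (by positivity) hkb ?_ hη1
      hn (S' k) (Finset.filter_subset _ _) (R k) ?_ ?_ ?_
    · intro j hj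
      have hi : (i * 2 ^ a) / 2 ^ (a + b) = i / 2 ^ b := by
        rw [mul_two_pow_div (by omega)]; congr 2; omega
      have h1 := abs_sub_lt_of_mem_block hj hi
      unfold start
      rw [← sub_div, abs_div, abs_of_pos (by positivity : 0 < G.m ^ 2), hη]
      push_cast at h1
      gcongr
    · intro i' hi'
      obtain ⟨h1, h2⟩ := Finset.mem_filter.1 hi'
      exact ⟨mem_block.1 h1, h2⟩
    · rw [hη, pow_add, mul_comm ((2 : ℝ) ^ a)]
      gcongr
      exact one_le_two
    · intro q hq
      exact (Finset.mem_filter.1 hq).2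
  calc (S.card : ℝ) ≤ (((Finset.range (b + 1)).biUnion S').card : ℝ) :=
        Nat.cast_le.2 (Finset.card_le_card hcover)
    _ ≤ ∑ k ∈ Finset.range (b + 1), ((S' k).card : ℝ) := by exact_mod_cast Finset.card_biUnion_le
    _ ≤ _ := Finset.sum_le_sum hk
    _ = _ := by
      rw [Finset.sum_const, Finset.card_range, nsmul_eq_mul]
      push_cast
      field_simp

/-- The bound for the number of points in a box of dimensions `1, m, m²`. -/
def boxBound (Λ ρ : ℝ) (f s : ℕ) : ℝ :=
  10 ^ 19 * 2 ^ 80 * G.C ^ 5 * (G.C + 4) ^ 2 * Λ ^ 6 *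
    (G.N ^ 3 * 2 ^ f * 16 ^ s / (G.m * ρ ^ 4 * (2 ^ s / G.m ^ 2) ^ 3))

-- When s ≥ a + 20, `transversal_count` over the transversal pairs supplies the count n₀ of the
-- shorter boxes, and `pair_energy` passes to the full box. When s < a + 20, 2^s is at most a
-- constant times m and the volume bound C m³ already lies below `boxBound`.
set_option maxHeartbeats 1000000 in
lemma card_near_le_boxBound {S₀ : Finset ι} (hS₀ : S₀ ⊆ G.pts) (v : V3) {a b i f s : ℕ} {ρ Λ : ℝ}
    (ha : (2 : ℝ) ^ a ≤ G.m) (ha' : G.m < 2 * 2 ^ a) (has : a ≤ s) (hs : (2 : ℝ) ^ s ≤ 2 * G.m ^ 2)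
    (hb : (4 : ℝ) ^ (a + b) ≤ G.m ^ 3) (hb' : G.m ^ 3 ≤ 4 * 4 ^ (a + b) ∨ a + b = s)
    (hρ : 0 < ρ) (hρs : ρ ≤ 2 ^ s) (hf : ρ * 2 ^ a ≤ 8 * 2 ^ s * 2 ^ f)
    (hbΛ : b + 1 ≤ Λ) (haΛ : a + 2 ≤ 2 * Λ) (hx : G.start a i ≤ 1)
    (hpairs : a + 20 ≤ s → ∀ q ∈ S₀, ρ ^ 2 / 2 ≤ (((transversalPairs a s i).filter
      fun p => p.1 ∈ G.X q ∧ p.2 ∈ G.X q).card : ℝ))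
    (hM : ∀ q ∈ S₀, ρ * 2 ^ (a + b) / (8 * Λ * 2 ^ s * 2 ^ f) ≤ (((block b (i / 2 ^ b)).filter
      fun i' => 2 ^ f ≤ (arc (G.X q) a i').card).card : ℝ)) :
    ((G.near S₀ v (G.start a i) 1 G.m (G.m ^ 2)).card : ℝ) ≤ G.boxBound Λ ρ f s := by
  have hm := G.one_le_m
  have hm0 := G.m_pos
  have hC := G.one_le_C
  have hC0 := G.C_pos
  have hN0 := G.N_pos
  have hx0 : 0 ≤ G.start a i := by unfold start; positivity
  have hΛ1 : 1 ≤ Λ := by linarith [(Nat.cast_nonneg b : (0 : ℝ) ≤ b)]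
  have hΛ0 : 0 < Λ := by linarith
  set σ : ℝ := 2 ^ s / G.m ^ 2 with hσ
  have hσ0 : 0 < σ := by positivity
  have hσ2 : σ ≤ 2 := by rw [hσ, div_le_iff₀ (by positivity)]; exact hs
  have has' : (2 : ℝ) ^ a ≤ 2 ^ s := pow_le_pow_right₀ one_le_two has
  have e16 : (16 : ℝ) ^ s = (2 ^ s) ^ 4 := by rw [← pow_mul, mul_comm, pow_mul]; norm_num
  have e4 : ∀ n : ℕ, (4 : ℝ) ^ n = (2 ^ n) ^ 2 := by
    intro n; rw [← pow_mul, mul_comm, pow_mul]; norm_num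
  have hp2s : (0 : ℝ) < 2 ^ s := by positivity
  have hp2a : (0 : ℝ) < 2 ^ a := by positivity
  have hp2f : (0 : ℝ) < 2 ^ f := by positivity
  rcases le_or_gt (a + 20) s with hbig | hsmall
  · set K₃ : ℝ := 2 * 10 ^ 6 * G.C ^ 3 * (G.C + 4) ^ 2 / (2⁻¹ ^ 20) ^ 4 * (G.N ^ 2 / σ ^ 3) with hK₃
    have hK₃0 : 0 < K₃ := by positivity
    have hn : ∀ u : V3, ((G.near S₀ u (G.start a i) 2 (2 * G.m) (G.m / σ ^ 2)).card : ℝ) ≤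
        4 ^ s * K₃ / (ρ ^ 2 / 2) := by
      intro u
      have h1 := G.transversal_count hS₀ (v := u) (x := G.start a i) (σ := σ) (ε := 2⁻¹ ^ 20) hx0 hx
        hσ2 ?_ (by positivity) (by norm_num) (transversalPairs a s i) ?_ (hpairs hbig)
      · rw [le_div_iff₀ (by positivity), mul_comm]
        exact h1.trans (mul_le_mul_of_nonneg_right (card_transversalPairs_le a s i) hK₃0.le)
      · rw [hσ, mul_div_assoc', le_div_iff₀ (by positivity)]
        nlinarith
      · intro p hp
        obtain ⟨h2, h3, h4, h5⟩ := Finset.mem_filter.1 hp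
        obtain ⟨h6, h7⟩ := Finset.mem_product.1 h2
        rw [mem_block] at h6 h7
        have hi : i * 2 ^ a / 2 ^ s = i / 2 ^ (s - a) := mul_two_pow_div has
        have g1 := abs_sub_lt_of_mem_block h6 hi
        have g2 := abs_sub_lt_of_mem_block h7 hi
        have g3 := h3.le_abs_sub
        have g4 := h4.le_abs_sub
        have g5 := h5.le_abs_sub
        have e20 : (2 : ℝ) ^ (s - 20) = 2⁻¹ ^ 20 * 2 ^ s := by
          have : (2 : ℝ) ^ s = 2 ^ (s - 20) * 2 ^ 20 := by rw [← pow_add]; congr 1; omega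
          rw [this]; ring
        rw [e20] at g3 g4 g5
        push_cast at g1 g2 g3 g4
        unfold start
        simp only [← sub_div, abs_div, abs_of_pos (by positivity : 0 < G.m ^ 2), hσ, ← mul_div_assoc]
        refine ⟨?_, ?_, ?_, ?_, ?_⟩ <;> gcongr
    have h := G.pair_energy hS₀ v (μ := ρ * 2 ^ (a + b) / (8 * Λ * 2 ^ s * 2 ^ f)) ha ha' hσ0
      (by positivity) hb hn hM
    refine h.trans ?_
    have hgeom : (G.m * σ ^ 2 + 4 ^ b) / 4 ^ (a + b) ≤ 20 / G.m ^ 2 := by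
      rw [add_div]
      have h1 : (4 : ℝ) ^ b / 4 ^ (a + b) ≤ 4 / G.m ^ 2 := by
        rw [pow_add, mul_comm ((4 : ℝ) ^ a), ← div_div, div_self (by positivity), e4 a,
          div_le_div_iff₀ (by positivity) (by positivity)]
        nlinarith
      have h2 : G.m * σ ^ 2 / 4 ^ (a + b) ≤ 16 / G.m ^ 2 := by
        rw [div_le_div_iff₀ (by positivity) (by positivity)]
        -- Either the blocks reach the angular length m^(-1/2) up to a constant, or they have the
        -- full length 2^s. In both cases m σ² is small against 4^(a+b)/m².
        rcases hb' with h3 | h3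
        · have : σ ^ 2 ≤ 4 := by nlinarith
          calc G.m * σ ^ 2 * G.m ^ 2 = σ ^ 2 * G.m ^ 3 := by ring
            _ ≤ 4 * (4 * 4 ^ (a + b)) := by gcongr
            _ = _ := by ring
        · rw [h3, hσ, e4 s]
          have e : G.m * (2 ^ s / G.m ^ 2) ^ 2 * G.m ^ 2 = (2 ^ s) ^ 2 / G.m := by field_simp
          rw [e, div_le_iff₀ hm0]
          nlinarith [pow_pos hp2s 2]
      have : 20 / G.m ^ 2 = 16 / G.m ^ 2 + 4 / G.m ^ 2 := by ring
      linarith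
    have e1 : (b + 1 : ℝ) ^ 3 * (10 ^ 8 * G.C ^ 2 * (a + 2) * G.N * (2 ^ a / 2 ^ f) /
        (ρ * 2 ^ (a + b) / (8 * Λ * 2 ^ s * 2 ^ f)) ^ 2 * (G.m * σ ^ 2 + 4 ^ b) *
        (4 ^ s * K₃ / (ρ ^ 2 / 2))) =
        (b + 1 : ℝ) ^ 3 * (a + 2) * 2 ^ a * ((G.m * σ ^ 2 + 4 ^ b) / 4 ^ (a + b)) *
        (10 ^ 8 * G.C ^ 2 * G.N * 64 * Λ ^ 2 * 2 ^ f * (2 ^ s) ^ 4 * 2 * K₃ / ρ ^ 4) := by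
      rw [e4 s, e4 (a + b)]
      field_simp
      ring
    rw [e1]
    have hb3 : (b + 1 : ℝ) ^ 3 ≤ Λ ^ 3 := by gcongr
    calc _ ≤ Λ ^ 3 * (2 * Λ) * G.m * (20 / G.m ^ 2) *
        (10 ^ 8 * G.C ^ 2 * G.N * 64 * Λ ^ 2 * 2 ^ f * (2 ^ s) ^ 4 * 2 * K₃ / ρ ^ 4) := by
          gcongr
      _ = (2 * 20 * 10 ^ 8 * 64 * 2 * (2 * 10 ^ 6)) * (2 ^ 80 * G.C ^ 5 * (G.C + 4) ^ 2 * Λ ^ 6 *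
          (G.N ^ 3 * 2 ^ f * 16 ^ s / (G.m * ρ ^ 4 * σ ^ 3))) := by
          rw [hK₃, e16]
          field_simp
      _ ≤ 10 ^ 19 * (2 ^ 80 * G.C ^ 5 * (G.C + 4) ^ 2 * Λ ^ 6 *
          (G.N ^ 3 * 2 ^ f * 16 ^ s / (G.m * ρ ^ 4 * σ ^ 3))) := by
          refine mul_le_mul_of_nonneg_right (by norm_num) (by positivity)
      _ = _ := by rw [boxBound, ← hσ]; ring
  · have h1 : ((G.near S₀ v (G.start a i) 1 G.m (G.m ^ 2)).card : ℝ) ≤ G.C * G.m ^ 3 := by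
      have h2 := G.sep (G.start a i) hx0 hx 1 G.m (G.m ^ 2) le_rfl hm (one_le_pow₀ hm) v
      refine le_trans (Nat.cast_le.2 (Finset.card_le_card ?_)) (h2.trans (le_of_eq (by ring)))
      intro q hq
      rw [mem_near] at hq
      rw [Finset.mem_filter]
      exact ⟨hS₀ hq.1, hq.2⟩
    refine h1.trans ?_
    have h2 : (2 : ℝ) ^ s ≤ 2 ^ 20 * G.m := by
      have : (2 : ℝ) ^ s ≤ 2 ^ (20 + a) := pow_le_pow_right₀ one_le_two (by omega)
      rw [pow_add] at this
      linarith [mul_le_mul_of_nonneg_left ha (by positivity : (0 : ℝ) ≤ 2 ^ 20)]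
    have hCN : 1 ≤ (G.C * G.N) ^ 3 := one_le_pow₀ G.one_le_N
    have h3 : 1 ≤ 16 * (2 ^ f * 16 ^ s / (G.m * ρ ^ 4)) := by
      rw [mul_div_assoc', le_div_iff₀ (by positivity), one_mul, e16]
      have k1 : ρ ^ 3 ≤ (2 ^ s) ^ 3 := by gcongr
      have k2 : ρ * G.m ≤ 16 * 2 ^ s * 2 ^ f := by nlinarith
      calc G.m * ρ ^ 4 = (ρ * G.m) * ρ ^ 3 := by ring
        _ ≤ (16 * 2 ^ s * 2 ^ f) * (2 ^ s) ^ 3 := by gcongr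
        _ = _ := by ring
    have h4 : G.m ^ 3 ≤ 2 ^ 60 * (1 / σ ^ 3) := by
      rw [mul_one_div, le_div_iff₀ (by positivity)]
      have : G.m * σ ≤ 2 ^ 20 := by
        rw [hσ, mul_div_assoc', div_le_iff₀ (by positivity)]
        nlinarith
      calc G.m ^ 3 * σ ^ 3 = (G.m * σ) ^ 3 := by ring
        _ ≤ (2 ^ 20) ^ 3 := by gcongr
        _ = _ := by norm_num
    have hΛ6 : 1 ≤ Λ ^ 6 := one_le_pow₀ hΛ1
    have hC4 : (1 : ℝ) ≤ (G.C + 4) ^ 2 := by nlinarith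
    have hCC : 1 ≤ G.C := hC
    calc G.C * G.m ^ 3 ≤ G.C * (2 ^ 60 * (1 / σ ^ 3)) := by gcongr
      _ = (G.C * (2 ^ 60 * (1 / σ ^ 3))) * 1 * 1 := by ring
      _ ≤ (G.C * (2 ^ 60 * (1 / σ ^ 3))) * (16 * (2 ^ f * 16 ^ s / (G.m * ρ ^ 4))) *
          (G.C * G.N) ^ 3 := by gcongr
      _ = (2 ^ 64 * G.C ^ 4 * 1 * 1) * (G.N ^ 3 * 2 ^ f * 16 ^ s / (G.m * ρ ^ 4 * σ ^ 3)) := by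
          field_simp
          ring
      _ ≤ (10 ^ 19 * 2 ^ 80 * G.C ^ 5 * (G.C + 4) ^ 2 * Λ ^ 6) *
          (G.N ^ 3 * 2 ^ f * 16 ^ s / (G.m * ρ ^ 4 * σ ^ 3)) := by
          gcongr
          · norm_num
          · norm_num
      _ = _ := by rw [boxBound, ← hσ]

end PlankConfig

/-! ### Windows, good triples of directions, and counting in cells. -/

/-- The distance of two natural numbers. -/
def gap (i j : ℕ) : ℕ := ((i : ℤ) - j).natAbs

lemma cast_gap (i j : ℕ) : (gap i j : ℝ) = |(i : ℝ) - j| := by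
  rw [gap, Nat.cast_natAbs]; push_cast; rfl

/-- The `w`-th window of length `2 ^ (l + 2)`. -/
def window (l w : ℕ) : Finset ℕ := Finset.Ico (w * 2 ^ (l + 1)) (w * 2 ^ (l + 1) + 2 ^ (l + 2))

/-- Triples of diameter at least `2 ^ l` with the two closer points first. -/
def goodTriples (l : ℕ) (Y : Finset ℕ) : Finset (ℕ × ℕ × ℕ) :=
  (Y ×ˢ Y ×ˢ Y).filter fun t =>
    (l = 0 ∨ 2 ^ l ≤ gap t.1 t.2.2) ∧ gap t.1 t.2.1 ≤ gap t.2.1 t.2.2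

lemma mem_goodTriples {l : ℕ} {Y : Finset ℕ} {t : ℕ × ℕ × ℕ} : t ∈ goodTriples l Y ↔
    (t.1 ∈ Y ∧ t.2.1 ∈ Y ∧ t.2.2 ∈ Y) ∧ (l = 0 ∨ 2 ^ l ≤ gap t.1 t.2.2) ∧
      gap t.1 t.2.1 ≤ gap t.2.1 t.2.2 := by
  simp [goodTriples]

lemma abs_sub_le_of_mem_window {l w i j : ℕ} (hi : i ∈ window l w) (hj : j ∈ window l w) :
    |(i : ℝ) - j| ≤ 2 ^ (l + 2) := by
  rw [window, Finset.mem_Ico] at hi hj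
  have h5 : i ≤ j + 2 ^ (l + 2) := by omega
  have h6 : j ≤ i + 2 ^ (l + 2) := by omega
  have h5' : (i : ℝ) ≤ j + 2 ^ (l + 2) := by exact_mod_cast h5
  have h6' : (j : ℝ) ≤ i + 2 ^ (l + 2) := by exact_mod_cast h6
  rw [abs_le]; constructor <;> linarith

lemma gap_lt_of_mem_window {l w i j : ℕ} (hi : i ∈ window l w) (hj : j ∈ window l w) :
    gap i j < 2 ^ (l + 2) := by
  rw [window, Finset.mem_Ico] at hi hj
  unfold gap
  omega

lemma card_window (l w : ℕ) : (window l w).card = 2 ^ (l + 2) := by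
  rw [window, Nat.card_Ico, Nat.add_sub_cancel_left]

/-- The class of gap + 1 about 2^k has O(2^k) members of weight at most 2^(-k), and only l + 3
classes occur. -/
lemma sum_one_div_gap_le {l w i : ℕ} {Y : Finset ℕ} (hY : Y ⊆ window l w) (hi : i ∈ window l w) :
    ∑ j ∈ Y, 1 / ((gap i j : ℝ) + 1) ≤ 13 * (l + 3) := by
  have hmaps : ∀ j ∈ Y, Nat.log 2 (gap i j + 1) ∈ Finset.range (l + 3) := by
    intro j hj
    rw [Finset.mem_range]
    refine Nat.lt_succ_iff.2 ?_
    have h1 : gap i j + 1 ≤ 2 ^ (l + 2) := gap_lt_of_mem_window hi (hY hj)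
    calc _ ≤ Nat.log 2 (2 ^ (l + 2)) := Nat.log_mono_right h1
      _ = l + 2 := Nat.log_pow one_lt_two _
  rw [← Finset.sum_fiberwise_of_maps_to hmaps]
  have hfib : ∀ k ∈ Finset.range (l + 3),
      ∑ j ∈ Y with Nat.log 2 (gap i j + 1) = k, 1 / ((gap i j : ℝ) + 1) ≤ 13 := by
    intro k _
    have h1 : ∀ j ∈ Y.filter (fun j => Nat.log 2 (gap i j + 1) = k),
        1 / ((gap i j : ℝ) + 1) ≤ 1 / 2 ^ k := by
      intro j hj
      have h2 := Nat.pow_log_le_self 2 (Nat.succ_ne_zero (gap i j))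
      rw [Nat.succ_eq_add_one, (Finset.mem_filter.1 hj).2] at h2
      have h3 : ((2 ^ k : ℕ) : ℝ) ≤ ((gap i j + 1 : ℕ) : ℝ) := by exact_mod_cast h2
      push_cast at h3
      exact one_div_le_one_div_of_le (by positivity) h3
    refine (Finset.sum_le_sum h1).trans ?_
    rw [Finset.sum_const, nsmul_eq_mul]
    have h4 := card_le_of_int_window (Y.filter fun j => Nat.log 2 (gap i j + 1) = k)
      (fun n => (n : ℤ)) Nat.cast_injective.injOn (c := i) (A := 2 * 2 ^ k) (by positivity) ?_
    · have h5 : (1 : ℝ) ≤ 2 ^ k := one_le_pow₀ one_le_two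
      rw [mul_one_div, div_le_iff₀ (by positivity)]
      linarith
    · intro j hj
      have h3 := Nat.lt_pow_succ_log_self (b := 2) one_lt_two (gap i j + 1)
      rw [(Finset.mem_filter.1 hj).2] at h3
      have h4 : ((gap i j + 1 : ℕ) : ℝ) < ((2 ^ (k + 1) : ℕ) : ℝ) := by exact_mod_cast h3
      push_cast at h4
      rw [pow_succ, cast_gap, abs_sub_comm] at h4
      push_cast
      linarith
  refine (Finset.sum_le_sum hfib).trans ?_
  rw [Finset.sum_const, Finset.card_range, nsmul_eq_mul]
  push_cast
  linarith

/-- Double counting with variable bounds. -/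
lemma mul_card_le_sum_of_double_count {α β : Type*} (S : Finset α) (T : Finset β)
    (r : α → β → Prop) [∀ a, DecidablePred (r a)] [∀ b, DecidablePred fun a => r a b] {κ : ℝ}
    {B : β → ℝ} (h1 : ∀ a ∈ S, κ ≤ ((T.filter fun b => r a b).card : ℝ))
    (h2 : ∀ b ∈ T, ((S.filter fun a => r a b).card : ℝ) ≤ B b) :
    κ * S.card ≤ ∑ b ∈ T, B b := by
  have h4 := Finset.sum_le_sum h1
  have h5 := Finset.sum_le_sum h2
  rw [Finset.sum_const, nsmul_eq_mul] at h4
  have h6 : (∑ a ∈ S, ((T.filter fun b => r a b).card : ℝ)) =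
      ∑ b ∈ T, ((S.filter fun a => r a b).card : ℝ) := by
    have h3 := @Finset.sum_card_bipartiteAbove_eq_sum_card_bipartiteBelow _ _ r S T
      (fun a b => ‹∀ a, DecidablePred (r a)› a b)
    have h7 : ∑ a ∈ S, (T.filter fun b => r a b).card = ∑ b ∈ T, (S.filter fun a => r a b).card := by
      convert h3 using 3 <;> (ext; simp [Finset.bipartiteAbove, Finset.bipartiteBelow])
    exact_mod_cast h7
  linarith

/-- The quadratic polynomial with value `e`, derivative `d` at `x` and leading coefficient `c`. -/
def jet (x e d c : ℝ) : V3 := (e - ((d - 2 * c * x) * x + c * x ^ 2), d - 2 * c * x, c)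

lemma ev_jet (x e d c : ℝ) : ev (jet x e d c) x = e := by simp [ev, jet]; ring

lemma de_jet (x e d c : ℝ) : de (jet x e d c) x = d := by simp [de, jet]

lemma co_jet (x e d c : ℝ) : co (jet x e d c) = c := by simp [co, jet]

namespace PlankConfig
variable {ι ϖ θ : Type} (G : PlankConfig ι ϖ θ)

/-- Points in the same three planks whose directions lie in a short block. -/
lemma card_three_planks_le {Q F : Finset ι} (hF : F ⊆ Q) {a i l : ℕ} {p : V3} {x₁ x₃ g b nU : ℝ}
    (ha : (2 : ℝ) ^ a ≤ G.m) (hla : l ≤ a)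
    (hx₁ : |x₁ - G.start a i| ≤ 1 / G.m) (hx₃ : |x₃ - x₁| ≤ 2 ^ (l + 2) / G.m ^ 2)
    (hg : 0 ≤ g) (hb : 0 ≤ b)
    (h1 : ∀ q ∈ F, |ev (G.pos q - p) x₁| ≤ G.C)
    (h2 : ∀ q ∈ F, |de (G.pos q - p) x₁ + co (G.pos q - p) * (x₃ - x₁)| ≤ b * (G.m ^ 2 / 2 ^ l))
    (h3 : ∀ q ∈ F, |co (G.pos q - p)| ≤ g)
    (hn : ∀ u : V3, ((G.near Q u (G.start a i) 1 G.m (G.m ^ 2)).card : ℝ) ≤ nU) :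
    (F.card : ℝ) ≤ (2 * g / G.m ^ 2 + 1) * ((2 * (b + 6) * (G.m / 2 ^ l) + 1) *
      ((2 * (G.C + 2) + 1) * nU)) := by
  have hm := G.one_le_m
  have hm0 := G.m_pos
  have hC := G.one_le_C
  set x := G.start a i with hx
  have hl : (2 : ℝ) ^ l ≤ G.m := (pow_le_pow_right₀ one_le_two hla).trans ha
  have hl0 : (0 : ℝ) < 2 ^ l := by positivity
  -- Windows of size m² for the leading coefficient, m for the slope and 1 for the value cut F into
  -- boxes counted by nU. Once the earlier coordinates are fixed, the constraints at x₁ and x₃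
  -- confine the next coordinate at the start of the block.
  refine card_le_of_windows F (fun q => co (G.pos q)) (c := co p) (by positivity) hg
    (fun y => ?_) (fun q hq => by rw [← co_sub]; exact h3 q hq)
  have hstep := card_le_of_windows (F.filter fun q => |co (G.pos q) - y| ≤ G.m ^ 2)
    (fun q => de (G.pos q) x) (c := de p x₁ - (y - co p) * (x₃ - x₁) + 2 * y * (x - x₁))
    (A := (b + 6) * (G.m ^ 2 / 2 ^ l)) (w := G.m) (M := (2 * (G.C + 2) + 1) * nU) hm0
    (by positivity) ?_ ?_
  · refine hstep.trans (le_of_eq ?_)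
    congr 1
    field_simp
  · intro z
    have hstep2 := card_le_of_windows ((F.filter fun q => |co (G.pos q) - y| ≤ G.m ^ 2).filter
      fun q => |de (G.pos q) x - z| ≤ G.m) (fun q => ev (G.pos q) x)
      (c := ev p x₁ - z * (x₁ - x) - y * (x₁ - x) ^ 2)
      (A := G.C + 2) (w := 1) (M := nU) one_pos (by linarith) ?_ ?_
    · refine hstep2.trans (le_of_eq ?_)
      rw [div_one]
    · intro e
      refine le_trans (Nat.cast_le.2 (Finset.card_le_card ?_)) (hn (jet x e z y))
      intro q hq
      obtain ⟨hq1, hq2⟩ := Finset.mem_filter.1 hq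
      obtain ⟨hq3, hq4⟩ := Finset.mem_filter.1 hq1
      obtain ⟨hq5, hq6⟩ := Finset.mem_filter.1 hq3
      rw [mem_near, ev_sub, de_sub, co_sub, ev_jet, de_jet, co_jet]
      exact ⟨hF hq5, hq2, hq4, hq6⟩
    · intro q hq
      obtain ⟨hq1, hq4⟩ := Finset.mem_filter.1 hq
      obtain ⟨hq5, hq6⟩ := Finset.mem_filter.1 hq1
      have e1 : ev (G.pos q) x - (ev p x₁ - z * (x₁ - x) - y * (x₁ - x) ^ 2) =
          ev (G.pos q - p) x₁ - (de (G.pos q) x - z) * (x₁ - x) - (co (G.pos q) - y) * (x₁ - x) ^ 2 := by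
        rw [ev_sub, ev_taylor (G.pos q) x x₁]; ring
      rw [e1]
      have k1 : |(de (G.pos q) x - z) * (x₁ - x)| ≤ 1 := by
        rw [abs_mul]
        calc _ ≤ G.m * (1 / G.m) := by gcongr
          _ = 1 := by field_simp
      have k2 : |(co (G.pos q) - y) * (x₁ - x) ^ 2| ≤ 1 := by
        rw [abs_mul, abs_pow]
        calc _ ≤ G.m ^ 2 * (1 / G.m) ^ 2 := by gcongr
          _ = 1 := by field_simp
      refine (abs_sub _ _).trans ?_
      have := (abs_sub (ev (G.pos q - p) x₁) ((de (G.pos q) x - z) * (x₁ - x))).trans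
        (add_le_add (h1 q hq5) k1)
      linarith
  · intro q hq
    obtain ⟨hq5, hq6⟩ := Finset.mem_filter.1 hq
    have e1 : de (G.pos q) x - (de p x₁ - (y - co p) * (x₃ - x₁) + 2 * y * (x - x₁)) =
        (de (G.pos q - p) x₁ + co (G.pos q - p) * (x₃ - x₁)) - (co (G.pos q) - y) * (x₃ - x₁) -
          2 * ((co (G.pos q) - y) * (x₁ - x)) := by
      rw [de_sub, co_sub, de_taylor (G.pos q) x₁ x]; ring
    rw [e1]
    have hml : G.m ≤ G.m ^ 2 / 2 ^ l := by
      rw [le_div_iff₀ hl0]; nlinarith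
    have hml2 : (2 : ℝ) ^ (l + 2) ≤ 4 * (G.m ^ 2 / 2 ^ l) := by
      rw [pow_add, mul_div_assoc', le_div_iff₀ hl0]; nlinarith
    have k1 : |(co (G.pos q) - y) * (x₃ - x₁)| ≤ 4 * (G.m ^ 2 / 2 ^ l) := by
      rw [abs_mul]
      calc _ ≤ G.m ^ 2 * (2 ^ (l + 2) / G.m ^ 2) := by gcongr
        _ = 2 ^ (l + 2) := by field_simp
        _ ≤ _ := hml2
    have k2 : |2 * ((co (G.pos q) - y) * (x₁ - x))| ≤ 2 * (G.m ^ 2 / 2 ^ l) := by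
      rw [abs_mul, abs_mul, abs_two]
      refine mul_le_mul_of_nonneg_left ?_ zero_le_two
      calc _ ≤ G.m ^ 2 * (1 / G.m) := by gcongr
        _ = G.m := by field_simp
        _ ≤ _ := hml
    refine (abs_sub _ _).trans ?_
    have := (abs_sub (de (G.pos q - p) x₁ + co (G.pos q - p) * (x₃ - x₁))
      ((co (G.pos q) - y) * (x₃ - x₁))).trans (add_le_add (h2 q hq5) k1)
    linarith

/-- The coefficients of a small quadratic polynomial at a good triple of directions. -/
lemma coeff_of_goodTriple {δ : V3} {l w j₁ j₂ j₃ : ℕ} (hw₁ : j₁ ∈ window l w)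
    (hw₂ : j₂ ∈ window l w) (hw₃ : j₃ ∈ window l w)
    (hl : l = 0 ∨ 2 ^ l ≤ gap j₁ j₃) (hgap : gap j₁ j₂ ≤ gap j₂ j₃)
    (h1 : |ev δ (j₁ / G.m ^ 2)| ≤ G.C) (h2 : |ev δ (j₂ / G.m ^ 2)| ≤ G.C)
    (h3 : |ev δ (j₃ / G.m ^ 2)| ≤ G.C) (hde : |de δ (j₁ / G.m ^ 2)| ≤ 3 * G.m ^ 2)
    (hco : |co δ| ≤ G.m ^ 4 / 2 ^ (l + 2)) :
    |co δ| ≤ 8 * G.C * (G.m ^ 4 / (((gap j₁ j₂ : ℝ) + 1) * 2 ^ l)) ∧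
    |de δ (j₁ / G.m ^ 2) + co δ * (j₃ / G.m ^ 2 - j₁ / G.m ^ 2)| ≤ 4 * G.C * (G.m ^ 2 / 2 ^ l) := by
  have hm0 := G.m_pos
  have hC := G.one_le_C
  have hM : 0 < G.m ^ 2 := by positivity
  have slope : ∀ i j : ℕ, |ev δ (i / G.m ^ 2)| ≤ G.C → |ev δ (j / G.m ^ 2)| ≤ G.C →
      |de δ (i / G.m ^ 2) + co δ * (j / G.m ^ 2 - i / G.m ^ 2)| * gap i j ≤ 2 * G.C * G.m ^ 2 := by
    intro i j hi hj
    have e : (de δ (i / G.m ^ 2) + co δ * (j / G.m ^ 2 - i / G.m ^ 2)) * ((j : ℝ) - i) =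
        (ev δ (j / G.m ^ 2) - ev δ (i / G.m ^ 2)) * G.m ^ 2 := by
      rw [ev_taylor δ (i / G.m ^ 2) (j / G.m ^ 2)]; field_simp; ring
    rw [cast_gap, abs_sub_comm (i : ℝ), ← abs_mul, e, abs_mul, abs_of_pos hM]
    refine mul_le_mul_of_nonneg_right ?_ hM.le
    exact (abs_sub _ _).trans (by linarith)
  set e : ℝ := (gap j₁ j₂ : ℝ) with he
  have he0 : 0 ≤ e := Nat.cast_nonneg _
  have hlpos : (0 : ℝ) < 2 ^ l := by positivity
  constructor
  -- A coincidence j₁ = j₂ carries no information, but then the divisor gap + 1 is 1 and the a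
  -- priori bound from the cell is enough.
  · by_cases he1 : gap j₁ j₂ = 0
    · rw [he, he1]
      refine hco.trans ?_
      rw [Nat.cast_zero, zero_add, one_mul, pow_add]
      have : G.m ^ 4 / (2 ^ l * 2 ^ 2) = (1 / 4) * (G.m ^ 4 / 2 ^ l) := by field_simp; norm_num
      rw [this]
      gcongr
      linarith
    rcases hl with rfl | hl
    · refine hco.trans ?_
      have h5 : gap j₁ j₂ < 4 := by simpa using gap_lt_of_mem_window hw₁ hw₂
      have h6 : e + 1 ≤ 4 := by
        have : gap j₁ j₂ + 1 ≤ 4 := h5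
        rw [he]; exact_mod_cast this
      calc G.m ^ 4 / 2 ^ (0 + 2) = 1 * (G.m ^ 4 / (4 * 2 ^ 0)) := by norm_num
        _ ≤ 8 * G.C * (G.m ^ 4 / ((e + 1) * 2 ^ 0)) := by gcongr; linarith
    · have he1' : 1 ≤ e := by
        have : 1 ≤ gap j₁ j₂ := Nat.one_le_iff_ne_zero.2 he1
        rw [he]; exact_mod_cast this
      -- Both mean slopes from the middle point j₂ are O(m²/gap j₁ j₂). Their difference is the
      -- leading coefficient times (j₁ - j₃)/m², and |j₁ - j₃| ≥ 2^l.
      have s1 := slope j₂ j₁ h2 h1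
      have s3 := slope j₂ j₃ h2 h3
      have hsym : gap j₂ j₁ = gap j₁ j₂ := by unfold gap; omega
      rw [hsym, ← he] at s1
      have hgap' : e ≤ gap j₂ j₃ := by rw [he]; exact_mod_cast hgap
      have s3' : |de δ (j₂ / G.m ^ 2) + co δ * (j₃ / G.m ^ 2 - j₂ / G.m ^ 2)| * e ≤
          2 * G.C * G.m ^ 2 := le_trans (mul_le_mul_of_nonneg_left hgap' (abs_nonneg _)) s3
      have hl' : (2 : ℝ) ^ l ≤ |(j₁ : ℝ) - j₃| := by rw [← cast_gap]; exact_mod_cast hl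
      have e2 : co δ * ((j₁ : ℝ) - j₃) = G.m ^ 2 *
          ((de δ (j₂ / G.m ^ 2) + co δ * (j₁ / G.m ^ 2 - j₂ / G.m ^ 2)) -
          (de δ (j₂ / G.m ^ 2) + co δ * (j₃ / G.m ^ 2 - j₂ / G.m ^ 2))) := by field_simp; ring
      have e3 : |co δ| * 2 ^ l * e ≤ 4 * G.C * G.m ^ 4 := by
        calc |co δ| * 2 ^ l * e ≤ |co δ| * |(j₁ : ℝ) - j₃| * e := by gcongr
          _ = G.m ^ 2 * (|(de δ (j₂ / G.m ^ 2) + co δ * (j₁ / G.m ^ 2 - j₂ / G.m ^ 2)) -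
          (de δ (j₂ / G.m ^ 2) + co δ * (j₃ / G.m ^ 2 - j₂ / G.m ^ 2))| * e) := by
              rw [← abs_mul, e2, abs_mul, abs_of_pos hM]; ring
          _ ≤ G.m ^ 2 * ((|de δ (j₂ / G.m ^ 2) + co δ * (j₁ / G.m ^ 2 - j₂ / G.m ^ 2)| +
          |de δ (j₂ / G.m ^ 2) + co δ * (j₃ / G.m ^ 2 - j₂ / G.m ^ 2)|) * e) := by
              gcongr; exact abs_sub _ _
          _ ≤ G.m ^ 2 * (4 * G.C * G.m ^ 2) := by
              refine mul_le_mul_of_nonneg_left ?_ hM.le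
              rw [add_mul]; linarith
          _ = _ := by ring
      rw [mul_div_assoc', le_div_iff₀ (by positivity)]
      have e4 : e + 1 ≤ 2 * e := by linarith
      calc |co δ| * ((e + 1) * 2 ^ l) ≤ |co δ| * ((2 * e) * 2 ^ l) := by gcongr
        _ = 2 * (|co δ| * 2 ^ l * e) := by ring
        _ ≤ 2 * (4 * G.C * G.m ^ 4) := by gcongr
        _ = _ := by ring
  · rcases hl with rfl | hl
    · have h5 := abs_sub_le_of_mem_window hw₃ hw₁
      have e1 : (j₃ : ℝ) / G.m ^ 2 - j₁ / G.m ^ 2 = ((j₃ : ℝ) - j₁) / G.m ^ 2 := by ring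
      have h6 : |co δ * (j₃ / G.m ^ 2 - j₁ / G.m ^ 2)| ≤ G.m ^ 2 := by
        rw [e1, abs_mul, abs_div, abs_of_pos hM]
        calc _ ≤ G.m ^ 4 / 2 ^ (0 + 2) * (2 ^ (0 + 2) / G.m ^ 2) := by gcongr
          _ = _ := by field_simp
      refine (abs_add_le _ _).trans ?_
      rw [pow_zero, div_one]
      nlinarith
    · have s := slope j₁ j₃ h1 h3
      rw [mul_div_assoc', le_div_iff₀ hlpos]
      have hl' : (2 : ℝ) ^ l ≤ gap j₁ j₃ := by exact_mod_cast hl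
      have := (mul_le_mul_of_nonneg_left hl' (abs_nonneg
        (de δ (j₁ / G.m ^ 2) + co δ * (j₃ / G.m ^ 2 - j₁ / G.m ^ 2)))).trans s
      nlinarith

set_option maxHeartbeats 1000000 in
/-- Points of a cell with many good triples of directions. -/
lemma card_cell_le {Q QB : Finset ι} (hQ : Q ⊆ G.pts) (hQB : QB ⊆ Q) {a i l w : ℕ} {κ nU : ℝ}
    (ha : (2 : ℝ) ^ a ≤ G.m) (hla : l ≤ a)
    (Y : ι → Finset ℕ) (hYX : ∀ q ∈ QB, Y q ⊆ G.X q) (hYb : ∀ q ∈ QB, Y q ⊆ block a i)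
    (hYw : ∀ q ∈ QB, Y q ⊆ window l w)
    (hcell : ∀ q ∈ QB, ∀ q' ∈ QB, |ev (G.pos q - G.pos q') (G.start (l + 1) w)| ≤ 4 * G.m ∧
      |de (G.pos q - G.pos q') (G.start (l + 1) w)| ≤ G.m ^ 2 ∧
      |co (G.pos q - G.pos q')| ≤ G.m ^ 4 / 2 ^ (l + 2))
    (hκ : ∀ q ∈ QB, κ ≤ (goodTriples l (Y q)).card)
    (hn : ∀ u : V3, ((G.near Q u (G.start a i) 1 G.m (G.m ^ 2)).card : ℝ) ≤ nU) :
    κ * QB.card ≤ 10 ^ 11 * G.C ^ 6 * (l + 3) * (G.N ^ 3 * (G.m ^ 3 / 2 ^ l) * nU) *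
      (QB.biUnion Y).card := by
  have hm := G.one_le_m
  have hm0 := G.m_pos
  have hC := G.one_le_C
  have hC0 := G.C_pos
  have hN0 := G.N_pos
  have hM : 0 < G.m ^ 2 := by positivity
  have hnU : 0 ≤ nU := (Nat.cast_nonneg _).trans (hn 0)
  have hl : (2 : ℝ) ^ l ≤ G.m := (pow_le_pow_right₀ one_le_two hla).trans ha
  have hl0 : (0 : ℝ) < 2 ^ l := by positivity
  set TB := QB.biUnion Y with hTB
  have hTw : TB ⊆ window l w := Finset.biUnion_subset.2 hYw
  have hTb : TB ⊆ block a i := Finset.biUnion_subset.2 hYb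
  set x₀ := G.start (l + 1) w with hx₀
  have hdist : ∀ j ∈ window l w, |(j : ℝ) / G.m ^ 2 - x₀| ≤ 2 ^ (l + 2) / G.m ^ 2 := by
    intro j hj
    have h1 : w * 2 ^ (l + 1) ∈ window l w := by
      rw [window, Finset.mem_Ico]; exact ⟨le_rfl, by simp⟩
    have h2 := abs_sub_le_of_mem_window hj h1
    rw [hx₀, start, ← sub_div, abs_div, abs_of_pos hM]
    push_cast at h2
    gcongr
  -- Across the window, of angular length at most 4/m, differences within a cell keep values O(m)
  -- and slopes O(m²), so the cell meets O(N) planks per direction.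
  have hbig : ∀ q ∈ QB, ∀ q' ∈ QB, ∀ j ∈ window l w,
      |ev (G.pos q - G.pos q') (j / G.m ^ 2)| ≤ 12 * G.m ∧
      |de (G.pos q - G.pos q') (j / G.m ^ 2)| ≤ 3 * G.m ^ 2 := by
    intro q hq q' hq' j hj
    obtain ⟨c1, c2, c3⟩ := hcell q hq q' hq'
    refine ⟨(abs_ev_le c1 c2 c3 (hdist j hj)).trans ?_, (abs_de_le c2 c3 (hdist j hj)).trans ?_⟩
    · have : 4 * G.m + G.m ^ 2 * (2 ^ (l + 2) / G.m ^ 2) + G.m ^ 4 / 2 ^ (l + 2) *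
          (2 ^ (l + 2) / G.m ^ 2) ^ 2 = 4 * G.m + 2 * 2 ^ (l + 2) := by field_simp; ring
      rw [this, pow_add]; linarith
    · have : G.m ^ 2 + 2 * (G.m ^ 4 / 2 ^ (l + 2)) * (2 ^ (l + 2) / G.m ^ 2) = 3 * G.m ^ 2 := by
        field_simp; ring
      rw [this]
  set E : ℝ := 4 * 10 ^ 8 * G.C ^ 6 * (G.N ^ 3 * (G.m ^ 3 / 4 ^ l) * nU) with hE
  have hE0 : 0 ≤ E := by positivity
  have e4 : (4 : ℝ) ^ l = 2 ^ l * 2 ^ l := by rw [← mul_pow]; norm_num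
  have hcount := mul_card_le_sum_of_double_count QB (goodTriples l TB)
    (fun q t => t.1 ∈ Y q ∧ t.2.1 ∈ Y q ∧ t.2.2 ∈ Y q) (κ := κ)
    (B := fun t => E * (1 / ((gap t.1 t.2.1 : ℝ) + 1))) ?_ ?_
  · refine hcount.trans ?_
    rw [← Finset.mul_sum]
    have h1 : ∑ t ∈ goodTriples l TB, 1 / ((gap t.1 t.2.1 : ℝ) + 1) ≤
        ∑ t ∈ TB ×ˢ TB ×ˢ TB, 1 / ((gap t.1 t.2.1 : ℝ) + 1) :=
      Finset.sum_le_sum_of_subset_of_nonneg (Finset.filter_subset _ _)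
        (fun t _ _ => by positivity)
    -- The weight makes the sum over the second entry logarithmic, the third entry is free in the
    -- window, and the first gives the number of directions of the cell.
    have h2 : ∑ t ∈ TB ×ˢ TB ×ˢ TB, 1 / ((gap t.1 t.2.1 : ℝ) + 1) ≤
        TB.card * (13 * (l + 3) * 2 ^ (l + 2)) := by
      rw [Finset.sum_product]
      have h3 : ∀ j₁ ∈ TB, ∑ t ∈ TB ×ˢ TB, 1 / ((gap j₁ t.1 : ℝ) + 1) ≤
          13 * (l + 3) * 2 ^ (l + 2) := by
        intro j₁ hj₁
        rw [Finset.sum_product]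
        simp only [Finset.sum_const, nsmul_eq_mul]
        rw [← Finset.mul_sum, mul_comm]
        have h4 := sum_one_div_gap_le hTw (hTw hj₁)
        have h5 : (TB.card : ℝ) ≤ 2 ^ (l + 2) := by
          have := Finset.card_le_card hTw
          rw [card_window] at this
          exact_mod_cast this
        gcongr
      refine (Finset.sum_le_sum h3).trans ?_
      rw [Finset.sum_const, nsmul_eq_mul]
    calc _ ≤ E * (TB.card * (13 * (l + 3) * 2 ^ (l + 2))) := by
          gcongr; exact h1.trans h2
      _ = (4 * 10 ^ 8 * 13 * 4) * (G.C ^ 6 * (l + 3) * (G.N ^ 3 * (G.m ^ 3 / 2 ^ l) * nU) *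
          TB.card) := by
          rw [hE, e4, pow_add]; field_simp; ring
      _ ≤ 10 ^ 11 * (G.C ^ 6 * (l + 3) * (G.N ^ 3 * (G.m ^ 3 / 2 ^ l) * nU) * TB.card) := by
          refine mul_le_mul_of_nonneg_right (by norm_num) (by positivity)
      _ = _ := by ring
  · intro q hq
    refine (hκ q hq).trans (Nat.cast_le.2 (Finset.card_le_card ?_))
    intro t ht
    rw [mem_goodTriples] at ht
    have hsub : Y q ⊆ TB := Finset.subset_biUnion_of_mem Y hq
    rw [Finset.mem_filter, mem_goodTriples]
    exact ⟨⟨⟨hsub ht.1.1, hsub ht.1.2.1, hsub ht.1.2.2⟩, ht.2⟩, ht.1⟩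
  · rintro ⟨j₁, j₂, j₃⟩ ht
    rw [mem_goodTriples] at ht
    obtain ⟨⟨t1, t2, t3⟩, t4, t5⟩ := ht
    dsimp only at t1 t2 t3 t4 t5 ⊢
    set U := QB.filter fun q => j₁ ∈ Y q ∧ j₂ ∈ Y q ∧ j₃ ∈ Y q with hU
    have hUmem : ∀ q ∈ U, q ∈ QB ∧ j₁ ∈ Y q ∧ j₂ ∈ Y q ∧ j₃ ∈ Y q := fun q hq =>
      Finset.mem_filter.1 hq
    set e : ℝ := (gap j₁ j₂ : ℝ) with he
    have he0 : 0 ≤ e := Nat.cast_nonneg _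
    have he4 : (e + 1) ≤ 4 * 2 ^ l := by
      have h1 : gap j₁ j₂ + 1 ≤ 2 ^ (l + 2) := gap_lt_of_mem_window (hTw t1) (hTw t2)
      have h2 : ((gap j₁ j₂ + 1 : ℕ) : ℝ) ≤ ((2 ^ (l + 2) : ℕ) : ℝ) := Nat.cast_le.2 h1
      push_cast at h2
      rw [pow_add] at h2
      linarith
    have himg : ∀ j ∈ TB, (∀ q ∈ U, j ∈ G.X q) →
        ((U.image fun q => G.pl q j).card : ℝ) ≤ 36 * G.C * G.N := by
      intro j hj hjU
      rcases U.eq_empty_or_nonempty with h | ⟨p, hp⟩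
      · rw [h]; simp; positivity
      · have h1 := G.plank_count j (G.pos p) 12 3 (by norm_num) (by norm_num)
        refine le_trans (Nat.cast_le.2 (Finset.card_le_card (Finset.image_subset_image ?_)))
          (h1.trans (le_of_eq (by ring)))
        intro q hq
        rw [Finset.mem_filter]
        exact ⟨hQ (hQB (hUmem q hq).1), hjU q hq, hbig q (hUmem q hq).1 p (hUmem p hp).1 j (hTw hj)⟩
    have hprod : ((U.image fun q => (G.pl q j₁, G.pl q j₂, G.pl q j₃)).card : ℝ) ≤
        (36 * G.C * G.N) ^ 3 := by
      have hsub : (U.image fun q => (G.pl q j₁, G.pl q j₂, G.pl q j₃)) ⊆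
          (U.image fun q => G.pl q j₁) ×ˢ (U.image fun q => G.pl q j₂) ×ˢ
            (U.image fun q => G.pl q j₃) := by
        intro z hz
        obtain ⟨q, hq, rfl⟩ := Finset.mem_image.1 hz
        exact Finset.mk_mem_product (Finset.mem_image_of_mem _ hq) (Finset.mk_mem_product
          (Finset.mem_image_of_mem _ hq) (Finset.mem_image_of_mem _ hq))
      have h1 := Finset.card_le_card hsub
      rw [Finset.card_product, Finset.card_product] at h1
      refine (Nat.cast_le.2 h1).trans ?_
      push_cast
      have k1 := himg j₁ t1 fun q hq => hYX q (hUmem q hq).1 (hUmem q hq).2.1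
      have k2 := himg j₂ t2 fun q hq => hYX q (hUmem q hq).1 (hUmem q hq).2.2.1
      have k3 := himg j₃ t3 fun q hq => hYX q (hUmem q hq).1 (hUmem q hq).2.2.2
      rw [show (36 * G.C * G.N) ^ 3 = 36 * G.C * G.N * (36 * G.C * G.N * (36 * G.C * G.N)) by ring]
      gcongr
    -- Points in the same three planks satisfy the constraints of `coeff_of_goodTriple`, so
    -- `card_three_planks_le` covers them by boxes holding nU points each.
    have hfib : ∀ p ∈ U, ((U.filter fun q => (G.pl q j₁, G.pl q j₂, G.pl q j₃) =
        (G.pl p j₁, G.pl p j₂, G.pl p j₃)).card : ℝ) ≤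
        8500 * G.C ^ 3 * (G.m ^ 3 / ((e + 1) * 4 ^ l)) * nU := by
      intro p hp
      set g : ℝ := 8 * G.C * (G.m ^ 4 / ((e + 1) * 2 ^ l)) with hg
      have hmain : ∀ q ∈ U.filter (fun q => (G.pl q j₁, G.pl q j₂, G.pl q j₃) =
          (G.pl p j₁, G.pl p j₂, G.pl p j₃)), |ev (G.pos q - G.pos p) (j₁ / G.m ^ 2)| ≤ G.C ∧
          |co (G.pos q - G.pos p)| ≤ g ∧
          |de (G.pos q - G.pos p) (j₁ / G.m ^ 2) + co (G.pos q - G.pos p) *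
            (j₃ / G.m ^ 2 - j₁ / G.m ^ 2)| ≤ 4 * G.C * (G.m ^ 2 / 2 ^ l) := by
        intro q hq
        obtain ⟨hq1, hq2⟩ := Finset.mem_filter.1 hq
        simp only [Prod.mk.injEq] at hq2
        obtain ⟨q1, q2, q3, q4⟩ := hUmem q hq1
        obtain ⟨p1, p2, p3, p4⟩ := hUmem p hp
        have thin : ∀ j, j ∈ Y q → j ∈ Y p → G.pl q j = G.pl p j →
            |ev (G.pos q - G.pos p) (j / G.m ^ 2)| ≤ G.C := fun j hj hj' h =>
          G.thin q (hQ (hQB q1)) p (hQ (hQB p1)) j (hYX q q1 hj) (hYX p p1 hj') h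
        have s1 := thin j₁ q2 p2 hq2.1
        have s2 := thin j₂ q3 p3 hq2.2.1
        have s3 := thin j₃ q4 p4 hq2.2.2
        exact ⟨s1, G.coeff_of_goodTriple (hTw t1) (hTw t2) (hTw t3) t4 t5 s1 s2 s3
          (hbig q q1 p p1 j₁ (hTw t1)).2 (hcell q q1 p p1).2.2⟩
      have h := G.card_three_planks_le (Q := Q) (a := a) (i := i) (l := l)
        (x₁ := j₁ / G.m ^ 2) (x₃ := j₃ / G.m ^ 2) (g := g) (b := 4 * G.C) (nU := nU) (p := G.pos p)
        (F := U.filter (fun q => (G.pl q j₁, G.pl q j₂, G.pl q j₃) =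
          (G.pl p j₁, G.pl p j₂, G.pl p j₃)))
        (fun q hq => hQB (hUmem q (Finset.mem_filter.1 hq).1).1) ha hla ?_ ?_ (by positivity)
        (by positivity) (fun q hq => (hmain q hq).1) (fun q hq => (hmain q hq).2.2)
        (fun q hq => (hmain q hq).2.1) hn
      · refine h.trans ?_
        have k1 : 2 * g / G.m ^ 2 + 1 ≤ 20 * G.C * (G.m ^ 2 / ((e + 1) * 2 ^ l)) := by
          have k2 : 1 ≤ 4 * G.C * (G.m ^ 2 / ((e + 1) * 2 ^ l)) := by
            rw [mul_div_assoc', le_div_iff₀ (by positivity), one_mul]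
            nlinarith
          have k3 : 2 * g / G.m ^ 2 = 16 * G.C * (G.m ^ 2 / ((e + 1) * 2 ^ l)) := by
            rw [hg]; field_simp; norm_num
          linarith
        have k4 : 2 * (4 * G.C + 6) * (G.m / 2 ^ l) + 1 ≤ 21 * G.C * (G.m / 2 ^ l) := by
          have : 1 ≤ G.m / 2 ^ l := by rwa [le_div_iff₀ hl0, one_mul]
          nlinarith
        have k5 : 2 * (G.C + 2) + 1 ≤ 7 * G.C := by linarith
        calc _ ≤ (20 * G.C * (G.m ^ 2 / ((e + 1) * 2 ^ l))) * ((21 * G.C * (G.m / 2 ^ l)) *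
              ((7 * G.C) * nU)) := by gcongr
          _ = 2940 * (G.C ^ 3 * (G.m ^ 3 / ((e + 1) * 4 ^ l)) * nU) := by
              rw [e4]; field_simp; ring
          _ ≤ 8500 * (G.C ^ 3 * (G.m ^ 3 / ((e + 1) * 4 ^ l)) * nU) := by
              refine mul_le_mul_of_nonneg_right (by norm_num) (by positivity)
          _ = _ := by ring
      · have hb := abs_sub_lt_of_mem_block (s := a) (mem_block.1 (hTb t1))
          (Nat.mul_div_cancel i (by positivity) : i * 2 ^ a / 2 ^ a = i)
        rw [start, ← sub_div, abs_div, abs_of_pos hM, div_le_div_iff₀ hM hm0]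
        push_cast at hb
        nlinarith
      · have hb := abs_sub_le_of_mem_window (hTw t3) (hTw t1)
        rw [← sub_div, abs_div, abs_of_pos hM]
        gcongr
    refine (card_le_mul_of_fibers U _ (by positivity) hprod hfib).trans ?_
    calc (36 * G.C * G.N) ^ 3 * (8500 * G.C ^ 3 * (G.m ^ 3 / ((e + 1) * 4 ^ l)) * nU)
        = 396576000 * (G.C ^ 6 * (G.N ^ 3 * (G.m ^ 3 / 4 ^ l) * nU) * (1 / (e + 1))) := by
          field_simp; ring
      _ ≤ (4 * 10 ^ 8) * (G.C ^ 6 * (G.N ^ 3 * (G.m ^ 3 / 4 ^ l) * nU) * (1 / (e + 1))) := by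
          refine mul_le_mul_of_nonneg_right (by norm_num) (by positivity)
      _ = _ := by rw [hE]; ring

end PlankConfig

lemma card_int_Icc_le (u : ℝ) : (Finset.Icc ⌈u - 1⌉ ⌊u + 1⌋).card ≤ 3 := by
  rw [Int.card_Icc, Int.floor_add_one, Int.ceil_sub_one]
  have := Int.floor_le_ceil u
  omega

lemma card_int_points_le (S : Finset (ℤ × ℤ × ℤ)) (u : V3) :
    ((S.filter fun s => |(s.1 : ℝ) - u.1| ≤ 1 ∧ |(s.2.1 : ℝ) - u.2.1| ≤ 1 ∧
      |(s.2.2 : ℝ) - u.2.2| ≤ 1).card : ℝ) ≤ 27 := by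
  have hsub : (S.filter fun s => |(s.1 : ℝ) - u.1| ≤ 1 ∧ |(s.2.1 : ℝ) - u.2.1| ≤ 1 ∧
      |(s.2.2 : ℝ) - u.2.2| ≤ 1) ⊆ Finset.Icc ⌈u.1 - 1⌉ ⌊u.1 + 1⌋ ×ˢ
        Finset.Icc ⌈u.2.1 - 1⌉ ⌊u.2.1 + 1⌋ ×ˢ Finset.Icc ⌈u.2.2 - 1⌉ ⌊u.2.2 + 1⌋ := by
    intro s hs
    obtain ⟨-, h1, h2, h3⟩ := Finset.mem_filter.1 hs
    rw [abs_le] at h1 h2 h3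
    simp only [Finset.mem_product, Finset.mem_Icc, Int.ceil_le, Int.le_floor]
    refine ⟨⟨?_, ?_⟩, ⟨?_, ?_⟩, ?_, ?_⟩ <;> linarith
  have h := Finset.card_le_card hsub
  rw [Finset.card_product, Finset.card_product] at h
  have h2 : _ ≤ 3 * (3 * 3) := h.trans (Nat.mul_le_mul (card_int_Icc_le _)
    (Nat.mul_le_mul (card_int_Icc_le _) (card_int_Icc_le _)))
  exact_mod_cast h2

namespace PlankConfig

set_option maxHeartbeats 1000000 in
/-- Counting points with many good triples of directions in a window. -/
lemma exists_window_count (C : ℝ) (hC : 1 ≤ C) : ∃ K : ℝ, 0 < K ∧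
    ∀ {ι ϖ θ : Type} (G : PlankConfig ι ϖ θ), G.C = C → ∀ (Q : Finset ι), Q ⊆ G.pts →
      ∀ (a i l w : ℕ) (t₀ τ₀ nU : ℝ), (2 : ℝ) ^ a ≤ G.m → l ≤ a → 0 < t₀ →
      (∀ q ∈ Q, t₀ ≤ (((arc (G.X q) a i) ∩ window l w).card : ℝ)) →
      (∀ q ∈ Q, τ₀ ≤ ((goodTriples l ((arc (G.X q) a i) ∩ window l w)).card : ℝ)) →
      (∀ u : V3, ((G.near Q u (G.start a i) 1 G.m (G.m ^ 2)).card : ℝ) ≤ nU) →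
      τ₀ * t₀ * Q.card ≤ K * (l + 3) ^ 3 * (G.N ^ 3 * G.Z * G.m ^ 3 * nU) *
        ∑ j ∈ block a i ∩ window l w, ((G.tau j).card : ℝ) := by
  obtain ⟨C', hC', htube⟩ := exists_tube_incidence (27 + C) (by linarith)
  refine ⟨10 ^ 11 * 324 * C' * C ^ 7, by positivity, ?_⟩
  intro ι ϖ θ G hGC Q hQ a i l w t₀ τ₀ nU ha hla ht₀ ht hτ hn
  have hm := G.one_le_m
  have hm0 := G.m_pos
  have hN0 := G.N_pos
  have hZ0 := G.Z_pos
  have hM : 0 < G.m ^ 2 := by positivity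
  have hnU : 0 ≤ nU := (Nat.cast_nonneg _).trans (hn 0)
  have hl : (2 : ℝ) ^ l ≤ G.m := (pow_le_pow_right₀ one_le_two hla).trans ha
  have hl0 : (0 : ℝ) < 2 ^ l := by positivity
  have hk0 : (0 : ℝ) < 2 ^ (l + 2) := by positivity
  set Y : ι → Finset ℕ := fun q => (arc (G.X q) a i) ∩ window l w with hY
  set x₀ := G.start (l + 1) w with hx₀
  -- In these units a box τ has bounded width in the first two coordinates and length about 2^(l+2)
  -- in the third.
  set cell : ι → ℤ × ℤ × ℤ := fun q => (⌊ev (G.pos q) x₀ / (4 * G.m)⌋, ⌊de (G.pos q) x₀ / G.m ^ 2⌋,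
    ⌊co (G.pos q) * 2 ^ (l + 2) / G.m ^ 4⌋) with hcell
  set S := Q.image cell with hS
  -- Directions are indexed by their offset in the window; those outside the block get no tubes.
  set T : ℕ → Finset θ := fun n =>
    if w * 2 ^ (l + 1) + n ∈ block a i then G.tau (w * 2 ^ (l + 1) + n) else ∅ with hT
  set pos : ℤ × ℤ × ℤ → V3 := fun s => ((s.1 : ℝ), (s.2.1 : ℝ), (s.2.2 : ℝ)) with hpos
  set tb : θ → V3 := fun t => (G.ta t / (4 * G.m), G.tb t / G.m ^ 2, 0) with htb
  -- A slope m² acting over the window angle 2^(l+2)/m² changes the value by 2^(l+2), which is κ =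
  -- 2^l/m in units of 4m.
  set κ : ℝ := 2 ^ l / G.m with hκ
  set H : ℤ × ℤ × ℤ → ℕ := fun s => tubeHits (2 ^ (l + 2)) κ (27 + C) T tb (pos s) with hH
  -- A direction of a point in the cell has a box τ near the point. Replacing the point by the
  -- corner of its cell moves the tilted coordinates by a bounded amount, which the margin 27 in the
  -- tube radius absorbs.
  have hhit : ∀ s ∈ S, ((Q.filter fun q => cell q = s).biUnion Y).card ≤ H s := by
    intro s _
    rw [hH]
    refine Finset.card_le_card_of_injOn (fun j => j - w * 2 ^ (l + 1)) ?_ ?_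
    · intro j hj
      rw [Finset.mem_coe, Finset.mem_biUnion] at hj
      obtain ⟨q, hq, hj⟩ := hj
      obtain ⟨hq0, rfl⟩ := Finset.mem_filter.1 hq
      obtain ⟨hj1, hj2⟩ := Finset.mem_inter.1 hj
      rw [mem_arc] at hj1
      rw [window, Finset.mem_Ico] at hj2
      obtain ⟨n, rfl⟩ := Nat.exists_eq_add_of_le hj2.1
      beta_reduce
      rw [Nat.add_sub_cancel_left, Finset.mem_coe, Finset.mem_filter, Finset.mem_range]
      have hn2 : n < 2 ^ (l + 2) := by omega
      refine ⟨hn2, ?_⟩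
      obtain ⟨t, ht, t1, t2⟩ := G.tau_mem q (hQ hq0) _ hj1.1
      have hb : w * 2 ^ (l + 1) + n ∈ block a i := mem_block.2 hj1.2
      refine ⟨t, ?_, ?_⟩
      · simp only [hT, if_pos hb]; exact ht
      set r : ℝ := (n : ℝ) / 2 ^ (l + 2) with hr
      have hr0 : 0 ≤ r := by positivity
      have hr1 : r ≤ 1 := by
        rw [hr, div_le_one hk0]
        exact_mod_cast hn2.le
      have hx : ((w * 2 ^ (l + 1) + n : ℕ) : ℝ) / G.m ^ 2 = x₀ + r * (2 ^ (l + 2) / G.m ^ 2) := by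
        rw [hx₀, start, hr]; push_cast; field_simp
      rw [hx] at t1 t2
      set α : ℝ := ev (G.pos q) x₀ / (4 * G.m) with hα
      set β : ℝ := de (G.pos q) x₀ / G.m ^ 2 with hβ
      set γ : ℝ := co (G.pos q) * 2 ^ (l + 2) / G.m ^ 4 with hγ
      have e1 : ev (G.pos q) (x₀ + r * (2 ^ (l + 2) / G.m ^ 2)) =
          4 * G.m * (α + κ * (β * r + γ * r ^ 2)) := by
        rw [ev_taylor _ x₀, hα, hβ, hγ, hκ, pow_add]; field_simp; ring
      have e2 : de (G.pos q) (x₀ + r * (2 ^ (l + 2) / G.m ^ 2)) = G.m ^ 2 * (β + 2 * γ * r) := by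
        rw [de_taylor _ x₀, hβ, hγ]; field_simp; ring
      rw [e1] at t1
      rw [e2] at t2
      have s1 : |(α + κ * (β * r + γ * r ^ 2)) - G.ta t / (4 * G.m)| ≤ C := by
        have : (α + κ * (β * r + γ * r ^ 2)) - G.ta t / (4 * G.m) =
            (4 * G.m * (α + κ * (β * r + γ * r ^ 2)) - G.ta t) / (4 * G.m) := by field_simp
        rw [this, abs_div, abs_of_pos (by positivity : 0 < 4 * G.m), div_le_iff₀ (by positivity)]
        rw [hGC] at t1
        nlinarith
      have s2 : |(β + 2 * γ * r) - G.tb t / G.m ^ 2| ≤ C := by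
        have : (β + 2 * γ * r) - G.tb t / G.m ^ 2 =
            (G.m ^ 2 * (β + 2 * γ * r) - G.tb t) / G.m ^ 2 := by field_simp
        rw [this, abs_div, abs_of_pos hM, div_le_iff₀ hM]
        rw [hGC] at t2
        exact t2
      have hκ0 : 0 ≤ κ := by positivity
      have hκ1 : κ ≤ 1 := by rw [hκ, div_le_one hm0]; exact hl
      have f1 := Int.floor_le α
      have f2 := Int.lt_floor_add_one α
      have f3 := Int.floor_le β
      have f4 := Int.lt_floor_add_one β
      have f5 := Int.floor_le γ
      have f6 := Int.lt_floor_add_one γ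
      simp only [hpos, hcell, htb, tilt, Prod.fst_sub, Prod.snd_sub]
      push_cast
      rw [← hr]
      set A : ℝ := (⌊α⌋ : ℝ)
      set B : ℝ := (⌊β⌋ : ℝ)
      set D : ℝ := (⌊γ⌋ : ℝ)
      have g1 : 0 ≤ (β - B) * r := mul_nonneg (by linarith) hr0
      have g2 : (β - B) * r ≤ 1 := mul_le_one₀ (by linarith) hr0 hr1
      have g3 : 0 ≤ (γ - D) * r := mul_nonneg (by linarith) hr0
      have g4 : (γ - D) * r ≤ 1 := mul_le_one₀ (by linarith) hr0 hr1
      have g5 : 0 ≤ (γ - D) * r * r := mul_nonneg g3 hr0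
      have g6 : (γ - D) * r * r ≤ 1 := mul_le_one₀ g4 hr0 hr1
      have g7 : 0 ≤ κ * ((β - B) * r + (γ - D) * r * r) := mul_nonneg hκ0 (by linarith)
      have g8 : κ * ((β - B) * r + (γ - D) * r * r) ≤ 2 := by nlinarith
      rw [abs_le] at s1 s2
      constructor
      · rw [abs_le]
        constructor <;> nlinarith
      · rw [abs_le]
        constructor <;> nlinarith
    · intro j hj j' hj' h
      simp only [Finset.coe_biUnion, Set.mem_iUnion] at hj hj'
      obtain ⟨q, _, hj⟩ := hj
      obtain ⟨q', _, hj'⟩ := hj'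
      have h1 := (Finset.mem_inter.1 (Finset.mem_coe.1 hj)).2
      have h2 := (Finset.mem_inter.1 (Finset.mem_coe.1 hj')).2
      rw [window, Finset.mem_Ico] at h1 h2
      simp only at h
      omega
  have hcellle : ∀ s ∈ S, τ₀ * ((Q.filter fun q => cell q = s).card : ℝ) ≤
      10 ^ 11 * G.C ^ 6 * (l + 3) * (G.N ^ 3 * (G.m ^ 3 / 2 ^ l) * nU) * H s := by
    intro s hs
    have h := G.card_cell_le (Q := Q) (QB := Q.filter fun q => cell q = s) (a := a) (i := i) (l := l)
      (w := w) (κ := τ₀) (nU := nU) hQ (Finset.filter_subset _ _) ha hla Y ?_ ?_ ?_ ?_ ?_ hn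
    · refine h.trans ?_
      have hC0 := G.C_pos
      have := hhit s hs
      gcongr
    · intro q _ j hj
      exact (mem_arc.1 (Finset.mem_inter.1 hj).1).1
    · intro q _ j hj
      exact mem_block.2 (mem_arc.1 (Finset.mem_inter.1 hj).1).2
    · intro q _
      exact Finset.inter_subset_right
    · intro q hq q' hq'
      have hqq := (Finset.mem_filter.1 hq).2.trans (Finset.mem_filter.1 hq').2.symm
      simp only [hcell, Prod.mk.injEq] at hqq
      obtain ⟨c1, c2, c3⟩ := hqq
      have d1 := (Int.abs_sub_lt_one_of_floor_eq_floor c1).le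
      have d2 := (Int.abs_sub_lt_one_of_floor_eq_floor c2).le
      have d3 := (Int.abs_sub_lt_one_of_floor_eq_floor c3).le
      rw [← sub_div, ← ev_sub, abs_div, abs_of_pos (by positivity : 0 < 4 * G.m),
        div_le_one (by positivity)] at d1
      rw [← sub_div, ← de_sub, abs_div, abs_of_pos hM, div_le_one hM] at d2
      rw [← sub_div, ← sub_mul, ← co_sub, abs_div, abs_of_pos (by positivity : 0 < G.m ^ 4),
        div_le_one (by positivity), abs_mul, abs_of_pos hk0, ← le_div_iff₀ hk0] at d3
      exact ⟨d1, d2, d3⟩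
    · intro q hq
      exact hτ q (Finset.mem_filter.1 hq).1
  have hsum : τ₀ * (Q.card : ℝ) ≤ 10 ^ 11 * G.C ^ 6 * (l + 3) *
      (G.N ^ 3 * (G.m ^ 3 / 2 ^ l) * nU) * ∑ s ∈ S, (H s : ℝ) := by
    rw [Finset.card_eq_sum_card_image cell Q]
    push_cast
    rw [Finset.mul_sum, Finset.mul_sum]
    exact Finset.sum_le_sum hcellle
  have htubes := htube (l + 2) κ (81 * C * G.Z) t₀ S pos T tb (by positivity)
    (by rw [hκ, div_le_one hm0]; exact hl) ht₀ ?_ ?_ (fun _ _ _ => rfl) ?_ ?_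
  · have hTsum : ∑ n ∈ Finset.range (2 ^ (l + 2)), ((T n).card : ℝ) =
        ∑ j ∈ block a i ∩ window l w, ((G.tau j).card : ℝ) := by
      rw [Finset.inter_comm, ← Finset.filter_mem_eq_inter, Finset.sum_filter, window,
        Finset.sum_Ico_eq_sum_range, Nat.add_sub_cancel_left]
      refine Finset.sum_congr rfl fun n _ => ?_
      simp only [hT]
      split_ifs <;> simp
    rw [hTsum] at htubes
    set Tot := ∑ j ∈ block a i ∩ window l w, ((G.tau j).card : ℝ) with hTot
    have hTot0 : 0 ≤ Tot := Finset.sum_nonneg fun _ _ => Nat.cast_nonneg _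
    rw [hGC] at hsum
    calc τ₀ * t₀ * Q.card = t₀ * (τ₀ * Q.card) := by ring
      _ ≤ t₀ * (10 ^ 11 * C ^ 6 * (l + 3) * (G.N ^ 3 * (G.m ^ 3 / 2 ^ l) * nU) *
          (C' * ((l + 2 : ℕ) + 1) ^ 2 * (81 * C * G.Z * (2 ^ (l + 2) / t₀) * Tot))) := by
          have hp : 0 ≤ 10 ^ 11 * C ^ 6 * (l + 3) * (G.N ^ 3 * (G.m ^ 3 / 2 ^ l) * nU) := by
            positivity
          exact mul_le_mul_of_nonneg_left (hsum.trans (mul_le_mul_of_nonneg_left htubes hp)) ht₀.le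
      _ = _ := by
          push_cast
          rw [pow_add]
          field_simp
          ring
  · intro u
    exact (card_int_points_le S u).trans (by linarith)
  · intro s hs
    obtain ⟨q, hq, rfl⟩ := Finset.mem_image.1 hs
    have h1 := G.co_le q (hQ hq)
    simp only [hpos, hcell]
    set γ : ℝ := co (G.pos q) * 2 ^ (l + 2) / G.m ^ 4 with hγ
    have h2 : |γ| ≤ C * 2 ^ (l + 2) := by
      rw [hγ, abs_div, abs_mul, abs_of_pos hk0, abs_of_pos (by positivity : 0 < G.m ^ 4),
        div_le_iff₀ (by positivity)]
      rw [hGC] at h1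
      nlinarith
    have h3 : (1 : ℝ) ≤ 2 ^ (l + 2) := one_le_pow₀ one_le_two
    rw [abs_le] at h2 ⊢
    have f5 := Int.floor_le γ
    have f6 := Int.lt_floor_add_one γ
    constructor <;> nlinarith
  · intro n α β
    simp only [hT, htb]
    by_cases hb : w * 2 ^ (l + 1) + n ∈ block a i
    · rw [if_pos hb]
      set j := w * 2 ^ (l + 1) + n
      -- As 2^l ≤ m, a unit by 2^(l+2) window of tubes is covered by 9 · 9 windows of size m × m³,
      -- whence 81.
      refine (card_le_of_windows _ G.ta (c := 4 * G.m * α) (A := 4 * G.m) (w := G.m)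
        (M := 9 * (C * G.Z)) hm0 (by positivity) ?_ ?_).trans (le_of_eq ?_)
      · intro y
        refine (card_le_of_windows _ G.tb (c := G.m ^ 2 * β) (A := 4 * G.m ^ 3) (w := G.m ^ 3)
          (M := C * G.Z) (by positivity) (by positivity) ?_ ?_).trans (le_of_eq ?_)
        · intro z
          refine le_trans (Nat.cast_le.2 (Finset.card_le_card ?_)) ((G.tau_count j y z).trans
            (le_of_eq (by rw [hGC])))
          intro t ht
          obtain ⟨ht1, ht2⟩ := Finset.mem_filter.1 ht
          obtain ⟨ht3, ht4⟩ := Finset.mem_filter.1 ht1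
          exact Finset.mem_filter.2 ⟨(Finset.mem_filter.1 ht3).1, ht4, ht2⟩
        · intro t ht
          have h1 := (Finset.mem_filter.1 (Finset.mem_filter.1 ht).1).2.2
          have e : G.tb t - G.m ^ 2 * β = G.m ^ 2 * (G.tb t / G.m ^ 2 - β) := by field_simp
          rw [e, abs_mul, abs_of_pos hM]
          calc G.m ^ 2 * |G.tb t / G.m ^ 2 - β| ≤ G.m ^ 2 * 2 ^ (l + 2) := by gcongr
            _ = 4 * G.m ^ 2 * 2 ^ l := by ring
            _ ≤ 4 * G.m ^ 2 * G.m := by gcongr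
            _ = _ := by ring
        · field_simp; norm_num
      · intro t ht
        have h1 := (Finset.mem_filter.1 ht).2.1
        have e : G.ta t - 4 * G.m * α = 4 * G.m * (G.ta t / (4 * G.m) - α) := by field_simp
        rw [e, abs_mul, abs_of_pos (by positivity : 0 < 4 * G.m)]
        nlinarith
      · field_simp; norm_num
    · rw [if_neg hb]
      simp
      positivity
  · intro s hs
    obtain ⟨q, hq, rfl⟩ := Finset.mem_image.1 hs
    refine (ht q hq).trans (Nat.cast_le.2 (le_trans (Finset.card_le_card ?_) (hhit _ hs)))
    exact Finset.subset_biUnion_of_mem Y (Finset.mem_filter.2 ⟨hq, rfl⟩)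

end PlankConfig

/-! ### Selecting well distributed blocks of directions. -/

/-- Pigeonholing a weighted sum over boundedly many classes. -/
lemma exists_class_sum {α : Type*} (S : Finset α) (F : α → ℕ) (g : α → ℝ) {a : ℕ}
    (hF : ∀ x ∈ S, F x ≤ a) :
    ∃ k ≤ a, ∑ x ∈ S, g x ≤ (a + 1) * ∑ x ∈ S.filter (fun x => F x = k), g x := by
  have hmaps : ∀ x ∈ S, F x ∈ Finset.range (a + 1) := fun x hx =>
    Finset.mem_range.2 (Nat.lt_succ_of_le (hF x hx))
  obtain ⟨k, hk, h⟩ := Finset.exists_le_of_sum_le (s := Finset.range (a + 1))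
    (f := fun _ => (∑ x ∈ S, g x) / (a + 1))
    (g := fun k => ∑ x ∈ S.filter (fun x => F x = k), g x) ⟨0, by simp⟩ (by
      rw [Finset.sum_fiberwise_of_maps_to hmaps, Finset.sum_const, Finset.card_range, nsmul_eq_mul]
      push_cast
      exact (mul_div_cancel₀ _ (by positivity)).le)
  refine ⟨k, Nat.lt_succ_iff.1 (Finset.mem_range.1 hk), ?_⟩
  rwa [div_le_iff₀' (by positivity)] at h

/-- Discarding the light terms loses at most half of a sum. -/
lemma half_sum_le_sum_heavy {α : Type*} (S : Finset α) (g : α → ℝ) {T M : ℝ}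
    (hM : (S.card : ℝ) ≤ M) (hM0 : 0 < M) (hT : 0 ≤ T) (h : T ≤ ∑ x ∈ S, g x) :
    T / 2 ≤ ∑ x ∈ S.filter (fun x => T / (2 * M) ≤ g x), g x := by
  have h1 := Finset.sum_filter_add_sum_filter_not S (fun x => T / (2 * M) ≤ g x) g
  have h2 : ∑ x ∈ S.filter (fun x => ¬ T / (2 * M) ≤ g x), g x ≤ T / 2 := by
    have h3 : ∀ x ∈ S.filter (fun x => ¬ T / (2 * M) ≤ g x), g x ≤ T / (2 * M) := fun x hx =>
      (not_le.1 (Finset.mem_filter.1 hx).2).le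
    refine (Finset.sum_le_sum h3).trans ?_
    rw [Finset.sum_const, nsmul_eq_mul]
    have h4 : ((S.filter (fun x => ¬ T / (2 * M) ≤ g x)).card : ℝ) ≤ M :=
      le_trans (Nat.cast_le.2 (Finset.card_le_card (Finset.filter_subset _ _))) hM
    calc _ ≤ M * (T / (2 * M)) := by gcongr
      _ = T / 2 := by field_simp
  linarith

/-- The rearrangements of a triple. -/
def rearrange (k : ℕ) (t : ℕ × ℕ × ℕ) : ℕ × ℕ × ℕ :=
  match k with
  | 0 => t
  | 1 => (t.1, t.2.2, t.2.1)
  | 2 => (t.2.1, t.1, t.2.2)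
  | 3 => (t.2.1, t.2.2, t.1)
  | 4 => (t.2.2, t.1, t.2.1)
  | _ => (t.2.2, t.2.1, t.1)

/-- Take l = log₂(w - u). Windows of length 4·2^l start at all multiples of 2·2^l, so one of them
contains the whole triple. Reversing the order puts the closer pair first. If u = w then `Nat.log`
gives l = 0, which is why `goodTriples` exempts l = 0. -/
lemma exists_goodTriple_of_le {a i u v w : ℕ} {Y : Finset ℕ} (hY : Y ⊆ block a i) (hu : u ∈ Y)
    (hv : v ∈ Y) (hw : w ∈ Y) (huv : u ≤ v) (hvw : v ≤ w) :
    ∃ l ≤ a, ∃ n < (i + 1) * 2 ^ a, (u, v, w) ∈ goodTriples l (Y ∩ window l n) ∨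
      (w, v, u) ∈ goodTriples l (Y ∩ window l n) := by
  have hub := hY hu
  have hwb := hY hw
  rw [block, Finset.mem_Ico] at hub hwb
  have e : (i + 1) * 2 ^ a = i * 2 ^ a + 2 ^ a := by ring
  set l := Nat.log 2 (w - u) with hl
  set n := u / 2 ^ (l + 1) with hn
  have h1 : w - u < 2 ^ (l + 1) := Nat.lt_pow_succ_log_self one_lt_two _
  obtain ⟨h2, h3⟩ := div_two_pow_eq_iff.1 hn.symm
  have e1 : (n + 1) * 2 ^ (l + 1) = n * 2 ^ (l + 1) + 2 ^ (l + 1) := by ring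
  have e2 : 2 ^ (l + 2) = 2 ^ (l + 1) + 2 ^ (l + 1) := by ring
  have h4 : l = 0 ∨ 2 ^ l ≤ w - u := by
    by_cases h : w - u = 0
    · left; rw [hl, h]; simp
    · right; exact Nat.pow_log_le_self 2 h
  have hmem : ∀ x ∈ Y, u ≤ x → x ≤ w → x ∈ Y ∩ window l n := by
    intro x hx hx1 hx2
    rw [Finset.mem_inter, window, Finset.mem_Ico]
    refine ⟨hx, ?_, ?_⟩ <;> omega
  have m1 := hmem u hu le_rfl (huv.trans hvw)
  have m2 := hmem v hv huv hvw
  have m3 := hmem w hw (huv.trans hvw) le_rfl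
  refine ⟨l, ?_, n, lt_of_le_of_lt (Nat.div_le_self _ _) hub.2, ?_⟩
  · rcases h4 with h4 | h4
    · omega
    · have : 2 ^ l < 2 ^ a := by omega
      exact ((Nat.pow_lt_pow_iff_right one_lt_two).1 this).le
  · rcases le_total (v - u) (w - v) with h | h
    · left
      rw [mem_goodTriples]
      refine ⟨⟨m1, m2, m3⟩, ?_, ?_⟩
      · unfold gap; dsimp only; omega
      · unfold gap; dsimp only; omega
    · right
      rw [mem_goodTriples]
      refine ⟨⟨m3, m2, m1⟩, ?_, ?_⟩
      · unfold gap; dsimp only; omega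
      · unfold gap; dsimp only; omega

lemma exists_rearrange_goodTriple {a i : ℕ} {t : ℕ × ℕ × ℕ} {Y : Finset ℕ} (hY : Y ⊆ block a i)
    (ht : t ∈ Y ×ˢ Y ×ˢ Y) :
    ∃ l ≤ a, ∃ n < (i + 1) * 2 ^ a, ∃ k < 6, ∃ t' ∈ goodTriples l (Y ∩ window l n),
      rearrange k t' = t := by
  obtain ⟨x, y, z⟩ := t
  simp only [Finset.mem_product] at ht
  obtain ⟨hx, hy, hz⟩ := ht
  have key : ∀ u v w : ℕ, u ∈ Y → v ∈ Y → w ∈ Y → u ≤ v → v ≤ w →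
      (∃ k < 6, rearrange k (u, v, w) = (x, y, z)) → (∃ k < 6, rearrange k (w, v, u) = (x, y, z)) →
      ∃ l ≤ a, ∃ n < (i + 1) * 2 ^ a, ∃ k < 6, ∃ t' ∈ goodTriples l (Y ∩ window l n),
        rearrange k t' = (x, y, z) := by
    rintro u v w hu hv hw h1 h2 ⟨k, hk, hk'⟩ ⟨k₂, hk₂, hk₂'⟩
    obtain ⟨l, hl, n, hn, h | h⟩ := exists_goodTriple_of_le hY hu hv hw h1 h2
    · exact ⟨l, hl, n, hn, k, hk, _, h, hk'⟩
    · exact ⟨l, hl, n, hn, k₂, hk₂, _, h, hk₂'⟩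
  rcases le_total x y with h1 | h1 <;> rcases le_total y z with h2 | h2 <;>
    rcases le_total x z with h3 | h3
  · exact key x y z hx hy hz h1 h2 ⟨0, by norm_num, rfl⟩ ⟨5, by norm_num, rfl⟩
  · exact key x y z hx hy hz h1 h2 ⟨0, by norm_num, rfl⟩ ⟨5, by norm_num, rfl⟩
  · exact key x z y hx hz hy h3 h2 ⟨1, by norm_num, rfl⟩ ⟨4, by norm_num, rfl⟩
  · exact key z x y hz hx hy h3 h1 ⟨3, by norm_num, rfl⟩ ⟨2, by norm_num, rfl⟩
  · exact key y x z hy hx hz h1 h3 ⟨2, by norm_num, rfl⟩ ⟨3, by norm_num, rfl⟩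
  · exact key y z x hy hz hx h2 h3 ⟨4, by norm_num, rfl⟩ ⟨1, by norm_num, rfl⟩
  · exact key z y x hz hy hx h2 h1 ⟨5, by norm_num, rfl⟩ ⟨0, by norm_num, rfl⟩
  · exact key z y x hz hy hx h2 h1 ⟨5, by norm_num, rfl⟩ ⟨0, by norm_num, rfl⟩

/-- Each ordered triple is one of six rearrangements of a good triple in some window. -/
lemma card_cube_le_sum_goodTriples {a i : ℕ} {Y : Finset ℕ} (hY : Y ⊆ block a i) :
    Y.card ^ 3 ≤ ∑ l ∈ Finset.range (a + 1), ∑ n ∈ Finset.range ((i + 1) * 2 ^ a),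
      6 * (goodTriples l (Y ∩ window l n)).card := by
  have hsub : Y ×ˢ Y ×ˢ Y ⊆ (Finset.range (a + 1)).biUnion fun l =>
      (Finset.range ((i + 1) * 2 ^ a)).biUnion fun n => (Finset.range 6).biUnion fun k =>
        (goodTriples l (Y ∩ window l n)).image (rearrange k) := by
    intro t ht
    obtain ⟨l, hl, n, hn, k, hk, t', ht', e⟩ := exists_rearrange_goodTriple hY ht
    simp only [Finset.mem_biUnion, Finset.mem_range, Finset.mem_image]
    exact ⟨l, Nat.lt_succ_of_le hl, n, hn, k, hk, t', ht', e⟩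
  have h := Finset.card_le_card hsub
  rw [Finset.card_product, Finset.card_product] at h
  calc Y.card ^ 3 = Y.card * (Y.card * Y.card) := by ring
    _ ≤ _ := h
    _ ≤ _ := by
      refine Finset.card_biUnion_le.trans (Finset.sum_le_sum fun l _ => ?_)
      refine Finset.card_biUnion_le.trans (Finset.sum_le_sum fun n _ => ?_)
      refine Finset.card_biUnion_le.trans ((Finset.sum_le_sum fun k _ =>
        Finset.card_image_le).trans ?_)
      rw [Finset.sum_const, Finset.card_range, smul_eq_mul]

lemma card_windows_le (l j : ℕ) (S : Finset ℕ) : (S.filter fun n => j ∈ window l n).card ≤ 2 := by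
  have hsub : (S.filter fun n => j ∈ window l n) ⊆
      Finset.Icc (j / 2 ^ (l + 1) - 1) (j / 2 ^ (l + 1)) := by
    intro n hn
    have h := (Finset.mem_filter.1 hn).2
    rw [window, Finset.mem_Ico] at h
    have e : n * 2 ^ (l + 1) + 2 ^ (l + 2) = (n + 2) * 2 ^ (l + 1) := by ring
    rw [e] at h
    rw [Finset.mem_Icc]
    have h1 : n ≤ j / 2 ^ (l + 1) := (Nat.le_div_iff_mul_le (by positivity)).2 h.1
    have h2 : j / 2 ^ (l + 1) < n + 2 := (Nat.div_lt_iff_lt_mul (by positivity)).2 h.2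
    omega
  refine (Finset.card_le_card hsub).trans ?_
  rw [Nat.card_Icc]
  omega

lemma sum_card_inter_window_le (l : ℕ) (Y S : Finset ℕ) :
    ∑ n ∈ S, (Y ∩ window l n).card ≤ 2 * Y.card := by
  have h1 : ∀ n ∈ S, (Y ∩ window l n).card = ∑ j ∈ Y, if j ∈ window l n then 1 else 0 := by
    intro n _
    rw [← Finset.filter_mem_eq_inter, Finset.card_filter]
  rw [Finset.sum_congr rfl h1, Finset.sum_comm]
  refine (Finset.sum_le_sum fun j _ => ?_).trans (?_ : ∑ _j ∈ Y, 2 ≤ _)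
  · rw [← Finset.card_filter]
    exact card_windows_le l j S
  · rw [Finset.sum_const, smul_eq_mul, mul_comm]

/-- Every set contains a window with many points and many good triples. -/
lemma exists_window {a i : ℕ} {Y : Finset ℕ} (hY : Y ⊆ block a i) (hne : Y.Nonempty) :
    ∃ l ≤ a, ∃ n : ℕ, (Y.card : ℝ) ≤ 24 * (a + 1) * (Y ∩ window l n).card ∧
      (Y.card : ℝ) ^ 3 ≤ (24 * (a + 1)) ^ 2 * (goodTriples l (Y ∩ window l n)).card := by
  set L : ℝ := 24 * (a + 1) with hL
  have hL1 : 1 ≤ L := by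
    have : (0 : ℝ) ≤ a := Nat.cast_nonneg a
    linarith
  have hL0 : 0 < L := by linarith
  set y : ℝ := (Y.card : ℝ) with hy
  have hy0 : 0 < y := by rw [hy]; exact_mod_cast hne.card_pos
  -- Otherwise, as the windows of one scale cover each point at most twice, summing over windows and
  -- the a + 1 scales would give |Y|³ ≤ |Y|³/2.
  have hex : ∃ l ≤ a, ∃ n : ℕ, (Y ∩ window l n).Nonempty ∧
      ((Y ∩ window l n).card : ℝ) * (y ^ 2 / L) ≤ (goodTriples l (Y ∩ window l n)).card := by
    by_contra hcon
    push Not at hcon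
    have hall : ∀ l ≤ a, ∀ n : ℕ, ((goodTriples l (Y ∩ window l n)).card : ℝ) ≤
        (Y ∩ window l n).card * (y ^ 2 / L) := by
      intro l hl n
      rcases (Y ∩ window l n).eq_empty_or_nonempty with h | h
      · rw [h]; simp [goodTriples]
      · exact (hcon l hl n h).le
    have h1 := card_cube_le_sum_goodTriples hY
    have h2 : y ^ 3 ≤ ∑ l ∈ Finset.range (a + 1), ∑ n ∈ Finset.range ((i + 1) * 2 ^ a),
        6 * ((goodTriples l (Y ∩ window l n)).card : ℝ) := by
      rw [hy]; exact_mod_cast h1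
    have h3 : ∀ l ∈ Finset.range (a + 1), ∑ n ∈ Finset.range ((i + 1) * 2 ^ a),
        6 * ((goodTriples l (Y ∩ window l n)).card : ℝ) ≤ 12 * y * (y ^ 2 / L) := by
      intro l hl
      have hl' : l ≤ a := Nat.lt_succ_iff.1 (Finset.mem_range.1 hl)
      have h4 : (∑ n ∈ Finset.range ((i + 1) * 2 ^ a), ((Y ∩ window l n).card : ℝ)) ≤ 2 * y := by
        rw [hy]; exact_mod_cast sum_card_inter_window_le l Y (Finset.range ((i + 1) * 2 ^ a))
      calc _ ≤ ∑ n ∈ Finset.range ((i + 1) * 2 ^ a), 6 * ((Y ∩ window l n).card * (y ^ 2 / L)) :=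
            Finset.sum_le_sum fun n _ => mul_le_mul_of_nonneg_left (hall l hl' n) (by norm_num)
        _ = 6 * ((∑ n ∈ Finset.range ((i + 1) * 2 ^ a), ((Y ∩ window l n).card : ℝ)) *
            (y ^ 2 / L)) := by rw [Finset.sum_mul, Finset.mul_sum]
        _ ≤ 6 * ((2 * y) * (y ^ 2 / L)) := by gcongr
        _ = _ := by ring
    have h5 := h2.trans (Finset.sum_le_sum h3)
    rw [Finset.sum_const, Finset.card_range, nsmul_eq_mul] at h5
    push_cast at h5
    have h6 : ((a : ℝ) + 1) * (12 * y * (y ^ 2 / L)) = y ^ 3 / 2 := by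
      rw [hL]
      have : (a : ℝ) + 1 ≠ 0 := by positivity
      field_simp
      ring
    rw [h6] at h5
    have : 0 < y ^ 3 := by positivity
    linarith
  obtain ⟨l, hl, n, hne', h⟩ := hex
  set z : ℝ := ((Y ∩ window l n).card : ℝ) with hz
  have hz0 : 0 < z := by rw [hz]; exact_mod_cast hne'.card_pos
  have hgt : ((goodTriples l (Y ∩ window l n)).card : ℝ) ≤ z ^ 3 := by
    have h1 : (goodTriples l (Y ∩ window l n)).card ≤ (Y ∩ window l n).card ^ 3 := by
      refine (Finset.card_le_card (Finset.filter_subset _ _)).trans (le_of_eq ?_)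
      rw [Finset.card_product, Finset.card_product]; ring
    rw [hz]; exact_mod_cast h1
  -- A window with z points has at most z³ triples, so a window with many triples also has many
  -- points.
  have h2 : y ^ 2 ≤ L * z ^ 2 := by
    have h3 := h.trans hgt
    rw [mul_div_assoc', div_le_iff₀ hL0] at h3
    have : z * y ^ 2 ≤ z * (L * z ^ 2) := by linarith
    exact le_of_mul_le_mul_left this hz0
  have h3 : y ≤ L * z := by
    refine le_of_sq_le_sq ?_ (by positivity)
    nlinarith [sq_nonneg z]
  refine ⟨l, hl, n, h3, ?_⟩
  rw [mul_div_assoc', div_le_iff₀ hL0] at h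
  calc y ^ 3 = y * y ^ 2 := by ring
    _ ≤ L * z * y ^ 2 := by gcongr
    _ = L * (z * y ^ 2) := by ring
    _ ≤ L * ((goodTriples l (Y ∩ window l n)).card * L) := by gcongr
    _ = _ := by ring

lemma Apart.symm {i j : ℕ} (h : Apart i j) : Apart j i := Or.symm h

/-- An index that is not apart from k is one of at most three neighbours, each holding at most x/32
directions. -/
lemma card_not_apart_le {X A : Finset ℕ} (hA : A ⊆ X) {c k : ℕ} {x : ℝ}
    (h : ∀ D, 32 * ((arc X c D).card : ℝ) ≤ x) :
    32 * ((A.filter fun j => ¬ Apart (j / 2 ^ c) k).card : ℝ) ≤ 3 * x := by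
  have hsub : (A.filter fun j => ¬ Apart (j / 2 ^ c) k) ⊆
      (Finset.Icc (k - 1) (k + 1)).biUnion fun D => arc X c D := by
    intro j hj
    obtain ⟨hj1, hj2⟩ := Finset.mem_filter.1 hj
    rw [Finset.mem_biUnion]
    refine ⟨j / 2 ^ c, ?_, mem_arc.2 ⟨hA hj1, rfl⟩⟩
    unfold Apart at hj2
    rw [Finset.mem_Icc]
    generalize j / 2 ^ c = i at hj2 ⊢
    omega
  have h1 : ((A.filter fun j => ¬ Apart (j / 2 ^ c) k).card : ℝ) ≤
      ∑ D ∈ Finset.Icc (k - 1) (k + 1), ((arc X c D).card : ℝ) := by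
    exact_mod_cast (Finset.card_le_card hsub).trans Finset.card_biUnion_le
  have h2 : ∑ D ∈ Finset.Icc (k - 1) (k + 1), ((arc X c D).card : ℝ) ≤ 3 * (x / 32) := by
    refine (Finset.sum_le_sum fun D _ => (show _ ≤ x / 32 by linarith [h D])).trans ?_
    rw [Finset.sum_const, nsmul_eq_mul, Nat.card_Icc]
    have h3 : ((k + 1 + 1 - (k - 1) : ℕ) : ℝ) ≤ 3 := by
      have : k + 1 + 1 - (k - 1) ≤ 3 := by omega
      exact_mod_cast this
    have h4 : 0 ≤ x / 32 := by
      have := h 0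
      have h5 : (0 : ℝ) ≤ (arc X c 0).card := Nat.cast_nonneg _
      linarith
    gcongr
  linarith

/-- A set without concentration on shorter blocks contains many transversal pairs. -/
lemma half_sq_le_card_transversalPairs {X : Finset ℕ} {a s J : ℕ} {x : ℝ}
    (hx : x = ((arc X s (J / 2 ^ (s - a))).card : ℝ))
    (h : ∀ D, 32 * ((arc X (s - 20) D).card : ℝ) ≤ x) :
    x ^ 2 / 2 ≤ (((transversalPairs a s J).filter fun p => p.1 ∈ X ∧ p.2 ∈ X).card : ℝ) := by
  set A := arc X s (J / 2 ^ (s - a)) with hA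
  set c := s - 20 with hc
  set k := J * 2 ^ a / 2 ^ c with hk
  have hAX : A ⊆ X := Finset.filter_subset _ _
  set G := (transversalPairs a s J).filter fun p => p.1 ∈ X ∧ p.2 ∈ X with hG
  set B := A.filter fun j => ¬ Apart (j / 2 ^ c) k with hB
  set E := (A ×ˢ A).filter fun p => ¬ Apart (p.1 / 2 ^ c) (p.2 / 2 ^ c) with hE
  have hsub : A ×ˢ A ⊆ G ∪ (B ×ˢ A ∪ (A ×ˢ B ∪ E)) := by
    rintro ⟨p, q⟩ hp
    obtain ⟨hp1, hp2⟩ := Finset.mem_product.1 hp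
    by_cases h1 : Apart (p / 2 ^ c) k
    · by_cases h2 : Apart (q / 2 ^ c) k
      · by_cases h3 : Apart (p / 2 ^ c) (q / 2 ^ c)
        · refine Finset.mem_union_left _ (Finset.mem_filter.2 ⟨Finset.mem_filter.2
            ⟨Finset.mem_product.2 ⟨mem_block.2 (mem_arc.1 hp1).2, mem_block.2 (mem_arc.1 hp2).2⟩,
              h1, h2, h3⟩, hAX hp1, hAX hp2⟩)
        · exact Finset.mem_union_right _ (Finset.mem_union_right _ (Finset.mem_union_right _
            (Finset.mem_filter.2 ⟨hp, h3⟩)))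
      · exact Finset.mem_union_right _ (Finset.mem_union_right _ (Finset.mem_union_left _
          (Finset.mem_product.2 ⟨hp1, Finset.mem_filter.2 ⟨hp2, h2⟩⟩)))
    · exact Finset.mem_union_right _ (Finset.mem_union_left _
        (Finset.mem_product.2 ⟨Finset.mem_filter.2 ⟨hp1, h1⟩, hp2⟩))
  have h1 : (A ×ˢ A).card ≤ G.card + (B.card * A.card + (A.card * B.card + E.card)) := by
    refine (Finset.card_le_card hsub).trans ((Finset.card_union_le _ _).trans ?_)
    gcongr
    refine (Finset.card_union_le _ _).trans ?_
    rw [Finset.card_product]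
    gcongr
    refine (Finset.card_union_le _ _).trans ?_
    rw [Finset.card_product]
  rw [Finset.card_product] at h1
  have h2 : (A.card : ℝ) * A.card ≤ G.card + (B.card * A.card + (A.card * B.card + E.card)) := by
    exact_mod_cast h1
  rw [← hx] at h2
  have hBle : 32 * (B.card : ℝ) ≤ 3 * x := card_not_apart_le hAX h
  have hEle : 32 * (E.card : ℝ) ≤ 3 * x * x := by
    have e1 : (E.card : ℝ) =
        ∑ p ∈ A, ((A.filter fun j => ¬ Apart (j / 2 ^ c) (p / 2 ^ c)).card : ℝ) := by
      rw [hE, Finset.card_filter, Finset.sum_product]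
      push_cast
      refine Finset.sum_congr rfl fun p _ => ?_
      rw [Finset.card_filter]
      push_cast
      refine Finset.sum_congr rfl fun j _ => ?_
      have : Apart (p / 2 ^ c) (j / 2 ^ c) ↔ Apart (j / 2 ^ c) (p / 2 ^ c) :=
        ⟨Apart.symm, Apart.symm⟩
      simp only [this]
    rw [e1, Finset.mul_sum]
    refine (Finset.sum_le_sum fun p _ => card_not_apart_le hAX h).trans ?_
    rw [Finset.sum_const, nsmul_eq_mul, ← hx, mul_comm]
  have hx0 : 0 ≤ x := by rw [hx]; exact Nat.cast_nonneg _
  -- The three kinds of bad pairs cost 3 · 3/32 of all pairs, less than one half.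
  nlinarith

/-- A block of directions around which a set of directions is well distributed. -/
structure IsRichBlock (X : Finset ℕ) (a b s f l : ℕ) (Λ ρ : ℝ) (J w : ℕ) : Prop where
  pairs : a + 20 ≤ s → ρ ^ 2 / 2 ≤ (((transversalPairs a s J).filter
    fun p => p.1 ∈ X ∧ p.2 ∈ X).card : ℝ)
  arcs : ρ * 2 ^ (a + b) / (8 * Λ * 2 ^ s * 2 ^ f) ≤ (((block b (J / 2 ^ b)).filter
    fun i' => 2 ^ f ≤ (arc X a i').card).card : ℝ)
  window_card : (2 : ℝ) ^ f ≤ 24 * Λ * (arc X a J ∩ window l w).card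
  triples : ((2 : ℝ) ^ f) ^ 3 ≤ (24 * Λ) ^ 2 * (goodTriples l (arc X a J ∩ window l w)).card

/-- The most concentrated block of a set of directions. -/
lemma exists_concentrated_block {X : Finset ℕ} {a M : ℕ} (hX : X ⊆ Finset.range (2 ^ M))
    (haM : a ≤ M) : ∃ s, a ≤ s ∧ s ≤ M ∧ ∃ D,
      (X.card : ℝ) ^ 4 * 2 ^ s ≤ ((arc X s D).card : ℝ) ^ 4 * 2 ^ M ∧
      (a + 20 ≤ s → ∀ D', 32 * ((arc X (s - 20) D').card : ℝ) ≤ (arc X s D).card) := by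
  -- Since 2^20 = 32⁴, maximality of card⁴/length bounds the share of any block shorter by 2^20 by
  -- 1/32.
  set g : ℕ × ℕ → ℝ := fun p => ((arc X p.1 p.2).card : ℝ) ^ 4 / 2 ^ p.1 with hg
  obtain ⟨⟨s, D⟩, hsD, hmax⟩ := Finset.exists_max_image
    (Finset.Icc a M ×ˢ Finset.range (2 ^ M)) g
    ⟨(M, 0), Finset.mem_product.2 ⟨Finset.mem_Icc.2 ⟨haM, le_rfl⟩, by simp⟩⟩
  obtain ⟨hs, hD⟩ := Finset.mem_product.1 hsD
  rw [Finset.mem_Icc] at hs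
  refine ⟨s, hs.1, hs.2, D, ?_, ?_⟩
  · have h1 := hmax (M, 0) (Finset.mem_product.2 ⟨Finset.mem_Icc.2 ⟨haM, le_rfl⟩, by simp⟩)
    have h2 : arc X M 0 = X := by
      refine Finset.filter_true_of_mem fun j hj => ?_
      exact Nat.div_eq_of_lt (Finset.mem_range.1 (hX hj))
    simp only [hg, h2] at h1
    rwa [div_le_div_iff₀ (by positivity) (by positivity)] at h1
  · intro has D'
    by_cases hD' : D' < 2 ^ M
    · have h1 := hmax (s - 20, D') (Finset.mem_product.2 ⟨Finset.mem_Icc.2 ⟨by omega, by omega⟩,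
        Finset.mem_range.2 hD'⟩)
      simp only [hg] at h1
      rw [div_le_div_iff₀ (by positivity) (by positivity)] at h1
      have e : (2 : ℝ) ^ s = 2 ^ 20 * 2 ^ (s - 20) := by rw [← pow_add]; congr 1; omega
      rw [e, ← mul_assoc] at h1
      have h2 := le_of_mul_le_mul_right h1 (by positivity)
      have h3 : (32 * ((arc X (s - 20) D').card : ℝ)) ^ 4 ≤ ((arc X s D).card : ℝ) ^ 4 := by
        refine le_trans (le_of_eq ?_) h2
        rw [mul_pow]; norm_num; ring
      exact le_of_pow_le_pow_left₀ (by norm_num) (Nat.cast_nonneg _) h3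
    · have : arc X (s - 20) D' = ∅ := by
        refine Finset.filter_false_of_mem fun j hj hj' => hD' ?_
        rw [← hj']
        exact lt_of_le_of_lt (Nat.div_le_self _ _) (Finset.mem_range.1 (hX hj))
      rw [this]
      simp

lemma sum_card_arc {X : Finset ℕ} {a s D : ℕ} (has : a ≤ s) :
    ∑ J ∈ block (s - a) D, ((arc X a J).card : ℝ) = (arc X s D).card := by
  have e2 : 2 ^ s = 2 ^ a * 2 ^ (s - a) := by rw [← pow_add]; congr 1; omega
  have hmaps : ∀ j ∈ arc X s D, j / 2 ^ a ∈ block (s - a) D := by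
    intro j hj
    rw [mem_block, Nat.div_div_eq_div_mul, ← e2]
    exact (mem_arc.1 hj).2
  rw [Finset.card_eq_sum_card_fiberwise hmaps]
  push_cast
  refine Finset.sum_congr rfl fun J hJ => ?_
  congr 2
  ext j
  rw [Finset.mem_filter, mem_arc, mem_arc]
  rw [mem_block] at hJ
  constructor
  · rintro ⟨h1, rfl⟩
    rw [Nat.div_div_eq_div_mul, ← e2] at hJ
    exact ⟨⟨h1, hJ⟩, rfl⟩
  · rintro ⟨⟨h1, _⟩, h2⟩
    exact ⟨h1, h2⟩

lemma card_arc_le (X : Finset ℕ) (a i : ℕ) : (arc X a i).card ≤ 2 ^ a := by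
  rw [← card_block a i]
  exact Finset.card_le_card fun j hj => mem_block.2 (mem_arc.1 hj).2

/-- The heavy arcs of a popular dyadic size in a block. -/
lemma exists_heavy_arcs {X : Finset ℕ} {a s D : ℕ} {x Λ : ℝ} (has : a ≤ s) (haΛ : (a : ℝ) + 1 ≤ Λ)
    (hx : x = ((arc X s D).card : ℝ)) (hx0 : 0 < x) : ∃ f ≤ a, ∃ F : Finset ℕ,
      x / (2 * Λ) ≤ ∑ J ∈ F, ((arc X a J).card : ℝ) ∧ ∀ J ∈ F, J / 2 ^ (s - a) = D ∧
        x / (2 * 2 ^ (s - a)) ≤ (arc X a J).card ∧ 2 ^ f ≤ (arc X a J).card ∧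
        ((arc X a J).card : ℝ) ≤ 2 * 2 ^ f := by
  have hΛ0 : 0 < Λ := lt_of_lt_of_le (by positivity) haΛ
  have hq : 0 < x / (2 * 2 ^ (s - a)) := by positivity
  have hF₁sum := half_sum_le_sum_heavy (block (s - a) D) (fun J => ((arc X a J).card : ℝ))
    (M := 2 ^ (s - a)) (T := x) (by rw [card_block]; push_cast; exact le_rfl) (by positivity) hx0.le
    ((sum_card_arc has).trans hx.symm).ge
  set F₁ := (block (s - a) D).filter fun J => x / (2 * 2 ^ (s - a)) ≤ (arc X a J).card with hF₁
  obtain ⟨f, hfa, hf⟩ := exists_class_sum F₁ (fun J => Nat.log 2 (arc X a J).card)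
    (fun J => ((arc X a J).card : ℝ)) (a := a)
    (fun J _ => (Nat.log_mono_right (card_arc_le X a J)).trans (Nat.log_pow one_lt_two a).le)
  refine ⟨f, hfa, F₁.filter fun J => Nat.log 2 (arc X a J).card = f, ?_, ?_⟩
  · have h0 : 0 ≤ ∑ J ∈ F₁.filter (fun J => Nat.log 2 (arc X a J).card = f),
        ((arc X a J).card : ℝ) := Finset.sum_nonneg fun _ _ => Nat.cast_nonneg _
    rw [div_le_iff₀ (by positivity)]
    have := mul_le_mul_of_nonneg_right haΛ h0
    linarith
  · intro J hJ
    obtain ⟨hJ1, hJ2⟩ := Finset.mem_filter.1 hJ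
    obtain ⟨hJ3, hJ4⟩ := Finset.mem_filter.1 hJ1
    have hne : (arc X a J).card ≠ 0 := by
      intro h0
      rw [h0, Nat.cast_zero] at hJ4
      linarith
    refine ⟨mem_block.1 hJ3, hJ4, ?_, ?_⟩
    · rw [← hJ2]; exact Nat.pow_log_le_self 2 hne
    · have := (Nat.lt_pow_succ_log_self one_lt_two (arc X a J).card).le
      rw [hJ2] at this
      have h2 : ((arc X a J).card : ℝ) ≤ ((2 ^ (f + 1) : ℕ) : ℝ) := Nat.cast_le.2 this
      push_cast at h2
      rw [pow_succ] at h2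
      linarith

/-- Restricting to the arcs contained in heavy longer blocks. -/
lemma exists_arcs_of_heavy_blocks (F : Finset ℕ) (n : ℕ → ℝ) {b c D : ℕ} {T : ℝ} (hT : 0 ≤ T)
    (hF : ∀ J ∈ F, J / 2 ^ (b + c) = D) (hsum : T ≤ ∑ J ∈ F, n J) :
    ∃ F' ⊆ F, T / 2 ≤ ∑ J ∈ F', n J ∧ ∀ J ∈ F', T / (2 * 2 ^ c) ≤
      ∑ J' ∈ F.filter (fun J' => J' / 2 ^ b = J / 2 ^ b), n J' := by
  set g : ℕ → ℝ := fun H => ∑ J ∈ F.filter (fun J => J / 2 ^ b = H), n J with hg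
  set Hs := (block c D).filter fun H => T / (2 * 2 ^ c) ≤ g H with hHs
  have hmaps : ∀ J ∈ F, J / 2 ^ b ∈ block c D := by
    intro J hJ
    rw [mem_block, Nat.div_div_eq_div_mul, ← pow_add]
    exact hF J hJ
  have hHsum : T / 2 ≤ ∑ H ∈ Hs, g H := half_sum_le_sum_heavy (block c D) g
    (by rw [card_block]; push_cast; exact le_rfl) (by positivity) hT
    (by rw [hg, Finset.sum_fiberwise_of_maps_to hmaps]; exact hsum)
  refine ⟨F.filter fun J => T / (2 * 2 ^ c) ≤ g (J / 2 ^ b), Finset.filter_subset _ _, ?_,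
    fun J hJ => (Finset.mem_filter.1 hJ).2⟩
  refine hHsum.trans (le_of_eq ?_)
  have hm2 : ∀ J ∈ F.filter (fun J => T / (2 * 2 ^ c) ≤ g (J / 2 ^ b)), J / 2 ^ b ∈ Hs :=
    fun J hJ => Finset.mem_filter.2
      ⟨hmaps J (Finset.mem_filter.1 hJ).1, (Finset.mem_filter.1 hJ).2⟩
  rw [← Finset.sum_fiberwise_of_maps_to hm2]
  refine Finset.sum_congr rfl fun H hH => ?_
  refine Finset.sum_congr ?_ fun _ _ => rfl
  ext J
  simp only [Finset.mem_filter]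
  constructor
  · rintro ⟨h1, rfl⟩
    exact ⟨⟨h1, (Finset.mem_filter.1 hH).2⟩, rfl⟩
  · rintro ⟨⟨h1, _⟩, h2⟩
    exact ⟨h1, h2⟩

/-- A popular scale of the windows of a family of arcs. -/
lemma exists_popular_windows {X F : Finset ℕ} {a : ℕ} (hF : ∀ J ∈ F, (arc X a J).Nonempty) :
    ∃ l ≤ a, ∃ 𝒥 ⊆ F, (F.card : ℝ) ≤ (a + 1) * 𝒥.card ∧ ∀ J ∈ 𝒥, ∃ w : ℕ,
      ((arc X a J).card : ℝ) ≤ 24 * (a + 1) * (arc X a J ∩ window l w).card ∧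
      ((arc X a J).card : ℝ) ^ 3 ≤ (24 * (a + 1)) ^ 2 *
        (goodTriples l (arc X a J ∩ window l w)).card := by
  have hwin : ∀ J, J ∈ F → ∃ l, l ≤ a ∧ ∃ w : ℕ,
      ((arc X a J).card : ℝ) ≤ 24 * (a + 1) * (arc X a J ∩ window l w).card ∧
      ((arc X a J).card : ℝ) ^ 3 ≤ (24 * (a + 1)) ^ 2 *
        (goodTriples l (arc X a J ∩ window l w)).card := fun J hJ => by
    obtain ⟨l, hl, w, hw⟩ := exists_window (a := a) (i := J) (Y := arc X a J)
      (fun j hj => mem_block.2 (mem_arc.1 hj).2) (hF J hJ)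
    exact ⟨l, hl, w, hw⟩
  choose! lf hla hlf using hwin
  obtain ⟨l, hl, hlsum⟩ := exists_class_sum F lf (fun _ => 1) hla
  simp only [Finset.sum_const, nsmul_eq_mul, mul_one] at hlsum
  refine ⟨l, hl, F.filter fun J => lf J = l, Finset.filter_subset _ _, hlsum, fun J hJ => ?_⟩
  obtain ⟨hJ1, rfl⟩ := Finset.mem_filter.1 hJ
  exact hlf J hJ1

/-- In the most concentrated block, arcs of length 2^a with a common dyadic size 2^f are kept, then
those in heavy blocks of length 2^(min h₀ s), then those whose good window has a common scale l. The
two dyadic pigeonholings cost at most Λ each, and discarding light pieces costs constants. The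
number ρ s is the size of the concentrated block that maximality guarantees. -/
lemma exists_rich_blocks {X : Finset ℕ} {a h₀ M : ℕ} {r Λ : ℝ} {ρ : ℕ → ℝ}
    (hX : X ⊆ Finset.range (2 ^ M)) (hah : a ≤ h₀) (hhM : h₀ ≤ M) (hΛ : (M : ℝ) + 1 ≤ Λ)
    (hr : r ≤ X.card) (hr0 : 0 < r) (hρ : ∀ s, 0 < ρ s ∧ ρ s ^ 4 * 2 ^ M = r ^ 4 * 2 ^ s) :
    ∃ s, a ≤ s ∧ s ≤ M ∧ ∃ f ≤ a, ∃ l ≤ a, ρ s ≤ 2 ^ s ∧ ρ s * 2 ^ a ≤ 8 * 2 ^ s * 2 ^ f ∧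
      ∃ 𝒥 : Finset ℕ, ρ s ≤ 8 * Λ ^ 2 * (𝒥.card * 2 ^ f) ∧
        ∀ J ∈ 𝒥, ∃ w, IsRichBlock X a (min h₀ s - a) s f l Λ (ρ s) J w := by
  obtain ⟨s, has, hsM, D, hD, hbroad⟩ := exists_concentrated_block hX (hah.trans hhM)
  obtain ⟨hρ0, hρe⟩ := hρ s
  obtain ⟨x, hx⟩ : ∃ x : ℝ, x = ((arc X s D).card : ℝ) := ⟨_, rfl⟩
  rw [← hx] at hD hbroad
  have hxn : 0 ≤ x := by rw [hx]; exact Nat.cast_nonneg _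
  have hρx : ρ s ≤ x := by
    have h1 : ρ s ^ 4 ≤ x ^ 4 := by
      have h2 : ρ s ^ 4 * 2 ^ M ≤ x ^ 4 * 2 ^ M := by
        rw [hρe]
        refine le_trans ?_ hD
        gcongr
      exact le_of_mul_le_mul_right h2 (by positivity)
    exact le_of_pow_le_pow_left₀ (by norm_num) hxn h1
  have hx0 : 0 < x := hρ0.trans_le hρx
  have hxs : x ≤ 2 ^ s := by rw [hx]; exact_mod_cast card_arc_le X s D
  have haM : (a : ℝ) ≤ M := by exact_mod_cast hah.trans hhM
  have ha0 : (0 : ℝ) ≤ a := Nat.cast_nonneg a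
  have hΛ0 : 0 < Λ := by linarith
  have haΛ : (a : ℝ) + 1 ≤ Λ := by linarith
  refine ⟨s, has, hsM, ?_⟩
  obtain ⟨h, hh⟩ : ∃ h, h = min h₀ s := ⟨_, rfl⟩
  rw [← hh]
  have hah' : a ≤ h := by rw [hh]; exact le_min hah has
  have hhs : h ≤ s := by rw [hh]; exact min_le_right _ _
  obtain ⟨b, rfl⟩ := Nat.exists_eq_add_of_le hah'
  rw [Nat.add_sub_cancel_left]
  obtain ⟨f, hfa, F, hFsum, hFmem⟩ := exists_heavy_arcs (X := X) (D := D) has haΛ hx hx0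
  obtain ⟨F', hF'F, hF'sum, hF'⟩ := exists_arcs_of_heavy_blocks F (fun J => ((arc X a J).card : ℝ))
    (b := b) (c := s - (a + b)) (D := D) (T := x / (2 * Λ)) (by positivity)
    (fun J hJ => by rw [show b + (s - (a + b)) = s - a by omega]; exact (hFmem J hJ).1) hFsum
  obtain ⟨l, hl, 𝒥, h𝒥, hcard, hwin⟩ := exists_popular_windows (X := X) (F := F') (a := a)
    (fun J hJ => Finset.card_pos.1 (lt_of_lt_of_le (by positivity) (hFmem J (hF'F hJ)).2.2.1))
  have hF'card : x ≤ 8 * Λ * (F'.card * 2 ^ f) := by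
    have h1 : ∑ J ∈ F', ((arc X a J).card : ℝ) ≤ F'.card * (2 * 2 ^ f) := by
      refine (Finset.sum_le_sum fun J hJ => (hFmem J (hF'F hJ)).2.2.2).trans ?_
      rw [Finset.sum_const, nsmul_eq_mul]
    have h2 := hF'sum.trans h1
    rw [div_div, div_le_iff₀ (by positivity)] at h2
    linarith
  refine ⟨f, hfa, l, hl, hρx.trans hxs, ?_, 𝒥, ?_, ?_⟩
  · have hne : F'.Nonempty := by
      rw [Finset.nonempty_iff_ne_empty]
      intro h0
      rw [h0] at hF'card
      simp at hF'card
      linarith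
    obtain ⟨J, hJ⟩ := hne
    obtain ⟨_, h2, _, h4⟩ := hFmem J (hF'F hJ)
    have h5 := h2.trans h4
    have e2 : (2 : ℝ) ^ s = 2 ^ a * 2 ^ (s - a) := by rw [← pow_add]; congr 1; omega
    rw [div_le_iff₀ (by positivity)] at h5
    have h6 : ρ s * 2 ^ a ≤ (2 * 2 ^ f * (2 * 2 ^ (s - a))) * 2 ^ a := by
      gcongr
      exact hρx.trans h5
    rw [e2]
    have h7 : 0 < (2 : ℝ) ^ a * 2 ^ (s - a) * 2 ^ f := by positivity
    linarith
  · calc ρ s ≤ x := hρx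
      _ ≤ 8 * Λ * (F'.card * 2 ^ f) := hF'card
      _ ≤ 8 * Λ * (((a + 1) * 𝒥.card) * 2 ^ f) := by gcongr
      _ ≤ 8 * Λ * ((Λ * 𝒥.card) * 2 ^ f) := by gcongr
      _ = _ := by ring
  · intro J hJ
    have hJ1 := h𝒥 hJ
    obtain ⟨w, hw1, hw2⟩ := hwin J hJ
    obtain ⟨f1, f2, f3, f4⟩ := hFmem J (hF'F hJ1)
    have f3' : (2 : ℝ) ^ f ≤ (arc X a J).card := by exact_mod_cast f3
    refine ⟨w, ?_, ?_, ?_, ?_⟩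
    · intro has20
      refine le_trans ?_ (half_sq_le_card_transversalPairs (X := X) (J := J) (x := x)
        (by rw [f1]; exact hx) (hbroad has20))
      gcongr
    · have h1 : ∑ J' ∈ F.filter (fun J' => J' / 2 ^ b = J / 2 ^ b), ((arc X a J').card : ℝ) ≤
          ((F.filter fun J' => J' / 2 ^ b = J / 2 ^ b).card : ℝ) * (2 * 2 ^ f) := by
        refine (Finset.sum_le_sum fun J' hJ' =>
          (hFmem J' (Finset.mem_filter.1 hJ').1).2.2.2).trans ?_
        rw [Finset.sum_const, nsmul_eq_mul]
      have h2 : ((F.filter fun J' => J' / 2 ^ b = J / 2 ^ b).card : ℝ) ≤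
          (((block b (J / 2 ^ b)).filter fun i' => 2 ^ f ≤ (arc X a i').card).card : ℝ) := by
        refine Nat.cast_le.2 (Finset.card_le_card fun J' hJ' => ?_)
        obtain ⟨h3, h4⟩ := Finset.mem_filter.1 hJ'
        exact Finset.mem_filter.2 ⟨mem_block.2 h4, (hFmem J' h3).2.2.1⟩
      refine le_trans ?_ h2
      have h3 := (hF' J hJ1).trans h1
      have e2 : (2 : ℝ) ^ s = 2 ^ (a + b) * 2 ^ (s - (a + b)) := by
        rw [← pow_add]; congr 1; omega
      rw [div_le_iff₀ (by positivity), e2]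
      rw [div_div, div_le_iff₀ (by positivity)] at h3
      calc ρ s * 2 ^ (a + b) ≤ x * 2 ^ (a + b) := by gcongr
        _ ≤ _ * 2 ^ (a + b) := mul_le_mul_of_nonneg_right h3 (by positivity)
        _ = _ := by ring
    · refine f3'.trans (hw1.trans ?_)
      gcongr
    · calc ((2 : ℝ) ^ f) ^ 3 ≤ ((arc X a J).card : ℝ) ^ 3 := by gcongr
        _ ≤ _ := hw2
        _ ≤ _ := by gcongr

/-- Blocks of one length are disjoint, and windows of one scale cover each index at most twice. -/
lemma sum_windows_le {l a : ℕ} (Ω : Finset (ℕ × ℕ)) (T : ℕ → ℝ) (hT : ∀ j, 0 ≤ T j) :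
    ∃ n, ∑ p ∈ Ω, ∑ j ∈ block a p.1 ∩ window l p.2, T j ≤ 2 * ∑ j ∈ Finset.range n, T j := by
  set U := Ω.biUnion fun p => block a p.1 ∩ window l p.2 with hU
  refine ⟨U.sup id + 1, ?_⟩
  have hUr : U ⊆ Finset.range (U.sup id + 1) := fun j hj =>
    Finset.mem_range.2 (Nat.lt_succ_of_le (Finset.le_sup (f := id) hj))
  have h1 : ∀ p ∈ Ω, ∑ j ∈ block a p.1 ∩ window l p.2, T j =
      ∑ j ∈ U, if j ∈ block a p.1 ∩ window l p.2 then T j else 0 := by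
    intro p hp
    rw [← Finset.sum_filter]
    refine Finset.sum_congr ?_ fun _ _ => rfl
    rw [Finset.filter_mem_eq_inter]
    exact (Finset.inter_eq_right.2
      (Finset.subset_biUnion_of_mem (fun p : ℕ × ℕ => block a p.1 ∩ window l p.2) hp)).symm
  rw [Finset.sum_congr rfl h1, Finset.sum_comm, Finset.mul_sum]
  refine le_trans (Finset.sum_le_sum fun j _ => ?_) (Finset.sum_le_sum_of_subset_of_nonneg hUr
    fun j _ _ => by have := hT j; positivity)
  rw [← Finset.sum_filter, Finset.sum_const, nsmul_eq_mul]
  refine mul_le_mul_of_nonneg_right ?_ (hT j)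
  have hsub : (Ω.filter fun p => j ∈ block a p.1 ∩ window l p.2) ⊆
      {j / 2 ^ a} ×ˢ ((Ω.image Prod.snd).filter fun n => j ∈ window l n) := by
    rintro ⟨J, w⟩ hp
    obtain ⟨h2, h3⟩ := Finset.mem_filter.1 hp
    obtain ⟨h4, h5⟩ := Finset.mem_inter.1 h3
    rw [Finset.mem_product, Finset.mem_singleton, Finset.mem_filter]
    exact ⟨(mem_block.1 h4).symm, Finset.mem_image_of_mem Prod.snd h2, h5⟩
  have h2 := Finset.card_le_card hsub
  rw [Finset.card_product, Finset.card_singleton, one_mul] at h2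
  exact_mod_cast h2.trans (card_windows_le l j _)

lemma le_of_rich_class_inequality {q F S m N Z P ρ Λ K C c : ℝ} (hF : 0 < F) (hS : 0 < S)
    (hm : 0 < m) (hN : 0 < N) (hρ : 0 < ρ) (hΛ : 0 < Λ)
    (h : F ^ 3 / (24 * Λ) ^ 2 * (F / (24 * Λ)) * (q * (ρ / (8 * Λ ^ 2 * F))) ≤
      K * (3 * Λ) ^ 3 * (N ^ 3 * Z * m ^ 3 * (10 ^ 19 * 2 ^ 80 * C ^ 5 * c ^ 2 * Λ ^ 6 *
        (N ^ 3 * F * S ^ 4 / (m * ρ ^ 4 * (S / m ^ 2) ^ 3)))) * (2 * (C * P / N))) :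
    q ≤ K * 27 * (2 * C) * 8 * 24 ^ 3 * (10 ^ 19 * 2 ^ 80 * C ^ 5 * c ^ 2) * Λ ^ 14 *
      (P * N ^ 5 * Z * m ^ 8 * S / (F ^ 2 * ρ ^ 5)) := by
  have e1 : F ^ 3 / (24 * Λ) ^ 2 * (F / (24 * Λ)) * (q * (ρ / (8 * Λ ^ 2 * F))) =
      q * (F ^ 3 * ρ / (24 ^ 3 * 8 * Λ ^ 5)) := by
    field_simp
  rw [e1, ← le_div_iff₀ (by positivity)] at h
  refine h.trans (le_of_eq ?_)
  field_simp
  ring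

/-! ### The bound for a plank configuration. -/

namespace PlankConfig

/-- Points with many rich blocks of given sizes. -/
lemma exists_rich_class_bound (C : ℝ) (hC : 1 ≤ C) : ∃ K : ℝ, 0 < K ∧
    ∀ {ι ϖ θ : Type} (G : PlankConfig ι ϖ θ), G.C = C → ∀ (Q : Finset ι), Q ⊆ G.pts →
      ∀ (a b s f l : ℕ) (Λ ρ : ℝ) (𝒥 : ι → Finset ℕ) (W : ι → ℕ → ℕ),
      (2 : ℝ) ^ a ≤ G.m → G.m < 2 * 2 ^ a → a ≤ s → (2 : ℝ) ^ s ≤ 2 * G.m ^ 2 →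
      (4 : ℝ) ^ (a + b) ≤ G.m ^ 3 → (G.m ^ 3 ≤ 4 * 4 ^ (a + b) ∨ a + b = s) →
      0 < ρ → ρ ≤ 2 ^ s → ρ * 2 ^ a ≤ 8 * 2 ^ s * 2 ^ f → (b : ℝ) + 1 ≤ Λ → (a : ℝ) + 1 ≤ Λ →
      l ≤ a → (∀ q ∈ Q, ρ ≤ 8 * Λ ^ 2 * ((𝒥 q).card * 2 ^ f)) →
      (∀ q ∈ Q, ∀ J ∈ 𝒥 q, IsRichBlock (G.X q) a b s f l Λ ρ J (W q J)) →
      (Q.card : ℝ) ≤ K * Λ ^ 14 * (G.P * G.N ^ 5 * G.Z * G.m ^ 8 * 2 ^ s / (4 ^ f * ρ ^ 5)) := by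
  obtain ⟨K, hK, hcount⟩ := exists_window_count C hC
  refine ⟨K * 27 * (2 * C) * 8 * 24 ^ 3 * (10 ^ 19 * 2 ^ 80 * C ^ 5 * (C + 4) ^ 2), by positivity, ?_⟩
  intro ι ϖ θ G hGC Q hQ a b s f l Λ ρ 𝒥 W ha ha' has hs hb hb' hρ hρs hρf hbΛ haΛ hl h𝒥 hrich
  have hm0 := G.m_pos
  have hN0 := G.N_pos
  have hZ0 := G.Z_pos
  have hC0 : 0 < C := by linarith
  have ha0 : (0 : ℝ) ≤ a := Nat.cast_nonneg a
  have hΛ1 : 1 ≤ Λ := by linarith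
  have hΛ0 : 0 < Λ := by linarith
  -- All pairs (block, window) chosen by some point. Each point is counted once for each of its
  -- blocks, hence at least ρ/(8Λ²2^f) times in the sum over Ω.
  set Ω := Q.biUnion fun q => (𝒥 q).image fun J => (J, W q J) with hΩ
  set QQ : ℕ × ℕ → Finset ι := fun p => Q.filter fun q => p.1 ∈ 𝒥 q ∧ W q p.1 = p.2 with hQQ
  obtain ⟨nU, hnU⟩ : ∃ nU, nU = G.boxBound Λ ρ f s := ⟨_, rfl⟩
  have hnU0 : 0 ≤ nU := by
    rw [hnU, boxBound, hGC]; positivity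
  obtain ⟨n, hn⟩ := sum_windows_le (l := l) (a := a) Ω (fun j => ((G.tau j).card : ℝ))
    (fun j => Nat.cast_nonneg _)
  have hsumQ : ∑ q ∈ Q, ((𝒥 q).card : ℝ) = ∑ p ∈ Ω, ((QQ p).card : ℝ) := by
    have e1 : ∀ q ∈ Q, (𝒥 q).card = ∑ p ∈ Ω, if p.1 ∈ 𝒥 q ∧ W q p.1 = p.2 then 1 else 0 := by
      intro q hq
      rw [← Finset.card_filter]
      have e2 : (Ω.filter fun p => p.1 ∈ 𝒥 q ∧ W q p.1 = p.2) = (𝒥 q).image fun J => (J, W q J) := by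
        ext ⟨J, w⟩
        rw [Finset.mem_filter, Finset.mem_image]
        constructor
        · rintro ⟨_, h1, h2⟩
          exact ⟨J, h1, by rw [h2]⟩
        · rintro ⟨J', h1, h2⟩
          rw [Prod.mk.injEq] at h2
          obtain ⟨rfl, h2⟩ := h2
          refine ⟨Finset.mem_biUnion.2 ⟨q, hq, ?_⟩, h1, h2⟩
          rw [← h2]
          exact Finset.mem_image_of_mem (fun J => (J, W q J)) h1
      rw [e2, Finset.card_image_of_injective]
      intro J J' h
      exact (Prod.mk.inj h).1
    have e3 : ∑ q ∈ Q, (𝒥 q).card = ∑ p ∈ Ω, (QQ p).card := by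
      rw [Finset.sum_congr rfl e1, Finset.sum_comm]
      refine Finset.sum_congr rfl fun p _ => ?_
      rw [← Finset.card_filter]
    exact_mod_cast e3
  have hclass : ∀ p ∈ Ω, (2 ^ f) ^ 3 / (24 * Λ) ^ 2 * (2 ^ f / (24 * Λ)) * ((QQ p).card : ℝ) ≤
      K * (l + 3) ^ 3 * (G.N ^ 3 * G.Z * G.m ^ 3 * nU) *
        ∑ j ∈ block a p.1 ∩ window l p.2, ((G.tau j).card : ℝ) := by
    rintro ⟨J, w⟩ hp
    have hmem : ∀ q ∈ QQ (J, w), q ∈ Q ∧ IsRichBlock (G.X q) a b s f l Λ ρ J w := by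
      intro q hq
      obtain ⟨h1, h2, h3⟩ := Finset.mem_filter.1 hq
      have h4 := hrich q h1 J h2
      rw [h3] at h4
      exact ⟨h1, h4⟩
    have hsub : QQ (J, w) ⊆ G.pts := fun q hq => hQ (hmem q hq).1
    have hstart : G.start a J ≤ 1 := by
      obtain ⟨q, hq, hp⟩ := Finset.mem_biUnion.1 hp
      obtain ⟨J', hJ', e⟩ := Finset.mem_image.1 hp
      rw [Prod.mk.injEq] at e
      obtain ⟨rfl, rfl⟩ := e
      have h1 := (hrich q hq J' hJ').window_card
      have hne : (arc (G.X q) a J' ∩ window l (W q J')).Nonempty := by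
        rw [Finset.nonempty_iff_ne_empty]
        intro h0
        rw [h0, Finset.card_empty, Nat.cast_zero, mul_zero] at h1
        have : (0 : ℝ) < 2 ^ f := by positivity
        linarith
      obtain ⟨j, hj⟩ := hne
      obtain ⟨hj1, hj2⟩ := mem_arc.1 (Finset.mem_inter.1 hj).1
      have h2 := G.dir_le q (hQ hq) j hj1
      have h3 := (div_two_pow_eq_iff.1 hj2).1
      have h4 : (J' : ℝ) * 2 ^ a ≤ j := by exact_mod_cast h3
      rw [start, div_le_one (by positivity)]
      linarith
    have hnear := fun u => G.card_near_le_boxBound hsub u (i := J) (b := b) ha ha' has hs hb hb' hρ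
      hρs hρf hbΛ (by linarith) hstart (fun h q hq => (hmem q hq).2.pairs h)
      (fun q hq => (hmem q hq).2.arcs)
    rw [← hnU] at hnear
    refine hcount G hGC (QQ (J, w)) hsub a J l w _ _ nU ha hl (by positivity) ?_ ?_ hnear
    · intro q hq
      rw [div_le_iff₀' (by positivity)]
      exact (hmem q hq).2.window_card
    · intro q hq
      rw [div_le_iff₀' (by positivity)]
      exact (hmem q hq).2.triples
  have h1 := Finset.sum_le_sum hclass
  rw [← Finset.mul_sum, ← Finset.mul_sum, ← hsumQ] at h1
  have h2 : (Q.card : ℝ) * (ρ / (8 * Λ ^ 2 * 2 ^ f)) ≤ ∑ q ∈ Q, ((𝒥 q).card : ℝ) := by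
    rw [← nsmul_eq_mul, ← Finset.sum_const]
    refine Finset.sum_le_sum fun q hq => ?_
    rw [div_le_iff₀ (by positivity)]
    exact (h𝒥 q hq).trans (le_of_eq (by ring))
  have h3 := G.tau_total n
  rw [hGC, ← le_div_iff₀' hN0] at h3
  have hlΛ : (l : ℝ) + 3 ≤ 3 * Λ := by
    have : (l : ℝ) ≤ a := by exact_mod_cast hl
    linarith
  have hcoef : 0 ≤ (2 ^ f) ^ 3 / (24 * Λ) ^ 2 * (2 ^ f / (24 * Λ)) := by positivity
  -- The powers of Λ add up to 14: 6 in `boxBound`, 3 from l + 3, 3 from the windows and 2 from the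
  -- number of blocks.
  have h4 : (2 ^ f) ^ 3 / (24 * Λ) ^ 2 * (2 ^ f / (24 * Λ)) *
      ((Q.card : ℝ) * (ρ / (8 * Λ ^ 2 * 2 ^ f))) ≤
      K * (3 * Λ) ^ 3 * (G.N ^ 3 * G.Z * G.m ^ 3 * nU) * (2 * (C * G.P / G.N)) := by
    refine (mul_le_mul_of_nonneg_left h2 hcoef).trans (h1.trans ?_)
    have h5 := hn.trans (mul_le_mul_of_nonneg_left h3 zero_le_two)
    have h6 : 0 ≤ 2 * (C * G.P / G.N) := le_trans (Finset.sum_nonneg fun _ _ =>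
      Finset.sum_nonneg fun _ _ => Nat.cast_nonneg _) h5
    have h7 : K * (l + 3 : ℝ) ^ 3 ≤ K * (3 * Λ) ^ 3 := by gcongr
    have h8 : 0 ≤ G.N ^ 3 * G.Z * G.m ^ 3 * nU := by positivity
    exact (mul_le_mul_of_nonneg_left h5 (mul_nonneg (by positivity) h8)).trans
      (mul_le_mul_of_nonneg_right (mul_le_mul_of_nonneg_right h7 h8) h6)
  have e4 : (4 : ℝ) ^ f = (2 ^ f) ^ 2 := by rw [← pow_mul, mul_comm, pow_mul]; norm_num
  have e16 : (16 : ℝ) ^ s = (2 ^ s) ^ 4 := by rw [← pow_mul, mul_comm, pow_mul]; norm_num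
  rw [hnU, boxBound, hGC, e16] at h4
  rw [e4]
  exact le_of_rich_class_inequality (by positivity) (by positivity) hm0 hN0 hρ hΛ0 h4

/-- The number of points lying on planks in at least `r` directions. -/
theorem exists_card_pts_le (C : ℝ) (hC : 1 ≤ C) : ∃ A : ℝ, 0 < A ∧
    ∀ {ι ϖ θ : Type} (G : PlankConfig ι ϖ θ), G.C = C → ∀ (M : ℕ) (r : ℝ),
      G.m ^ 2 < 2 ^ M → (2 : ℝ) ^ M ≤ 2 * G.m ^ 2 → 0 < r → (∀ q ∈ G.pts, r ≤ (G.X q).card) →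
      (G.pts.card : ℝ) ≤ A * (M + 1) ^ 17 * (G.P * G.N ^ 5 * G.Z * G.m ^ 12 / r ^ 7) := by
  obtain ⟨K, hK, hclass⟩ := exists_rich_class_bound C hC
  refine ⟨K * 2 ^ 11, by positivity, ?_⟩
  intro ι ϖ θ G hGC M r hM hM' hr hX
  have hm := G.one_le_m
  have hm0 := G.m_pos
  have hN0 := G.N_pos
  have hZ0 := G.Z_pos
  have hP0 : 0 ≤ G.P := by
    have := G.tau_total 0
    simp only [Finset.range_zero, Finset.sum_empty, mul_zero] at this
    exact nonneg_of_mul_nonneg_right this G.C_pos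
  -- Dyadically 2^a is m and 2^h₀ is m^(3/2), the block lengths corresponding to the angles 1/m and
  -- m^(-1/2).
  obtain ⟨a, ha, ha'⟩ := exists_nat_pow_near hm one_lt_two
  obtain ⟨h₀, hh, hh'⟩ := exists_nat_pow_near (one_le_pow₀ hm : 1 ≤ G.m ^ 3)
    (by norm_num : (1 : ℝ) < 4)
  have e4 : ∀ n : ℕ, (4 : ℝ) ^ n = (2 ^ n) ^ 2 := by
    intro n; rw [← pow_mul, mul_comm, pow_mul]; norm_num
  have hah : a ≤ h₀ := by
    have h1 : (4 : ℝ) ^ a < 4 ^ (h₀ + 1) := by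
      calc (4 : ℝ) ^ a = (2 ^ a) ^ 2 := e4 a
        _ ≤ G.m ^ 2 := by gcongr
        _ ≤ G.m ^ 3 := pow_le_pow_right₀ hm (by norm_num)
        _ < _ := hh'
    exact Nat.lt_succ_iff.1 ((pow_lt_pow_iff_right₀ (by norm_num)).1 h1)
  have hhM : h₀ ≤ M := by
    have h1 : (4 : ℝ) ^ h₀ < 4 ^ M := by
      calc (4 : ℝ) ^ h₀ ≤ G.m ^ 3 := hh
        _ ≤ G.m ^ 4 := pow_le_pow_right₀ hm (by norm_num)
        _ = (G.m ^ 2) ^ 2 := by ring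
        _ < (2 ^ M) ^ 2 := by gcongr
        _ = _ := (e4 M).symm
    exact ((pow_lt_pow_iff_right₀ (by norm_num)).1 h1).le
  obtain ⟨Λ, hΛ⟩ : ∃ Λ : ℝ, Λ = M + 1 := ⟨_, rfl⟩
  have hM0 : (0 : ℝ) ≤ M := Nat.cast_nonneg M
  have hΛ1 : 1 ≤ Λ := by linarith
  -- This is r·2^((s-M)/4), the fourth root being taken as two square roots.
  set ρ : ℕ → ℝ := fun s => √√(r ^ 4 * 2 ^ s / 2 ^ M) with hρ
  have hρe : ∀ s, 0 < ρ s ∧ ρ s ^ 4 * 2 ^ M = r ^ 4 * 2 ^ s := by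
    intro s
    have h1 : 0 < r ^ 4 * 2 ^ s / 2 ^ M := by positivity
    refine ⟨Real.sqrt_pos.2 (Real.sqrt_pos.2 h1), ?_⟩
    have h2 : ρ s ^ 4 = r ^ 4 * 2 ^ s / 2 ^ M := by
      calc ρ s ^ 4 = (ρ s ^ 2) ^ 2 := by ring
        _ = _ := by rw [hρ, Real.sq_sqrt (Real.sqrt_nonneg _), Real.sq_sqrt h1.le]
    rw [h2]
    field_simp
  clear_value ρ
  have hrich : ∀ q, q ∈ G.pts → ∃ t : ℕ × ℕ × ℕ, (a ≤ t.1 ∧ t.1 ≤ M) ∧ (t.2.1 ≤ a ∧ t.2.2 ≤ a) ∧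
      (ρ t.1 ≤ 2 ^ t.1 ∧ ρ t.1 * 2 ^ a ≤ 8 * 2 ^ t.1 * 2 ^ t.2.1) ∧ ∃ 𝒥 : Finset ℕ,
        ρ t.1 ≤ 8 * Λ ^ 2 * (𝒥.card * 2 ^ t.2.1) ∧ ∀ J ∈ 𝒥, ∃ w,
          IsRichBlock (G.X q) a (min h₀ t.1 - a) t.1 t.2.1 t.2.2 Λ (ρ t.1) J w := by
    intro q hq
    have hXr : G.X q ⊆ Finset.range (2 ^ M) := by
      intro j hj
      have h1 := (G.dir_le q hq j hj).trans_lt hM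
      rw [Finset.mem_range]
      exact_mod_cast h1
    obtain ⟨s, h1, h2, f, h3, l, h4, h5, h6, 𝒥, h7, h8⟩ :=
      exists_rich_blocks hXr hah hhM hΛ.ge (hX q hq) hr hρe
    exact ⟨(s, f, l), ⟨h1, h2⟩, ⟨h3, h4⟩, ⟨h5, h6⟩, 𝒥, h7, h8⟩
  choose! t ht1 ht2 ht3 𝒥 h𝒥 hW using hrich
  choose! W hW using hW
  have hmaps : ∀ q ∈ G.pts, t q ∈ Finset.range (M + 1) ×ˢ Finset.range (a + 1) ×ˢ
      Finset.range (a + 1) := by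
    intro q hq
    have h1 := ht1 q hq
    have h2 := ht2 q hq
    simp only [Finset.mem_product, Finset.mem_range]
    omega
  rw [Finset.card_eq_sum_card_fiberwise hmaps]
  push_cast
  have haM : (a : ℝ) + 1 ≤ Λ := by
    have : (a : ℝ) ≤ M := by exact_mod_cast hah.trans hhM
    linarith
  have hbound : ∀ p ∈ Finset.range (M + 1) ×ˢ Finset.range (a + 1) ×ˢ Finset.range (a + 1),
      ((G.pts.filter fun q => t q = p).card : ℝ) ≤
        K * 2 ^ 11 * Λ ^ 14 * (G.P * G.N ^ 5 * G.Z * G.m ^ 12 / r ^ 7) := by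
    rintro ⟨s, f, l⟩ -
    rcases (G.pts.filter fun q => t q = (s, f, l)).eq_empty_or_nonempty with h0 | ⟨q₀, hq₀⟩
    · rw [h0, Finset.card_empty, Nat.cast_zero]
      positivity
    have hmem : ∀ q ∈ G.pts.filter (fun q => t q = (s, f, l)), q ∈ G.pts ∧ t q = (s, f, l) :=
      fun q hq => Finset.mem_filter.1 hq
    obtain ⟨k1, k2⟩ := hmem q₀ hq₀
    have k3 := ht1 q₀ k1
    have k4 := ht2 q₀ k1
    have k5 := ht3 q₀ k1
    rw [k2] at k3 k4 k5
    dsimp only at k3 k4 k5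
    obtain ⟨hρ0, hρ4⟩ := hρe s
    have hab : a + (min h₀ s - a) = min h₀ s := by omega
    have h2sM : (2 : ℝ) ^ s ≤ 2 ^ M := pow_le_pow_right₀ one_le_two k3.2
    have h := hclass G hGC (G.pts.filter fun q => t q = (s, f, l)) (Finset.filter_subset _ _)
      a (min h₀ s - a) s f l Λ (ρ s) 𝒥 W ha (by rw [pow_succ] at ha'; linarith) k3.1
      (h2sM.trans hM')
      (by rw [hab]; exact (pow_le_pow_right₀ (by norm_num) (min_le_left _ _)).trans hh)
      (by
        rw [hab]
        rcases le_total h₀ s with h | h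
        · left; rw [min_eq_left h, mul_comm, ← pow_succ]; exact hh'.le
        · right; exact min_eq_right h)
      hρ0 k5.1 k5.2
      (by
        have h1 : min h₀ s - a ≤ M := by omega
        have : ((min h₀ s - a : ℕ) : ℝ) ≤ M := by exact_mod_cast h1
        linarith)
      haM k4.2 ?_ ?_
    · refine h.trans ?_
      have hPN : 0 ≤ K * Λ ^ 14 * (G.P * G.N ^ 5 * G.Z) := by positivity
      -- The relation ρ m ≤ 16·2^s·2^f removes 4^f, and r⁷4^s ≤ ρ⁷4^M, a consequence of ρ⁴2^M =
      -- r⁴2^s, removes s. This is where r⁷ arises.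
      have key : G.m ^ 8 * 2 ^ s / (4 ^ f * ρ s ^ 5) ≤ 2 ^ 11 * (G.m ^ 12 / r ^ 7) := by
        have j1 : ρ s * G.m ≤ 16 * 2 ^ s * 2 ^ f := by
          rw [pow_succ] at ha'
          nlinarith [k5.2]
        have j2 : ρ s ≤ r := by
          have : ρ s ^ 4 ≤ r ^ 4 := by
            have : ρ s ^ 4 * 2 ^ M ≤ r ^ 4 * 2 ^ M := by rw [hρ4]; gcongr
            exact le_of_mul_le_mul_right this (by positivity)
          exact le_of_pow_le_pow_left₀ (by norm_num) hr.le this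
        have j3 : r ^ 7 * (2 ^ s) ^ 2 ≤ ρ s ^ 7 * (2 ^ M) ^ 2 := by
          have : (r ^ 7 * (2 ^ s) ^ 2) * r ≤ (ρ s ^ 7 * (2 ^ M) ^ 2) * r := by
            calc (r ^ 7 * (2 ^ s) ^ 2) * r = (r ^ 4 * 2 ^ s) ^ 2 := by ring
              _ = (ρ s ^ 4 * 2 ^ M) ^ 2 := by rw [hρ4]
              _ = (ρ s ^ 7 * (2 ^ M) ^ 2) * ρ s := by ring
              _ ≤ _ := by gcongr
          exact le_of_mul_le_mul_right this hr
        have j4 : (ρ s * G.m) ^ 2 ≤ (16 * 2 ^ s * 2 ^ f) ^ 2 := by gcongr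
        rw [mul_div_assoc', div_le_div_iff₀ (by positivity) (by positivity), e4]
        have j5 : (2 ^ M : ℝ) ^ 2 ≤ (2 * G.m ^ 2) ^ 2 := by gcongr
        have j6 : (2 : ℝ) ^ s ≤ 2 * G.m ^ 2 := h2sM.trans hM'
        have hz : (0 : ℝ) < 2 ^ s := by positivity
        have j7 : (G.m ^ 8 * 2 ^ s * r ^ 7) * (ρ s ^ 2 * (2 ^ s) ^ 2) ≤
            (2 ^ 11 * G.m ^ 12 * ((2 ^ f) ^ 2 * ρ s ^ 5)) * (ρ s ^ 2 * (2 ^ s) ^ 2) := by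
          calc (G.m ^ 8 * 2 ^ s * r ^ 7) * (ρ s ^ 2 * (2 ^ s) ^ 2)
              = G.m ^ 6 * 2 ^ s * (r ^ 7 * (2 ^ s) ^ 2) * (ρ s * G.m) ^ 2 := by ring
            _ ≤ G.m ^ 6 * (2 * G.m ^ 2) * (ρ s ^ 7 * (2 * G.m ^ 2) ^ 2) *
                (16 * 2 ^ s * 2 ^ f) ^ 2 := by
                have j8 := j3.trans (mul_le_mul_of_nonneg_left j5 (by positivity))
                gcongr
            _ = _ := by ring
        exact le_of_mul_le_mul_right j7 (by positivity)
      calc K * Λ ^ 14 * (G.P * G.N ^ 5 * G.Z * G.m ^ 8 * 2 ^ s / (4 ^ f * ρ s ^ 5))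
          = K * Λ ^ 14 * (G.P * G.N ^ 5 * G.Z) * (G.m ^ 8 * 2 ^ s / (4 ^ f * ρ s ^ 5)) := by ring
        _ ≤ K * Λ ^ 14 * (G.P * G.N ^ 5 * G.Z) * (2 ^ 11 * (G.m ^ 12 / r ^ 7)) :=
            mul_le_mul_of_nonneg_left key hPN
        _ = _ := by ring
    · intro q hq
      obtain ⟨h1, h2⟩ := hmem q hq
      have := h𝒥 q h1
      rwa [h2] at this
    · intro q hq J hJ
      obtain ⟨h1, h2⟩ := hmem q hq
      have := hW q h1 J hJ
      rwa [h2] at this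
  -- There are at most Λ³ classes (s, f, l), which with Λ¹⁴ for each class gives the exponent 17.
  refine (Finset.sum_le_sum hbound).trans ?_
  rw [Finset.sum_const, nsmul_eq_mul, Finset.card_product, Finset.card_product, Finset.card_range,
    Finset.card_range]
  push_cast
  rw [← hΛ]
  have hB : 0 ≤ G.P * G.N ^ 5 * G.Z * G.m ^ 12 / r ^ 7 := by positivity
  have hΛ0 : 0 ≤ Λ := by linarith
  calc Λ * (((a : ℝ) + 1) * (a + 1)) * (K * 2 ^ 11 * Λ ^ 14 *
        (G.P * G.N ^ 5 * G.Z * G.m ^ 12 / r ^ 7))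
      ≤ Λ * (Λ * Λ) * (K * 2 ^ 11 * Λ ^ 14 * (G.P * G.N ^ 5 * G.Z * G.m ^ 12 / r ^ 7)) := by
        gcongr
    _ = _ := by ring

end PlankConfig

/-! ### From Frenet boxes to boxes in polynomial coordinates. -/

lemma inner_eq_three (v w : E3) : inner ℝ v w = v 0 * w 0 + v 1 * w 1 + v 2 * w 2 := by
  simp [PiLp.inner_apply, Fin.sum_univ_three]
  ring

lemma norm_sq_eq_three (v : E3) : ‖v‖ ^ 2 = v 0 ^ 2 + v 1 ^ 2 + v 2 ^ 2 := by
  rw [EuclideanSpace.real_norm_sq_eq, Fin.sum_univ_three]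

/-- The product with a unit vector, for a vector of bounded length. -/
lemma abs_inner_normalize_le {w v : E3} {X : ℝ} (hw : 1 ≤ ‖w‖ ^ 2) (h : |inner ℝ w v| ≤ X) :
    |inner ℝ (‖w‖⁻¹ • w) v| ≤ X := by
  have h1 : 1 ≤ ‖w‖ := by
    by_contra hcon
    nlinarith [norm_nonneg w]
  rw [real_inner_smul_left, abs_mul, abs_inv, abs_norm]
  calc ‖w‖⁻¹ * |inner ℝ w v| ≤ 1 * |inner ℝ w v| := by
        gcongr
        exact inv_le_one_of_one_le₀ h1
    _ ≤ X := by rwa [one_mul]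

lemma abs_inner_le_of_normalize {w v : E3} {X n : ℝ} (hw : 1 ≤ ‖w‖ ^ 2) (hn : ‖w‖ ^ 2 ≤ n ^ 2)
    (hn0 : 0 ≤ n) (h : |inner ℝ (‖w‖⁻¹ • w) v| ≤ X) : |inner ℝ w v| ≤ n * X := by
  have h1 : 0 < ‖w‖ := by
    by_contra hcon
    have : ‖w‖ = 0 := le_antisymm (not_lt.1 hcon) (norm_nonneg w)
    rw [this] at hw; norm_num at hw
  have h2 : ‖w‖ ≤ n := le_of_sq_le_sq hn hn0
  rw [real_inner_smul_left, abs_mul, abs_inv, abs_norm] at h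
  have h3 : |inner ℝ w v| = ‖w‖ * (‖w‖⁻¹ * |inner ℝ w v|) := by field_simp
  rw [h3]
  exact mul_le_mul h2 h (by positivity) hn0

/-- The coordinates adapted to the direction `c`, and the Frenet frame. -/
lemma abs_frenet_le {c A B G : ℝ} (hc0 : 0 ≤ c) (hc1 : c ≤ 1) {v : E3} (hAB : A ≤ B) (hBG : B ≤ G)
    (h0 : |v 0 + 2 * c * v 1 + 3 * c ^ 2 * v 2| ≤ A) (h1 : |2 * v 1 + 6 * c * v 2| ≤ B)
    (h2 : |3 * v 2| ≤ G) : |inner ℝ (frenet c 0) v| ≤ 18 * A ∧ |inner ℝ (frenet c 1) v| ≤ 18 * B ∧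
      |inner ℝ (frenet c 2) v| ≤ 18 * G := by
  have hA0 : 0 ≤ A := (abs_nonneg _).trans h0
  have c2 : c ^ 2 ≤ 1 := pow_le_one₀ hc0 hc1
  have c3 : c ^ 3 ≤ 1 := pow_le_one₀ hc0 hc1
  have c4 : c ^ 4 ≤ 1 := pow_le_one₀ hc0 hc1
  have p2 : 0 ≤ c ^ 2 := by positivity
  have p3 : 0 ≤ c ^ 3 := by positivity
  have p4 : 0 ≤ c ^ 4 := by positivity
  have p6 : 0 ≤ c ^ 6 := by positivity
  have p8 : 0 ≤ c ^ 8 := by positivity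
  set δ := v 0 + 2 * c * v 1 + 3 * c ^ 2 * v 2 with hδ
  set ε := 2 * v 1 + 6 * c * v 2 with hε
  set γ := 3 * v 2 with hγ
  refine ⟨?_, ?_, ?_⟩
  · refine abs_inner_normalize_le ?_ ?_
    · rw [norm_sq_eq_three]; simp; nlinarith
    · have e : inner ℝ (!₂[1, 2 * c, 3 * c ^ 2] : E3) v = δ := by
        rw [inner_eq_three]; simp [hδ]
      rw [e]; linarith
  · refine abs_inner_normalize_le ?_ ?_
    · rw [norm_sq_eq_three]; simp; nlinarith
    · have e : inner ℝ (!₂[-2 * c - 9 * c ^ 3, 1 - 9 * c ^ 4, 3 * c + 6 * c ^ 3] : E3) v =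
          -((2 * c + 9 * c ^ 3) * δ) + (1 / 2 + 2 * c ^ 2 + 9 / 2 * c ^ 4) * ε := by
        rw [inner_eq_three]; simp [hδ, hε]; ring
      rw [e]
      refine (abs_add_le _ _).trans ?_
      rw [abs_neg, abs_mul _ δ, abs_mul _ ε, abs_of_nonneg (by positivity : 0 ≤ 2 * c + 9 * c ^ 3),
        abs_of_nonneg (by positivity : 0 ≤ 1 / 2 + 2 * c ^ 2 + 9 / 2 * c ^ 4)]
      have k1 : (2 * c + 9 * c ^ 3) * |δ| ≤ 11 * A := by gcongr; linarith
      have k2 : (1 / 2 + 2 * c ^ 2 + 9 / 2 * c ^ 4) * |ε| ≤ 7 * B := by gcongr; linarith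
      linarith
  · refine abs_inner_normalize_le ?_ ?_
    · rw [norm_sq_eq_three]; simp; nlinarith
    · have e : inner ℝ (!₂[3 * c ^ 2, -3 * c, 1] : E3) v =
          3 * c ^ 2 * δ + (-((3 * c ^ 3 + 3 / 2 * c) * ε) + (3 * c ^ 4 + 3 * c ^ 2 + 1 / 3) * γ) := by
        rw [inner_eq_three]; simp [hδ, hε, hγ]; ring
      rw [e]
      refine (abs_add_le _ _).trans (le_trans (add_le_add_right (abs_add_le _ _) _) ?_)
      rw [abs_neg, abs_mul _ δ, abs_mul _ ε, abs_mul _ γ, abs_of_nonneg (by positivity : 0 ≤ 3 * c ^ 2),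
        abs_of_nonneg (by positivity : 0 ≤ 3 * c ^ 3 + 3 / 2 * c),
        abs_of_nonneg (by positivity : 0 ≤ 3 * c ^ 4 + 3 * c ^ 2 + 1 / 3)]
      have k1 : 3 * c ^ 2 * |δ| ≤ 3 * A := by gcongr; linarith
      have k2 : (3 * c ^ 3 + 3 / 2 * c) * |ε| ≤ 5 * B := by gcongr; linarith
      have k3 : (3 * c ^ 4 + 3 * c ^ 2 + 1 / 3) * |γ| ≤ 7 * G := by gcongr; linarith
      linarith

/-- The unnormalised frame functionals are triangular combinations of value, slope and leading
coefficient, with diagonal entries bounded below. Back substitution works because A ≤ B ≤ G keeps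
the off-diagonal terms below the size of the row. -/
lemma abs_le_of_frenet {c A B G : ℝ} (hc0 : 0 ≤ c) (hc1 : c ≤ 1) {v : E3} (hAB : A ≤ B) (hBG : B ≤ G)
    (h0 : |inner ℝ (frenet c 0) v| ≤ A) (h1 : |inner ℝ (frenet c 1) v| ≤ B)
    (h2 : |inner ℝ (frenet c 2) v| ≤ G) : |v 0 + 2 * c * v 1 + 3 * c ^ 2 * v 2| ≤ 2000 * A ∧
      |2 * v 1 + 6 * c * v 2| ≤ 2000 * B ∧ |3 * v 2| ≤ 2000 * G := by
  have hA0 : 0 ≤ A := (abs_nonneg _).trans h0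
  have c2 : c ^ 2 ≤ 1 := pow_le_one₀ hc0 hc1
  have c3 : c ^ 3 ≤ 1 := pow_le_one₀ hc0 hc1
  have c4 : c ^ 4 ≤ 1 := pow_le_one₀ hc0 hc1
  have c6 : c ^ 6 ≤ 1 := pow_le_one₀ hc0 hc1
  have c8 : c ^ 8 ≤ 1 := pow_le_one₀ hc0 hc1
  have p2 : 0 ≤ c ^ 2 := by positivity
  have p3 : 0 ≤ c ^ 3 := by positivity
  have p4 : 0 ≤ c ^ 4 := by positivity
  have p6 : 0 ≤ c ^ 6 := by positivity
  have p8 : 0 ≤ c ^ 8 := by positivity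
  set δ := v 0 + 2 * c * v 1 + 3 * c ^ 2 * v 2 with hδ
  set ε := 2 * v 1 + 6 * c * v 2 with hε
  set γ := 3 * v 2 with hγ
  have i0 := abs_inner_le_of_normalize (n := 4) (by rw [norm_sq_eq_three]; simp; nlinarith)
    (by rw [norm_sq_eq_three]; simp; nlinarith) (by norm_num) h0
  have i1 := abs_inner_le_of_normalize (n := 17) (by rw [norm_sq_eq_three]; simp; nlinarith)
    (by rw [norm_sq_eq_three]; simp; nlinarith) (by norm_num) h1
  have i2 := abs_inner_le_of_normalize (n := 5) (by rw [norm_sq_eq_three]; simp; nlinarith)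
    (by rw [norm_sq_eq_three]; simp; nlinarith) (by norm_num) h2
  have e0 : inner ℝ (!₂[1, 2 * c, 3 * c ^ 2] : E3) v = δ := by
    rw [inner_eq_three]; simp [hδ]
  have e1 : inner ℝ (!₂[-2 * c - 9 * c ^ 3, 1 - 9 * c ^ 4, 3 * c + 6 * c ^ 3] : E3) v =
      -((2 * c + 9 * c ^ 3) * δ) + (1 / 2 + 2 * c ^ 2 + 9 / 2 * c ^ 4) * ε := by
    rw [inner_eq_three]; simp [hδ, hε]; ring
  have e2 : inner ℝ (!₂[3 * c ^ 2, -3 * c, 1] : E3) v =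
      3 * c ^ 2 * δ + (-((3 * c ^ 3 + 3 / 2 * c) * ε) + (3 * c ^ 4 + 3 * c ^ 2 + 1 / 3) * γ) := by
    rw [inner_eq_three]; simp [hδ, hε, hγ]; ring
  rw [e0] at i0
  rw [e1] at i1
  rw [e2] at i2
  have j0 : |(2 * c + 9 * c ^ 3) * δ| ≤ 44 * A := by
    rw [abs_mul, abs_of_nonneg (by positivity : 0 ≤ 2 * c + 9 * c ^ 3)]
    calc _ ≤ 11 * (4 * A) := by gcongr; linarith
      _ = _ := by ring
  have j1 : |ε| ≤ 122 * B := by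
    have h3 : |(1 / 2 + 2 * c ^ 2 + 9 / 2 * c ^ 4) * ε| ≤ 61 * B := by
      have := abs_add_le (-((2 * c + 9 * c ^ 3) * δ) + (1 / 2 + 2 * c ^ 2 + 9 / 2 * c ^ 4) * ε)
        ((2 * c + 9 * c ^ 3) * δ)
      have e : -((2 * c + 9 * c ^ 3) * δ) + (1 / 2 + 2 * c ^ 2 + 9 / 2 * c ^ 4) * ε +
        (2 * c + 9 * c ^ 3) * δ = (1 / 2 + 2 * c ^ 2 + 9 / 2 * c ^ 4) * ε := by ring
      rw [e] at this
      linarith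
    rw [abs_mul, abs_of_nonneg (by positivity : 0 ≤ 1 / 2 + 2 * c ^ 2 + 9 / 2 * c ^ 4)] at h3
    have : 1 / 2 * |ε| ≤ (1 / 2 + 2 * c ^ 2 + 9 / 2 * c ^ 4) * |ε| := by gcongr; linarith
    linarith
  have j2 : |3 * c ^ 2 * δ| ≤ 12 * A := by
    rw [abs_mul _ δ, abs_of_nonneg (by positivity : 0 ≤ 3 * c ^ 2)]
    calc _ ≤ 3 * (4 * A) := by gcongr; linarith
      _ = _ := by ring
  have j3 : |(3 * c ^ 3 + 3 / 2 * c) * ε| ≤ 549 * B := by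
    rw [abs_mul, abs_of_nonneg (by positivity : 0 ≤ 3 * c ^ 3 + 3 / 2 * c)]
    calc _ ≤ (9 / 2) * (122 * B) := by gcongr; linarith
      _ = _ := by ring
  have j4 : |(3 * c ^ 4 + 3 * c ^ 2 + 1 / 3) * γ| ≤ 566 * G := by
    rw [abs_le] at i2 j2 j3 ⊢
    constructor <;> linarith
  rw [abs_mul, abs_of_nonneg (by positivity : 0 ≤ 3 * c ^ 4 + 3 * c ^ 2 + 1 / 3)] at j4
  have j5 : 1 / 3 * |γ| ≤ (3 * c ^ 4 + 3 * c ^ 2 + 1 / 3) * |γ| := by gcongr; linarith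
  refine ⟨?_, ?_, ?_⟩ <;> linarith

/-- The quadratic polynomial attached to a point. -/
def coeffs (m : ℝ) (z : E3) : V3 := (z 0 / m ^ 2, 2 * z 1 / m ^ 2, 3 * z 2 / m ^ 2)

lemma coeffs_sub (m : ℝ) (x z : E3) : coeffs m (x - z) = coeffs m x - coeffs m z := by
  simp [coeffs]
  refine ⟨?_, ?_, ?_⟩ <;> ring

lemma ev_coeffs (m c : ℝ) (z : E3) :
    ev (coeffs m z) c = (z 0 + 2 * c * z 1 + 3 * c ^ 2 * z 2) / m ^ 2 := by
  simp [ev, coeffs]; ring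

lemma de_coeffs (m c : ℝ) (z : E3) : de (coeffs m z) c = (2 * z 1 + 6 * c * z 2) / m ^ 2 := by
  simp [de, coeffs]; ring

lemma co_coeffs (m : ℝ) (z : E3) : co (coeffs m z) = 3 * z 2 / m ^ 2 := by simp [co, coeffs]

/-- The polynomial `v` is small in the coordinates adapted to `c`. -/
def Within (c a b g : ℝ) (v : V3) : Prop := |ev v c| ≤ a ∧ |de v c| ≤ b ∧ |co v| ≤ g

lemma Within.mono {c a b g a' b' g' : ℝ} {v : V3} (h : Within c a b g v) (ha : a ≤ a') (hb : b ≤ b')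
    (hg : g ≤ g') : Within c a' b' g' v := ⟨h.1.trans ha, h.2.1.trans hb, h.2.2.trans hg⟩

lemma Within.sub_sub {c a b g a' b' g' : ℝ} {u v w : V3} (h : Within c a b g (u - v))
    (h' : Within c a' b' g' (v - w)) : Within c (a + a') (b + b') (g + g') (u - w) := by
  have e : u - w = (u - v) - (w - v) := by abel
  have e2 : v - w = -(w - v) := by abel
  unfold Within at *
  simp only [ev_sub, de_sub, co_sub] at *
  obtain ⟨h1, h2, h3⟩ := h
  obtain ⟨k1, k2, k3⟩ := h'
  exact ⟨(abs_sub_le _ _ _).trans (add_le_add h1 k1), (abs_sub_le _ _ _).trans (add_le_add h2 k2),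
    (abs_sub_le _ _ _).trans (add_le_add h3 k3)⟩

lemma Within.symm {c a b g : ℝ} {v w : V3} (h : Within c a b g (v - w)) : Within c a b g (w - v) := by
  unfold Within at *
  simp only [ev_sub, de_sub, co_sub] at *
  rwa [abs_sub_comm (ev w c), abs_sub_comm (de w c), abs_sub_comm (co w)]

lemma within_zero {c a b g : ℝ} (ha : 0 ≤ a) (hb : 0 ≤ b) (hg : 0 ≤ g) (v : V3) :
    Within c a b g (v - v) := by
  simpa [Within, ev, de, co] using ⟨ha, hb, hg⟩

/-- The set `B` is comparable to a box of dimensions `a, b, g` at `z` in the coordinates adapted to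
`c`. -/
def Comparable (m c L a b g : ℝ) (B : Set E3) (z : E3) : Prop :=
  (∀ x, Within c (a / L) (b / L) (g / L) (coeffs m x - coeffs m z) → x ∈ B) ∧
  ∀ x ∈ B, Within c (L * a) (L * b) (L * g) (coeffs m x - coeffs m z)

/-- The change of coordinates costs 18 one way and 2000 the other; with the half side lengths of
`rectBox`, both fit into the factor 1000 K. -/
lemma IsBox.exists_comparable {m c K a b g : ℝ} (hm : 0 < m) (hK : 1 ≤ K) (hc0 : 0 ≤ c) (hc1 : c ≤ 1)
    (hab : a ≤ b) (hbg : b ≤ g) {d : Fin 3 → ℝ} (h0 : d 0 = m ^ 2 * a)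
    (h1 : d 1 = m ^ 2 * b) (h2 : d 2 = m ^ 2 * g) {B : Set E3} (hB : IsBox K (frenet c) d B) :
    ∃ z, Comparable m c (1000 * K) a b g B z := by
  obtain ⟨-, z, hz1, hz2⟩ := hB
  have hM : 0 < m ^ 2 := by positivity
  have hK0 : 0 < K := by linarith
  refine ⟨z, fun x hx => hz1 ?_, fun x hx => ?_⟩
  · rw [← coeffs_sub] at hx
    obtain ⟨k1, k2, k3⟩ := hx
    rw [ev_coeffs, abs_div, abs_of_pos hM, div_le_iff₀ hM] at k1
    rw [de_coeffs, abs_div, abs_of_pos hM, div_le_iff₀ hM] at k2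
    rw [co_coeffs, abs_div, abs_of_pos hM, div_le_iff₀ hM] at k3
    have hab' : a / (1000 * K) * m ^ 2 ≤ b / (1000 * K) * m ^ 2 := by gcongr
    have hbg' : b / (1000 * K) * m ^ 2 ≤ g / (1000 * K) * m ^ 2 := by gcongr
    obtain ⟨j1, j2, j3⟩ := abs_frenet_le hc0 hc1 hab' hbg' k1 k2 k3
    have key : ∀ y, 0 ≤ y → 18 * (y / (1000 * K) * m ^ 2) ≤ K⁻¹ * (m ^ 2 * y) / 2 := by
      intro y hy
      have e1 : 18 * (y / (1000 * K) * m ^ 2) = (18 / 1000) * (m ^ 2 * y / K) := by field_simp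
      have e2 : K⁻¹ * (m ^ 2 * y) / 2 = (1 / 2) * (m ^ 2 * y / K) := by field_simp
      rw [e1, e2]
      exact mul_le_mul_of_nonneg_right (by norm_num) (by positivity)
    have ha0 : 0 ≤ a := by
      have h3 := (abs_nonneg _).trans k1
      by_contra hcon
      have : a / (1000 * K) * m ^ 2 < 0 :=
        mul_neg_of_neg_of_pos (div_neg_of_neg_of_pos (not_le.1 hcon) (by positivity)) hM
      linarith
    intro i
    fin_cases i
    · simp only [Fin.zero_eta, h0]; exact j1.trans (key a ha0)
    · simp only [Fin.mk_one, h1]; exact j2.trans (key b (ha0.trans hab))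
    · simp only [Fin.reduceFinMk, h2]; exact j3.trans (key g (ha0.trans (hab.trans hbg)))
  · have hx' := hz2 hx
    have j1 := hx' 0
    have j2 := hx' 1
    have j3 := hx' 2
    simp only [h0, h1, h2] at j1 j2 j3
    have hab' : K * (m ^ 2 * a) / 2 ≤ K * (m ^ 2 * b) / 2 := by gcongr
    have hbg' : K * (m ^ 2 * b) / 2 ≤ K * (m ^ 2 * g) / 2 := by gcongr
    obtain ⟨k1, k2, k3⟩ := abs_le_of_frenet hc0 hc1 hab' hbg' j1 j2 j3
    rw [← coeffs_sub]
    refine ⟨?_, ?_, ?_⟩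
    · rw [ev_coeffs, abs_div, abs_of_pos hM, div_le_iff₀ hM]; linarith
    · rw [de_coeffs, abs_div, abs_of_pos hM, div_le_iff₀ hM]; linarith
    · rw [co_coeffs, abs_div, abs_of_pos hM, div_le_iff₀ hM]; linarith

lemma norm_sq_eq_sum_inner {e : Fin 3 → E3} (he : Orthonormal ℝ e) (v : E3) :
    ‖v‖ ^ 2 = inner ℝ (e 0) v ^ 2 + inner ℝ (e 1) v ^ 2 + inner ℝ (e 2) v ^ 2 := by
  have hsp : ⊤ ≤ Submodule.span ℝ (Set.range e) := by
    rw [he.linearIndependent.span_eq_top_of_card_eq_finrank (by simp)]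
  have h := (OrthonormalBasis.mk he hsp).sum_sq_norm_inner_right v
  rw [← h, Fin.sum_univ_three]
  simp

/-- Cubes are comparable to unit cubes in all adapted coordinates. -/
lemma IsCube.exists_comparable {m K : ℝ} (hm : 0 < m) (hK : 1 ≤ K) {q : Set E3}
    (hq : IsCube K (m ^ 2) q) : ∃ z, ∀ c, 0 ≤ c → c ≤ 1 → Comparable m c (1000 * K) 1 1 1 q z := by
  obtain ⟨e, he, -, z, hz1, hz2⟩ := hq
  have hM : 0 < m ^ 2 := by positivity
  have hK0 : 0 < K := by linarith
  refine ⟨z, fun c hc0 hc1 => ⟨fun x hx => hz1 ?_, fun x hx => ?_⟩⟩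
  · rw [← coeffs_sub] at hx
    obtain ⟨k1, k2, k3⟩ := hx
    rw [ev_coeffs, abs_div, abs_of_pos hM, div_le_iff₀ hM] at k1
    rw [de_coeffs, abs_div, abs_of_pos hM, div_le_iff₀ hM] at k2
    rw [co_coeffs, abs_div, abs_of_pos hM, div_le_iff₀ hM] at k3
    set v := x - z with hv
    set y := 1 / (1000 * K) * m ^ 2 with hy
    have hy0 : 0 ≤ y := by positivity
    have i2 : |v 2| ≤ y := by
      rw [abs_mul, abs_of_pos (by norm_num : (0 : ℝ) < 3)] at k3
      linarith [abs_nonneg (v 2)]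
    have i2' : |c * v 2| ≤ y := by
      rw [abs_mul, abs_of_nonneg hc0]; nlinarith [abs_nonneg (v 2)]
    have i1 : |v 1| ≤ 4 * y := by
      rw [abs_le] at *; constructor <;> linarith
    have i1' : |c * v 1| ≤ 4 * y := by
      rw [abs_mul, abs_of_nonneg hc0]; nlinarith [abs_nonneg (v 1)]
    have i2'' : |c ^ 2 * v 2| ≤ y := by
      rw [sq, mul_assoc, abs_mul, abs_of_nonneg hc0]; nlinarith [abs_nonneg (c * v 2)]
    have i0 : |v 0| ≤ 12 * y := by
      rw [abs_le] at *; constructor <;> linarith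
    have hn : ‖v‖ ^ 2 ≤ (20 * y) ^ 2 := by
      rw [norm_sq_eq_three, ← sq_abs (v 0), ← sq_abs (v 1), ← sq_abs (v 2)]
      have s0 : |v 0| ^ 2 ≤ (12 * y) ^ 2 := by gcongr
      have s1 : |v 1| ^ 2 ≤ (4 * y) ^ 2 := by gcongr
      have s2 : |v 2| ^ 2 ≤ y ^ 2 := by gcongr
      nlinarith
    have hn' : ‖v‖ ≤ 20 * y := le_of_sq_le_sq hn (by positivity)
    intro i
    have h1 := abs_real_inner_le_norm (e i) v
    rw [he.1 i, one_mul] at h1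
    refine h1.trans (hn'.trans ?_)
    have e1 : 20 * y = (20 / 1000) * (m ^ 2 / K) := by rw [hy]; field_simp
    have e2 : K⁻¹ * m ^ 2 / 2 = (1 / 2) * (m ^ 2 / K) := by field_simp
    rw [e1, e2]
    exact mul_le_mul_of_nonneg_right (by norm_num) (by positivity)
  · have hx' := hz2 hx
    set v := x - z with hv
    have hn : ‖v‖ ^ 2 ≤ (K * m ^ 2) ^ 2 := by
      rw [norm_sq_eq_sum_inner he, ← sq_abs (inner ℝ (e 0) v), ← sq_abs (inner ℝ (e 1) v),
        ← sq_abs (inner ℝ (e 2) v)]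
      have s : ∀ i, |inner ℝ (e i) v| ^ 2 ≤ (K * m ^ 2 / 2) ^ 2 := fun i =>
        pow_le_pow_left₀ (abs_nonneg _) (hx' i) 2
      nlinarith [s 0, s 1, s 2]
    have hcoord : ∀ i, |v i| ≤ K * m ^ 2 := by
      intro i
      have : |v i| ^ 2 ≤ (K * m ^ 2) ^ 2 := by
        refine le_trans ?_ hn
        rw [norm_sq_eq_three, sq_abs]
        fin_cases i <;> simp <;> nlinarith [sq_nonneg (v 0), sq_nonneg (v 1), sq_nonneg (v 2)]
      exact le_of_sq_le_sq this (by positivity)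
    have i0 := hcoord 0
    have i1 := hcoord 1
    have i2 := hcoord 2
    have i2' : |c * v 2| ≤ K * m ^ 2 := by
      rw [abs_mul, abs_of_nonneg hc0]; nlinarith [abs_nonneg (v 2)]
    have i1' : |c * v 1| ≤ K * m ^ 2 := by
      rw [abs_mul, abs_of_nonneg hc0]; nlinarith [abs_nonneg (v 1)]
    have i2'' : |c ^ 2 * v 2| ≤ K * m ^ 2 := by
      rw [sq, mul_assoc, abs_mul, abs_of_nonneg hc0]; nlinarith [abs_nonneg (c * v 2)]
    rw [← coeffs_sub, ← hv]
    have hp : 0 < K * m ^ 2 := by positivity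
    refine ⟨?_, ?_, ?_⟩
    · rw [ev_coeffs, abs_div, abs_of_pos hM, div_le_iff₀ hM]
      rw [abs_le] at *; constructor <;> linarith
    · rw [de_coeffs, abs_div, abs_of_pos hM, div_le_iff₀ hM]
      rw [abs_le] at *; constructor <;> linarith
    · rw [co_coeffs, abs_div, abs_of_pos hM, div_le_iff₀ hM]
      rw [abs_le] at *; constructor <;> linarith

/-! ### Packing of sets with disjoint interiors, and the τ-structure of one direction. -/

lemma mem_interior_of_within {m c a b g : ℝ} {B : Set E3} {z x : E3}
    (hB : ∀ x, Within c a b g (coeffs m x - coeffs m z) → x ∈ B)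
    (h1 : |ev (coeffs m x - coeffs m z) c| < a) (h2 : |de (coeffs m x - coeffs m z) c| < b)
    (h3 : |co (coeffs m x - coeffs m z)| < g) : x ∈ interior B := by
  have hopen : IsOpen {x : E3 | |ev (coeffs m x - coeffs m z) c| < a ∧
      |de (coeffs m x - coeffs m z) c| < b ∧ |co (coeffs m x - coeffs m z)| < g} := by
    have c1 : Continuous fun x : E3 => |ev (coeffs m x - coeffs m z) c| := by
      simp only [ev, coeffs]; fun_prop
    have c2 : Continuous fun x : E3 => |de (coeffs m x - coeffs m z) c| := by
      simp only [de, coeffs]; fun_prop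
    have c3 : Continuous fun x : E3 => |co (coeffs m x - coeffs m z)| := by
      simp only [co, coeffs]; fun_prop
    exact (isOpen_lt c1 continuous_const).inter
      ((isOpen_lt c2 continuous_const).inter (isOpen_lt c3 continuous_const))
  exact interior_maximal (fun y hy => hB y ⟨hy.1.le, hy.2.1.le, hy.2.2.le⟩) hopen ⟨h1, h2, h3⟩

/-- Counting sets with disjoint interiors that contain boxes of a given size. -/
lemma card_le_of_nonOverlapping {m c α β γ A B G : ℝ} {F : Finset (Set E3)} (ctr : Set E3 → E3)
    {v : V3} (hα : 0 < α) (hβ : 0 < β) (hγ : 0 < γ) (hA : 0 ≤ A) (hB : 0 ≤ B) (hG : 0 ≤ G)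
    (hF : NonOverlapping (F : Set (Set E3)))
    (hin : ∀ b ∈ F, ∀ x, Within c α β γ (coeffs m x - coeffs m (ctr b)) → x ∈ b)
    (hout : ∀ b ∈ F, Within c A B G (coeffs m (ctr b) - v)) :
    (F.card : ℝ) ≤ (6 * A / α + 1) * ((6 * B / β + 1) * (6 * G / γ + 1)) := by
  have e : ∀ X y : ℝ, 2 * X / (y / 3) = 6 * X / y := by
    intro X y
    rw [div_div_eq_mul_div]; ring
  have hout' : ∀ b ∈ F, |ev (coeffs m (ctr b)) c - ev v c| ≤ A ∧
      |de (coeffs m (ctr b)) c - de v c| ≤ B ∧ |co (coeffs m (ctr b)) - co v| ≤ G := by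
    intro b hb
    have := hout b hb
    unfold Within at this
    rwa [ev_sub, de_sub, co_sub] at this
  rw [← e, ← e, ← e]
  refine card_le_of_windows F (fun b => ev (coeffs m (ctr b)) c) (c := ev v c) (by positivity) hA
    (fun y₁ => ?_) (fun b hb => (hout' b hb).1)
  refine card_le_of_windows _ (fun b => de (coeffs m (ctr b)) c) (c := de v c) (by positivity) hB
    (fun y₂ => ?_) (fun b hb => (hout' b (Finset.mem_filter.1 hb).1).2.1)
  rw [← mul_one (2 * G / (γ / 3) + 1)]
  refine card_le_of_windows _ (fun b => co (coeffs m (ctr b))) (c := co v) (by positivity) hG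
    (fun y₃ => ?_) (fun b hb => (hout' b (Finset.mem_filter.1 (Finset.mem_filter.1 hb).1).1).2.2)
  -- Windows have radius one third of the inner dimensions, so two centres in the same window are so
  -- close that one of them is interior to both sets.
  rw [Nat.cast_le_one, Finset.card_le_one]
  intro b hb b' hb'
  obtain ⟨hb1, k3⟩ := Finset.mem_filter.1 hb
  obtain ⟨hb2, k2⟩ := Finset.mem_filter.1 hb1
  obtain ⟨hb3, k1⟩ := Finset.mem_filter.1 hb2
  obtain ⟨hb1', k3'⟩ := Finset.mem_filter.1 hb'
  obtain ⟨hb2', k2'⟩ := Finset.mem_filter.1 hb1'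
  obtain ⟨hb3', k1'⟩ := Finset.mem_filter.1 hb2'
  by_contra hne
  have hd := hF hb3 hb3' hne
  have hi : ctr b ∈ interior b ∧ ctr b ∈ interior b' := by
    refine ⟨mem_interior_of_within (hin b hb3) ?_ ?_ ?_,
      mem_interior_of_within (hin b' hb3') ?_ ?_ ?_⟩
    · simpa [ev] using hα
    · simpa [de] using hβ
    · simpa [co] using hγ
    · rw [ev_sub]; rw [abs_le] at k1 k1'; rw [abs_lt]; constructor <;> linarith
    · rw [de_sub]; rw [abs_le] at k2 k2'; rw [abs_lt]; constructor <;> linarith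
    · rw [co_sub]; rw [abs_le] at k3 k3'; rw [abs_lt]; constructor <;> linarith
  exact Set.disjoint_left.1 hd hi.1 hi.2

lemma Comparable.interior_nonempty {m c L a b g : ℝ} {B : Set E3} {z : E3}
    (h : Comparable m c L a b g B z) (hL : 0 < L) (ha : 0 < a) (hb : 0 < b) (hg : 0 < g) :
    (interior B).Nonempty := by
  refine ⟨z, mem_interior_of_within h.1 ?_ ?_ ?_⟩
  · simpa [ev] using div_pos ha hL
  · simpa [de] using div_pos hb hL
  · simpa [co] using div_pos hg hL

lemma NonOverlapping.eq_of_subset {F : Set (Set E3)} (hF : NonOverlapping F) {A B C : Set E3}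
    (hA : A ∈ F) (hB : B ∈ F) (hC : (interior C).Nonempty) (hCA : C ⊆ A) (hCB : C ⊆ B) : A = B := by
  by_contra hne
  obtain ⟨x, hx⟩ := hC
  exact Set.disjoint_left.1 (hF hA hB hne) (interior_mono hCA hx) (interior_mono hCB hx)

lemma nonOverlapping_of_nested {F G : Set (Set E3)} (hF : NonOverlapping F)
    (hG : ∀ B ∈ G, ∃ A ∈ F, B ⊆ A) (h : ∀ A ∈ F, NonOverlapping {B | B ∈ G ∧ B ⊆ A}) :
    NonOverlapping G := by
  intro B hB B' hB' hne
  obtain ⟨A, hA, hBA⟩ := hG B hB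
  obtain ⟨A', hA', hBA'⟩ := hG B' hB'
  by_cases hAA : A = A'
  · subst hAA
    exact h A hA ⟨hB, hBA⟩ ⟨hB', hBA'⟩ hne
  · exact (hF hA hA' hAA).mono (interior_mono hBA) (interior_mono hBA')

/-- The planks in one direction, grouped into coarser boxes. -/
structure TauSystem (m c L K N Z : ℝ) (Pl : Finset (Set E3)) where
  tauOf : Set E3 → Set E3
  zP : Set E3 → E3
  zT : Set E3 → E3
  plank : ∀ P ∈ Pl, Comparable m c L 1 (m ^ 2) (m ^ 4) P (zP P)
  tau : ∀ P ∈ Pl, Comparable m c L m (m ^ 2) (m ^ 4) (tauOf P) (zT (tauOf P))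
  subset : ∀ P ∈ Pl, P ⊆ tauOf P
  co_le : ∀ P ∈ Pl, ∀ x ∈ P, |co (coeffs m x)| ≤ 3 * m ^ 4
  nonOverlapping_plank : NonOverlapping (Pl : Set (Set E3))
  nonOverlapping_tau : NonOverlapping (Pl.image tauOf : Set (Set E3))
  card_le : ∀ T, ((Pl.filter fun P => tauOf P = T).card : ℝ) ≤ K * N
  le_card : N * (Pl.image tauOf).card ≤ K * Pl.card
  tau_count : ∀ a b : ℝ, (((Pl.image tauOf).filter fun T => |ev (coeffs m (zT T)) c - a| ≤ m ∧
    |de (coeffs m (zT T)) c - b| ≤ m ^ 3).card : ℝ) ≤ (13 * L ^ 2) ^ 3 * (K * Z)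
  one_le_N : Pl.Nonempty → 1 ≤ K * N
  one_le_Z : Pl.Nonempty → 1 ≤ K * Z

/-- For R = m⁶ the side lengths are powers of m, and `coeffs` divides them all by m². -/
lemma IsVinogradovTiling.comparable {m c K : ℝ} (hm : 1 ≤ m) (hK : 1 ≤ K) (hc0 : 0 ≤ c) (hc1 : c ≤ 1)
    {𝒮 𝒯 𝒱 : Set (Set E3)} (h : IsVinogradovTiling K (m ^ 6) c 𝒮 𝒯 𝒱) :
    (∀ S ∈ 𝒮, ∃ z, Comparable m c (1000 * K) m (m ^ 3) (m ^ 4) S z) ∧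
    (∀ T ∈ 𝒯, ∃ z, Comparable m c (1000 * K) m (m ^ 2) (m ^ 4) T z) ∧
    (∀ P ∈ 𝒱, ∃ z, Comparable m c (1000 * K) 1 (m ^ 2) (m ^ 4) P z) := by
  have hm0 : 0 < m := by linarith
  have root : ∀ (e : ℝ) (n : ℕ), 6 * e = n → (m ^ 6) ^ e = m ^ n := by
    intro e n he
    rw [← Real.rpow_natCast m 6, ← Real.rpow_mul hm0.le]
    push_cast
    rw [he, Real.rpow_natCast]
  have e2 : (m ^ 6) ^ (1 / 3 : ℝ) = m ^ 2 := root _ 2 (by norm_num)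
  have e3 : (m ^ 6) ^ (1 / 2 : ℝ) = m ^ 3 := root _ 3 (by norm_num)
  have e4 : (m ^ 6) ^ (2 / 3 : ℝ) = m ^ 4 := root _ 4 (by norm_num)
  have e5 : (m ^ 6) ^ (5 / 6 : ℝ) = m ^ 5 := root _ 5 (by norm_num)
  have m12 : m ≤ m ^ 2 := le_self_pow₀ hm (by norm_num)
  have m13 : m ≤ m ^ 3 := le_self_pow₀ hm (by norm_num)
  have m34 : m ^ 3 ≤ m ^ 4 := pow_le_pow_right₀ hm (by norm_num)
  have m24 : m ^ 2 ≤ m ^ 4 := pow_le_pow_right₀ hm (by norm_num)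
  refine ⟨fun S hS => ?_, fun T hT => ?_, fun P hP => ?_⟩
  · refine IsBox.exists_comparable hm0 hK hc0 hc1 m13 m34 ?_ ?_ ?_ (h.box_sigma S hS)
    · simp only [Matrix.cons_val_zero]; rw [e3]; ring
    · simp only [Matrix.cons_val_one, Matrix.cons_val_zero]; rw [e5]; ring
    · simp only [Matrix.cons_val]; ring
  · refine IsBox.exists_comparable hm0 hK hc0 hc1 m12 m24 ?_ ?_ ?_ (h.box_tau T hT)
    · simp only [Matrix.cons_val_zero]; rw [e3]; ring
    · simp only [Matrix.cons_val_one, Matrix.cons_val_zero]; rw [e4]; ring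
    · simp only [Matrix.cons_val]; ring
  · refine IsBox.exists_comparable hm0 hK hc0 hc1 (one_le_pow₀ hm) m24 ?_ ?_ ?_ (h.box_plank P hP)
    · simp only [Matrix.cons_val_zero]; rw [e2]; ring
    · simp only [Matrix.cons_val_one, Matrix.cons_val_zero]; rw [e4]; ring
    · simp only [Matrix.cons_val]; ring

-- Disjoint interiors make the τ containing a plank unique. Hence (Sp1) gives about N planks in each
-- occupied τ, and (Sp2) gives at most K Z occupied τ in a Σ that contains one. A packing count for
-- the boxes Σ near an m × m³ window then yields `tau_count`.
set_option maxHeartbeats 1000000 in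
lemma IsVinogradovTiling.nonempty_tauSystem {m c K N Z : ℝ} (hm : 1 ≤ m) (hK : 1 ≤ K) (hc0 : 0 ≤ c)
    (hc1 : c ≤ 1) {𝒮 𝒯 𝒱 : Set (Set E3)} (h : IsVinogradovTiling K (m ^ 6) c 𝒮 𝒯 𝒱)
    {Pl : Finset (Set E3)} (hPl : ∀ P ∈ Pl, P ∈ 𝒱 ∧ P ⊆ bigCube (m ^ 6)) (hN : 0 < N) (hZ : 0 < Z)
    (h1 : ∀ T ∈ 𝒯, HeavyTau K N Pl T ∨ ∀ P ∈ Pl, ¬ P ⊆ T)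
    (h2 : ∀ S ∈ 𝒮, HeavySigma K N Z Pl 𝒯 S ∨ ∀ T ∈ 𝒯, T ⊆ S → ¬ HeavyTau K N Pl T) :
    Nonempty (TauSystem m c (1000 * K) K N Z Pl) := by
  have hm0 : 0 < m := by linarith
  have hK0 : 0 < K := by linarith
  obtain ⟨hS, hT, hP⟩ := IsVinogradovTiling.comparable hm hK hc0 hc1 h
  choose! zS hzS using hS
  choose! zT hzT using hT
  choose! zP hzP using hP
  choose! tauOf htau hsub using h.plank_subset
  choose! sigmaOf hsigma hsubS using h.tau_subset
  have hnT : NonOverlapping 𝒯 := nonOverlapping_of_nested h.tiles_cube.2 h.tau_subset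
    fun S hS => (h.tiles_sigma S hS).2
  have hnV : NonOverlapping 𝒱 := nonOverlapping_of_nested hnT h.plank_subset
    fun T hT => (h.tiles_tau T hT).2
  have hintP : ∀ P ∈ 𝒱, (interior P).Nonempty := fun P hP =>
    (hzP P hP).interior_nonempty (by positivity) one_pos (by positivity) (by positivity)
  have hTmem : ∀ P ∈ Pl, tauOf P ∈ 𝒯 := fun P hP => htau P (hPl P hP).1
  have hTsub : ∀ P ∈ Pl, P ⊆ tauOf P := fun P hP => hsub P (hPl P hP).1
  have hfin : ∀ T, {P | P ∈ Pl ∧ P ⊆ T} = ((Pl.filter fun P => P ⊆ T : Finset (Set E3)) :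
      Set (Set E3)) := by
    intro T; ext P; simp
  have hheavy : ∀ P ∈ Pl, HeavyTau K N Pl (tauOf P) := fun P hP =>
    (h1 _ (hTmem P hP)).resolve_right fun hcon => hcon P hP (hTsub P hP)
  have heq : ∀ P ∈ Pl, ∀ T ∈ 𝒯, P ⊆ T → tauOf P = T := fun P hP T hT hPT =>
    NonOverlapping.eq_of_subset hnT (hTmem P hP) hT (hintP P (hPl P hP).1) (hTsub P hP) hPT
  have hfiber : ∀ T ∈ 𝒯, (Pl.filter fun P => tauOf P = T) = Pl.filter fun P => P ⊆ T := by
    intro T hT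
    refine Finset.filter_congr fun P hP => ⟨?_, heq P hP T hT⟩
    rintro rfl
    exact hTsub P hP
  have hmemI : ∀ T ∈ Pl.image tauOf, T ∈ 𝒯 ∧ HeavyTau K N Pl T ∧ ∃ P ∈ Pl, P ⊆ T := by
    intro T hT
    obtain ⟨P, hP, rfl⟩ := Finset.mem_image.1 hT
    exact ⟨hTmem P hP, hheavy P hP, P, hP, hTsub P hP⟩
  have hcount : ∀ T ∈ Pl.image tauOf, Sim K ((Pl.filter fun P => tauOf P = T).card : ℝ) N := by
    intro T hT
    obtain ⟨hT1, hT2, _⟩ := hmemI T hT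
    rw [hfiber T hT1]
    rw [HeavyTau, hfin, Set.ncard_coe_finset] at hT2
    exact hT2
  have hco : ∀ x ∈ bigCube (m ^ 6), |co (coeffs m x)| ≤ 3 * m ^ 4 := by
    intro x hx
    have := hx 2
    rw [co_coeffs, abs_div, abs_of_pos (by positivity : 0 < m ^ 2), div_le_iff₀ (by positivity),
      abs_mul, abs_of_pos (by norm_num : (0 : ℝ) < 3)]
    calc 3 * |x 2| ≤ 3 * m ^ 6 := by gcongr
      _ = _ := by ring
  -- the heavy boxes inside a box `Σ`
  have hSfin : ∀ S, {T | T ∈ 𝒯 ∧ T ⊆ S ∧ HeavyTau K N Pl T} ⊆ (Pl.image tauOf : Set (Set E3)) := by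
    rintro S T ⟨hT1, _, hT3⟩
    have hpos : 0 < ({P | P ∈ Pl ∧ P ⊆ T}.ncard : ℝ) := by
      by_contra hcon
      have := hT3.2
      nlinarith
    rw [hfin, Set.ncard_coe_finset] at hpos
    obtain ⟨P, hP⟩ := Finset.card_pos.1 (Nat.cast_pos.1 hpos)
    obtain ⟨hP1, hP2⟩ := Finset.mem_filter.1 hP
    rw [← heq P hP1 T hT1 hP2]
    exact Finset.mem_coe.2 (Finset.mem_image_of_mem _ hP1)
  have hSheavy : ∀ T ∈ Pl.image tauOf,
      ({T' | T' ∈ 𝒯 ∧ T' ⊆ sigmaOf T ∧ HeavyTau K N Pl T'}.ncard : ℝ) ≤ K * Z := by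
    intro T hT
    obtain ⟨hT1, hT2, _⟩ := hmemI T hT
    exact ((h2 _ (hsigma T hT1)).resolve_right fun hcon => hcon T hT1 (hsubS T hT1) hT2).1
  have hSfib : ∀ T ∈ Pl.image tauOf, (((Pl.image tauOf).filter fun T' => sigmaOf T' = sigmaOf T).card :
      ℝ) ≤ K * Z := by
    intro T hT
    refine le_trans (Nat.cast_le.2 ?_) (hSheavy T hT)
    rw [← Set.ncard_coe_finset]
    refine Set.ncard_le_ncard ?_ ((Pl.image tauOf).finite_toSet.subset (hSfin _))
    intro T' hT'
    obtain ⟨hT1', hT2'⟩ := Finset.mem_filter.1 (Finset.mem_coe.1 hT')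
    obtain ⟨hT3', hT4', _⟩ := hmemI T' hT1'
    refine ⟨hT3', ?_, hT4'⟩
    rw [← hT2']
    exact hsubS T' hT3'
  refine ⟨⟨tauOf, zP, zT, fun P hP => hzP P (hPl P hP).1, fun P hP => hzT _ (hTmem P hP), hTsub,
    fun P hP x hx => hco x ((hPl P hP).2 hx), hnV.mono fun P hP => (hPl P hP).1,
    hnT.mono fun T hT => (hmemI T hT).1, ?_, ?_, ?_, ?_, ?_⟩⟩
  · intro T
    by_cases hT : T ∈ Pl.image tauOf
    · exact (hcount T hT).1
    · have h0 : (Pl.filter fun P => tauOf P = T) = ∅ := by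
        refine Finset.filter_false_of_mem fun P hP hPT => hT ?_
        rw [← hPT]
        exact Finset.mem_image_of_mem _ hP
      rw [h0]
      simp only [Finset.card_empty, Nat.cast_zero]
      positivity
  · rw [Finset.card_eq_sum_card_image tauOf Pl]
    push_cast
    rw [Finset.mul_sum, mul_comm, ← nsmul_eq_mul, ← Finset.sum_const]
    exact Finset.sum_le_sum fun T hT => (hcount T hT).2
  · intro a b
    set F := (Pl.image tauOf).filter fun T => |ev (coeffs m (zT T)) c - a| ≤ m ∧
      |de (coeffs m (zT T)) c - b| ≤ m ^ 3 with hF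
    have hFI : ∀ T ∈ F, T ∈ Pl.image tauOf := fun T hT => (Finset.mem_filter.1 hT).1
    refine card_le_mul_of_fibers F sigmaOf (by positivity) ?_ ?_
    -- The window says nothing about leading coefficients; these are bounded because each Σ here
    -- contains a plank inside [-R, R]³.
    · have hout : ∀ S ∈ F.image sigmaOf, S ∈ 𝒮 ∧ Within c (2 * (1000 * K) * m)
          (2 * (1000 * K) * m ^ 3) (2 * (1000 * K) * m ^ 4) (coeffs m (zS S) - jet c a b 0) := by
        intro S hS
        obtain ⟨T, hT, rfl⟩ := Finset.mem_image.1 hS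
        obtain ⟨hT1, hT2, P, hP, hPT⟩ := hmemI T (hFI T hT)
        obtain ⟨k1, k2⟩ := (Finset.mem_filter.1 hT).2
        refine ⟨hsigma T hT1, ?_⟩
        have hSc := hzS _ (hsigma T hT1)
        have hzTmem : zT T ∈ T := (hzT T hT1).1 _ (within_zero (by positivity) (by positivity)
          (by positivity) _)
        obtain ⟨s1, s2, -⟩ := hSc.2 _ (hsubS T hT1 hzTmem)
        obtain ⟨x, hx⟩ := (hintP P (hPl P hP).1).mono interior_subset
        obtain ⟨-, -, s3⟩ := hSc.2 _ (hsubS T hT1 (hPT hx))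
        have k3 := hco x ((hPl P hP).2 hx)
        rw [ev_sub] at s1
        rw [de_sub] at s2
        rw [co_sub] at s3
        have m3 : 0 < m ^ 3 := by positivity
        have m4 : 0 < m ^ 4 := by positivity
        refine ⟨?_, ?_, ?_⟩
        · rw [ev_sub, ev_jet]
          rw [abs_le] at *
          constructor <;> nlinarith
        · rw [de_sub, de_jet]
          rw [abs_le] at *
          constructor <;> nlinarith
        · rw [co_sub, co_jet]
          rw [abs_le] at *
          constructor <;> nlinarith
      have hp := card_le_of_nonOverlapping (m := m) (c := c) (F := F.image sigmaOf) zS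
        (α := m / (1000 * K)) (β := m ^ 3 / (1000 * K)) (γ := m ^ 4 / (1000 * K))
        (v := jet c a b 0) (by positivity) (by positivity) (by positivity) (by positivity)
        (by positivity) (by positivity)
        (h.tiles_cube.2.mono fun S hS => (hout S hS).1)
        (fun S hS => (hzS S (hout S hS).1).1) (fun S hS => (hout S hS).2)
      refine hp.trans ?_
      have hL1 : 1 ≤ (1000 * K) ^ 2 := one_le_pow₀ (by linarith)
      have e : ∀ y : ℝ, 0 < y → 6 * (2 * (1000 * K) * y) / (y / (1000 * K)) + 1 ≤
          13 * (1000 * K) ^ 2 := by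
        intro y hy
        have : 6 * (2 * (1000 * K) * y) / (y / (1000 * K)) = 12 * (1000 * K) ^ 2 := by
          field_simp; ring
        rw [this]; linarith
      calc _ ≤ 13 * (1000 * K) ^ 2 * (13 * (1000 * K) ^ 2 * (13 * (1000 * K) ^ 2)) :=
            mul_le_mul (e _ hm0) (mul_le_mul (e _ (by positivity)) (e _ (by positivity))
              (by positivity) (by positivity)) (by positivity) (by positivity)
        _ = _ := by ring
    · intro T hT
      refine le_trans (Nat.cast_le.2 (Finset.card_le_card ?_)) (hSfib T (hFI T hT))
      exact Finset.filter_subset_filter _ (Finset.filter_subset _ _)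
  · rintro ⟨P, hP⟩
    have hI : tauOf P ∈ Pl.image tauOf := Finset.mem_image_of_mem _ hP
    refine le_trans ?_ (hcount _ hI).1
    have hpos : 0 < (Pl.filter fun P' => tauOf P' = tauOf P).card :=
      Finset.card_pos.2 ⟨P, Finset.mem_filter.2 ⟨hP, rfl⟩⟩
    exact_mod_cast hpos
  · rintro ⟨P, hP⟩
    have hI : tauOf P ∈ Pl.image tauOf := Finset.mem_image_of_mem _ hP
    refine le_trans ?_ (hSfib _ hI)
    have hpos : 0 < ((Pl.image tauOf).filter fun T' => sigmaOf T' = sigmaOf (tauOf P)).card :=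
      Finset.card_pos.2 ⟨tauOf P, Finset.mem_filter.2 ⟨hI, rfl⟩⟩
    exact_mod_cast hpos

/-! ### Families of cubes as plank configurations. -/

/-- Cubes meeting planks in the directions `k / m ^ 2`. -/
structure CubeFamily (K : ℝ) where
  m : ℝ
  N : ℝ
  Z : ℝ
  n : ℕ
  Pl : ℕ → Finset (Set E3)
  sys : ∀ k : ℕ, TauSystem m (k / m ^ 2) (1000 * K) K N Z (Pl k)
  Q : Finset (Set E3)
  ctr : Set E3 → E3
  one_le_K : 1 ≤ K
  one_le_m : 1 ≤ m
  N_pos : 0 < N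
  Z_pos : 0 < Z
  le_sq : ∀ k, (Pl k).Nonempty → k < n ∧ (k : ℝ) ≤ m ^ 2
  cube : ∀ q ∈ Q, ∀ c, 0 ≤ c → c ≤ 1 → Comparable m c (1000 * K) 1 1 1 q (ctr q)
  nonOverlapping : NonOverlapping (Q : Set (Set E3))
  meets : ∀ q ∈ Q, ∃ k, ∃ P ∈ Pl k, (P ∩ q).Nonempty
  nonempty : Q.Nonempty

namespace CubeFamily
variable {K : ℝ} (F : CubeFamily K)

lemma m_pos : 0 < F.m := by linarith [F.one_le_m]

lemma dir_mem {k : ℕ} (h : (F.Pl k).Nonempty) : 0 ≤ (k : ℝ) / F.m ^ 2 ∧ (k : ℝ) / F.m ^ 2 ≤ 1 := by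
  have := F.m_pos
  refine ⟨by positivity, ?_⟩
  rw [div_le_one (by positivity)]
  exact (F.le_sq k h).2

/-- The directions of the planks through a cube. -/
def dirs (q : Set E3) : Finset ℕ :=
  (Finset.range F.n).filter fun k => ∃ P ∈ F.Pl k, (P ∩ q).Nonempty

lemma mem_dirs {q : Set E3} {k : ℕ} : k ∈ F.dirs q ↔ ∃ P ∈ F.Pl k, (P ∩ q).Nonempty := by
  rw [dirs, Finset.mem_filter, Finset.mem_range]
  exact ⟨fun h => h.2, fun h => ⟨(F.le_sq k ⟨_, h.choose_spec.1⟩).1, h⟩⟩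

/-- A plank through a cube in a given direction. -/
def plank (q : Set E3) (k : ℕ) : Set E3 :=
  if h : ∃ P ∈ F.Pl k, (P ∩ q).Nonempty then h.choose else ∅

lemma plank_spec {q : Set E3} {k : ℕ} (h : k ∈ F.dirs q) :
    F.plank q k ∈ F.Pl k ∧ (F.plank q k ∩ q).Nonempty := by
  rw [mem_dirs] at h
  rw [plank, dif_pos h]
  exact h.choose_spec

/-- A cube meeting a plank is near the centre of the plank. -/
lemma within_ctr_plank {q P : Set E3} {k : ℕ} (hq : q ∈ F.Q) (hP : P ∈ F.Pl k)
    (h : (P ∩ q).Nonempty) : Within (k / F.m ^ 2) (2 * (1000 * K)) (2 * (1000 * K) * F.m ^ 2)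
      (2 * (1000 * K) * F.m ^ 4) (coeffs F.m ((F.sys k).zP P) - coeffs F.m (F.ctr q)) := by
  obtain ⟨x, hxP, hxq⟩ := h
  obtain ⟨c0, c1⟩ := F.dir_mem ⟨P, hP⟩
  have h1 := (((F.sys k).plank P hP).2 x hxP).symm
  have h2 := (F.cube q hq _ c0 c1).2 x hxq
  have hK := F.one_le_K
  have m2 : 1 ≤ F.m ^ 2 := one_le_pow₀ F.one_le_m
  have m4 : 1 ≤ F.m ^ 4 := one_le_pow₀ F.one_le_m
  refine (h1.sub_sub h2).mono ?_ ?_ ?_ <;> nlinarith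

lemma within_ctr_tau {q P : Set E3} {k : ℕ} (hq : q ∈ F.Q) (hP : P ∈ F.Pl k)
    (h : (P ∩ q).Nonempty) : Within (k / F.m ^ 2) (2 * (1000 * K) * F.m) (2 * (1000 * K) * F.m ^ 2)
      (2 * (1000 * K) * F.m ^ 4)
      (coeffs F.m (F.ctr q) - coeffs F.m ((F.sys k).zT ((F.sys k).tauOf P))) := by
  obtain ⟨x, hxP, hxq⟩ := h
  obtain ⟨c0, c1⟩ := F.dir_mem ⟨P, hP⟩
  have h1 := (((F.sys k).tau P hP).2 x ((F.sys k).subset P hP hxP))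
  have h2 := ((F.cube q hq _ c0 c1).2 x hxq).symm
  have hK := F.one_le_K
  have m1 := F.one_le_m
  have m2 : 1 ≤ F.m ^ 2 := one_le_pow₀ F.one_le_m
  have m4 : 1 ≤ F.m ^ 4 := one_le_pow₀ F.one_le_m
  refine (h2.sub_sub h1).mono ?_ ?_ ?_ <;> nlinarith

/-- The centres of planks of one direction meeting q lie in a fixed multiple of a plank, and the
planks do not overlap. Richness in planks is thus comparable to richness in directions. -/
lemma card_meeting_le {q : Set E3} (hq : q ∈ F.Q) (k : ℕ) :
    (((F.Pl k).filter fun P => (P ∩ q).Nonempty).card : ℝ) ≤ (13 * (1000 * K) ^ 2) ^ 3 := by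
  have hm := F.m_pos
  have hK := F.one_le_K
  have hK0 : 0 < K := by linarith
  set S := (F.Pl k).filter fun P => (P ∩ q).Nonempty with hS
  have hS' : ∀ P ∈ S, P ∈ F.Pl k ∧ (P ∩ q).Nonempty := fun P hP => Finset.mem_filter.1 hP
  have hp := card_le_of_nonOverlapping (m := F.m) (c := k / F.m ^ 2) (F := S) (F.sys k).zP
    (α := 1 / (1000 * K)) (β := F.m ^ 2 / (1000 * K)) (γ := F.m ^ 4 / (1000 * K))
    (v := coeffs F.m (F.ctr q)) (by positivity) (by positivity) (by positivity)
    (A := 2 * (1000 * K)) (B := 2 * (1000 * K) * F.m ^ 2) (G := 2 * (1000 * K) * F.m ^ 4)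
    (by positivity) (by positivity) (by positivity)
    ((F.sys k).nonOverlapping_plank.mono fun P hP => (hS' P hP).1)
    (fun P hP => ((F.sys k).plank P (hS' P hP).1).1)
    (fun P hP => F.within_ctr_plank hq (hS' P hP).1 (hS' P hP).2)
  refine hp.trans ?_
  have hL1 : 1 ≤ (1000 * K) ^ 2 := one_le_pow₀ (by linarith)
  have e : ∀ y : ℝ, 0 < y → 6 * (2 * (1000 * K) * y) / (y / (1000 * K)) + 1 ≤
      13 * (1000 * K) ^ 2 := by
    intro y hy
    have : 6 * (2 * (1000 * K) * y) / (y / (1000 * K)) = 12 * (1000 * K) ^ 2 := by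
      field_simp; ring
    rw [this]; linarith
  have e1 := e 1 one_pos
  rw [mul_one] at e1
  calc _ ≤ 13 * (1000 * K) ^ 2 * (13 * (1000 * K) ^ 2 * (13 * (1000 * K) ^ 2)) :=
        mul_le_mul e1 (mul_le_mul (e _ (by positivity)) (e _ (by positivity))
          (by positivity) (by positivity)) (by positivity) (by positivity)
    _ = _ := by ring

lemma card_ctr_le {x a b g : ℝ} (hx0 : 0 ≤ x) (hx1 : x ≤ 1) (ha : 1 ≤ a) (hb : 1 ≤ b) (hg : 1 ≤ g)
    (v : V3) : ((F.Q.filter fun q => Within x a b g (coeffs F.m (F.ctr q) - v)).card : ℝ) ≤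
      (7 * (1000 * K)) ^ 3 * (a * b * g) := by
  have hK := F.one_le_K
  have hK0 : 0 < K := by linarith
  set S := F.Q.filter fun q => Within x a b g (coeffs F.m (F.ctr q) - v) with hS
  have hS' : ∀ q ∈ S, q ∈ F.Q ∧ Within x a b g (coeffs F.m (F.ctr q) - v) :=
    fun q hq => Finset.mem_filter.1 hq
  have hp := card_le_of_nonOverlapping (m := F.m) (c := x) (F := S) F.ctr
    (α := 1 / (1000 * K)) (β := 1 / (1000 * K)) (γ := 1 / (1000 * K))
    (v := v) (by positivity) (by positivity) (by positivity)
    (A := a) (B := b) (G := g) (by positivity) (by positivity) (by positivity)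
    (F.nonOverlapping.mono fun q hq => (hS' q hq).1)
    (fun q hq => (F.cube q (hS' q hq).1 x hx0 hx1).1)
    (fun q hq => (hS' q hq).2)
  refine hp.trans ?_
  have e : ∀ y : ℝ, 1 ≤ y → 6 * y / (1 / (1000 * K)) + 1 ≤ 7 * (1000 * K) * y := by
    intro y hy
    have : 6 * y / (1 / (1000 * K)) = 6 * (1000 * K) * y := by field_simp
    rw [this]; nlinarith
  calc _ ≤ 7 * (1000 * K) * a * (7 * (1000 * K) * b * (7 * (1000 * K) * g)) :=
        mul_le_mul (e _ ha) (mul_le_mul (e _ hb) (e _ hg) (by positivity) (by positivity))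
          (by positivity) (by positivity)
    _ = _ := by ring

/-- The boxes τ of these planks have centres with leading coefficient O(m⁴), so by packing there are
O(A B) of them, and each holds at most K N planks. -/
lemma card_plank_image_le (k : ℕ) (v : V3) {A B : ℝ} (hA : 1 ≤ A) (hB : 1 ≤ B) :
    (((F.Q.filter fun q => k ∈ F.dirs q ∧ |ev (coeffs F.m (F.ctr q) - v) (k / F.m ^ 2)| ≤ A * F.m ∧
      |de (coeffs F.m (F.ctr q) - v) (k / F.m ^ 2)| ≤ B * F.m ^ 2).image
        fun q => F.plank q k).card : ℝ) ≤ (19 * (1000 * K) ^ 2) ^ 3 * (A * B) * (K * F.N) := by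
  have hm := F.m_pos
  have hm1 := F.one_le_m
  have hK := F.one_le_K
  have hK0 : 0 < K := by linarith
  have hN := F.N_pos
  set c : ℝ := k / F.m ^ 2 with hc
  set S := (F.Q.filter fun q => k ∈ F.dirs q ∧ |ev (coeffs F.m (F.ctr q) - v) c| ≤ A * F.m ∧
      |de (coeffs F.m (F.ctr q) - v) c| ≤ B * F.m ^ 2).image fun q => F.plank q k with hS
  have hS' : ∀ P ∈ S, P ∈ F.Pl k ∧ Within c (3 * (1000 * K) * A * F.m)
      (3 * (1000 * K) * B * F.m ^ 2) (3 * (1000 * K) * F.m ^ 4)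
      (coeffs F.m ((F.sys k).zT ((F.sys k).tauOf P)) - jet c (ev v c) (de v c) 0) := by
    intro P hP
    obtain ⟨q, hq, rfl⟩ := Finset.mem_image.1 hP
    obtain ⟨hqQ, hk, i1, i2⟩ := Finset.mem_filter.1 hq
    obtain ⟨j1, j2⟩ := F.plank_spec hk
    refine ⟨j1, ?_⟩
    obtain ⟨w1, w2, -⟩ : Within c (2 * (1000 * K) * F.m) (2 * (1000 * K) * F.m ^ 2)
      (2 * (1000 * K) * F.m ^ 4) (coeffs F.m (F.ctr q) -
        coeffs F.m ((F.sys k).zT ((F.sys k).tauOf (F.plank q k)))) := F.within_ctr_tau hqQ j1 j2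
    obtain ⟨x, hxP, -⟩ := j2
    obtain ⟨-, -, s3⟩ := ((F.sys k).tau _ j1).2 x ((F.sys k).subset _ j1 hxP)
    have s4 := (F.sys k).co_le _ j1 x hxP
    rw [ev_sub] at w1 i1
    rw [de_sub] at w2 i2
    rw [co_sub] at s3
    have m1 : 0 < F.m ^ 2 := by positivity
    have m4 : 0 < F.m ^ 4 := by positivity
    have p1 : 2 * (1000 * K) * F.m + A * F.m ≤ 3 * (1000 * K) * A * F.m := by
      have : 2 * (1000 * K) + A ≤ 3 * (1000 * K) * A := by nlinarith
      nlinarith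
    have p2 : 2 * (1000 * K) * F.m ^ 2 + B * F.m ^ 2 ≤ 3 * (1000 * K) * B * F.m ^ 2 := by
      have : 2 * (1000 * K) + B ≤ 3 * (1000 * K) * B := by nlinarith
      nlinarith
    have p3 : 1000 * K * F.m ^ 4 + 3 * F.m ^ 4 ≤ 3 * (1000 * K) * F.m ^ 4 := by
      have : 1000 * K + 3 ≤ 3 * (1000 * K) := by nlinarith
      nlinarith
    refine ⟨?_, ?_, ?_⟩
    · rw [ev_sub, ev_jet]; rw [abs_le] at *; constructor <;> linarith
    · rw [de_sub, de_jet]; rw [abs_le] at *; constructor <;> linarith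
    · rw [co_sub, co_jet]; rw [abs_le] at *; constructor <;> linarith
  have hKN : 0 ≤ K * F.N := by positivity
  refine card_le_mul_of_fibers S (F.sys k).tauOf hKN ?_ ?_
  · have hT : ∀ T ∈ S.image (F.sys k).tauOf, ∃ P ∈ S, (F.sys k).tauOf P = T := fun T hT =>
      Finset.mem_image.1 hT
    have hp := card_le_of_nonOverlapping (m := F.m) (c := c) (F := S.image (F.sys k).tauOf)
      (F.sys k).zT (α := F.m / (1000 * K)) (β := F.m ^ 2 / (1000 * K)) (γ := F.m ^ 4 / (1000 * K))
      (v := jet c (ev v c) (de v c) 0) (by positivity) (by positivity) (by positivity)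
      (A := 3 * (1000 * K) * A * F.m) (B := 3 * (1000 * K) * B * F.m ^ 2)
      (G := 3 * (1000 * K) * F.m ^ 4) (by positivity) (by positivity) (by positivity) ?_ ?_ ?_
    · refine hp.trans ?_
      have hL1 : 1 ≤ (1000 * K) ^ 2 := one_le_pow₀ (by linarith)
      have e : ∀ X y : ℝ, 1 ≤ X → 0 < y → 6 * (3 * (1000 * K) * X * y) / (y / (1000 * K)) + 1 ≤
          19 * (1000 * K) ^ 2 * X := by
        intro X y hX hy
        have : 6 * (3 * (1000 * K) * X * y) / (y / (1000 * K)) = 18 * (1000 * K) ^ 2 * X := by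
          field_simp; ring
        rw [this]; nlinarith
      have e1 := e 1 (F.m ^ 4) le_rfl (by positivity)
      rw [mul_one, mul_one] at e1
      calc _ ≤ 19 * (1000 * K) ^ 2 * A * (19 * (1000 * K) ^ 2 * B * (19 * (1000 * K) ^ 2)) :=
            mul_le_mul (e _ _ hA hm) (mul_le_mul (e _ _ hB (by positivity)) e1
              (by positivity) (by positivity)) (by positivity) (by positivity)
        _ = _ := by ring
    · refine (F.sys k).nonOverlapping_tau.mono fun T hT' => ?_
      obtain ⟨P, hP, rfl⟩ := hT T hT'
      exact Finset.mem_coe.2 (Finset.mem_image_of_mem _ (hS' P hP).1)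
    · intro T hT'
      obtain ⟨P, hP, rfl⟩ := hT T hT'
      exact ((F.sys k).tau P (hS' P hP).1).1
    · intro T hT'
      obtain ⟨P, hP, rfl⟩ := hT T hT'
      exact (hS' P hP).2
  · intro P hP
    refine le_trans (Nat.cast_le.2 (Finset.card_le_card ?_)) ((F.sys k).card_le ((F.sys k).tauOf P))
    exact Finset.filter_subset_filter _ fun P hP => (hS' P hP).1

/-- The boxes of the `k`-th direction with their coordinates. -/
def tau (k : ℕ) : Finset (Set E3 × ℝ × ℝ) :=
  ((F.Pl k).image (F.sys k).tauOf).image fun T =>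
    (T, ev (coeffs F.m ((F.sys k).zT T)) (k / F.m ^ 2), de (coeffs F.m ((F.sys k).zT T)) (k / F.m ^ 2))

lemma card_tau_le (k : ℕ) : F.N * (F.tau k).card ≤ K * (F.Pl k).card := by
  refine le_trans ?_ (F.sys k).le_card
  have := F.N_pos
  have h : (F.tau k).card ≤ ((F.Pl k).image (F.sys k).tauOf).card := Finset.card_image_le
  gcongr

lemma tau_count (k : ℕ) (a b : ℝ) : (((F.tau k).filter fun t => |t.2.1 - a| ≤ F.m ∧
    |t.2.2 - b| ≤ F.m ^ 3).card : ℝ) ≤ (13 * (1000 * K) ^ 2) ^ 3 * (K * F.Z) := by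
  refine le_trans (Nat.cast_le.2 ?_) ((F.sys k).tau_count a b)
  rw [tau, Finset.filter_image]
  exact Finset.card_image_le

/-- The plank configuration of a family of cubes. -/
def toConfig : PlankConfig (Set E3) (Set E3) (Set E3 × ℝ × ℝ) where
  C := 10 ^ 4 * K * (1000 * K) ^ 6
  m := F.m
  N := F.N
  Z := F.Z
  P := ∑ k ∈ Finset.range F.n, ((F.Pl k).card : ℝ)
  pts := F.Q
  pos q := coeffs F.m (F.ctr q)
  X := F.dirs
  pl := F.plank
  tau := F.tau
  ta t := t.2.1
  tb t := t.2.2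
  one_le_C := by
    have hK := F.one_le_K
    have : 1 ≤ (1000 * K) ^ 6 := one_le_pow₀ (by linarith)
    nlinarith
  one_le_m := F.one_le_m
  dir_le q _ k hk := by
    obtain ⟨P, hP, _⟩ := F.mem_dirs.1 hk
    exact (F.le_sq k ⟨P, hP⟩).2
  sep x hx0 hx1 a b c ha hb hc v := by
    refine le_trans (Nat.cast_le.2 (Finset.card_le_card fun q hq => ?_))
      ((F.card_ctr_le hx0 hx1 ha hb hc v).trans ?_)
    · obtain ⟨h1, h2⟩ := Finset.mem_filter.1 hq
      exact Finset.mem_filter.2 ⟨h1, h2⟩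
    have hK := F.one_le_K
    have : (7 * (1000 * K)) ^ 3 ≤ 10 ^ 4 * K * (1000 * K) ^ 6 := by
      have h3 : (1000 * K) ^ 3 ≤ (1000 * K) ^ 6 := pow_le_pow_right₀ (by linarith) (by norm_num)
      have h6 : 0 < (1000 * K) ^ 6 := by positivity
      nlinarith
    gcongr
  co_le q hq := by
    obtain ⟨k, P, hP, x, hxP, hxq⟩ := F.meets q hq
    obtain ⟨c0, c1⟩ := F.dir_mem ⟨P, hP⟩
    obtain ⟨-, -, h1⟩ := (F.cube q hq _ c0 c1).2 x hxq
    have h2 := (F.sys k).co_le P hP x hxP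
    rw [co_sub] at h1
    have hK := F.one_le_K
    have m4 : 1 ≤ F.m ^ 4 := one_le_pow₀ F.one_le_m
    have h3 : 1000 * K * 1 + 3 * F.m ^ 4 ≤ 10 ^ 4 * K * (1000 * K) ^ 6 * F.m ^ 4 := by
      have h6 : 1 ≤ (1000 * K) ^ 6 := one_le_pow₀ (by linarith)
      have h7 : 10 ^ 4 * K * F.m ^ 4 ≤ 10 ^ 4 * K * F.m ^ 4 * (1000 * K) ^ 6 :=
        le_mul_of_one_le_right (by positivity) h6
      nlinarith
    rw [abs_le] at *
    constructor <;> linarith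
  thin q hq q' hq' k hk hk' h := by
    obtain ⟨i1, i2⟩ := F.plank_spec hk
    obtain ⟨j1, j2⟩ := F.plank_spec hk'
    have h1 := F.within_ctr_plank hq i1 i2
    have h2 := F.within_ctr_plank hq' j1 j2
    rw [← h] at h2
    refine (h1.symm.sub_sub h2).1.trans ?_
    have hK := F.one_le_K
    have h6 : 1 ≤ (1000 * K) ^ 6 := one_le_pow₀ (by linarith)
    nlinarith
  plank_count k v A B hA hB := by
    refine (F.card_plank_image_le k v hA hB).trans ?_
    have hK := F.one_le_K
    have hN := F.N_pos
    have e : (19 * (1000 * K) ^ 2) ^ 3 * (A * B) * (K * F.N) =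
        6859 * (K * (1000 * K) ^ 6 * (A * B * F.N)) := by ring
    have e2 : 10 ^ 4 * K * (1000 * K) ^ 6 * (A * B * F.N) =
        10 ^ 4 * (K * (1000 * K) ^ 6 * (A * B * F.N)) := by ring
    rw [e, e2]
    exact mul_le_mul_of_nonneg_right (by norm_num) (by positivity)
  tau_mem q hq k hk := by
    obtain ⟨i1, i2⟩ := F.plank_spec hk
    obtain ⟨h1, h2, -⟩ := F.within_ctr_tau hq i1 i2
    have hK := F.one_le_K
    have hm := F.m_pos
    have h6 : 1 ≤ (1000 * K) ^ 6 := one_le_pow₀ (by linarith)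
    have h7 : 2 * (1000 * K) ≤ 10 ^ 4 * K * (1000 * K) ^ 6 := by nlinarith
    rw [ev_sub] at h1
    rw [de_sub] at h2
    refine ⟨_, Finset.mem_image_of_mem _ (Finset.mem_image_of_mem _ i1), h1.trans ?_, h2.trans ?_⟩
    · gcongr
    · gcongr
  tau_count k a b := by
    refine (F.tau_count k a b).trans ?_
    have hK := F.one_le_K
    have hZ := F.Z_pos
    have e : (13 * (1000 * K) ^ 2) ^ 3 * (K * F.Z) = 2197 * (K * (1000 * K) ^ 6 * F.Z) := by ring
    have e2 : 10 ^ 4 * K * (1000 * K) ^ 6 * F.Z = 10 ^ 4 * (K * (1000 * K) ^ 6 * F.Z) := by ring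
    rw [e, e2]
    exact mul_le_mul_of_nonneg_right (by norm_num) (by positivity)
  tau_total n := by
    have hK := F.one_le_K
    have h6 : 1 ≤ (1000 * K) ^ 6 := one_le_pow₀ (by linarith)
    have h1 : ∑ k ∈ Finset.range n, ((F.Pl k).card : ℝ) ≤
        ∑ k ∈ Finset.range F.n, ((F.Pl k).card : ℝ) := by
      refine (Finset.sum_le_sum_of_subset_of_nonneg (Finset.range_subset_range.2 (le_max_left n F.n))
        fun _ _ _ => Nat.cast_nonneg _).trans (le_of_eq ?_)
      refine (Finset.sum_subset (Finset.range_subset_range.2 (le_max_right n F.n)) ?_).symm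
      intro k _ hk
      rw [Finset.mem_range] at hk
      rw [Finset.not_nonempty_iff_eq_empty.1 fun h => hk (F.le_sq k h).1]
      simp
    rw [Finset.mul_sum]
    refine (Finset.sum_le_sum fun k _ => F.card_tau_le k).trans ?_
    rw [← Finset.mul_sum]
    have h0 : 0 ≤ ∑ k ∈ Finset.range n, ((F.Pl k).card : ℝ) :=
      Finset.sum_nonneg fun _ _ => Nat.cast_nonneg _
    have h7 : K ≤ 10 ^ 4 * K * (1000 * K) ^ 6 := by nlinarith
    gcongr
  one_le_N := by
    obtain ⟨q, hq⟩ := F.nonempty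
    obtain ⟨k, P, hP, _⟩ := F.meets q hq
    refine ((F.sys k).one_le_N ⟨P, hP⟩).trans ?_
    have hK := F.one_le_K
    have hN := F.N_pos
    have h6 : 1 ≤ (1000 * K) ^ 6 := one_le_pow₀ (by linarith)
    have h7 : K ≤ 10 ^ 4 * K * (1000 * K) ^ 6 := by nlinarith
    gcongr
  one_le_Z := by
    obtain ⟨q, hq⟩ := F.nonempty
    obtain ⟨k, P, hP, _⟩ := F.meets q hq
    refine ((F.sys k).one_le_Z ⟨P, hP⟩).trans ?_
    have hK := F.one_le_K
    have hZ := F.Z_pos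
    have h6 : 1 ≤ (1000 * K) ^ 6 := one_le_pow₀ (by linarith)
    have h7 : K ≤ 10 ^ 4 * K * (1000 * K) ^ 6 := by nlinarith
    gcongr

end CubeFamily

/-- Serves the indices beyond the partition of [0, 1], for which there are no planks. -/
lemma nonempty_tauSystem_empty {m c K N Z : ℝ} (hK : 0 ≤ K) (hN : 0 ≤ N) (hZ : 0 ≤ Z) :
    Nonempty (TauSystem m c (1000 * K) K N Z ∅) := by
  refine ⟨⟨id, fun _ => 0, fun _ => 0, ?_, ?_, ?_, ?_, ?_, ?_, ?_, ?_, ?_, ?_, ?_⟩⟩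
  · simp
  · simp
  · simp
  · simp
  · simp [NonOverlapping]
  · simp [NonOverlapping]
  · intro T
    simp only [Finset.filter_empty, Finset.card_empty, Nat.cast_zero]
    positivity
  · simp
  · intro a b
    simp only [Finset.image_empty, Finset.filter_empty, Finset.card_empty, Nat.cast_zero]
    positivity
  · simp
  · simp

/-- A family all of whose finite subfamilies obey one bound is finite and obeys it; finiteness of
the family of rich cubes is obtained this way. -/
lemma finite_of_card_le {α : Type*} {Q : Set α} {B : ℝ}
    (h : ∀ S : Finset α, (S : Set α) ⊆ Q → (S.card : ℝ) ≤ B) : Q.Finite ∧ (Q.ncard : ℝ) ≤ B := by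
  have hfin : Q.Finite := by
    by_contra hinf
    obtain ⟨S, hS, hcard⟩ := Set.Infinite.exists_subset_card_eq hinf (⌈B⌉₊ + 1)
    have h1 := h S hS
    rw [hcard] at h1
    push_cast at h1
    linarith [Nat.le_ceil B]
  refine ⟨hfin, ?_⟩
  rw [Set.ncard_eq_toFinset_card Q hfin]
  exact h _ (by simp)

lemma CubeFamily.le_card_dirs {K : ℝ} (F : CubeFamily K) {q : Set E3} (hq : q ∈ F.Q) {r : ℝ}
    (hr : r ≤ ∑ k ∈ Finset.range F.n, (((F.Pl k).filter fun P => (P ∩ q).Nonempty).card : ℝ)) :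
    r / (13 * (1000 * K) ^ 2) ^ 3 ≤ (F.dirs q).card := by
  have hK := F.one_le_K
  have hK0 : 0 < K := by linarith
  rw [div_le_iff₀ (by positivity)]
  refine hr.trans ?_
  have hsub : F.dirs q ⊆ Finset.range F.n := Finset.filter_subset _ _
  rw [← Finset.sum_subset hsub]
  · refine (Finset.sum_le_sum fun k _ => F.card_meeting_le hq k).trans ?_
    rw [Finset.sum_const, nsmul_eq_mul]
  · intro k _ hk
    rw [F.mem_dirs] at hk
    rw [Finset.filter_false_of_mem fun P hP h => hk ⟨P, hP, h⟩]
    simp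

/-- The number of cubes of a family meeting planks in many directions. -/
lemma exists_card_cubes_le (K : ℝ) (hK : 1 ≤ K) : ∃ A : ℝ, 0 < A ∧ ∀ (F : CubeFamily K) (r : ℝ),
    0 < r → 2 ≤ F.m ^ 6 → (∀ q ∈ F.Q, r ≤ ∑ k ∈ Finset.range F.n,
      (((F.Pl k).filter fun P => (P ∩ q).Nonempty).card : ℝ)) →
    (F.Q.card : ℝ) ≤ A * log (F.m ^ 6) ^ 17 *
      ((∑ k ∈ Finset.range F.n, ((F.Pl k).card : ℝ)) * F.N ^ 5 * F.Z * (F.m ^ 6) ^ 2 / r ^ 7) := by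
  have hC : 1 ≤ 10 ^ 4 * K * (1000 * K) ^ 6 := by
    have : 1 ≤ (1000 * K) ^ 6 := one_le_pow₀ (by linarith)
    nlinarith
  obtain ⟨A, hA, hmain⟩ := PlankConfig.exists_card_pts_le _ hC
  have hK0 : 0 < K := by linarith
  obtain ⟨c, hc⟩ : ∃ c : ℝ, c = (13 * (1000 * K) ^ 2) ^ 3 := ⟨_, rfl⟩
  have hc0 : 0 < c := by rw [hc]; positivity
  -- The factor 5 turns M + 2 into a multiple of the logarithm, using m⁶ ≥ 2. The constant c bounds
  -- the planks of one direction through a cube, so r planks give r/c directions.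
  refine ⟨A * 5 ^ 17 * c ^ 7, by positivity, ?_⟩
  intro F r hr hm2 hrich
  have hm := F.one_le_m
  have hm0 := F.m_pos
  obtain ⟨M, hM1, hM2⟩ := exists_nat_pow_near (one_le_pow₀ hm : 1 ≤ F.m ^ 2) one_lt_two
  have h := hmain F.toConfig rfl (M + 1) (r / c) hM2
    (by
      have e : F.toConfig.m = F.m := rfl
      rw [pow_succ, e]; linarith)
    (by positivity) (fun q hq => by rw [hc]; exact F.le_card_dirs hq (hrich q hq))
  have hlog2 := Real.log_two_gt_d9
  have hlogm : log 2 ≤ log (F.m ^ 6) := Real.log_le_log two_pos hm2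
  have hM3 : (M : ℝ) * log 2 ≤ log (F.m ^ 6) := by
    rw [← Real.log_pow]
    refine Real.log_le_log (by positivity) (hM1.trans (pow_le_pow_right₀ hm (by norm_num)))
  have hM4 : (M : ℝ) + 2 ≤ 5 * log (F.m ^ 6) := by
    have h0 : (M : ℝ) * 0.69 ≤ M * log 2 := by
      gcongr
      linarith
    linarith
  have hM5 : ((M + 1 : ℕ) : ℝ) + 1 ≤ 5 * log (F.m ^ 6) := by push_cast; linarith
  have hP : 0 ≤ (∑ k ∈ Finset.range F.n, ((F.Pl k).card : ℝ)) * F.N ^ 5 * F.Z * F.m ^ 12 /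
      (r / c) ^ 7 := by
    have hN := F.N_pos
    have hZ := F.Z_pos
    have hS : (0 : ℝ) ≤ ∑ k ∈ Finset.range F.n, ((F.Pl k).card : ℝ) :=
      Finset.sum_nonneg fun _ _ => Nat.cast_nonneg _
    positivity
  refine h.trans ?_
  calc A * (((M + 1 : ℕ) : ℝ) + 1) ^ 17 * ((∑ k ∈ Finset.range F.n, ((F.Pl k).card : ℝ)) *
        F.N ^ 5 * F.Z * F.m ^ 12 / (r / c) ^ 7)
      ≤ A * (5 * log (F.m ^ 6)) ^ 17 * ((∑ k ∈ Finset.range F.n, ((F.Pl k).card : ℝ)) *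
        F.N ^ 5 * F.Z * F.m ^ 12 / (r / c) ^ 7) := by gcongr
    _ = _ := by
        generalize ∑ k ∈ Finset.range F.n, ((F.Pl k).card : ℝ) = S
        field_simp

lemma richness_eq_sum {R : ℝ} (Pl : Fin (numIntervals R) → Finset (Set E3)) (q : Set E3) :
    (richness Pl q : ℝ) = ∑ k, (((Pl k).filter fun P => (P ∩ q).Nonempty).card : ℝ) := by
  rw [richness, Nat.cast_sum]
  refine Finset.sum_congr rfl fun k _ => ?_
  rw [← Set.ncard_coe_finset, Finset.coe_filter]

lemma exists_extension {n : ℕ} {α : Type*} (f : Fin n → Finset α) :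
    ∃ g : ℕ → Finset α, (∀ k : Fin n, g k = f k) ∧ ∀ k, ¬ k < n → g k = ∅ :=
  ⟨fun k => if h : k < n then f ⟨k, h⟩ else ∅, fun k => dif_pos k.2, fun _ h => dif_neg h⟩

end Vinogradov
end

/-! ### The theorem. -/

theorem mainTheorem2 :
    ∃ D : ℕ, ∀ K : ℝ, 1 ≤ K → ∃ A : ℝ, 0 < A ∧
      ∀ R : ℝ, 2 ≤ R →
      ∀ 𝒮 𝒯 𝒱 : Fin (numIntervals R) → Set (Set E3),
      (∀ k, IsVinogradovTiling K R (leftEndpoint R k) (𝒮 k) (𝒯 k) (𝒱 k)) →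
      ∀ Pl : Fin (numIntervals R) → Finset (Set E3),
      (∀ k, ∀ P ∈ Pl k, P ∈ 𝒱 k ∧ P ⊆ bigCube R) →
      ∀ N Z₁ : ℝ, 0 < N → 0 < Z₁ →
      (∀ k, ∀ T ∈ 𝒯 k, HeavyTau K N (Pl k) T ∨ ∀ P ∈ Pl k, ¬ P ⊆ T) →
      (∀ k, ∀ S ∈ 𝒮 k, HeavySigma K N Z₁ (Pl k) (𝒯 k) S ∨
        ∀ T ∈ 𝒯 k, T ⊆ S → ¬ HeavyTau K N (Pl k) T) →
      ∀ r : ℝ, 1 ≤ r → r ≤ R ^ (1 / 3 : ℝ) →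
      ∀ Q : Set (Set E3),
      (∀ q ∈ Q, IsCube K (R ^ (1 / 3 : ℝ)) q) →
      NonOverlapping Q →
      (∀ q ∈ Q, r ≤ (richness Pl q : ℝ)) →
      Q.Finite ∧
        (Q.ncard : ℝ) ≤ A * log R ^ D *
          ((∑ k, ((Pl k).card : ℝ)) * N ^ 5 * Z₁ * R ^ 2 / r ^ 7) := by
  classical
  refine ⟨17, fun K hK => ?_⟩
  obtain ⟨A, hA, hmain⟩ := Vinogradov.exists_card_cubes_le K hK
  refine ⟨A, hA, ?_⟩
  intro R hR 𝒮 𝒯 𝒱 htiling Pl hPl N Z₁ hN hZ hSp1 hSp2 r hr _ Q hcube hQ hrich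
  have hK0 : 0 < K := by linarith
  -- The scale m = R^(1/6) makes all side lengths integral powers of m.
  obtain ⟨m, hm, hmR, hm13⟩ : ∃ m : ℝ, 1 ≤ m ∧ m ^ 6 = R ∧ R ^ (1 / 3 : ℝ) = m ^ 2 := by
    refine ⟨R ^ (1 / 6 : ℝ), Real.one_le_rpow (by linarith) (by norm_num), ?_, ?_⟩
    · rw [← Real.rpow_natCast, ← Real.rpow_mul (by linarith)]
      norm_num
    · rw [← Real.rpow_natCast, ← Real.rpow_mul (by linarith)]
      norm_num
  have hm0 : 0 < m := by linarith
  have hend : ∀ k, leftEndpoint R k = (k : ℕ) / m ^ 2 := by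
    intro k
    rw [leftEndpoint, Real.rpow_neg (by linarith), hm13, div_eq_mul_inv]
  -- An index below ⌈m²⌉ is below m² itself, so the left endpoints stay in [0, 1] even when m² is
  -- not an integer.
  have hlt : ∀ k : Fin (numIntervals R), ((k : ℕ) : ℝ) ≤ m ^ 2 := by
    intro k
    have h1 : (k : ℕ) < ⌈R ^ (1 / 3 : ℝ)⌉₊ := k.2
    rw [hm13, Nat.lt_ceil] at h1
    exact h1.le
  subst hmR
  rw [hm13] at hcube
  obtain ⟨Pl', hPlFin, hPlempty⟩ := Vinogradov.exists_extension Pl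
  have hPlne : ∀ k, (Pl' k).Nonempty → k < numIntervals (m ^ 6) ∧ (k : ℝ) ≤ m ^ 2 := by
    intro k hk
    by_cases h : k < numIntervals (m ^ 6)
    · exact ⟨h, hlt ⟨k, h⟩⟩
    · rw [hPlempty k h] at hk
      exact absurd hk Finset.not_nonempty_empty
  have hsys : ∀ k : ℕ, Nonempty (Vinogradov.TauSystem m (k / m ^ 2) (1000 * K) K N Z₁ (Pl' k)) := by
    intro k
    by_cases h : k < numIntervals (m ^ 6)
    · have e : Pl' k = Pl ⟨k, h⟩ := hPlFin ⟨k, h⟩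
      have ht := htiling ⟨k, h⟩
      rw [hend] at ht
      rw [e]
      refine Vinogradov.IsVinogradovTiling.nonempty_tauSystem hm hK (by positivity) ?_ ht
        (hPl ⟨k, h⟩) hN hZ (hSp1 ⟨k, h⟩) (hSp2 ⟨k, h⟩)
      rw [div_le_one (by positivity)]
      exact hlt ⟨k, h⟩
    · have e : Pl' k = ∅ := hPlempty k h
      rw [e]
      exact Vinogradov.nonempty_tauSystem_empty hK0.le hN.le hZ.le
  have hsum : ∑ k, ((Pl k).card : ℝ) =
      ∑ k ∈ Finset.range (numIntervals (m ^ 6)), ((Pl' k).card : ℝ) := by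
    rw [Finset.sum_range]
    exact Finset.sum_congr rfl fun k _ => by rw [hPlFin]
  have hrichness : ∀ q, (richness Pl q : ℝ) =
      ∑ k ∈ Finset.range (numIntervals (m ^ 6)),
        (((Pl' k).filter fun P => (P ∩ q).Nonempty).card : ℝ) := by
    intro q
    rw [Finset.sum_range, Vinogradov.richness_eq_sum]
    exact Finset.sum_congr rfl fun k _ => by rw [hPlFin]
  choose! ctr hctr using fun q (hq : q ∈ Q) =>
    Vinogradov.IsCube.exists_comparable hm0 hK (hcube q hq)
  refine Vinogradov.finite_of_card_le fun S hS => ?_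
  rcases S.eq_empty_or_nonempty with rfl | hne
  · have hlog : 0 ≤ log (m ^ 6) := Real.log_nonneg (by linarith)
    have hS0 : (0 : ℝ) ≤ ∑ k, ((Pl k).card : ℝ) := Finset.sum_nonneg fun _ _ => Nat.cast_nonneg _
    rw [Finset.card_empty, Nat.cast_zero]
    exact mul_nonneg (mul_nonneg hA.le (pow_nonneg hlog _)) (div_nonneg (mul_nonneg (mul_nonneg
      (mul_nonneg hS0 (pow_nonneg hN.le _)) hZ.le) (pow_nonneg (by linarith) _))
      (pow_nonneg (by linarith) _))
  · have h := hmain ⟨m, N, Z₁, numIntervals (m ^ 6), Pl', fun k => (hsys k).some, S, ctr, hK,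
      hm, hN, hZ, hPlne, fun q hq => hctr q (hS hq), hQ.mono hS,
      fun q hq => ?_, hne⟩ r (by linarith) hR
      (fun q hq => by rw [← hrichness]; exact hrich q (hS hq))
    · rw [hsum]
      exact h
    -- As r ≥ 1, every cube meets a plank; this is what bounds its leading coefficient and makes N
    -- and Z₁ bounded below.
    · have h1 : (0 : ℝ) < richness Pl q := by linarith [hrich q (hS hq)]
      rw [hrichness] at h1
      obtain ⟨k, _, hk⟩ := Finset.exists_ne_zero_of_sum_ne_zero h1.ne'
      have h2 : 0 < ((Pl' k).filter fun P => (P ∩ q).Nonempty).card :=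
        Nat.pos_of_ne_zero fun h0 => hk (by rw [h0, Nat.cast_zero])
      obtain ⟨P, hP⟩ := Finset.card_pos.1 h2
      exact ⟨k, P, (Finset.mem_filter.1 hP).1, (Finset.mem_filter.1 hP).2⟩
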